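/- Let $L>0$ and $a>0$, and put $\mu=\pi/L$. Consider the one-dimensional system $$\omega_t+u\,\omega_x=\theta_x,\qquad \theta_t+u\,\theta_x=0$$ for functions $\omega(x,t)$, $\theta(x,t)$ that are $L$-periodic in $x$, where the velocity is given by $$u(x,t)=\frac1{2\pi}\int_0^L \omega(y,t)\Big(\log\big|\sin^2[\mu(x-y)]\big|-\log\big|\sin^2[\mu(x-y)]+a\big|\Big)\,dy .$$ A classical solution on $[0,T)$ is a pair of functions, $L$-periodic in $x$, with $\omega\in C^1([0,T)\times\mathbb R)$ and $\theta\in C^2([0,T)\times\mathbb R)$, that satisfies the equations pointwise on $[0,T)\times\mathbb R$ (with one-sided time derivatives at $t=0$). There exist $L$-periodic initial data $(\omega_0,\theta_0)$ such that $\omega_0$ and $\theta_{0x}$ are $C^\infty$, odd, and nonnegative on $[0,L/2]$, $\int_0^L\omega_0\,dx=0$ and $\theta_0(0)=0$, for which the solution blows up in finite time. That is, there are a time $0<T^*<\infty$ and a classical solution $(\omega,\theta)$ on $[0,T^*)$ with initial data $(\omega_0,\theta_0)$, which is $C^\infty$ on $[0,T^*)\times\mathbb R$, such that 1. every classical solution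 with the same initial data on an interval $[0,T)$, $T>0$, satisfies $T\le T^*$ and coincides with $(\omega,\theta)$ on $[0,T)$, so that $T^*$ is the maximal time of existence; 2. $\displaystyle \lim_{t\nearrow T^*}\int_0^t\|u_x(\cdot,\tau)\|_{L^\infty}\,d\tau=\infty .$ -/

import Mathlib

open Filter Topology
open scoped ContDiff

namespace HouLuo

/-- The velocity generated by the `L`-periodic vorticity profile `w` through the periodic modified
Hou–Luo kernel, with `μ = π / L`:
`u(x) = (1/2π) ∫₀ᴸ w(y) (log |sin² μ(x-y)| - log |sin² μ(x-y) + a|) dy`. -/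
noncomputable def velocity (L a : ℝ) (w : ℝ → ℝ) (x : ℝ) : ℝ :=
  1 / (2 * Real.pi) * ∫ y in (0 : ℝ)..L,
    w y * (Real.log |Real.sin (Real.pi / L * (x - y)) ^ 2|
      - Real.log |Real.sin (Real.pi / L * (x - y)) ^ 2 + a|)

/-- The norm `‖u_x‖_{L^∞}` of the gradient of the velocity generated by `w`. For a `C¹` periodic
`w` the function `u_x` is continuous and periodic, so that its `L^∞` norm is its supremum. -/
noncomputable def gradNorm (L a : ℝ) (w : ℝ → ℝ) : ℝ :=
  ⨆ x : ℝ, |deriv (velocity L a w) x|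

/-- The class of initial data: `ω₀` and `θ₀'` are smooth, odd and `L`-periodic, nonnegative on
`[0, L/2]`, the vorticity `ω₀` has mean zero, `θ₀` is `L`-periodic and `θ₀(0) = 0`. -/
structure IsInitialDatum (L : ℝ) (w₀ θ₀ : ℝ → ℝ) : Prop where
  smooth_vorticity : ContDiff ℝ ∞ w₀
  smooth_density : ContDiff ℝ ∞ θ₀
  periodic_vorticity : Function.Periodic w₀ L
  periodic_density : Function.Periodic θ₀ L
  odd_vorticity : ∀ x, w₀ (-x) = -w₀ x
  odd_deriv_density : ∀ x, deriv θ₀ (-x) = -deriv θ₀ x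
  nonneg_vorticity : ∀ x ∈ Set.Icc 0 (L / 2), 0 ≤ w₀ x
  nonneg_deriv_density : ∀ x ∈ Set.Icc 0 (L / 2), 0 ≤ deriv θ₀ x
  density_zero : θ₀ 0 = 0
  mean_zero : ∫ x in (0 : ℝ)..L, w₀ x = 0

/-- `(w, θ)`, functions of `(t, x)`, is a classical `L`-periodic solution on the time interval
`[0, T)`, with initial data `(w₀, θ₀)`, of `ω_t + u ω_x = θ_x`, `θ_t + u θ_x = 0`, where `u(t, ·)`
is the velocity generated by `ω(t, ·)`. The vorticity is `C¹` and the density `C²` in `(t, x)` on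
`[0, T) × ℝ` (up to `t = 0`, where the time derivatives are one-sided). -/
structure IsClassicalSolution (L a T : ℝ) (w₀ θ₀ : ℝ → ℝ) (w θ : ℝ → ℝ → ℝ) : Prop where
  regular_vorticity :
    ContDiffOn ℝ 1 (fun p : ℝ × ℝ => w p.1 p.2) (Set.Ico 0 T ×ˢ Set.univ)
  regular_density :
    ContDiffOn ℝ 2 (fun p : ℝ × ℝ => θ p.1 p.2) (Set.Ico 0 T ×ˢ Set.univ)
  periodic_vorticity : ∀ t ∈ Set.Ico 0 T, Function.Periodic (w t) L
  periodic_density : ∀ t ∈ Set.Ico 0 T, Function.Periodic (θ t) L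
  vorticity_eq : ∀ t ∈ Set.Ico 0 T, ∀ x : ℝ,
    HasDerivWithinAt (fun s => w s x)
      (deriv (θ t) x - velocity L a (w t) x * deriv (w t) x) (Set.Ico 0 T) t
  density_eq : ∀ t ∈ Set.Ico 0 T, ∀ x : ℝ,
    HasDerivWithinAt (fun s => θ s x)
      (-(velocity L a (w t) x * deriv (θ t) x)) (Set.Ico 0 T) t
  initial_vorticity : ∀ x, w 0 x = w₀ x
  initial_density : ∀ x, θ 0 x = θ₀ x

end HouLuo

/-! Write r = θ_x, and let ω and r be odd and nonnegative on [0, L/2]. The maximum principle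
preserves the signs, because u vanishes at 0 and L/2. The blow-up is forced by two functionals, X =
∫ θ cot(μx) dx and Y = ∫ θ ω cot(μx) dx over [0, L/2]. A lower bound for the reflected kernel and
Fubini give X' ≥ c₁ Y (`integral_velocity_mul_cotWeight_lower`). In Y' the term ∫ θ θ_x cot
dominates X² (`sq_integral_mul_cotWeight_le`) and the nonlinear rest is nonnegative
(`stretching_nonneg`), so Y' ≥ c₂ X² (`sq_le_integral_deriv_mul_cotWeight`). Then (XY)' ≥ c
(XY)^(6/5), which bounds the lifespan when X(0) > 0 (`exists_lifespan_bound`). The data ω₀ = 0, θ₀ =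
1 - cos(2πx/L) qualify.

The sign of the nonlinear rest is the delicate point. After an integration by parts it becomes ∫∫
ω(x) ω(y) K(x, y) with x in [z, L/2] and y in [0, L/2], where K is the x-derivative of the reflected
kernel times cot(μx). To make sense of K, the kernel with a replaced by a small τ is subtracted,
which cancels the logarithmic singularity. The dependence of K on τ has an explicit rational
derivative, whose sign yields K(x, y) ≥ 0 for y ≤ x and K(x, y) + K(y, x) ≥ 0. This is enough after
symmetrising on [z, L/2]², and τ → 0 recovers the original velocity.

A well-posedness theory turns the bounded lifespan into blow-up of ∫ ‖u_x‖. The Fourier coefficients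
of the kernel are O(1/n), so ω ↦ u gains one derivative in L² (`exists_l2_velocity_le`) and Sobolev
estimates close for the pair (ω, r). Sine-Galerkin approximations give a smooth solution on a time
that depends only on the first order energy (`exists_local_solution`). That energy stays bounded
while ∫ ‖u_x‖ does (`IsSmoothSolution.exists_energy_le`), so the integral is unbounded at the
supremum T* of the existence times (`exists_maximal_solution`). An L² stability estimate identifies
every classical solution with the smooth one (`IsClassicalSolution.eq_smooth`); a classical solution
living beyond T* would keep u_x bounded on [0, T*], a contradiction. -/

namespace HouLuo
open MeasureTheory Set

/-! ### Parametric integrals, joint smoothness and Gronwall inequalities. -/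

/-- A weighted parametric integral over a compact interval is continuous in the parameter. -/
theorem continuousAt_weighted_integral {P : Type*} [TopologicalSpace P] [LocallyCompactSpace P]
    [FirstCountableTopology P]
    {a b : ℝ} {k : ℝ → ℝ} (hk : IntervalIntegrable k volume a b) {U : Set P} (hU : IsOpen U)
    {f : P → ℝ → ℝ} (hf : ContinuousOn (fun p : P × ℝ => f p.1 p.2) (U ×ˢ univ)) {p₀ : P}
    (hp : p₀ ∈ U) : ContinuousAt (fun p => ∫ y in a..b, k y * f p y) p₀ := by
  obtain ⟨V, hVc, hpV, hVU⟩ : ∃ V : Set P, IsCompact V ∧ V ∈ 𝓝 p₀ ∧ V ⊆ U := by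
    obtain ⟨V, hV, hVU, hVc⟩ := local_compact_nhds (hU.mem_nhds hp)
    exact ⟨V, hVc, hV, hVU⟩
  have hsub : V ×ˢ uIcc a b ⊆ U ×ˢ (univ : Set ℝ) := prod_mono hVU (subset_univ _)
  obtain ⟨M, hM⟩ := (hVc.prod isCompact_uIcc).exists_bound_of_continuousOn (hf.mono hsub)
  have hfp : ∀ p ∈ U, Continuous (f p) := fun p hpU => by
    have : ContinuousOn (f p) univ :=
      hf.comp (f := fun y : ℝ => (p, y)) (by fun_prop) (fun y _ => ⟨hpU, mem_univ _⟩)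
    exact continuousOn_univ.mp this
  refine intervalIntegral.continuousAt_of_dominated_interval (bound := fun y => |k y| * M) ?_ ?_ ?_ ?_
  · filter_upwards [hpV] with p hpV'
    exact hk.aestronglyMeasurable_restrict_uIoc.mul (hfp p (hVU hpV')).aestronglyMeasurable
  · filter_upwards [hpV] with p hpV'
    refine Eventually.of_forall fun y hy => ?_
    rw [norm_mul, Real.norm_eq_abs]
    exact mul_le_mul_of_nonneg_left (hM (p, y) ⟨hpV', uIoc_subset_uIcc hy⟩) (abs_nonneg _)
  · exact hk.abs.mul_const _
  · refine Eventually.of_forall fun y _ => ?_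
    have : ContinuousAt (fun p : P × ℝ => f p.1 p.2) (p₀, y) :=
      hf.continuousAt ((hU.prod isOpen_univ).mem_nhds ⟨hp, mem_univ _⟩)
    exact continuousAt_const.mul (this.comp (f := fun p : P => (p, y)) (by fun_prop))

/-- Differentiation of a weighted integral over a compact interval with respect to a parameter. -/
theorem hasDerivAt_weighted_integral {a b : ℝ} {k : ℝ → ℝ} (hk : IntervalIntegrable k volume a b)
    {U : Set ℝ} (hU : IsOpen U) {f f' : ℝ → ℝ → ℝ}
    (hf : ContinuousOn (fun p : ℝ × ℝ => f p.1 p.2) (U ×ˢ univ))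
    (hf' : ContinuousOn (fun p : ℝ × ℝ => f' p.1 p.2) (U ×ˢ univ))
    (hd : ∀ t ∈ U, ∀ x, HasDerivAt (fun s => f s x) (f' t x) t) {t₀ : ℝ} (ht : t₀ ∈ U) :
    HasDerivAt (fun t => ∫ y in a..b, k y * f t y) (∫ y in a..b, k y * f' t₀ y) t₀ := by
  obtain ⟨V, hV, hVU, hVc⟩ := local_compact_nhds (hU.mem_nhds ht)
  have hsub : V ×ˢ uIcc a b ⊆ U ×ˢ (univ : Set ℝ) := prod_mono hVU (subset_univ _)
  obtain ⟨M, hM⟩ := (hVc.prod isCompact_uIcc).exists_bound_of_continuousOn (hf'.mono hsub)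
  have hcont : ∀ {g : ℝ → ℝ → ℝ}, ContinuousOn (fun p : ℝ × ℝ => g p.1 p.2) (U ×ˢ univ) →
      ∀ p ∈ U, Continuous (g p) := fun hg p hpU =>
    continuousOn_univ.mp
      (hg.comp (f := fun y : ℝ => (p, y)) (by fun_prop) (fun y _ => ⟨hpU, mem_univ _⟩))
  refine (intervalIntegral.hasDerivAt_integral_of_dominated_loc_of_deriv_le
    (F := fun t y => k y * f t y) (F' := fun t y => k y * f' t y) (s := V) (bound := fun y => |k y| * M) hV ?_ ?_ ?_ ?_ ?_ ?_).2
  · filter_upwards [hV] with p hpV'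
    exact hk.aestronglyMeasurable_restrict_uIoc.mul (hcont hf p (hVU hpV')).aestronglyMeasurable
  · exact hk.mul_continuousOn (hcont hf t₀ ht).continuousOn
  · exact hk.aestronglyMeasurable_restrict_uIoc.mul (hcont hf' t₀ ht).aestronglyMeasurable
  · refine Eventually.of_forall fun y hy t htV => ?_
    rw [norm_mul, Real.norm_eq_abs]
    exact mul_le_mul_of_nonneg_left (hM (t, y) ⟨htV, uIoc_subset_uIcc hy⟩) (abs_nonneg _)
  · exact hk.abs.mul_const _
  · exact Eventually.of_forall fun y _ t htV => (hd t (hVU htV) y).const_mul _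

/-- A function whose partial derivatives are jointly `C^n` is jointly `C^(n+1)`. -/
theorem contDiffOn_succ_of_partials {I : Set ℝ} (hI : IsOpen I) {f f₁ f₂ : ℝ → ℝ → ℝ} {n : ℕ}
    (h₁ : ∀ t ∈ I, ∀ x, HasDerivAt (fun s => f s x) (f₁ t x) t)
    (h₂ : ∀ t ∈ I, ∀ x, HasDerivAt (f t) (f₂ t x) x)
    (c₁ : ContDiffOn ℝ n (fun p : ℝ × ℝ => f₁ p.1 p.2) (I ×ˢ univ))
    (c₂ : ContDiffOn ℝ n (fun p : ℝ × ℝ => f₂ p.1 p.2) (I ×ˢ univ)) :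
    ContDiffOn ℝ (n + 1) (fun p : ℝ × ℝ => f p.1 p.2) (I ×ˢ univ) := by
  have hO : IsOpen (I ×ˢ (univ : Set ℝ)) := hI.prod isOpen_univ
  have key : ∀ p ∈ I ×ˢ (univ : Set ℝ), HasFDerivAt (fun p : ℝ × ℝ => f p.1 p.2)
      ((f₁ p.1 p.2) • ContinuousLinearMap.fst ℝ ℝ ℝ + (f₂ p.1 p.2) • ContinuousLinearMap.snd ℝ ℝ ℝ) p := by
    rintro ⟨t, x⟩ hp
    have hev : ∀ᶠ q : ℝ × ℝ in 𝓝 (t, x), q ∈ I ×ˢ (univ : Set ℝ) := hO.mem_nhds hp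
    have := (hasStrictFDerivAt_uncurry_coprod (𝕜 := ℝ) (u := (t, x)) (f := f)
      (f₁ := fun t x => ContinuousLinearMap.toSpanSingleton ℝ (f₁ t x))
      (f₂ := fun t x => ContinuousLinearMap.toSpanSingleton ℝ (f₂ t x)) ?_ ?_ ?_ ?_).hasFDerivAt
    · refine this.congr_fderiv ?_
      ext <;> simp [Function.HasUncurry.uncurry]
    · filter_upwards [hev] with q hq
      exact (h₁ q.1 hq.1 q.2).hasFDerivAt
    · filter_upwards [hev] with q hq
      exact (h₂ q.1 hq.1 q.2).hasFDerivAt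
    · have := (c₁.continuousOn.continuousAt (hO.mem_nhds hp))
      exact ((ContinuousLinearMap.toSpanSingletonCLE (𝕜 := ℝ) (E := ℝ)).continuous.continuousAt.comp this :)
    · have := (c₂.continuousOn.continuousAt (hO.mem_nhds hp))
      exact ((ContinuousLinearMap.toSpanSingletonCLE (𝕜 := ℝ) (E := ℝ)).continuous.continuousAt.comp this :)
  rw [contDiffOn_succ_iff_fderiv_of_isOpen hO]
  refine ⟨fun p hp => (key p hp).differentiableAt.differentiableWithinAt, by simp, ?_⟩
  refine ContDiffOn.congr ?_ (fun p hp => (key p hp).fderiv)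
  exact (c₁.smul contDiffOn_const).add (c₂.smul contDiffOn_const)

/-- The partial derivatives of a jointly `C^(n+1)` function. -/
theorem partials_of_contDiffOn_succ {I : Set ℝ} (hI : IsOpen I) {f : ℝ → ℝ → ℝ} {n : ℕ}
    (hf : ContDiffOn ℝ (n + 1) (fun p : ℝ × ℝ => f p.1 p.2) (I ×ˢ univ)) :
    (∀ t ∈ I, ∀ x, HasDerivAt (fun s => f s x) (deriv (fun s => f s x) t) t) ∧
    (∀ t ∈ I, ∀ x, HasDerivAt (f t) (deriv (f t) x) x) ∧
    ContDiffOn ℝ n (fun p : ℝ × ℝ => deriv (fun s => f s p.2) p.1) (I ×ˢ univ) ∧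
    ContDiffOn ℝ n (fun p : ℝ × ℝ => deriv (f p.1) p.2) (I ×ˢ univ) := by
  have hO : IsOpen (I ×ˢ (univ : Set ℝ)) := hI.prod isOpen_univ
  have h := (contDiffOn_succ_iff_fderiv_of_isOpen hO).1 hf
  have hd : ∀ t ∈ I, ∀ x, HasFDerivAt (fun p : ℝ × ℝ => f p.1 p.2)
      (fderiv ℝ (fun p : ℝ × ℝ => f p.1 p.2) (t, x)) (t, x) := fun t ht x =>
    ((h.1 (t, x) ⟨ht, mem_univ _⟩).differentiableAt (hO.mem_nhds ⟨ht, mem_univ _⟩)).hasFDerivAt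
  have p1 : ∀ t ∈ I, ∀ x, HasDerivAt (fun s => f s x)
      (fderiv ℝ (fun p : ℝ × ℝ => f p.1 p.2) (t, x) (1, 0)) t := fun t ht x =>
    (hd t ht x).comp_hasDerivAt (f := fun s : ℝ => (s, x)) t
      ((hasDerivAt_id t).prodMk (hasDerivAt_const t x))
  have p2 : ∀ t ∈ I, ∀ x, HasDerivAt (f t)
      (fderiv ℝ (fun p : ℝ × ℝ => f p.1 p.2) (t, x) (0, 1)) x := fun t ht x =>
    (hd t ht x).comp_hasDerivAt (f := fun y : ℝ => (t, y)) x
      ((hasDerivAt_const x t).prodMk (hasDerivAt_id x))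
  refine ⟨fun t ht x => (p1 t ht x).differentiableAt.hasDerivAt,
    fun t ht x => (p2 t ht x).differentiableAt.hasDerivAt, ?_, ?_⟩
  · exact (h.2.2.clm_apply contDiffOn_const).congr fun p hp => (p1 p.1 hp.1 p.2).deriv
  · exact (h.2.2.clm_apply contDiffOn_const).congr fun p hp => (p2 p.1 hp.1 p.2).deriv

/-- Two-sided logarithmic Gronwall inequality. -/
theorem gronwall_two_sided {I : Set ℝ} (hI : Convex ℝ I) {y y' : ℝ → ℝ} {C ε : ℝ} (hε : 0 < ε)
    (hy : ∀ t ∈ I, 0 ≤ y t) (hd : ∀ t ∈ I, HasDerivAt y (y' t) t)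
    (hb : ∀ t ∈ I, |y' t| ≤ C * (y t + ε)) {s t : ℝ} (hs : s ∈ I) (ht : t ∈ I) :
    y t + ε ≤ Real.exp (C * |t - s|) * (y s + ε) := by
  -- The slope of log (y + ε) is at most C in absolute value, so the mean value inequality on a
  -- convex set works forward and backward in time. The shift ε keeps the logarithm differentiable
  -- where y = 0.
  have h := hI.norm_image_sub_le_of_norm_hasDerivWithin_le (f := fun t => Real.log (y t + ε))
    (f' := fun t => y' t / (y t + ε)) (C := C) (fun x hx =>
      (((hd x hx).add_const ε).log (by linarith [hy x hx])).hasDerivWithinAt) (fun x hx => by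
      have := hy x hx
      rw [Real.norm_eq_abs, abs_div, abs_of_pos (by linarith : 0 < y x + ε), div_le_iff₀ (by linarith)]
      exact hb x hx) hs ht
  have h1 := (le_abs_self _).trans h
  have pt : 0 < y t + ε := by linarith [hy t ht]
  have ps : 0 < y s + ε := by linarith [hy s hs]
  rw [← Real.exp_log pt, ← Real.exp_log ps, ← Real.exp_add, Real.exp_le_exp]
  rw [Real.norm_eq_abs] at h1
  linarith

/-- Limit ε → 0 of the previous inequality. In particular y vanishes on all of I once it vanishes at
one time, which is the form needed for uniqueness. -/
theorem gronwall_zero {I : Set ℝ} (hI : Convex ℝ I) {y y' : ℝ → ℝ} {C : ℝ}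
    (hy : ∀ t ∈ I, 0 ≤ y t) (hd : ∀ t ∈ I, HasDerivAt y (y' t) t)
    (hb : ∀ t ∈ I, |y' t| ≤ C * y t) (hC : 0 ≤ C) {s t : ℝ} (hs : s ∈ I) (ht : t ∈ I) :
    y t ≤ Real.exp (C * |t - s|) * y s := by
  have key : ∀ ε : ℝ, 0 < ε → y t + ε ≤ Real.exp (C * |t - s|) * (y s + ε) := fun ε hε =>
    gronwall_two_sided hI hε hy hd (fun t ht => (hb t ht).trans (by nlinarith)) hs ht
  have h1 : Tendsto (fun ε : ℝ => y t + ε) (𝓝[>] 0) (𝓝 (y t + 0)) :=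
    (Continuous.tendsto (by fun_prop) 0).mono_left nhdsWithin_le_nhds
  have h2 : Tendsto (fun ε : ℝ => Real.exp (C * |t - s|) * (y s + ε)) (𝓝[>] 0)
      (𝓝 (Real.exp (C * |t - s|) * (y s + 0))) :=
    (Continuous.tendsto (by fun_prop) 0).mono_left nhdsWithin_le_nhds
  simpa using le_of_tendsto_of_tendsto h1 h2 (eventually_nhdsWithin_of_forall key)

/-- The reciprocal 1 / (1 + y) is C-Lipschitz. In time 1 / (2C(1 + B)) it loses at most half of 1 /
(1 + B), which bounds it from below at time s. The admissible time depends on B and C alone. -/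
theorem quadratic_gronwall {I : Set ℝ} (hI : Convex ℝ I) {y y' : ℝ → ℝ} {C B : ℝ} (hC : 0 < C)
    (hB : 0 ≤ B) (hy : ∀ t ∈ I, 0 ≤ y t) (hd : ∀ t ∈ I, HasDerivAt y (y' t) t)
    (hb : ∀ t ∈ I, |y' t| ≤ C * (1 + y t) ^ 2) {s t : ℝ} (hs : s ∈ I) (ht : t ∈ I)
    (hyB : y s ≤ B) (hst : |t - s| ≤ 1 / (2 * C * (1 + B))) : y t ≤ 2 * (1 + B) := by
  have h := hI.norm_image_sub_le_of_norm_hasDerivWithin_le (f := fun t => (1 + y t)⁻¹)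
    (f' := fun t => -y' t / (1 + y t) ^ 2) (C := C) (fun x hx =>
      (((hd x hx).const_add 1).fun_inv (by linarith [hy x hx])).hasDerivWithinAt) (fun x hx => by
      have := hy x hx
      have h2 : 0 < (1 + y x) ^ 2 := by positivity
      rw [Real.norm_eq_abs, abs_div, abs_neg, abs_of_pos h2, div_le_iff₀ h2]
      exact hb x hx) hs ht
  have h1 := (neg_le_abs _).trans h
  have pt : 0 < 1 + y t := by linarith [hy t ht]
  have ps : 0 < 1 + y s := by linarith [hy s hs]
  rw [Real.norm_eq_abs] at h1
  have h3 : C * |t - s| ≤ 1 / 2 * (1 + B)⁻¹ := by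
    calc C * |t - s| ≤ C * (1 / (2 * C * (1 + B))) := by gcongr
      _ = _ := by field_simp
  have h4 : (1 + B)⁻¹ ≤ (1 + y s)⁻¹ := by gcongr
  have h5 : 1 / 2 * (1 + B)⁻¹ ≤ (1 + y t)⁻¹ := by linarith
  have h6 : (2 * (1 + B))⁻¹ ≤ (1 + y t)⁻¹ := by rw [mul_inv]; linarith
  have := (inv_le_inv₀ (by positivity) pt).1 h6
  linarith

end HouLuo
-- The L² norm over a period and smooth periodic functions.
namespace HouLuo
open MeasureTheory Set

/-- The `L²` norm over one period. -/
noncomputable def l2 (L : ℝ) (f : ℝ → ℝ) : ℝ := √(∫ x in (0 : ℝ)..L, f x ^ 2)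

theorem l2_nonneg (L : ℝ) (f : ℝ → ℝ) : 0 ≤ l2 L f := Real.sqrt_nonneg _

theorem l2_sq {L : ℝ} (hL : 0 < L) (f : ℝ → ℝ) : l2 L f ^ 2 = ∫ x in (0 : ℝ)..L, f x ^ 2 :=
  Real.sq_sqrt (intervalIntegral.integral_nonneg hL.le fun _ _ => sq_nonneg _)

/-- Cauchy–Schwarz, from the discriminant of the nonnegative quadratic s ↦ ∫ (f + s g)². -/
theorem abs_integral_mul_le {L : ℝ} (hL : 0 < L) {f g : ℝ → ℝ} (hf : Continuous f)
    (hg : Continuous g) : |∫ x in (0 : ℝ)..L, f x * g x| ≤ l2 L f * l2 L g := by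
  have h := discrim_le_zero (a := ∫ x in (0 : ℝ)..L, g x ^ 2)
    (b := 2 * ∫ x in (0 : ℝ)..L, f x * g x) (c := ∫ x in (0 : ℝ)..L, f x ^ 2) fun s => by
      have e : ∫ x in (0 : ℝ)..L, (f x + s * g x) ^ 2
          = (∫ x in (0 : ℝ)..L, g x ^ 2) * (s * s) + (2 * ∫ x in (0 : ℝ)..L, f x * g x) * s
            + ∫ x in (0 : ℝ)..L, f x ^ 2 := by
        have : ∀ x, (f x + s * g x) ^ 2 = (s * s) * g x ^ 2 + (2 * s) * (f x * g x) + f x ^ 2 :=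
          fun x => by ring
        simp_rw [this]
        rw [intervalIntegral.integral_add, intervalIntegral.integral_add,
          intervalIntegral.integral_const_mul, intervalIntegral.integral_const_mul]
        · ring
        all_goals exact Continuous.intervalIntegrable (by fun_prop) _ _
      rw [← e]
      exact intervalIntegral.integral_nonneg hL.le fun _ _ => sq_nonneg _
  rw [discrim, ← l2_sq hL, ← l2_sq hL] at h
  refine abs_le_of_sq_le_sq ?_ (mul_nonneg (l2_nonneg _ _) (l2_nonneg _ _))
  nlinarith

theorem l2_add_le {L : ℝ} (hL : 0 < L) {f g : ℝ → ℝ} (hf : Continuous f)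
    (hg : Continuous g) : l2 L (fun x => f x + g x) ≤ l2 L f + l2 L g := by
  refine le_of_sq_le_sq ?_ (add_nonneg (l2_nonneg _ _) (l2_nonneg _ _))
  have h := (le_abs_self _).trans (abs_integral_mul_le hL hf hg)
  have e : l2 L (fun x => f x + g x) ^ 2
      = l2 L f ^ 2 + 2 * (∫ x in (0 : ℝ)..L, f x * g x) + l2 L g ^ 2 := by
    rw [l2_sq hL, l2_sq hL, l2_sq hL]
    have : ∀ x, (f x + g x) ^ 2 = f x ^ 2 + 2 * (f x * g x) + g x ^ 2 := fun x => by ring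
    simp_rw [this]
    rw [intervalIntegral.integral_add, intervalIntegral.integral_add,
      intervalIntegral.integral_const_mul]
    all_goals exact Continuous.intervalIntegrable (by fun_prop) _ _
  rw [e]
  nlinarith

theorem l2_const_mul {L : ℝ} (c : ℝ) (f : ℝ → ℝ) :
    l2 L (fun x => c * f x) = |c| * l2 L f := by
  unfold l2
  simp_rw [mul_pow]
  rw [intervalIntegral.integral_const_mul, Real.sqrt_mul (sq_nonneg _), Real.sqrt_sq_eq_abs]

theorem l2_neg {L : ℝ} (f : ℝ → ℝ) : l2 L (fun x => -f x) = l2 L f := by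
  unfold l2; simp

theorem l2_sub_le {L : ℝ} (hL : 0 < L) {f g : ℝ → ℝ} (hf : Continuous f)
    (hg : Continuous g) : l2 L (fun x => f x - g x) ≤ l2 L f + l2 L g := by
  have := l2_add_le hL hf hg.neg
  simpa only [Pi.neg_def, l2_neg, ← sub_eq_add_neg] using this

theorem l2_mono {L : ℝ} (hL : 0 < L) {f g : ℝ → ℝ} (hf : Continuous f) (hg : Continuous g)
    (h : ∀ x ∈ Icc 0 L, |f x| ≤ |g x|) : l2 L f ≤ l2 L g :=
  Real.sqrt_le_sqrt (intervalIntegral.integral_mono_on hL.le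
    (Continuous.intervalIntegrable (by fun_prop) _ _)
    (Continuous.intervalIntegrable (by fun_prop) _ _) fun x hx => sq_le_sq.2 (h x hx))

theorem l2_const {L : ℝ} (M : ℝ) : l2 L (fun _ => M) = √L * |M| := by
  unfold l2
  rw [intervalIntegral.integral_const, sub_zero, smul_eq_mul]
  rw [Real.sqrt_mul' _ (sq_nonneg _), Real.sqrt_sq_eq_abs]

theorem l2_le_of_bound {L : ℝ} (hL : 0 < L) {f : ℝ → ℝ} (hf : Continuous f) {M : ℝ}
    (h : ∀ x, |f x| ≤ M) : l2 L f ≤ √L * M := by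
  have hM : 0 ≤ M := (abs_nonneg _).trans (h 0)
  have := l2_mono hL hf (continuous_const (y := M)) fun x _ => by rw [abs_of_nonneg hM]; exact h x
  rwa [l2_const, abs_of_nonneg hM] at this

theorem l2_mul_le_of_bound {L : ℝ} (hL : 0 < L) {f g : ℝ → ℝ} (hf : Continuous f)
    (hg : Continuous g) {M : ℝ} (h : ∀ x, |f x| ≤ M) :
    l2 L (fun x => f x * g x) ≤ M * l2 L g := by
  have hM : 0 ≤ M := (abs_nonneg _).trans (h 0)
  rw [← abs_of_nonneg hM, ← l2_const_mul]
  refine l2_mono hL (by fun_prop) (by fun_prop) fun x _ => ?_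
  rw [abs_mul, abs_mul, abs_of_nonneg hM]
  exact mul_le_mul_of_nonneg_right (h x) (abs_nonneg _)

theorem l2_sum_le {L : ℝ} (hL : 0 < L) {ι : Type*} (s : Finset ι) {f : ι → ℝ → ℝ}
    (hf : ∀ i ∈ s, Continuous (f i)) :
    l2 L (fun x => ∑ i ∈ s, f i x) ≤ ∑ i ∈ s, l2 L (f i) := by
  classical
  induction s using Finset.induction_on with
  | empty => simp [l2]
  | insert i s hi ih =>
    simp only [Finset.sum_insert hi]
    refine (l2_add_le hL (hf i (Finset.mem_insert_self _ _)) (continuous_finsetSum _ fun j hj =>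
      hf j (Finset.mem_insert_of_mem hj))).trans ?_
    gcongr
    exact ih fun j hj => hf j (Finset.mem_insert_of_mem hj)

theorem integral_abs_le_l2 {L : ℝ} (hL : 0 < L) {f : ℝ → ℝ} (hf : Continuous f) :
    ∫ x in (0 : ℝ)..L, |f x| ≤ √L * l2 L f := by
  have h := (le_abs_self _).trans (abs_integral_mul_le hL (continuous_const (y := (1 : ℝ))) hf.abs)
  simp only [one_mul] at h
  refine h.trans_eq ?_
  rw [l2_const]
  simp [l2, sq_abs]

/-- Sup bound of a periodic function with a zero by the `L²` norm of its derivative. -/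
theorem abs_le_l2_deriv {L : ℝ} (hL : 0 < L) {f f' : ℝ → ℝ} (hf : ∀ x, HasDerivAt f (f' x) x)
    (hc : Continuous f') (hp : Function.Periodic f L) (hp' : Function.Periodic f' L) {z : ℝ}
    (hz : f z = 0) (x : ℝ) : |f x| ≤ √L * l2 L f' := by
  -- The point is moved into the period that begins at the zero z, so that f is an integral of f'
  -- over at most one period.
  obtain ⟨y, hy, hxy⟩ := hp.exists_mem_Ico hL x z
  rw [hxy]
  have h := intervalIntegral.integral_eq_sub_of_hasDerivAt (a := z) (b := y) (fun x _ => hf x)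
    (hc.intervalIntegrable _ _)
  rw [hz, sub_zero] at h
  rw [← h]
  calc |∫ x in z..y, f' x| ≤ ∫ x in z..y, |f' x| := intervalIntegral.abs_integral_le_integral_abs hy.1
    _ ≤ ∫ x in z..(z + L), |f' x| := by
      refine intervalIntegral.integral_mono_interval le_rfl hy.1 hy.2.le ?_
        (hc.abs.intervalIntegrable _ _)
      exact Eventually.of_forall fun _ => abs_nonneg _
    _ = ∫ x in (0 : ℝ)..L, |f' x| := by
      have hpa : Function.Periodic (fun x => |f' x|) L := fun x => by simp only [hp' x]
      simpa using hpa.intervalIntegral_add_eq z 0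
    _ ≤ _ := integral_abs_le_l2 hL hc

/-- Poincaré inequality, with a zero of f in place of the mean zero condition. -/
theorem l2_le_l2_deriv {L : ℝ} (hL : 0 < L) {f f' : ℝ → ℝ} (hf : ∀ x, HasDerivAt f (f' x) x)
    (hc : Continuous f') (hp : Function.Periodic f L) (hp' : Function.Periodic f' L) {z : ℝ}
    (hz : f z = 0) : l2 L f ≤ L * l2 L f' := by
  have hfc : Continuous f := continuous_iff_continuousAt.2 fun x => (hf x).continuousAt
  have := l2_le_of_bound hL hfc (abs_le_l2_deriv hL hf hc hp hp' hz)
  rwa [← mul_assoc, Real.mul_self_sqrt hL.le] at this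

/-- Integration by parts over one period. -/
theorem integral_deriv_mul_eq_neg {L : ℝ} {f f' g g' : ℝ → ℝ} (hf : ∀ x, HasDerivAt f (f' x) x)
    (hg : ∀ x, HasDerivAt g (g' x) x) (hf' : Continuous f') (hg' : Continuous g')
    (hpf : Function.Periodic f L) (hpg : Function.Periodic g L) :
    ∫ x in (0 : ℝ)..L, f' x * g x = -∫ x in (0 : ℝ)..L, f x * g' x := by
  have h := intervalIntegral.integral_mul_deriv_eq_deriv_mul (a := 0) (b := L) (u := f) (v := g)
    (fun x _ => hf x) (fun x _ => hg x)
    (hf'.intervalIntegrable _ _) (hg'.intervalIntegrable _ _)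
  have e1 : f L = f 0 := by simpa using hpf 0
  have e2 : g L = g 0 := by simpa using hpg 0
  rw [h, e1, e2]; ring

theorem integral_deriv_eq_zero {L : ℝ} {f f' : ℝ → ℝ} (hf : ∀ x, HasDerivAt f (f' x) x)
    (hf' : Continuous f') (hpf : Function.Periodic f L) : ∫ x in (0 : ℝ)..L, f' x = 0 := by
  rw [intervalIntegral.integral_eq_sub_of_hasDerivAt (fun x _ => hf x)
    (hf'.intervalIntegrable _ _)]
  simpa using sub_eq_zero.2 (hpf 0)

/-- Smooth `L`-periodic functions. -/
structure SmoothPeriodic (L : ℝ) (f : ℝ → ℝ) : Prop where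
  smooth : ContDiff ℝ ∞ f
  periodic : Function.Periodic f L

theorem periodic_deriv {L : ℝ} {f : ℝ → ℝ} (h : Function.Periodic f L) :
    Function.Periodic (deriv f) L := fun x => by
  rw [← deriv_comp_add_const]
  congr 1
  exact funext h

theorem contDiff_iteratedDeriv {f : ℝ → ℝ} (h : ContDiff ℝ ∞ f) (k : ℕ) :
    ContDiff ℝ ∞ (iteratedDeriv k f) :=
  ContDiff.iterate_deriv k h |> fun h => by rwa [iteratedDeriv_eq_iterate]

theorem hasDerivAt_iteratedDeriv {f : ℝ → ℝ} (h : ContDiff ℝ ∞ f) (k : ℕ) (x : ℝ) :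
    HasDerivAt (iteratedDeriv k f) (iteratedDeriv (k + 1) f x) x := by
  rw [iteratedDeriv_succ]
  exact ((contDiff_iteratedDeriv h k).differentiable (by simp) x).hasDerivAt

namespace SmoothPeriodic

variable {L : ℝ} {f g : ℝ → ℝ}

theorem iteratedDeriv (h : SmoothPeriodic L f) (k : ℕ) : SmoothPeriodic L (iteratedDeriv k f) := by
  refine ⟨contDiff_iteratedDeriv h.smooth k, ?_⟩
  induction k with
  | zero => simpa using h.periodic
  | succ k ih => rw [iteratedDeriv_succ]; exact periodic_deriv ih

theorem deriv (h : SmoothPeriodic L f) : SmoothPeriodic L (deriv f) := by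
  simpa [iteratedDeriv_one] using h.iteratedDeriv 1

theorem continuous (h : SmoothPeriodic L f) : Continuous f := h.smooth.continuous

theorem hasDerivAt (h : SmoothPeriodic L f) (x : ℝ) : HasDerivAt f (_root_.deriv f x) x :=
  (h.smooth.differentiable (by simp) x).hasDerivAt

theorem add (hf : SmoothPeriodic L f) (hg : SmoothPeriodic L g) :
    SmoothPeriodic L (fun x => f x + g x) :=
  ⟨hf.smooth.add hg.smooth, fun x => by simp only [hf.periodic x, hg.periodic x]⟩

theorem sub (hf : SmoothPeriodic L f) (hg : SmoothPeriodic L g) :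
    SmoothPeriodic L (fun x => f x - g x) :=
  ⟨hf.smooth.sub hg.smooth, fun x => by simp only [hf.periodic x, hg.periodic x]⟩

theorem mul (hf : SmoothPeriodic L f) (hg : SmoothPeriodic L g) :
    SmoothPeriodic L (fun x => f x * g x) :=
  ⟨hf.smooth.mul hg.smooth, fun x => by simp only [hf.periodic x, hg.periodic x]⟩

theorem const_mul (c : ℝ) (hf : SmoothPeriodic L f) :
    SmoothPeriodic L (fun x => c * f x) :=
  ⟨contDiff_const.mul hf.smooth, fun x => by simp only [hf.periodic x]⟩

theorem sum {ι : Type*} (s : Finset ι) {f : ι → ℝ → ℝ} (hf : ∀ i ∈ s, SmoothPeriodic L (f i)) :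
    SmoothPeriodic L (fun x => ∑ i ∈ s, f i x) :=
  ⟨ContDiff.sum fun i hi => (hf i hi).smooth,
    fun x => Finset.sum_congr rfl fun i hi => (hf i hi).periodic x⟩

/-- Every derivative of positive order of a smooth periodic function vanishes somewhere. -/
theorem exists_iteratedDeriv_eq_zero (hL : 0 < L) (hf : SmoothPeriodic L f) (k : ℕ) :
    ∃ z, _root_.iteratedDeriv (k + 1) f z = 0 := by
  have h := hf.iteratedDeriv k
  obtain ⟨c, -, hc⟩ := exists_hasDerivAt_eq_zero (f := _root_.iteratedDeriv k f)
    (f' := _root_.iteratedDeriv (k + 1) f) hL h.continuous.continuousOn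
    (by simpa using (h.periodic 0).symm) (fun x _ => hasDerivAt_iteratedDeriv hf.smooth k x)
  exact ⟨c, hc⟩

theorem integral_iteratedDeriv_mul (hf : SmoothPeriodic L f) (hg : SmoothPeriodic L g) (k : ℕ) :
    ∫ x in (0 : ℝ)..L, _root_.iteratedDeriv k f x * g x
      = (-1) ^ k * ∫ x in (0 : ℝ)..L, f x * _root_.iteratedDeriv k g x := by
  induction k generalizing g with
  | zero => simp
  | succ k ih =>
    rw [integral_deriv_mul_eq_neg (hasDerivAt_iteratedDeriv hf.smooth k) hg.hasDerivAt
      (hf.iteratedDeriv _).continuous hg.deriv.continuous (hf.iteratedDeriv k).periodic hg.periodic,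
      ih hg.deriv, pow_succ]
    simp only [iteratedDeriv_succ']
    ring

/-- The energy identity: moving all derivatives on one factor. -/
theorem integral_mul_iteratedDeriv_two_mul (hf : SmoothPeriodic L f) (hg : SmoothPeriodic L g)
    (k : ℕ) : ∫ x in (0 : ℝ)..L, f x * ((-1) ^ k * _root_.iteratedDeriv (2 * k) g x)
      = ∫ x in (0 : ℝ)..L, _root_.iteratedDeriv k f x * _root_.iteratedDeriv k g x := by
  rw [integral_iteratedDeriv_mul hf (hg.iteratedDeriv k) k]
  have : _root_.iteratedDeriv k (_root_.iteratedDeriv k g) = _root_.iteratedDeriv (2 * k) g := by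
    rw [iteratedDeriv_eq_iterate, iteratedDeriv_eq_iterate, iteratedDeriv_eq_iterate, two_mul,
      Function.iterate_add_apply]
  rw [this, ← intervalIntegral.integral_const_mul]
  congr 1; ext x; ring

end SmoothPeriodic

end HouLuo
-- The convolution kernel and the regularity of the velocity.
namespace HouLuo
open MeasureTheory Set

/-- The convolution kernel of `velocity`. -/
noncomputable def kern (L a z : ℝ) : ℝ :=
  1 / (2 * Real.pi) * (Real.log |Real.sin (Real.pi / L * z) ^ 2|
      - Real.log |Real.sin (Real.pi / L * z) ^ 2 + a|)

theorem velocity_eq_integral_kern_sub (L a : ℝ) (w : ℝ → ℝ) (x : ℝ) :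
    velocity L a w x = ∫ y in (0 : ℝ)..L, w y * kern L a (x - y) := by
  rw [velocity, ← intervalIntegral.integral_const_mul]
  congr 1; ext y; rw [kern]; ring

theorem kern_periodic {L : ℝ} (hL : 0 < L) (a : ℝ) : Function.Periodic (kern L a) L := fun z => by
  have : Real.pi / L * (z + L) = Real.pi / L * z + Real.pi := by field_simp
  simp only [kern, this, Real.sin_add_pi, neg_sq]

theorem kern_neg (L a z : ℝ) : kern L a (-z) = kern L a z := by
  simp only [kern, mul_neg, Real.sin_neg, neg_sq]

theorem continuous_log_sin_sq_add {L a : ℝ} (ha : 0 < a) :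
    Continuous fun z => Real.log |Real.sin (Real.pi / L * z) ^ 2 + a| := by
  refine Continuous.log (by fun_prop) fun z => ?_
  have : 0 < Real.sin (Real.pi / L * z) ^ 2 + a := by positivity
  exact (abs_pos.2 this.ne').ne'

theorem intervalIntegrable_log_sin_sq {L : ℝ} (hL : 0 < L) (b c : ℝ) :
    IntervalIntegrable (fun z => Real.log |Real.sin (Real.pi / L * z) ^ 2|) volume b c := by
  have h : IntervalIntegrable (fun z => Real.log (Real.sin (Real.pi / L * z))) volume b c := by
    have := (intervalIntegrable_log_sin (a := Real.pi / L * b) (b := Real.pi / L * c)).comp_mul_left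
      (c := Real.pi / L)
    have hne : Real.pi / L ≠ 0 := by positivity
    rwa [mul_div_cancel_left₀ _ hne, mul_div_cancel_left₀ _ hne] at this
  -- `Real.log` is even and `Real.log 0 = 0`, so log |s²| = 2 log s holds for every real s,
  -- including the zeros and negative values of the sine.
  refine (h.const_mul 2).congr fun z _ => ?_
  simp [Real.log_pow]

theorem intervalIntegrable_kern {L a : ℝ} (hL : 0 < L) (ha : 0 < a) (b c : ℝ) :
    IntervalIntegrable (kern L a) volume b c :=
  ((intervalIntegrable_log_sin_sq hL b c).sub
    ((continuous_log_sin_sq_add ha).intervalIntegrable _ _)).const_mul _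

/-- In this form the parameter x sits in the argument of w, and the singular kernel is a fixed
integrable weight. All derivatives of the velocity therefore fall on w. -/
theorem velocity_eq {L : ℝ} (hL : 0 < L) (a : ℝ) {w : ℝ → ℝ} (hp : Function.Periodic w L) (x : ℝ) :
    velocity L a w x = ∫ y in (0 : ℝ)..L, kern L a y * w (x - y) := by
  rw [velocity_eq_integral_kern_sub]
  have h := intervalIntegral.integral_comp_sub_left (a := 0) (b := L)
    (fun y => kern L a y * w (x - y)) x
  have hper : Function.Periodic (fun y => kern L a y * w (x - y)) L := fun y => by
    have : w (x - (y + L)) = w (x - y) := by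
      rw [← hp (x - (y + L))]; congr 1; ring
    simp only [kern_periodic hL a y, this]
  have h2 := hper.intervalIntegral_add_eq (x - L) 0
  simp only [sub_add_cancel, zero_add, sub_zero] at h2 h
  rw [← h2, ← h]
  congr 1; ext y; rw [sub_sub_cancel]; ring

/-- The `L¹` norm of the kernel over one period. -/
noncomputable def kernNorm (L a : ℝ) : ℝ := ∫ y in (0 : ℝ)..L, |kern L a y|

theorem kernNorm_nonneg {L : ℝ} (hL : 0 < L) (a : ℝ) : 0 ≤ kernNorm L a :=
  intervalIntegral.integral_nonneg hL.le fun _ _ => abs_nonneg _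

theorem abs_velocity_le {L a : ℝ} (hL : 0 < L) (ha : 0 < a) {w : ℝ → ℝ}
    (hp : Function.Periodic w L) {M : ℝ} (hM : ∀ x, |w x| ≤ M) (x : ℝ) :
    |velocity L a w x| ≤ kernNorm L a * M := by
  rw [velocity_eq hL a hp, kernNorm, ← intervalIntegral.integral_mul_const]
  refine intervalIntegral.norm_integral_le_of_norm_le (f := fun y => kern L a y * w (x - y))
    (g := fun y => |kern L a y| * M) hL.le
    (Eventually.of_forall fun y _ => ?_) ((intervalIntegrable_kern hL ha _ _).abs.mul_const _)
  rw [norm_mul]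
  exact mul_le_mul_of_nonneg_left (hM _) (abs_nonneg _)

theorem velocity_periodic {L : ℝ} (hL : 0 < L) (a : ℝ) {w : ℝ → ℝ}
    (hp : Function.Periodic w L) : Function.Periodic (velocity L a w) L := fun x => by
  rw [velocity_eq hL a hp, velocity_eq hL a hp]
  congr 1; ext y
  rw [show x + L - y = (x - y) + L by ring, hp]

theorem velocity_neg_of_odd {L : ℝ} (hL : 0 < L) (a : ℝ) {w : ℝ → ℝ}
    (hp : Function.Periodic w L) (ho : ∀ x, w (-x) = -w x) (x : ℝ) :
    velocity L a w (-x) = -velocity L a w x := by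
  rw [velocity_eq hL a hp, velocity_eq hL a hp, ← intervalIntegral.integral_neg]
  have h := intervalIntegral.integral_comp_sub_left (a := 0) (b := L)
    (fun y => kern L a y * w (-x - y)) L
  simp only [sub_self, sub_zero] at h
  rw [← h]
  congr 1; ext y
  have e1 : kern L a (L - y) = kern L a y := by
    rw [← kern_neg, neg_sub, ← kern_periodic hL a (y - L), sub_add_cancel]
  have e2 : w (-x - (L - y)) = -w (x - y) := by
    rw [← ho, ← hp]; congr 1; ring
  rw [e1, e2]; ring

theorem intervalIntegrable_kern_mul {L a : ℝ} (hL : 0 < L) (ha : 0 < a) {w : ℝ → ℝ}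
    (hw : Continuous w) (x b c : ℝ) :
    IntervalIntegrable (fun y => kern L a y * w (x - y)) volume b c :=
  (intervalIntegrable_kern hL ha b c).mul_continuousOn (by fun_prop)

theorem velocity_sub {L a : ℝ} (hL : 0 < L) (ha : 0 < a) {w v : ℝ → ℝ}
    (hw : Continuous w) (hv : Continuous v) (hpw : Function.Periodic w L)
    (hpv : Function.Periodic v L) (x : ℝ) :
    velocity L a (fun x => w x - v x) x = velocity L a w x - velocity L a v x := by
  have hp : Function.Periodic (fun x => w x - v x) L := fun x => by simp only [hpw x, hpv x]
  rw [velocity_eq hL a hp, velocity_eq hL a hpw, velocity_eq hL a hpv,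
    ← intervalIntegral.integral_sub (intervalIntegrable_kern_mul hL ha hw _ _ _)
    (intervalIntegrable_kern_mul hL ha hv _ _ _)]
  congr 1; ext y; ring

theorem velocity_sum {L a : ℝ} (hL : 0 < L) (ha : 0 < a) {ι : Type*} (s : Finset ι) (c : ι → ℝ)
    {f : ι → ℝ → ℝ} (hf : ∀ i ∈ s, Continuous (f i)) (hp : ∀ i ∈ s, Function.Periodic (f i) L)
    (x : ℝ) : velocity L a (fun x => ∑ i ∈ s, c i * f i x) x
      = ∑ i ∈ s, c i * velocity L a (f i) x := by
  have hp' : Function.Periodic (fun x => ∑ i ∈ s, c i * f i x) L := fun x =>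
    Finset.sum_congr rfl fun i hi => by rw [hp i hi x]
  rw [velocity_eq hL a hp']
  simp_rw [Finset.mul_sum]
  rw [intervalIntegral.integral_finsetSum fun i hi => ?_]
  · refine Finset.sum_congr rfl fun i hi => ?_
    rw [velocity_eq hL a (hp i hi), ← intervalIntegral.integral_const_mul]
    congr 1; ext y; ring
  · refine ((intervalIntegrable_kern_mul hL ha (hf i hi) x 0 L).const_mul (c i)).congr fun y _ => ?_
    ring

theorem velocity_hasDerivAt {L a : ℝ} (hL : 0 < L) (ha : 0 < a) {w w' : ℝ → ℝ}
    (hp : Function.Periodic w L) (hp' : Function.Periodic w' L)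
    (hw : ∀ x, HasDerivAt w (w' x) x) (hc : Continuous w') (x : ℝ) :
    HasDerivAt (velocity L a w) (velocity L a w' x) x := by
  have hwc : Continuous w := continuous_iff_continuousAt.2 fun x => (hw x).continuousAt
  rw [velocity_eq hL a hp', show velocity L a w = _ from funext (velocity_eq hL a hp)]
  refine hasDerivAt_weighted_integral (U := univ) (f := fun x y => w (x - y))
    (f' := fun x y => w' (x - y)) (intervalIntegrable_kern hL ha _ _) isOpen_univ
    (by fun_prop) (by fun_prop) (fun t _ y => ?_) (mem_univ x)
  exact (hw (t - y)).comp_sub_const t y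

theorem velocity_continuous {L a : ℝ} (hL : 0 < L) (ha : 0 < a) {w : ℝ → ℝ}
    (hp : Function.Periodic w L) (hw : Continuous w) : Continuous (velocity L a w) := by
  rw [show velocity L a w = _ from funext (velocity_eq hL a hp)]
  exact continuous_iff_continuousAt.2 fun x =>
    continuousAt_weighted_integral (U := univ) (intervalIntegrable_kern hL ha _ _) isOpen_univ
      (f := fun x y => w (x - y)) (by fun_prop) (mem_univ x)

theorem iteratedDeriv_velocity {L a : ℝ} (hL : 0 < L) (ha : 0 < a) {w : ℝ → ℝ}
    (hw : SmoothPeriodic L w) (k : ℕ) :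
    iteratedDeriv k (velocity L a w) = velocity L a (iteratedDeriv k w) := by
  induction k with
  | zero => simp
  | succ k ih =>
    rw [iteratedDeriv_succ, ih]
    ext x
    exact (velocity_hasDerivAt hL ha (hw.iteratedDeriv k).periodic (hw.iteratedDeriv (k + 1)).periodic
      (hasDerivAt_iteratedDeriv hw.smooth k) (hw.iteratedDeriv (k + 1)).continuous x).deriv

theorem SmoothPeriodic.velocity {L a : ℝ} (hL : 0 < L) (ha : 0 < a) {w : ℝ → ℝ}
    (hw : SmoothPeriodic L w) : SmoothPeriodic L (velocity L a w) := by
  have key : ∀ n : ℕ, ∀ w : ℝ → ℝ, SmoothPeriodic L w → ContDiff ℝ n (HouLuo.velocity L a w) := by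
    intro n
    induction n with
    | zero =>
      intro w hw
      rw [Nat.cast_zero, contDiff_zero]
      exact velocity_continuous hL ha hw.periodic hw.continuous
    | succ n ih =>
      intro w hw
      have hd := velocity_hasDerivAt hL ha hw.periodic hw.deriv.periodic hw.hasDerivAt
        hw.deriv.continuous
      rw [Nat.cast_succ, contDiff_succ_iff_deriv]
      refine ⟨fun x => (hd x).differentiableAt, by simp, ?_⟩
      rw [show _root_.deriv (HouLuo.velocity L a w) = _ from funext fun x => (hd x).deriv]
      exact ih _ hw.deriv
  exact ⟨contDiff_infty.2 fun n => key n w hw, velocity_periodic hL a hw.periodic⟩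

/-- Joint smoothness of the velocity. -/
theorem contDiffOn_velocity {L a : ℝ} (hL : 0 < L) (ha : 0 < a) {I : Set ℝ} (hI : IsOpen I)
    (n : ℕ) : ∀ {f : ℝ → ℝ → ℝ}, (∀ t ∈ I, Function.Periodic (f t) L) →
    ContDiffOn ℝ n (fun p : ℝ × ℝ => f p.1 p.2) (I ×ˢ univ) →
    ContDiffOn ℝ n (fun p : ℝ × ℝ => velocity L a (f p.1) p.2) (I ×ˢ univ) := by
  have hO : IsOpen (I ×ˢ (univ : Set ℝ)) := hI.prod isOpen_univ
  induction n with
  | zero =>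
    intro f hp hf
    rw [Nat.cast_zero, contDiffOn_zero] at hf ⊢
    refine ContinuousOn.congr (f := fun p : ℝ × ℝ => ∫ y in (0 : ℝ)..L, kern L a y * f p.1 (p.2 - y))
      (fun p hpI => ContinuousAt.continuousWithinAt ?_) (fun p hpI => velocity_eq hL a (hp _ hpI.1) _)
    refine continuousAt_weighted_integral (P := ℝ × ℝ) (intervalIntegrable_kern hL ha _ _) hO
      (f := fun p y => f p.1 (p.2 - y)) ?_ hpI
    exact hf.comp (f := fun q : (ℝ × ℝ) × ℝ => (q.1.1, q.1.2 - q.2)) (by fun_prop)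
      fun q hq => ⟨hq.1.1, mem_univ _⟩
  | succ n ih =>
    intro f hp hf
    rw [Nat.cast_succ] at hf ⊢
    obtain ⟨p1, p2, c1, c2⟩ := partials_of_contDiffOn_succ hI hf
    have hper1 : ∀ t ∈ I, Function.Periodic (fun x => deriv (fun s => f s x) t) L := by
      intro t ht x
      refine Filter.EventuallyEq.deriv_eq ?_
      filter_upwards [hI.mem_nhds ht] with s hs
      exact hp s hs x
    -- Both partial derivatives of the velocity are velocities of partial derivatives of f, so the
    -- induction hypothesis applies to each.
    refine contDiffOn_succ_of_partials hI (f := fun t x => velocity L a (f t) x)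
      (f₁ := fun t x => velocity L a (fun x => deriv (fun s => f s x) t) x)
      (f₂ := fun t x => velocity L a (fun x => deriv (f t) x) x) ?_ ?_ (ih hper1 c1)
      (ih (fun t ht => periodic_deriv (hp t ht)) c2)
    · intro t ht x
      rw [velocity_eq hL a (hper1 t ht)]
      have := hasDerivAt_weighted_integral (U := I) (intervalIntegrable_kern hL ha 0 L) hI
        (f := fun t y => f t (x - y)) (f' := fun t y => deriv (fun s => f s (x - y)) t) ?_ ?_
        (fun t ht y => p1 t ht (x - y)) ht
      · refine this.congr_of_eventuallyEq ?_
        filter_upwards [hI.mem_nhds ht] with s hs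
        exact velocity_eq hL a (hp s hs) x
      · exact hf.continuousOn.comp (f := fun q : ℝ × ℝ => (q.1, x - q.2)) (by fun_prop)
          fun q hq => ⟨hq.1, mem_univ _⟩
      · exact c1.continuousOn.comp (f := fun q : ℝ × ℝ => (q.1, x - q.2)) (by fun_prop)
          fun q hq => ⟨hq.1, mem_univ _⟩
    · intro t ht x
      refine velocity_hasDerivAt hL ha (hp t ht) (periodic_deriv (hp t ht)) (p2 t ht) ?_ x
      exact continuousOn_univ.mp (c2.continuousOn.comp (f := fun y : ℝ => (t, y)) (by fun_prop)
        (fun y _ => ⟨ht, mem_univ _⟩))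

end HouLuo
-- The velocity as a Fourier multiplier of order -1.
namespace HouLuo
open MeasureTheory Set

theorem hasSum_sq_fourierCoeffOn_l2 {L : ℝ} (hL : 0 < L) {f : ℝ → ℝ} (hf : Continuous f) :
    HasSum (fun n : ℤ => ‖fourierCoeffOn hL (fun x => (f x : ℂ)) n‖ ^ 2) (L⁻¹ * l2 L f ^ 2) := by
  have hm : MemLp (fun x => (f x : ℂ)) 2 (volume.restrict (Ioc 0 L)) := by
    obtain ⟨M, hM⟩ := (isCompact_Icc (a := (0 : ℝ)) (b := L)).exists_bound_of_continuousOn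
      hf.continuousOn
    refine MemLp.of_bound (by fun_prop) M ?_
    rw [ae_restrict_iff' measurableSet_Ioc]
    exact Eventually.of_forall fun x hx => by simpa using hM x (Ioc_subset_Icc_self hx)
  have h := hasSum_sq_fourierCoeffOn hL hm
  simpa [l2_sq hL] using h

/-- By Parseval, a termwise comparison of Fourier coefficients is a comparison of L² norms. -/
theorem l2_le_of_fourierCoeffOn_le {L : ℝ} (hL : 0 < L) {f g : ℝ → ℝ} (hf : Continuous f)
    (hg : Continuous g) {C : ℝ} (hC : 0 ≤ C)
    (h : ∀ n, ‖fourierCoeffOn hL (fun x => (g x : ℂ)) n‖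
      ≤ C * ‖fourierCoeffOn hL (fun x => (f x : ℂ)) n‖) : l2 L g ≤ C * l2 L f := by
  have h1 := hasSum_le (fun n => by
    have := pow_le_pow_left₀ (norm_nonneg _) (h n) 2
    rwa [mul_pow] at this) (hasSum_sq_fourierCoeffOn_l2 hL hg)
    ((hasSum_sq_fourierCoeffOn_l2 hL hf).mul_left (C ^ 2))
  refine le_of_sq_le_sq ?_ (mul_nonneg hC (l2_nonneg _ _))
  have h2 : 0 < L⁻¹ := by positivity
  rw [mul_pow]
  nlinarith

theorem fourier_neg_coe {L : ℝ} (n : ℤ) (x : ℝ) :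
    (fourier (-n) (x : AddCircle L) : ℂ)
      = (Real.cos (2 * Real.pi * n / L * x) : ℂ) - Real.sin (2 * Real.pi * n / L * x) * Complex.I := by
  rw [fourier_coe_apply, show (2 * Real.pi * Complex.I * ((-n : ℤ) : ℂ) * x / L : ℂ)
    = -((2 * Real.pi * n / L * x : ℝ) : ℂ) * Complex.I by push_cast; ring,
    Complex.exp_mul_I, Complex.cos_neg, Complex.sin_neg]
  push_cast; ring

theorem fourierCoeffOn_eq_integral_zero {L : ℝ} (hL : 0 < L) (f : ℝ → ℂ) (n : ℤ) :
    fourierCoeffOn hL f n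
      = ((1 / L : ℝ) : ℂ) * ∫ x in (0 : ℝ)..L, fourier (-n) (x : AddCircle L) * f x := by
  rw [fourierCoeffOn_eq_integral]
  simp only [fourier_coe_apply, sub_zero, smul_eq_mul, Complex.real_smul]

/-- The Fourier multiplier of the velocity operator. -/
noncomputable def kernHat (L a : ℝ) (n : ℤ) : ℝ :=
  ∫ y in (0 : ℝ)..L, kern L a y * Real.cos (2 * Real.pi * n / L * y)

/-- Under y ↦ L - y the kernel is even and the sine odd. Hence the Fourier coefficients of the
kernel are real and reduce to cosine integrals. -/
theorem integral_kern_mul_sin {L a : ℝ} (hL : 0 < L) (n : ℤ) :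
    ∫ y in (0 : ℝ)..L, kern L a y * Real.sin (2 * Real.pi * n / L * y) = 0 := by
  have h := intervalIntegral.integral_comp_sub_left (a := 0) (b := L)
    (fun y => kern L a y * Real.sin (2 * Real.pi * n / L * y)) L
  have e : ∀ y, kern L a (L - y) * Real.sin (2 * Real.pi * n / L * (L - y))
      = -(kern L a y * Real.sin (2 * Real.pi * n / L * y)) := by
    intro y
    have e1 : kern L a (L - y) = kern L a y := by
      rw [← kern_neg, neg_sub, ← kern_periodic hL a (y - L), sub_add_cancel]
    have e2 : 2 * Real.pi * n / L * (L - y) = n * (2 * Real.pi) - 2 * Real.pi * n / L * y := by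
      field_simp
    rw [e1, e2, Real.sin_int_mul_two_pi_sub]; ring
  simp_rw [e] at h
  rw [intervalIntegral.integral_neg] at h
  simp only [sub_self, sub_zero] at h
  linarith

theorem integral_kern_mul_fourier {L a : ℝ} (hL : 0 < L) (ha : 0 < a) (n : ℤ) :
    ∫ y in (0 : ℝ)..L, (kern L a y : ℂ) * fourier (-n) (y : AddCircle L) = kernHat L a n := by
  have h1 : IntervalIntegrable (fun y => kern L a y * Real.cos (2 * Real.pi * n / L * y)) volume 0 L :=
    (intervalIntegrable_kern hL ha _ _).mul_continuousOn (by fun_prop)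
  have h2 : IntervalIntegrable (fun y => kern L a y * Real.sin (2 * Real.pi * n / L * y)) volume 0 L :=
    (intervalIntegrable_kern hL ha _ _).mul_continuousOn (by fun_prop)
  have h1' : IntervalIntegrable (fun y => ((kern L a y * Real.cos (2 * Real.pi * n / L * y) : ℝ) : ℂ))
      volume 0 L := ⟨h1.1.ofReal, h1.2.ofReal⟩
  have h2' : IntervalIntegrable (fun y => ((kern L a y * Real.sin (2 * Real.pi * n / L * y) : ℝ) : ℂ))
      volume 0 L := ⟨h2.1.ofReal, h2.2.ofReal⟩
  have e : ∀ y : ℝ, (kern L a y : ℂ) * fourier (-n) (y : AddCircle L)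
      = ((kern L a y * Real.cos (2 * Real.pi * n / L * y) : ℝ) : ℂ)
        - ((kern L a y * Real.sin (2 * Real.pi * n / L * y) : ℝ) : ℂ) * Complex.I := by
    intro y; rw [fourier_neg_coe]; push_cast; ring
  simp_rw [e]
  rw [intervalIntegral.integral_sub h1' (h2'.mul_const _),
    intervalIntegral.integral_mul_const, intervalIntegral.integral_ofReal,
    intervalIntegral.integral_ofReal, integral_kern_mul_sin hL]
  simp [kernHat]

/-- The convolution theorem: Fubini, then a translation by y in the inner integral, which produces
the character at y. -/
theorem fourierCoeffOn_velocity {L a : ℝ} (hL : 0 < L) (ha : 0 < a) {w : ℝ → ℝ}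
    (hp : Function.Periodic w L) (hw : Continuous w) (n : ℤ) :
    fourierCoeffOn hL (fun x => (velocity L a w x : ℂ)) n
      = kernHat L a n * fourierCoeffOn hL (fun x => (w x : ℂ)) n := by
  rw [fourierCoeffOn_eq_integral_zero, fourierCoeffOn_eq_integral_zero, mul_left_comm]
  congr 1
  have e : ∀ x : ℝ, fourier (-n) (x : AddCircle L) * (velocity L a w x : ℂ)
      = ∫ y in (0 : ℝ)..L, (kern L a y : ℂ) * ((w (x - y) : ℂ) * fourier (-n) (x : AddCircle L)) := by
    intro x
    rw [velocity_eq hL a hp, ← intervalIntegral.integral_ofReal, ← intervalIntegral.integral_const_mul]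
    congr 1; ext y; push_cast; ring
  simp_rw [e]
  have hfc : Continuous fun x : ℝ => (fourier (-n) (x : AddCircle L) : ℂ) :=
    (fourier (-n)).continuous.comp (AddCircle.continuous_mk' L)
  have inner : ∀ y : ℝ, ∫ x in (0 : ℝ)..L, (kern L a y : ℂ) * ((w (x - y) : ℂ) *
      fourier (-n) (x : AddCircle L)) = ((kern L a y : ℂ) * fourier (-n) (y : AddCircle L)) *
        ∫ x in (0 : ℝ)..L, fourier (-n) (x : AddCircle L) * (w x : ℂ) := by
    intro y
    rw [intervalIntegral.integral_const_mul, mul_assoc]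
    congr 1
    have hper : Function.Periodic (fun x : ℝ => fourier (-n) (x : AddCircle L) * (w x : ℂ)) L := by
      intro x; simp only [hp x, AddCircle.coe_add_period]
    have h2 := hper.intervalIntegral_add_eq (-y) 0
    have h3 := intervalIntegral.integral_comp_sub_right (a := 0) (b := L)
      (fun x : ℝ => fourier (-n) (x : AddCircle L) * (w x : ℂ)) y
    simp only [zero_sub, zero_add] at h2 h3
    rw [show -y + L = L - y by ring] at h2
    rw [← h2, ← h3, ← intervalIntegral.integral_const_mul]
    congr 1; ext x
    have : (fourier (-n) (x : AddCircle L) : ℂ)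
        = fourier (-n) (y : AddCircle L) * fourier (-n) ((x - y : ℝ) : AddCircle L) := by
      rw [fourier_coe_apply, fourier_coe_apply, fourier_coe_apply, ← Complex.exp_add]
      congr 1; push_cast; ring
    rw [this]; ring
  simp_rw [intervalIntegral.integral_of_le hL.le] at inner ⊢
  rw [integral_integral_swap]
  · simp_rw [inner]
    rw [integral_mul_const, ← intervalIntegral.integral_of_le hL.le,
      ← intervalIntegral.integral_of_le hL.le, integral_kern_mul_fourier hL ha]
  -- Fubini is justified because the integrand is an integrable function of y times a bounded
  -- continuous function of both variables.
  · have hk : Integrable (fun y => (kern L a y : ℂ)) (volume.restrict (Ioc 0 L)) :=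
      ((intervalIntegrable_iff_integrableOn_Ioc_of_le hL.le).1 (intervalIntegrable_kern hL ha 0 L)).ofReal
    obtain ⟨M, hM⟩ := (isCompact_Icc (a := (0 : ℝ)) (b := L)).exists_bound_of_continuousOn
      hw.continuousOn
    have h1 : Integrable (fun p : ℝ × ℝ => (kern L a p.2 : ℂ))
        ((volume.restrict (Ioc 0 L)).prod (volume.restrict (Ioc 0 L))) := hk.comp_snd _
    refine h1.mul_bdd (c := M) (g := fun p : ℝ × ℝ => (w (p.1 - p.2) : ℂ) * fourier (-n) (p.1 : AddCircle L)) ?_ ?_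
    · exact Continuous.aestronglyMeasurable (by fun_prop)
    · refine Eventually.of_forall fun p => ?_
      obtain ⟨y, hy, hxy⟩ := hp.exists_mem_Ico hL (p.1 - p.2) 0
      rw [norm_mul, hxy]
      have : ‖(fourier (-n) (p.1 : AddCircle L) : ℂ)‖ = 1 := by
        rw [fourier_apply]; exact Circle.norm_coe _
      rw [this, mul_one, Complex.norm_real]
      exact hM y (by simpa using Ico_subset_Icc_self hy)

theorem abs_kernHat_le {L a : ℝ} (hL : 0 < L) (ha : 0 < a) (n : ℤ) : |kernHat L a n| ≤ kernNorm L a := by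
  refine intervalIntegral.norm_integral_le_of_norm_le
    (f := fun y => kern L a y * Real.cos (2 * Real.pi * n / L * y)) (g := fun y => |kern L a y|) hL.le
    (Eventually.of_forall fun y _ => ?_) (intervalIntegrable_kern hL ha _ _).abs
  rw [norm_mul]
  exact mul_le_of_le_one_right (norm_nonneg _) (Real.abs_cos_le_one _)

theorem integral_cos_period {L : ℝ} (hL : 0 < L) {n : ℕ} (hn : n ≠ 0) :
    ∫ y in (0 : ℝ)..L, Real.cos (2 * n * (Real.pi / L * y)) = 0 := by
  have hc : (2 * n * (Real.pi / L) : ℝ) ≠ 0 := by positivity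
  simp_rw [← mul_assoc]
  rw [intervalIntegral.integral_comp_mul_left (fun x => Real.cos x) hc, integral_cos]
  have : 2 * (n : ℝ) * (Real.pi / L) * L = (2 * n : ℕ) * Real.pi := by field_simp; push_cast; ring
  rw [this, Real.sin_nat_mul_pi]; simp

/-- The decay rate 1/n comes from the logarithmic singularity, for which the coefficient can be
computed exactly by one integration by parts. -/
theorem integral_log_sin_sq_mul_cos {L : ℝ} (hL : 0 < L) {n : ℕ} (hn : n ≠ 0) :
    ∫ y in (0 : ℝ)..L, Real.log |Real.sin (Real.pi / L * y) ^ 2| * Real.cos (2 * n * (Real.pi / L * y))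
      = -(L / n) := by
  set μ := Real.pi / L with hμ
  have hμ0 : 0 < μ := by positivity
  have hn0 : (n : ℝ) ≠ 0 := by exact_mod_cast hn
  -- U(z) is sin(2nz) / sin z written as a trigonometric polynomial, so that the zeros of the sine
  -- cause no division.
  set U : ℝ → ℝ := fun z => ∑ j ∈ Finset.range n, 2 * Real.cos ((2 * j + 1) * z) with hU
  have hUc : Continuous U := by fun_prop
  have hsin : ∀ z, Real.sin z * U z = Real.sin (2 * n * z) := by
    intro z
    rw [hU]; simp only
    clear hn hn0 hU hUc U
    induction n with
    | zero => simp
    | succ n ih =>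
      rw [Finset.sum_range_succ, mul_add, ih]
      have e1 : (2 * ((n + 1 : ℕ) : ℝ) * z) = (2 * n + 1) * z + z := by push_cast; ring
      have e2 : (2 * (n : ℝ) * z) = (2 * n + 1) * z - z := by ring
      rw [e1, e2, Real.sin_add, Real.sin_sub]; ring
  have hcos : ∀ z, Real.cos z * U z
      = ∑ j ∈ Finset.range n, (Real.cos (2 * (j + 1 : ℕ) * z) + Real.cos (2 * j * z)) := by
    intro z
    rw [hU, Finset.mul_sum]
    refine Finset.sum_congr rfl fun j _ => ?_
    have e1 : (2 * ((j + 1 : ℕ) : ℝ) * z) = (2 * j + 1) * z + z := by push_cast; ring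
    have e2 : (2 * (j : ℝ) * z) = (2 * j + 1) * z - z := by ring
    rw [e1, e2, Real.cos_add, Real.cos_sub]; ring
  -- The product cos z · U(z) is a sum of cosines of even multiples of z. Only the constant cos 0
  -- that occurs for j = 0 survives integration over a period.
  have hint : ∫ y in (0 : ℝ)..L, Real.cos (μ * y) * U (μ * y) = L := by
    simp_rw [hcos]
    rw [intervalIntegral.integral_finsetSum fun j _ => Continuous.intervalIntegrable (by fun_prop) _ _,
      ← Finset.sum_erase_add _ _ (Finset.mem_range.2 (Nat.pos_of_ne_zero hn)),
      Finset.sum_eq_zero]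
    · rw [intervalIntegral.integral_add (Continuous.intervalIntegrable (by fun_prop) _ _)
        (Continuous.intervalIntegrable (by fun_prop) _ _), integral_cos_period hL (by simp)]
      simp
    · intro j hj
      rw [intervalIntegral.integral_add (Continuous.intervalIntegrable (by fun_prop) _ _)
        (Continuous.intervalIntegrable (by fun_prop) _ _), integral_cos_period hL (by simp),
        integral_cos_period hL (Finset.mem_erase.1 hj).1]
      simp
  have hlog : ∀ z, Real.log |Real.sin z ^ 2| = 2 * Real.log (Real.sin z) := by
    intro z; simp [Real.log_pow]
  have hmain : ∫ y in (0 : ℝ)..L, (Real.log |Real.sin (μ * y) ^ 2| * Real.cos (2 * n * (μ * y))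
      + 1 / n * (Real.cos (μ * y) * U (μ * y))) = 0 := by
    -- The antiderivative is sin(2nμy) log(sin μy) / (nμ). Grouped as U times sin · log sin, it is
    -- continuous up to 0 and L, since s log s is continuous, and it vanishes there.
    have h := intervalIntegral.integral_eq_sub_of_hasDerivAt_of_le hL.le
      (f := fun y => 1 / (n * μ) * (U (μ * y) * (Real.sin (μ * y) * Real.log (Real.sin (μ * y)))))
      (f' := fun y => Real.log |Real.sin (μ * y) ^ 2| * Real.cos (2 * n * (μ * y))
      + 1 / n * (Real.cos (μ * y) * U (μ * y))) ?_ ?_ ?_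
    · rw [h]
      have : Real.sin (μ * L) = 0 := by rw [hμ, div_mul_cancel₀ _ hL.ne', Real.sin_pi]
      simp [this]
    · have : Continuous fun y => Real.sin (μ * y) * Real.log (Real.sin (μ * y)) :=
        Real.continuous_mul_log.comp (by fun_prop : Continuous fun y => Real.sin (μ * y))
      fun_prop
    · intro y hy
      have hs : 0 < Real.sin (μ * y) := by
        refine Real.sin_pos_of_pos_of_lt_pi (mul_pos hμ0 hy.1) ?_
        calc μ * y < μ * L := by have := hy.2; gcongr
          _ = Real.pi := by rw [hμ, div_mul_cancel₀ _ hL.ne']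
      have hμy : HasDerivAt (fun y => μ * y) μ y := by simpa using (hasDerivAt_id y).const_mul μ
      have hds : HasDerivAt (fun y => Real.sin (μ * y)) (Real.cos (μ * y) * μ) y := hμy.sin
      have hdl : HasDerivAt (fun y => Real.log (Real.sin (μ * y)))
        (Real.cos (μ * y) * μ / Real.sin (μ * y)) y := hds.log hs.ne'
      have hdn : HasDerivAt (fun y => Real.sin (2 * n * (μ * y)))
        (Real.cos (2 * n * (μ * y)) * (2 * n * μ)) y := (hμy.const_mul (2 * (n : ℝ))).sin
      have hd := (hdn.mul hdl).const_mul (1 / (n * μ))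
      refine (hd.congr_of_eventuallyEq (Eventually.of_forall fun y => ?_)).congr_deriv ?_
      · simp only [Pi.mul_apply, ← hsin]; ring
      · rw [hlog, ← hsin]
        field_simp
    · exact ((intervalIntegrable_log_sin_sq hL 0 L).mul_continuousOn (by fun_prop)).add
        (Continuous.intervalIntegrable (by fun_prop) _ _)
  rw [intervalIntegral.integral_add ((intervalIntegrable_log_sin_sq hL 0 L).mul_continuousOn
    (by fun_prop)) (Continuous.intervalIntegrable (by fun_prop) _ _),
    intervalIntegral.integral_const_mul, hint] at hmain
  rw [eq_neg_of_add_eq_zero_left hmain]; ring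

/-- The quantitative form of the gain of one derivative. The singular part log sin² contributes
exactly L / n; the smooth part log(sin² + a) is O(1/n) by one integration by parts, with constant L
/ a because its denominator is at least a. -/
theorem exists_abs_mul_kernHat_le {L a : ℝ} (hL : 0 < L) (ha : 0 < a) :
    ∃ C, 0 ≤ C ∧ ∀ n : ℤ, |n * kernHat L a n| ≤ C := by
  set μ := Real.pi / L with hμ
  have hμ0 : 0 < μ := by positivity
  refine ⟨1 / (2 * Real.pi) * (L + L * (1 / a)), by positivity, ?_⟩
  have hnat : ∀ n : ℕ, n ≠ 0 → |n * kernHat L a n| ≤ 1 / (2 * Real.pi) * (L + L * (1 / a)) := by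
    intro n hn
    have hn0 : (n : ℝ) ≠ 0 := by exact_mod_cast hn
    have hsplit : kernHat L a n = 1 / (2 * Real.pi) * ((-(L / n))
        - ∫ y in (0 : ℝ)..L, Real.log |Real.sin (μ * y) ^ 2 + a| * Real.cos (2 * n * (μ * y))) := by
      rw [← integral_log_sin_sq_mul_cos hL hn, ← intervalIntegral.integral_sub,
        ← intervalIntegral.integral_const_mul, kernHat]
      · congr 1; ext y
        rw [kern, show 2 * Real.pi * ((n : ℤ) : ℝ) / L * y = 2 * n * (μ * y) by
          rw [hμ]; push_cast; ring]
        ring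
      · exact (intervalIntegrable_log_sin_sq hL 0 L).mul_continuousOn (by fun_prop)
      · exact ((continuous_log_sin_sq_add ha).mul (by fun_prop)).intervalIntegrable _ _
    have hparts : ∫ y in (0 : ℝ)..L, Real.log |Real.sin (μ * y) ^ 2 + a| * Real.cos (2 * n * (μ * y))
        = -∫ y in (0 : ℝ)..L, (2 * Real.sin (μ * y) * (Real.cos (μ * y) * μ)
            / (Real.sin (μ * y) ^ 2 + a)) * (1 / (2 * n * μ) * Real.sin (2 * n * (μ * y))) := by
      have hpos : ∀ y, 0 < Real.sin (μ * y) ^ 2 + a := fun y => by positivity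
      have h := intervalIntegral.integral_mul_deriv_eq_deriv_mul (a := 0) (b := L)
        (u := fun y => Real.log |Real.sin (μ * y) ^ 2 + a|)
        (u' := fun y => 2 * Real.sin (μ * y) * (Real.cos (μ * y) * μ) / (Real.sin (μ * y) ^ 2 + a))
        (v := fun y => 1 / (2 * n * μ) * Real.sin (2 * n * (μ * y)))
        (v' := fun y => Real.cos (2 * n * (μ * y))) ?_ ?_ ?_ ?_
      · rw [h]
        have e1 : 2 * n * (μ * L) = (2 * n : ℕ) * Real.pi := by
          rw [hμ]; field_simp; push_cast; ring
        simp only [e1, Real.sin_nat_mul_pi]; simp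
      · intro y _
        have hμy : HasDerivAt (fun y => μ * y) μ y := by simpa using (hasDerivAt_id y).const_mul μ
        have h1 := ((hμy.sin.pow 2).add_const a).log (hpos y).ne'
        refine (h1.congr_of_eventuallyEq (Eventually.of_forall fun z => ?_)).congr_deriv ?_
        · simp [Real.log_abs]
        · simp
      · intro y _
        have hμy : HasDerivAt (fun y => μ * y) μ y := by simpa using (hasDerivAt_id y).const_mul μ
        refine ((hμy.const_mul (2 * (n : ℝ))).sin.const_mul (1 / (2 * n * μ))).congr_deriv ?_
        field_simp
      · refine Continuous.intervalIntegrable ?_ _ _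
        exact Continuous.div (by fun_prop) (by fun_prop) fun y => (hpos y).ne'
      · exact Continuous.intervalIntegrable (by fun_prop) _ _
    have hb : |∫ y in (0 : ℝ)..L, (2 * Real.sin (μ * y) * (Real.cos (μ * y) * μ)
            / (Real.sin (μ * y) ^ 2 + a)) * (1 / (2 * n * μ) * Real.sin (2 * n * (μ * y)))|
        ≤ (1 / (a * n)) * |L - 0| := by
      refine intervalIntegral.norm_integral_le_of_norm_le_const
        (f := fun y => (2 * Real.sin (μ * y) * (Real.cos (μ * y) * μ)
            / (Real.sin (μ * y) ^ 2 + a)) * (1 / (2 * n * μ) * Real.sin (2 * n * (μ * y)))) fun y _ => ?_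
      have hpos : 0 < Real.sin (μ * y) ^ 2 + a := by positivity
      rw [Real.norm_eq_abs, abs_mul, abs_div, abs_mul, abs_mul, abs_mul, abs_mul, abs_of_pos hpos,
        abs_of_pos hμ0, abs_of_pos (by positivity : 0 < 1 / (2 * n * μ)), abs_two]
      have h1 := Real.abs_sin_le_one (μ * y)
      have h2 := Real.abs_cos_le_one (μ * y)
      have h3 := Real.abs_sin_le_one (2 * n * (μ * y))
      calc 2 * |Real.sin (μ * y)| * (|Real.cos (μ * y)| * μ) / (Real.sin (μ * y) ^ 2 + a) *
            (1 / (2 * n * μ) * |Real.sin (2 * n * (μ * y))|)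
          ≤ 2 * 1 * (1 * μ) / (0 + a) * (1 / (2 * n * μ) * 1) := by gcongr; positivity
        _ = 1 / (a * n) := by field_simp; ring
    rw [hsplit, hparts, mul_left_comm, abs_mul, abs_of_pos (by positivity : 0 < 1 / (2 * Real.pi))]
    gcongr
    rw [abs_mul, abs_of_pos (by positivity : 0 < (n : ℝ))]
    rw [sub_zero, abs_of_pos hL] at hb
    calc (n : ℝ) * |(-(L / n)) - (-∫ y in (0 : ℝ)..L, (2 * Real.sin (μ * y) * (Real.cos (μ * y) * μ)
            / (Real.sin (μ * y) ^ 2 + a)) * (1 / (2 * n * μ) * Real.sin (2 * n * (μ * y))))|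
        ≤ n * (L / n + 1 / (a * n) * L) := by
          gcongr
          refine (abs_sub _ _).trans (add_le_add ?_ ?_)
          · rw [abs_neg, abs_of_pos (by positivity)]
          · rwa [abs_neg]
      _ = L + L * (1 / a) := by field_simp
  intro n
  rcases eq_or_ne n 0 with rfl | hn
  · simp; positivity
  · obtain ⟨m, rfl | rfl⟩ := n.eq_nat_or_neg
    · exact_mod_cast hnat m (by simpa using hn)
    · have h := hnat m (by simpa using hn)
      have : kernHat L a (-(m : ℤ)) = kernHat L a (m : ℤ) := by
        unfold kernHat
        congr 1; ext y
        rw [← Real.cos_neg]; congr 2; push_cast; ring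
      rw [this, Int.cast_neg, neg_mul, abs_neg]
      exact_mod_cast h

/-- The velocity operator is bounded on `L²`, and so is its composition with the derivative. -/
theorem exists_l2_velocity_le {L a : ℝ} (hL : 0 < L) (ha : 0 < a) :
    ∃ C, 0 ≤ C ∧
      (∀ w : ℝ → ℝ, Function.Periodic w L → Continuous w → l2 L (velocity L a w) ≤ C * l2 L w) ∧
      (∀ w w' : ℝ → ℝ, Function.Periodic w L → Function.Periodic w' L →
        (∀ x, HasDerivAt w (w' x) x) → Continuous w' → l2 L (velocity L a w') ≤ C * l2 L w) := by
  obtain ⟨C, hC, hCn⟩ := exists_abs_mul_kernHat_le hL ha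
  -- The first entry bounds the multiplier itself. The second bounds the multiplier times the
  -- frequency 2πn/L, which belongs to the composition with d/dx.
  refine ⟨max (kernNorm L a) (C * (2 * Real.pi / L)), le_max_of_le_left (kernNorm_nonneg hL a), ?_, ?_⟩
  · intro w hp hw
    refine l2_le_of_fourierCoeffOn_le hL hw (velocity_continuous hL ha hp hw)
      (le_max_of_le_left (kernNorm_nonneg hL a)) fun n => ?_
    rw [fourierCoeffOn_velocity hL ha hp hw, norm_mul, Complex.norm_real]
    gcongr
    exact (abs_kernHat_le hL ha n).trans (le_max_left _ _)
  · intro w w' hp hp' hd hc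
    have hw : Continuous w := continuous_iff_continuousAt.2 fun x => (hd x).continuousAt
    refine l2_le_of_fourierCoeffOn_le hL hw (velocity_continuous hL ha hp' hc)
      (le_max_of_le_left (kernNorm_nonneg hL a)) fun n => ?_
    rw [fourierCoeffOn_velocity hL ha hp' hc]
    -- The zero mode of w' vanishes by periodicity. For the other modes differentiation is
    -- multiplication by 2πin/L.
    rcases eq_or_ne n 0 with rfl | hn
    · have : fourierCoeffOn hL (fun x => (w' x : ℂ)) 0 = 0 := by
        rw [fourierCoeffOn_eq_integral]
        simp [intervalIntegral.integral_ofReal, integral_deriv_eq_zero hd hc hp]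
      rw [this, mul_zero, norm_zero]
      exact mul_nonneg (le_max_of_le_left (kernNorm_nonneg hL a)) (norm_nonneg _)
    · have h := fourierCoeffOn_of_hasDerivAt hL (f := fun x => (w x : ℂ)) (f' := fun x => (w' x : ℂ))
        hn (fun x _ => (hd x).ofReal_comp) (Continuous.intervalIntegrable (by fun_prop) _ _)
      have hwL : w L = w 0 := by simpa using hp 0
      rw [hwL, sub_self, mul_zero, zero_sub] at h
      have hn' : (n : ℂ) ≠ 0 := by exact_mod_cast hn
      have hL' : (L : ℂ) ≠ 0 := by exact_mod_cast hL.ne'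
      have hpi : (Real.pi : ℂ) ≠ 0 := by exact_mod_cast Real.pi_ne_zero
      have e : fourierCoeffOn hL (fun x => (w' x : ℂ)) n
          = (2 * Real.pi / L * n : ℝ) * (Complex.I * fourierCoeffOn hL (fun x => (w x : ℂ)) n) := by
        rw [h]; push_cast
        field_simp [Complex.I_ne_zero]
        simp
      rw [e, norm_mul, norm_mul, norm_mul, Complex.norm_real, Complex.norm_real, Complex.norm_I, one_mul,
        ← mul_assoc]
      gcongr
      refine le_trans ?_ (le_max_right _ _)
      rw [Real.norm_eq_abs, Real.norm_eq_abs, ← abs_mul,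
        show kernHat L a n * (2 * Real.pi / L * n) = (n * kernHat L a n) * (2 * Real.pi / L) by ring,
        abs_mul, abs_of_pos (by positivity : 0 < 2 * Real.pi / L)]
      gcongr
      exact hCn n

end HouLuo
-- Sine series of smooth odd periodic functions.
namespace HouLuo
open MeasureTheory Set

/-- The frequencies of the sine basis. -/
noncomputable def freq (L : ℝ) (n : ℕ) : ℝ := 2 * Real.pi * (n + 1) / L

theorem freq_pos {L : ℝ} (hL : 0 < L) (n : ℕ) : 0 < freq L n := by unfold freq; positivity

/-- The sine basis. -/
noncomputable def sineBasis (L : ℝ) (n : ℕ) (x : ℝ) : ℝ := Real.sin (freq L n * x)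

theorem sineBasis_neg (L : ℝ) (n : ℕ) (x : ℝ) : sineBasis L n (-x) = -sineBasis L n x := by
  simp [sineBasis]

theorem abs_sineBasis_le (L : ℝ) (n : ℕ) (x : ℝ) : |sineBasis L n x| ≤ 1 := Real.abs_sin_le_one _

theorem smoothPeriodic_sineBasis {L : ℝ} (hL : 0 < L) (n : ℕ) : SmoothPeriodic L (sineBasis L n) := by
  refine ⟨Real.contDiff_sin.comp (contDiff_const.mul contDiff_id), fun x => ?_⟩
  have : freq L n * (x + L) = freq L n * x + (n + 1 : ℕ) * (2 * Real.pi) := by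
    unfold freq; field_simp; push_cast; ring
  rw [sineBasis, this, Real.sin_add_nat_mul_two_pi, sineBasis]

theorem iteratedDeriv_two_sineBasis (L : ℝ) (n : ℕ) :
    iteratedDeriv 2 (sineBasis L n) = fun x => -freq L n ^ 2 * sineBasis L n x := by
  have hl : ∀ x : ℝ, HasDerivAt (fun x => freq L n * x) (freq L n) x := fun x => by
    simpa using (hasDerivAt_id x).const_mul (freq L n)
  have h1 : deriv (sineBasis L n) = fun x => Real.cos (freq L n * x) * freq L n :=
    funext fun x => (hl x).sin.deriv
  rw [iteratedDeriv_succ, iteratedDeriv_one, h1]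
  ext x
  rw [((hl x).cos.mul_const _).deriv, sineBasis]; ring

theorem iteratedDeriv_two_mul_sineBasis (L : ℝ) (n k : ℕ) :
    iteratedDeriv (2 * k) (sineBasis L n)
      = fun x => (-1) ^ k * freq L n ^ (2 * k) * sineBasis L n x := by
  induction k with
  | zero => simp
  | succ k ih =>
    have e : iteratedDeriv (2 * (k + 1)) (sineBasis L n)
        = iteratedDeriv (2 * k) (iteratedDeriv 2 (sineBasis L n)) := by
      rw [iteratedDeriv_eq_iterate, iteratedDeriv_eq_iterate, iteratedDeriv_eq_iterate,
        mul_add, mul_one, Function.iterate_add_apply]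
    rw [e, iteratedDeriv_two_sineBasis]
    ext x
    rw [iteratedDeriv_const_mul_field, ih]; ring

/-- Orthogonality is the usual property of the symmetric operator d²/dx²: distinct modes have
distinct eigenvalues -`freq`². Only the normalisation is computed by hand. -/
theorem integral_sineBasis_mul_sineBasis {L : ℝ} (hL : 0 < L) (m n : ℕ) :
    ∫ x in (0 : ℝ)..L, sineBasis L m x * sineBasis L n x = if m = n then L / 2 else 0 := by
  have hm := smoothPeriodic_sineBasis hL m
  have hn := smoothPeriodic_sineBasis hL n
  split_ifs with h
  · subst h
    have hc : (2 * freq L m) ≠ 0 := by have := freq_pos hL m; positivity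
    have e : ∀ x, sineBasis L m x * sineBasis L m x = 1 / 2 - 1 / 2 * Real.cos (2 * freq L m * x) := by
      intro x
      have := Real.cos_sq' (freq L m * x)
      have h2 := Real.cos_two_mul (freq L m * x)
      rw [mul_assoc, h2, this, sineBasis]; ring
    simp_rw [e]
    rw [intervalIntegral.integral_sub (by simp) (Continuous.intervalIntegrable (by fun_prop) _ _),
      intervalIntegral.integral_const_mul,
      intervalIntegral.integral_comp_mul_left (fun x => Real.cos x) hc, integral_cos]
    have : 2 * freq L m * L = (4 * (m + 1) : ℕ) * Real.pi := by
      unfold freq; field_simp; push_cast; ring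
    rw [this, Real.sin_nat_mul_pi]; simp; ring
  · have h1 := hm.integral_iteratedDeriv_mul hn 2
    rw [iteratedDeriv_two_sineBasis, iteratedDeriv_two_sineBasis] at h1
    have e1 : ∀ x, -freq L m ^ 2 * sineBasis L m x * sineBasis L n x
      = -freq L m ^ 2 * (sineBasis L m x * sineBasis L n x) := fun x => by ring
    have e2 : ∀ x, sineBasis L m x * (-freq L n ^ 2 * sineBasis L n x)
      = -freq L n ^ 2 * (sineBasis L m x * sineBasis L n x) := fun x => by ring
    simp only [e1, e2, intervalIntegral.integral_const_mul] at h1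
    have hne : freq L m ^ 2 ≠ freq L n ^ 2 := by
      intro h2
      have h3 := (sq_eq_sq₀ (freq_pos hL m).le (freq_pos hL n).le).1 h2
      unfold freq at h3
      field_simp at h3
      exact h (by exact_mod_cast add_right_cancel h3)
    have h4 : (freq L m ^ 2 - freq L n ^ 2) * ∫ x in (0 : ℝ)..L, sineBasis L m x * sineBasis L n x = 0 := by
      linarith
    exact (mul_eq_zero.1 h4).resolve_left (sub_ne_zero.2 hne)

/-- The sine coefficients. -/
noncomputable def sineCoeff (L : ℝ) (f : ℝ → ℝ) (n : ℕ) : ℝ :=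
  2 / L * ∫ x in (0 : ℝ)..L, f x * sineBasis L n x

/-- Two integrations by parts. The resulting quadratic decay is summable and controls the tail of
the series by the second derivative alone. -/
theorem abs_sineCoeff_le {L : ℝ} (hL : 0 < L) {f : ℝ → ℝ} (hf : SmoothPeriodic L f) {M : ℝ}
    (hM : ∀ x, |iteratedDeriv 2 f x| ≤ M) (n : ℕ) : |sineCoeff L f n| ≤ 2 * M / freq L n ^ 2 := by
  have hs := smoothPeriodic_sineBasis hL n
  have h1 := hf.integral_iteratedDeriv_mul hs 2
  rw [iteratedDeriv_two_sineBasis] at h1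
  have e2 : ∀ x, f x * (-freq L n ^ 2 * sineBasis L n x)
      = -freq L n ^ 2 * (f x * sineBasis L n x) := fun x => by ring
  simp only [e2, intervalIntegral.integral_const_mul] at h1
  have hb : |∫ x in (0 : ℝ)..L, iteratedDeriv 2 f x * sineBasis L n x| ≤ M * |L - 0| := by
    refine intervalIntegral.norm_integral_le_of_norm_le_const
      (f := fun x => iteratedDeriv 2 f x * sineBasis L n x) fun x _ => ?_
    rw [Real.norm_eq_abs, abs_mul]
    exact (mul_le_of_le_one_right (abs_nonneg _) (abs_sineBasis_le L n x)).trans (hM x)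
  have hfp := freq_pos hL n
  rw [le_div_iff₀ (by positivity), sineCoeff, abs_mul, abs_of_pos (by positivity : 0 < 2 / L)]
  have h3 : |∫ x in (0 : ℝ)..L, f x * sineBasis L n x| * freq L n ^ 2 ≤ M * L := by
    rw [sub_zero, abs_of_pos hL] at hb
    refine le_trans (le_of_eq ?_) hb
    rw [h1, abs_mul, abs_mul, abs_neg, abs_of_pos (by positivity : 0 < freq L n ^ 2)]
    norm_num
    ring
  calc 2 / L * |∫ x in (0 : ℝ)..L, f x * sineBasis L n x| * freq L n ^ 2
      = 2 / L * (|∫ x in (0 : ℝ)..L, f x * sineBasis L n x| * freq L n ^ 2) := by ring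
    _ ≤ 2 / L * (M * L) := by gcongr
    _ = 2 * M := by field_simp

theorem summable_inv_freq_sq {L : ℝ} (hL : 0 < L) : Summable fun n : ℕ => 2 / freq L n ^ 2 := by
  have h := ((summable_nat_add_iff 1).2 (Real.summable_one_div_nat_pow.2 one_lt_two)).mul_left
    (2 * (L / (2 * Real.pi)) ^ 2)
  refine h.congr fun n => ?_
  unfold freq
  push_cast
  field_simp

theorem integral_odd_mul_cos {L : ℝ} (c : ℝ) {f : ℝ → ℝ} (hL : 0 < L)
    (hp : Function.Periodic f L) (ho : ∀ x, f (-x) = -f x) (n : ℤ) (hc : c = 2 * Real.pi * n / L) :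
    ∫ x in (0 : ℝ)..L, f x * Real.cos (c * x) = 0 := by
  have h := intervalIntegral.integral_comp_sub_left (a := 0) (b := L)
    (fun x => f x * Real.cos (c * x)) L
  have e : ∀ x, f (L - x) * Real.cos (c * (L - x)) = -(f x * Real.cos (c * x)) := by
    intro x
    have e1 : f (L - x) = -f x := by rw [← ho, ← hp (-x)]; congr 1; ring
    have e2 : c * (L - x) = n * (2 * Real.pi) - c * x := by rw [hc]; field_simp
    rw [e1, e2, Real.cos_int_mul_two_pi_sub]; ring
  simp only [e, sub_self, sub_zero] at h
  rw [intervalIntegral.integral_neg] at h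
  linarith

theorem eq_zero_of_l2_eq_zero {L : ℝ} (hL : 0 < L) {f : ℝ → ℝ} (hf : Continuous f)
    (hp : Function.Periodic f L) (h : l2 L f = 0) (x : ℝ) : f x = 0 := by
  by_contra hx
  obtain ⟨y, hy, hxy⟩ := hp.exists_mem_Ico hL x 0
  rw [zero_add] at hy
  rw [hxy] at hx
  have := intervalIntegral.integral_pos hL (f := fun x => f x ^ 2) (by fun_prop)
    (fun x _ => sq_nonneg _) ⟨y, Ico_subset_Icc_self hy, by positivity⟩
  rw [← l2_sq hL, h] at this
  simp at this

/-- Oddness removes the cosine integrals and the hypothesis the sine integrals. All Fourier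
coefficients vanish, and Parseval concludes. -/
theorem eq_zero_of_sine_orthogonal {L : ℝ} (hL : 0 < L) {f : ℝ → ℝ} (hf : Continuous f)
    (hp : Function.Periodic f L) (ho : ∀ x, f (-x) = -f x)
    (h : ∀ n, ∫ x in (0 : ℝ)..L, f x * sineBasis L n x = 0) (x : ℝ) : f x = 0 := by
  refine eq_zero_of_l2_eq_zero hL hf hp ?_ x
  have hsin : ∀ n : ℤ, ∫ x in (0 : ℝ)..L, f x * Real.sin (2 * Real.pi * n / L * x) = 0 := by
    intro n
    have hnat : ∀ m : ℕ, ∫ x in (0 : ℝ)..L, f x * Real.sin (2 * Real.pi * (m : ℝ) / L * x) = 0 := by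
      intro m
      rcases m with _ | m
      · simp
      · have := h m
        simp only [sineBasis, freq] at this
        push_cast; exact this
    obtain ⟨m, rfl | rfl⟩ := n.eq_nat_or_neg
    · exact_mod_cast hnat m
    · have e : ∀ x, f x * Real.sin (2 * Real.pi * ((-(m : ℤ) : ℤ) : ℝ) / L * x)
        = -(f x * Real.sin (2 * Real.pi * (m : ℝ) / L * x)) := by
        intro x
        rw [show 2 * Real.pi * ((-(m : ℤ) : ℤ) : ℝ) / L * x = -(2 * Real.pi * (m : ℝ) / L * x) by
          push_cast; ring, Real.sin_neg]; ring
      simp_rw [e]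
      rw [intervalIntegral.integral_neg, hnat, neg_zero]
  have hz : ∀ n : ℤ, fourierCoeffOn hL (fun x => (f x : ℂ)) n = 0 := by
    intro n
    rw [fourierCoeffOn_eq_integral_zero]
    have e : ∀ x : ℝ, fourier (-n) (x : AddCircle L) * (f x : ℂ)
        = ((f x * Real.cos (2 * Real.pi * n / L * x) : ℝ) : ℂ)
          - ((f x * Real.sin (2 * Real.pi * n / L * x) : ℝ) : ℂ) * Complex.I := by
      intro x; rw [fourier_neg_coe]; push_cast; ring
    simp_rw [e]
    rw [intervalIntegral.integral_sub (Continuous.intervalIntegrable (by fun_prop) _ _)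
      (Continuous.intervalIntegrable (by fun_prop) _ _), intervalIntegral.integral_mul_const,
      intervalIntegral.integral_ofReal, intervalIntegral.integral_ofReal, hsin,
      integral_odd_mul_cos _ hL hp ho n rfl]
    simp
  have h1 := hasSum_sq_fourierCoeffOn_l2 hL hf
  simp only [hz, norm_zero, ne_eq, OfNat.ofNat_ne_zero, not_false_eq_true, zero_pow] at h1
  have h2 := h1.unique hasSum_zero
  have h3 : l2 L f ^ 2 = 0 := by
    rcases mul_eq_zero.1 h2 with h | h
    · exact absurd h (by positivity)
    · exact h
  exact pow_eq_zero_iff (by norm_num) |>.1 h3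

theorem SmoothPeriodic.exists_bound {L : ℝ} (hL : 0 < L) {f : ℝ → ℝ} (hf : SmoothPeriodic L f) :
    ∃ M, 0 ≤ M ∧ ∀ x, |f x| ≤ M := by
  obtain ⟨M, hM⟩ := (isCompact_Icc (a := (0 : ℝ)) (b := L)).exists_bound_of_continuousOn
    hf.continuous.continuousOn
  refine ⟨M, (norm_nonneg _).trans (hM 0 ⟨le_rfl, hL.le⟩), fun x => ?_⟩
  obtain ⟨y, hy, hxy⟩ := hf.periodic.exists_mem_Ico hL x 0
  rw [hxy]
  exact hM y (by simpa using Ico_subset_Icc_self hy)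

/-- The series converges uniformly to a continuous odd function G with the same sine coefficients as
f, so that G - f is orthogonal to the sine basis and vanishes. -/
theorem hasSum_sineCoeff {L : ℝ} (hL : 0 < L) {f : ℝ → ℝ} (hf : SmoothPeriodic L f)
    (ho : ∀ x, f (-x) = -f x) (x : ℝ) :
    HasSum (fun n => sineCoeff L f n * sineBasis L n x) (f x) := by
  obtain ⟨M, hM0, hM⟩ := (hf.iteratedDeriv 2).exists_bound hL
  have hb : ∀ n x, ‖sineCoeff L f n * sineBasis L n x‖ ≤ M * (2 / freq L n ^ 2) := by
    intro n x
    rw [norm_mul]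
    refine (mul_le_of_le_one_right (norm_nonneg _) (abs_sineBasis_le L n x)).trans ?_
    exact (abs_sineCoeff_le hL hf hM n).trans_eq (by ring)
  have hsum : Summable fun n : ℕ => M * (2 / freq L n ^ 2) := (summable_inv_freq_sq hL).mul_left M
  have hS : ∀ x, Summable fun n => sineCoeff L f n * sineBasis L n x := fun x =>
    Summable.of_norm_bounded hsum fun n => hb n x
  have hc : ∀ n, Continuous (sineBasis L n) := fun n => (smoothPeriodic_sineBasis hL n).continuous
  set G : ℝ → ℝ := fun x => ∑' n, sineCoeff L f n * sineBasis L n x with hG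
  have hGc : Continuous G := continuous_tsum (fun n => continuous_const.mul (hc n)) hsum fun n x => hb n x
  have hGp : Function.Periodic G L := fun x => by
    simp only [hG]; congr 1; ext n; rw [(smoothPeriodic_sineBasis hL n).periodic x]
  have hGo : ∀ x, G (-x) = -G x := fun x => by
    simp only [hG, sineBasis_neg, mul_neg, tsum_neg]
  have hGi : ∀ m, ∫ x in (0 : ℝ)..L, G x * sineBasis L m x
      = ∫ x in (0 : ℝ)..L, f x * sineBasis L m x := by
    intro m
    have h := intervalIntegral.hasSum_integral_of_dominated_convergence (μ := volume) (a := 0) (b := L)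
      (F := fun n x => sineCoeff L f n * sineBasis L n x * sineBasis L m x)
      (f := fun x => G x * sineBasis L m x)
      (fun n _ => M * (2 / freq L n ^ 2)) (fun n => Continuous.aestronglyMeasurable (by fun_prop))
      (fun n => Eventually.of_forall fun x _ => by
        rw [norm_mul]
        exact (mul_le_of_le_one_right (norm_nonneg _) (abs_sineBasis_le L m x)).trans (hb n x))
      (Eventually.of_forall fun x _ => hsum) (by simp)
      (Eventually.of_forall fun x _ => (hS x).hasSum.mul_right _)
    have h2 := hasSum_single (f := fun n => ∫ x in (0 : ℝ)..L,
        sineCoeff L f n * sineBasis L n x * sineBasis L m x) m (fun n hn => by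
      simp only [mul_assoc, intervalIntegral.integral_const_mul,
        integral_sineBasis_mul_sineBasis hL, if_neg hn, mul_zero])
    rw [h.unique h2]
    simp only [mul_assoc, intervalIntegral.integral_const_mul,
        integral_sineBasis_mul_sineBasis hL, if_true, sineCoeff]
    field_simp
  have hz := eq_zero_of_sine_orthogonal hL (f := fun x => G x - f x) (hGc.sub hf.continuous)
    (fun x => by simp only [hGp x, hf.periodic x]) (fun x => by rw [hGo, ho]; ring) (fun m => by
      have := hf.continuous
      simp_rw [sub_mul]
      rw [intervalIntegral.integral_sub (Continuous.intervalIntegrable (by fun_prop) _ _)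
        (Continuous.intervalIntegrable (by fun_prop) _ _), hGi, sub_self]) x
  rw [← sub_eq_zero.1 hz]
  exact (hS x).hasSum

/-- The sine projection onto the first `N` modes. -/
noncomputable def sineProj (L : ℝ) (N : ℕ) (f : ℝ → ℝ) (x : ℝ) : ℝ :=
  ∑ n ∈ Finset.range N, sineCoeff L f n * sineBasis L n x

/-- The error bound of the sine projection. -/
noncomputable def sineTail (L : ℝ) (N : ℕ) : ℝ := ∑' n, 2 / freq L (n + N) ^ 2

theorem sineTail_nonneg (L : ℝ) (N : ℕ) : 0 ≤ sineTail L N :=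
  tsum_nonneg fun n => by positivity

theorem tendsto_sineTail (L : ℝ) : Tendsto (sineTail L) atTop (𝓝 0) :=
  tendsto_sum_nat_add fun n => 2 / freq L n ^ 2

/-- This is the consistency error of the Galerkin scheme; it is uniform over families with bounded
second derivatives. -/
theorem abs_sub_sineProj_le {L : ℝ} (hL : 0 < L) {f : ℝ → ℝ} (hf : SmoothPeriodic L f)
    (ho : ∀ x, f (-x) = -f x) {M : ℝ} (hM : ∀ x, |iteratedDeriv 2 f x| ≤ M) (N : ℕ) (x : ℝ) :
    |f x - sineProj L N f x| ≤ M * sineTail L N := by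
  have h := hasSum_sineCoeff hL hf ho x
  have h1 := (hasSum_nat_add_iff' N).2 h
  have h2 : HasSum (fun n => M * (2 / freq L (n + N) ^ 2)) (M * sineTail L N) :=
    (((summable_nat_add_iff N).2 (summable_inv_freq_sq hL)).hasSum).mul_left M
  refine h1.norm_le_of_bounded h2 fun n => ?_
  rw [norm_mul]
  refine (mul_le_of_le_one_right (norm_nonneg _) (abs_sineBasis_le L _ x)).trans ?_
  exact (abs_sineCoeff_le hL hf hM _).trans_eq (by ring)

end HouLuo
-- Sobolev inequalities and energy estimates for odd periodic functions.
namespace HouLuo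
open MeasureTheory Set

/-- Smooth odd `L`-periodic functions. -/
structure OddPeriodic (L : ℝ) (f : ℝ → ℝ) : Prop extends SmoothPeriodic L f where
  odd : ∀ x, f (-x) = -f x

namespace OddPeriodic

variable {L : ℝ} {f g : ℝ → ℝ}

theorem apply_zero (hf : OddPeriodic L f) : f 0 = 0 := by
  have := hf.odd 0
  rw [neg_zero] at this; linarith

theorem apply_half (hf : OddPeriodic L f) : f (L / 2) = 0 := by
  have h1 := hf.odd (L / 2)
  have h2 := hf.periodic (-(L / 2))
  rw [show -(L / 2) + L = L / 2 by ring] at h2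
  linarith

theorem velocity {a : ℝ} (hL : 0 < L) (ha : 0 < a) (hf : OddPeriodic L f) :
    OddPeriodic L (velocity L a f) :=
  ⟨hf.toSmoothPeriodic.velocity hL ha, velocity_neg_of_odd hL a hf.periodic hf.odd⟩

theorem add (hf : OddPeriodic L f) (hg : OddPeriodic L g) : OddPeriodic L (fun x => f x + g x) :=
  ⟨hf.toSmoothPeriodic.add hg.toSmoothPeriodic, fun x => by rw [hf.odd, hg.odd]; ring⟩

theorem sub (hf : OddPeriodic L f) (hg : OddPeriodic L g) : OddPeriodic L (fun x => f x - g x) :=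
  ⟨hf.toSmoothPeriodic.sub hg.toSmoothPeriodic, fun x => by rw [hf.odd, hg.odd]; ring⟩

theorem deriv_even (hf : OddPeriodic L f) (x : ℝ) : deriv f (-x) = deriv f x := by
  have h : (fun x => f (-x)) = fun x => -f x := funext hf.odd
  have h1 : deriv (fun x => f (-x)) x = -deriv f (-x) := deriv_comp_neg f x
  rw [h, deriv.fun_neg] at h1
  linarith

theorem deriv_mul (hf : OddPeriodic L f) (hg : OddPeriodic L g) :
    OddPeriodic L (fun x => f x * deriv g x) :=
  ⟨hf.toSmoothPeriodic.mul hg.toSmoothPeriodic.deriv, fun x => by rw [hf.odd, hg.deriv_even]; ring⟩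

/-- Order zero is included thanks to oddness. Hence Poincaré holds at every order and the
homogeneous seminorms control all lower ones. -/
theorem exists_zero (hL : 0 < L) (hf : OddPeriodic L f) (k : ℕ) : ∃ z, iteratedDeriv k f z = 0 := by
  rcases k with _ | k
  · exact ⟨0, by simpa using hf.apply_zero⟩
  · exact hf.toSmoothPeriodic.exists_iteratedDeriv_eq_zero hL k

theorem abs_iteratedDeriv_le (hL : 0 < L) (hf : OddPeriodic L f) (k : ℕ) (x : ℝ) :
    |iteratedDeriv k f x| ≤ √L * l2 L (iteratedDeriv (k + 1) f) := by
  obtain ⟨z, hz⟩ := hf.exists_zero hL k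
  exact abs_le_l2_deriv hL (hasDerivAt_iteratedDeriv hf.smooth k) (hf.iteratedDeriv _).continuous
    (hf.iteratedDeriv k).periodic (hf.iteratedDeriv (k + 1)).periodic hz x

theorem l2_iteratedDeriv_le_succ (hL : 0 < L) (hf : OddPeriodic L f) (k : ℕ) :
    l2 L (iteratedDeriv k f) ≤ L * l2 L (iteratedDeriv (k + 1) f) := by
  obtain ⟨z, hz⟩ := hf.exists_zero hL k
  exact l2_le_l2_deriv hL (hasDerivAt_iteratedDeriv hf.smooth k) (hf.iteratedDeriv _).continuous
    (hf.iteratedDeriv k).periodic (hf.iteratedDeriv (k + 1)).periodic hz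

/-- Iterated Poincaré. The factor `max 1 L` is used instead of L because L may be smaller than 1,
and the power k - j is rounded up to k. -/
theorem l2_iteratedDeriv_mono (hL : 0 < L) (hf : OddPeriodic L f) {j k : ℕ} (hjk : j ≤ k) :
    l2 L (iteratedDeriv j f) ≤ max 1 L ^ k * l2 L (iteratedDeriv k f) := by
  have h1 : (1 : ℝ) ≤ max 1 L := le_max_left _ _
  have key : l2 L (iteratedDeriv j f) ≤ max 1 L ^ (k - j) * l2 L (iteratedDeriv k f) := by
    induction k, hjk using Nat.le_induction with
    | base => simp
    | succ k hjk ih =>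
      refine ih.trans ?_
      rw [Nat.succ_sub hjk, pow_succ, mul_assoc]
      gcongr
      refine (hf.l2_iteratedDeriv_le_succ hL k).trans ?_
      exact mul_le_mul_of_nonneg_right (le_max_right _ _) (l2_nonneg _ _)
  refine key.trans ?_
  gcongr
  · exact l2_nonneg _ _
  · exact Nat.sub_le _ _

end OddPeriodic

theorem iteratedDeriv_mul_eq_sum {f g : ℝ → ℝ} (hf : ContDiff ℝ ∞ f) (hg : ContDiff ℝ ∞ g) (k : ℕ)
    (x : ℝ) : iteratedDeriv k (fun x => f x * g x) x
      = ∑ i ∈ Finset.range (k + 1), k.choose i * iteratedDeriv i f x * iteratedDeriv (k - i) g x :=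
  iteratedDeriv_fun_mul (hf.contDiffAt.of_le (by exact_mod_cast le_top))
    (hg.contDiffAt.of_le (by exact_mod_cast le_top))

/-- Product estimate: all terms except the transport term are bounded by the top order norms. -/
theorem exists_l2_product_le {L a : ℝ} (hL : 0 < L) (ha : 0 < a) {k : ℕ} (hk : 1 ≤ k) :
    ∃ C, 0 ≤ C ∧ ∀ w f : ℝ → ℝ, OddPeriodic L w → OddPeriodic L f → ∀ B : ℝ,
      l2 L (iteratedDeriv (max 1 (k - 1)) w) ≤ B → l2 L (iteratedDeriv (max 1 (k - 1)) f) ≤ B →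
      ∀ i, 1 ≤ i → i ≤ k + 1 →
      l2 L (fun x => iteratedDeriv i (velocity L a w) x * iteratedDeriv (k + 1 - i) f x)
        ≤ C * B * (l2 L (iteratedDeriv k w) + l2 L (iteratedDeriv k f)) := by
  obtain ⟨c, hc, -, hc2⟩ := exists_l2_velocity_le hL ha
  set Λ := max 1 L with hΛ
  have hΛ1 : 1 ≤ Λ := le_max_left _ _
  -- For k ≥ 2 the order m lies strictly below k, so the estimate is linear in the top order norms.
  -- For k = 1 both orders coincide and it is quadratic.
  set m := max 1 (k - 1) with hm
  have hmk : m ≤ k := by omega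
  have hΛm : 1 ≤ Λ ^ m := one_le_pow₀ hΛ1
  have hΛk : 1 ≤ Λ ^ k := one_le_pow₀ hΛ1
  refine ⟨√L * c * Λ ^ m * Λ ^ k, by positivity, fun w f hw hf B hBw hBf i hi1 hik => ?_⟩
  have hB : 0 ≤ B := (l2_nonneg _ _).trans hBw
  have hu := hw.velocity hL ha
  have hvel : ∀ j, l2 L (iteratedDeriv (j + 1) (velocity L a w)) ≤ c * l2 L (iteratedDeriv j w) := by
    intro j
    rw [iteratedDeriv_velocity hL ha hw.toSmoothPeriodic]
    exact hc2 _ _ (hw.iteratedDeriv j).periodic (hw.iteratedDeriv (j + 1)).periodic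
      (hasDerivAt_iteratedDeriv hw.smooth j) (hw.iteratedDeriv (j + 1)).continuous
  have hnw := l2_nonneg L (iteratedDeriv k w)
  have hnf := l2_nonneg L (iteratedDeriv k f)
  have hlow : ∀ {g : ℝ → ℝ}, OddPeriodic L g → l2 L (iteratedDeriv m g) ≤ B → ∀ j ≤ m,
      l2 L (iteratedDeriv j g) ≤ Λ ^ m * B := fun hg hgB j hj =>
    (hg.l2_iteratedDeriv_mono hL hj).trans (by gcongr)
  have hhigh : ∀ {g : ℝ → ℝ}, OddPeriodic L g → ∀ j ≤ k,
      l2 L (iteratedDeriv j g) ≤ Λ ^ k * l2 L (iteratedDeriv k g) := fun hg j hj =>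
    hg.l2_iteratedDeriv_mono hL hj
  have hcu : Continuous (iteratedDeriv i (velocity L a w)) := (hu.iteratedDeriv i).continuous
  have hcf : Continuous (iteratedDeriv (k + 1 - i) f) := (hf.iteratedDeriv _).continuous
  rcases Nat.eq_or_lt_of_le hi1 with rfl | hi2
  -- One derivative on u: u' is bounded uniformly through the L² norm of u'', hence through w',
  -- while f carries its k derivatives in L².
  · have hsup : ∀ x, |iteratedDeriv 1 (velocity L a w) x| ≤ √L * (c * (Λ ^ m * B)) := fun x =>
      (hu.abs_iteratedDeriv_le hL 1 x).trans (by
        gcongr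
        exact (hvel 1).trans (by gcongr; exact hlow hw hBw 1 (le_max_left _ _)))
    refine (l2_mul_le_of_bound hL hcu hcf hsup).trans ?_
    rw [Nat.add_sub_cancel]
    calc √L * (c * (Λ ^ m * B)) * l2 L (iteratedDeriv k f)
        = √L * c * Λ ^ m * 1 * B * (0 + l2 L (iteratedDeriv k f)) := by ring
      _ ≤ _ := by gcongr
  -- At least two derivatives on u: now f goes into the sup norm at the cost of one more derivative,
  -- and u^(j+1) costs only w^(j) in L². One factor is always of order at most m: w^(j) when j < k,
  -- and f' when j = k.
  · obtain ⟨j, rfl⟩ : ∃ j, i = j + 1 := ⟨i - 1, by omega⟩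
    have hsw : l2 L (fun x => iteratedDeriv (j + 1) (velocity L a w) x * iteratedDeriv (k + 1 - (j + 1)) f x)
        ≤ √L * l2 L (iteratedDeriv (k + 1 - (j + 1) + 1) f) * (c * l2 L (iteratedDeriv j w)) := by
      have h1 := l2_mul_le_of_bound hL hcf hcu (hf.abs_iteratedDeriv_le hL _)
      simp_rw [mul_comm (iteratedDeriv (k + 1 - (j + 1)) f _)] at h1
      refine h1.trans ?_
      gcongr
      · exact mul_nonneg (Real.sqrt_nonneg _) (l2_nonneg _ _)
      · exact hvel j
    refine hsw.trans ?_
    rcases Nat.lt_or_ge j k with hjk | hjk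
    · have e1 := hlow hw hBw j (by omega)
      have e2 := hhigh hf (k + 1 - (j + 1) + 1) (by omega)
      calc √L * l2 L (iteratedDeriv (k + 1 - (j + 1) + 1) f) * (c * l2 L (iteratedDeriv j w))
          ≤ √L * (Λ ^ k * l2 L (iteratedDeriv k f)) * (c * (Λ ^ m * B)) := by
            gcongr
            exact mul_nonneg hc (l2_nonneg _ _)
        _ = √L * c * Λ ^ m * Λ ^ k * B * (0 + l2 L (iteratedDeriv k f)) := by ring
        _ ≤ _ := by gcongr
    · obtain rfl : j = k := by omega
      have e1 := hlow hf hBf 1 (le_max_left _ _)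
      have e2 : j + 1 - (j + 1) + 1 = 1 := by omega
      rw [e2]
      calc √L * l2 L (iteratedDeriv 1 f) * (c * l2 L (iteratedDeriv j w))
          ≤ √L * (Λ ^ m * B) * (c * l2 L (iteratedDeriv j w)) := by gcongr
        _ = √L * c * Λ ^ m * 1 * B * (l2 L (iteratedDeriv j w) + 0) := by ring
        _ ≤ _ := by gcongr

/-- Since f' f = (f²)' / 2, the integral equals -½ ∫ u' f². Transport therefore loses no derivative
and only sup |u'| enters; the factor ½ is given away. -/
theorem abs_integral_transport_le {L : ℝ} (hL : 0 < L) {u u' f f' : ℝ → ℝ}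
    (hu : ∀ x, HasDerivAt u (u' x) x) (hf : ∀ x, HasDerivAt f (f' x) x) (cu' : Continuous u')
    (cf' : Continuous f') (hpu : Function.Periodic u L) (hpf : Function.Periodic f L)
    {G : ℝ} (hG : ∀ x, |u' x| ≤ G) :
    |∫ x in (0 : ℝ)..L, u x * f' x * f x| ≤ G * l2 L f ^ 2 := by
  have cu : Continuous u := continuous_iff_continuousAt.2 fun x => (hu x).continuousAt
  have cf : Continuous f := continuous_iff_continuousAt.2 fun x => (hf x).continuousAt
  have hG0 : 0 ≤ G := (abs_nonneg _).trans (hG 0)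
  have h := integral_deriv_mul_eq_neg (L := L) (f := u) (g := fun x => f x ^ 2) hu
    (fun x => (hf x).pow 2) cu' (by fun_prop) hpu (fun x => by simp only [hpf x])
  have e : ∀ x, u x * (((2 : ℕ) : ℝ) * f x ^ (2 - 1) * f' x) = 2 * (u x * f' x * f x) := fun x => by
    norm_num; ring
  have e' : ∀ x, u' x * f x ^ 2 = u' x * f x * f x := fun x => by ring
  simp_rw [e, e'] at h
  rw [intervalIntegral.integral_const_mul] at h
  have h1 := abs_integral_mul_le hL (f := fun x => u' x * f x) (g := f) (by fun_prop) cf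
  have h2 := mul_le_mul_of_nonneg_right (l2_mul_le_of_bound hL cu' cf hG) (l2_nonneg L f)
  rw [h, abs_neg, abs_mul, abs_two] at h1
  have h4 := abs_nonneg (∫ x in (0 : ℝ)..L, u x * f' x * f x)
  nlinarith

/-- Energy estimate for the transport term `u f'`. -/
theorem exists_energy_transport {L a : ℝ} (hL : 0 < L) (ha : 0 < a) {k : ℕ} (hk : 1 ≤ k) :
    ∃ C, 0 ≤ C ∧ ∀ w f : ℝ → ℝ, OddPeriodic L w → OddPeriodic L f → ∀ B : ℝ,
      l2 L (iteratedDeriv (max 1 (k - 1)) w) ≤ B → l2 L (iteratedDeriv (max 1 (k - 1)) f) ≤ B →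
      |∫ x in (0 : ℝ)..L, iteratedDeriv k (fun x => velocity L a w x * deriv f x) x
        * iteratedDeriv k f x|
        ≤ C * B * (l2 L (iteratedDeriv k w) + l2 L (iteratedDeriv k f)) * l2 L (iteratedDeriv k f) := by
  obtain ⟨C, hC, hCp⟩ := exists_l2_product_le hL ha hk
  obtain ⟨c, hc, -, hc2⟩ := exists_l2_velocity_le hL ha
  set Λ := max 1 L with hΛ
  have hΛ1 : 1 ≤ Λ := le_max_left _ _
  set m := max 1 (k - 1) with hm
  refine ⟨√L * (c * Λ ^ m) + ∑ i ∈ Finset.range k, k.choose (i + 1) * C, by positivity,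
    fun w f hw hf B hBw hBf => ?_⟩
  have hB : 0 ≤ B := (l2_nonneg _ _).trans hBw
  have hu := hw.velocity hL ha
  set u := velocity L a w with hu_def
  have hnw := l2_nonneg L (iteratedDeriv k w)
  have hnf := l2_nonneg L (iteratedDeriv k f)
  -- In the Leibniz sum the term with no derivative on u is split off. It alone contains k + 1
  -- derivatives of f and needs the integration by parts.
  have hexp : ∀ x, iteratedDeriv k (fun x => u x * deriv f x) x
      = (∑ i ∈ Finset.range k, k.choose (i + 1) *
          (iteratedDeriv (i + 1) u x * iteratedDeriv (k + 1 - (i + 1)) f x))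
        + u x * deriv (iteratedDeriv k f) x := by
    intro x
    rw [iteratedDeriv_mul_eq_sum hu.smooth hf.toSmoothPeriodic.deriv.smooth, Finset.sum_range_succ']
    congr 1
    · refine Finset.sum_congr rfl fun i hi => ?_
      rw [← iteratedDeriv_succ', show k - (i + 1) + 1 = k + 1 - (i + 1) by
        have := Finset.mem_range.1 hi; omega]; ring
    · rw [← iteratedDeriv_succ', ← iteratedDeriv_succ]; simp
  have hck := (hf.iteratedDeriv k).continuous
  have hck1 : Continuous (deriv (iteratedDeriv k f)) := (hf.iteratedDeriv k).deriv.continuous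
  have hcu := hu.continuous
  have hci : ∀ i, Continuous (iteratedDeriv i u) := fun i => (hu.iteratedDeriv i).continuous
  have hcf : ∀ i, Continuous (iteratedDeriv i f) := fun i => (hf.iteratedDeriv i).continuous
  have hSc : Continuous fun x => ∑ i ∈ Finset.range k, (k.choose (i + 1) : ℝ) *
          (iteratedDeriv (i + 1) u x * iteratedDeriv (k + 1 - (i + 1)) f x) := by fun_prop
  simp_rw [hexp, add_mul]
  rw [intervalIntegral.integral_add (Continuous.intervalIntegrable (by fun_prop) _ _)
    (Continuous.intervalIntegrable (by fun_prop) _ _)]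
  have h1 := abs_integral_mul_le hL hSc hck
  have hG : ∀ x, |deriv u x| ≤ √L * (c * (Λ ^ m * B)) := by
    intro x
    rw [← iteratedDeriv_one]
    refine (hu.abs_iteratedDeriv_le hL 1 x).trans ?_
    gcongr
    have hv : l2 L (iteratedDeriv (1 + 1) u) ≤ c * l2 L (iteratedDeriv 1 w) := by
      rw [hu_def, iteratedDeriv_velocity hL ha hw.toSmoothPeriodic]
      exact hc2 _ _ (hw.iteratedDeriv 1).periodic (hw.iteratedDeriv (1 + 1)).periodic
        (hasDerivAt_iteratedDeriv hw.smooth 1) (hw.iteratedDeriv (1 + 1)).continuous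
    refine hv.trans ?_
    gcongr
    exact (hw.l2_iteratedDeriv_mono hL (le_max_left _ _)).trans (by gcongr)
  have h2 := abs_integral_transport_le hL hu.hasDerivAt (hf.iteratedDeriv k).hasDerivAt
    hu.toSmoothPeriodic.deriv.continuous hck1 hu.periodic (hf.iteratedDeriv k).periodic hG
  have h3 : l2 L (fun x => ∑ i ∈ Finset.range k, (k.choose (i + 1) : ℝ) *
          (iteratedDeriv (i + 1) u x * iteratedDeriv (k + 1 - (i + 1)) f x))
      ≤ (∑ i ∈ Finset.range k, k.choose (i + 1) * C) * B * (l2 L (iteratedDeriv k w) + l2 L (iteratedDeriv k f)) := by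
    refine (l2_sum_le hL _ fun i _ => by fun_prop).trans ?_
    rw [Finset.sum_mul, Finset.sum_mul]
    refine Finset.sum_le_sum fun i hi => ?_
    rw [l2_const_mul, abs_of_nonneg (by positivity), mul_assoc, mul_assoc]
    gcongr
    rw [← mul_assoc]
    exact hCp w f hw hf B hBw hBf (i + 1) (by omega) (by have := Finset.mem_range.1 hi; omega)
  refine (abs_add_le _ _).trans ?_
  have h4 := mul_le_mul_of_nonneg_right h3 hnf
  have h5 : √L * (c * (Λ ^ m * B)) * l2 L (iteratedDeriv k f) ^ 2
      ≤ √L * (c * Λ ^ m) * B * (l2 L (iteratedDeriv k w) + l2 L (iteratedDeriv k f)) * l2 L (iteratedDeriv k f) := by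
    have : √L * (c * (Λ ^ m * B)) * l2 L (iteratedDeriv k f) ^ 2
      = √L * (c * Λ ^ m) * B * (0 + l2 L (iteratedDeriv k f)) * l2 L (iteratedDeriv k f) := by ring
    rw [this]
    gcongr
  calc _ ≤ _ := add_le_add (h1.trans h4) (h2.trans h5)
    _ = _ := by ring

/-- Energy estimate for the stretching term `u' f`. -/
theorem exists_energy_stretching {L a : ℝ} (hL : 0 < L) (ha : 0 < a) {k : ℕ} (hk : 1 ≤ k) :
    ∃ C, 0 ≤ C ∧ ∀ w f : ℝ → ℝ, OddPeriodic L w → OddPeriodic L f → ∀ B : ℝ,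
      l2 L (iteratedDeriv (max 1 (k - 1)) w) ≤ B → l2 L (iteratedDeriv (max 1 (k - 1)) f) ≤ B →
      |∫ x in (0 : ℝ)..L, iteratedDeriv k (fun x => deriv (velocity L a w) x * f x) x
        * iteratedDeriv k f x|
        ≤ C * B * (l2 L (iteratedDeriv k w) + l2 L (iteratedDeriv k f)) * l2 L (iteratedDeriv k f) := by
  obtain ⟨C, hC, hCp⟩ := exists_l2_product_le hL ha hk
  refine ⟨∑ i ∈ Finset.range (k + 1), k.choose i * C, by positivity, fun w f hw hf B hBw hBf => ?_⟩
  have hu := hw.velocity hL ha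
  set u := velocity L a w with hu_def
  -- Every term has at least one derivative on u and at most k on f, so the product estimate covers
  -- the whole sum.
  have hexp : ∀ x, iteratedDeriv k (fun x => deriv u x * f x) x
      = ∑ i ∈ Finset.range (k + 1), k.choose i *
          (iteratedDeriv (i + 1) u x * iteratedDeriv (k + 1 - (i + 1)) f x) := by
    intro x
    rw [iteratedDeriv_mul_eq_sum hu.toSmoothPeriodic.deriv.smooth hf.smooth]
    refine Finset.sum_congr rfl fun i hi => ?_
    rw [← iteratedDeriv_succ', Nat.add_sub_add_right]; ring
  have hci : ∀ i, Continuous (iteratedDeriv i u) := fun i => (hu.iteratedDeriv i).continuous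
  have hcf : ∀ i, Continuous (iteratedDeriv i f) := fun i => (hf.iteratedDeriv i).continuous
  simp_rw [hexp]
  refine (abs_integral_mul_le hL (by fun_prop) (hcf k)).trans ?_
  refine mul_le_mul_of_nonneg_right ?_ (l2_nonneg _ _)
  refine (l2_sum_le hL _ fun i _ => by fun_prop).trans ?_
  rw [Finset.sum_mul, Finset.sum_mul]
  refine Finset.sum_le_sum fun i hi => ?_
  rw [l2_const_mul, abs_of_nonneg (by positivity), mul_assoc, mul_assoc]
  gcongr
  rw [← mul_assoc]
  exact hCp w f hw hf B hBw hBf (i + 1) (by omega) (by have := Finset.mem_range.1 hi; omega)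

end HouLuo
-- L² stability for approximate solutions.
namespace HouLuo
open MeasureTheory Set

/-- The squared `L²` distance of two states. -/
noncomputable def stateDist (L : ℝ) (w₁ r₁ w₂ r₂ : ℝ → ℝ) : ℝ :=
  l2 L (fun x => w₁ x - w₂ x) ^ 2 + l2 L (fun x => r₁ x - r₂ x) ^ 2

theorem stateDist_nonneg (L : ℝ) (w₁ r₁ w₂ r₂ : ℝ → ℝ) : 0 ≤ stateDist L w₁ r₁ w₂ r₂ := by
  unfold stateDist; positivity

theorem continuous_of_continuousOn_prod {I : Set ℝ} {f : ℝ → ℝ → ℝ}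
    (hf : ContinuousOn (fun p : ℝ × ℝ => f p.1 p.2) (I ×ˢ univ)) {t : ℝ} (ht : t ∈ I) :
    Continuous (f t) :=
  continuousOn_univ.mp
    (hf.comp (f := fun y : ℝ => (t, y)) (by fun_prop) (fun y _ => ⟨ht, mem_univ _⟩))

/-- The arithmetic of the stability estimate, by Young's inequality. Here d and r stand for the L²
norms of the two differences, ε for the size of the errors, q for √L and c for the norm of the
velocity operator; the X's are the nine integrals into which the time derivative splits. -/
theorem difference_estimate_aux {L M c d r q ε X₁ X₂ X₃ X₄ X₅ X₆ X₇ X₈ X₉ : ℝ} (hL : 0 ≤ L)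
    (hM : 0 ≤ M) (hc : 0 ≤ c) (hsq : q ^ 2 = L)
    (i1 : |X₁| ≤ d * r) (i2 : |X₂| ≤ M * d ^ 2) (i3 : |X₃| ≤ M * (c * d) * d) (i4 : |X₄| ≤ q * ε * d)
    (i5 : |X₅| ≤ M * r ^ 2) (i6 : |X₆| ≤ M * r * r) (i7 : |X₇| ≤ M * (c * d) * r)
    (i8 : |X₈| ≤ M * (c * d) * r) (i9 : |X₉| ≤ q * ε * r) :
    |2 * (X₁ - X₂ - X₃ + X₄) + 2 * (-X₅ - X₆ - X₇ - X₈ + X₉)|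
      ≤ 2 * (1 + 2 * M + 4 * M * c + 1 + L) * (d ^ 2 + r ^ 2 + ε ^ 2) := by
  have h : |2 * (X₁ - X₂ - X₃ + X₄) + 2 * (-X₅ - X₆ - X₇ - X₈ + X₉)|
      ≤ 2 * (d * r + M * d ^ 2 + M * (c * d) * d + q * ε * d) + 2 * (M * r ^ 2 + M * r * r
        + M * (c * d) * r + M * (c * d) * r + q * ε * r) := by
    rw [abs_le] at i1 i2 i3 i4 i5 i6 i7 i8 i9 ⊢
    constructor <;> linarith
  refine h.trans ?_
  have m1 : d * r ≤ (d ^ 2 + r ^ 2) / 2 := by linarith [sq_nonneg (d - r), sub_sq d r]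
  have m2 : q * ε * d ≤ (L * ε ^ 2 + d ^ 2) / 2 := by
    rw [← hsq]; linarith [sq_nonneg (q * ε - d), sub_sq (q * ε) d, mul_pow q ε 2]
  have m3 : q * ε * r ≤ (L * ε ^ 2 + r ^ 2) / 2 := by
    rw [← hsq]; linarith [sq_nonneg (q * ε - r), sub_sq (q * ε) r, mul_pow q ε 2]
  have m4 : M * (c * d) * r ≤ M * c * ((d ^ 2 + r ^ 2) / 2) := by
    have : M * (c * d) * r = M * c * (d * r) := by ring
    rw [this]; exact mul_le_mul_of_nonneg_left m1 (by positivity)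
  have n1 : 0 ≤ M * c * d ^ 2 := by positivity
  have n2 : 0 ≤ M * c * r ^ 2 := by positivity
  have n3 : 0 ≤ M * d ^ 2 := by positivity
  have n4 : 0 ≤ M * r ^ 2 := by positivity
  have n5 : 0 ≤ L * ε ^ 2 := by positivity
  have n6 : 0 ≤ L * d ^ 2 := by positivity
  have n7 : 0 ≤ L * r ^ 2 := by positivity
  have n8 : 0 ≤ M * ε ^ 2 := by positivity
  have n9 : 0 ≤ M * c * ε ^ 2 := by positivity
  linarith [sq_nonneg d, sq_nonneg r, sq_nonneg ε]

/-- Static estimate for the difference of two states. -/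
theorem exists_difference_estimate {L a : ℝ} (hL : 0 < L) (ha : 0 < a) (M : ℝ) :
    ∃ C, 0 ≤ C ∧ ∀ w₁ w₁' r₁ r₁' w₂ w₂' r₂ r₂' e f : ℝ → ℝ, ∀ ε : ℝ,
      (∀ x, HasDerivAt w₁ (w₁' x) x) → (∀ x, HasDerivAt r₁ (r₁' x) x) →
      (∀ x, HasDerivAt w₂ (w₂' x) x) → (∀ x, HasDerivAt r₂ (r₂' x) x) →
      Continuous w₁' → Continuous r₁' → Continuous w₂' → Continuous r₂' →
      Function.Periodic w₁ L → Function.Periodic r₁ L → Function.Periodic w₂ L →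
      Function.Periodic r₂ L → Continuous e → Continuous f → (∀ x, |e x| ≤ ε) → (∀ x, |f x| ≤ ε) →
      (∀ x, |deriv (velocity L a w₁) x| ≤ M) → (∀ x, |w₂' x| ≤ M) → (∀ x, |r₂ x| ≤ M) →
      (∀ x, |r₂' x| ≤ M) →
      |2 * (∫ x in (0 : ℝ)..L, (w₁ x - w₂ x) * (r₁ x - r₂ x
          - (velocity L a w₁ x * w₁' x - velocity L a w₂ x * w₂' x) + e x))
        + 2 * ∫ x in (0 : ℝ)..L, (r₁ x - r₂ x) * (-(deriv (fun y => velocity L a w₁ y * r₁ y) x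
          - deriv (fun y => velocity L a w₂ y * r₂ y) x) + f x)|
        ≤ C * (stateDist L w₁ r₁ w₂ r₂ + ε ^ 2) := by
  obtain ⟨c, hc, hc1, hc2⟩ := exists_l2_velocity_le hL ha
  rcases lt_or_ge M 0 with hM | hM
  · refine ⟨0, le_rfl, ?_⟩
    intro w₁ w₁' r₁ r₁' w₂ w₂' r₂ r₂' e f ε _ _ _ _ _ _ _ _ _ _ _ _ _ _ _ _ h
    exact absurd ((abs_nonneg _).trans (h 0)) (not_le.2 hM)
  refine ⟨2 * (1 + 2 * M + 4 * M * c + 1 + L), by positivity, ?_⟩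
  intro w₁ w₁' r₁ r₁' w₂ w₂' r₂ r₂' e f ε hw₁ hr₁ hw₂ hr₂ cw₁' cr₁' cw₂' cr₂' pw₁ pr₁ pw₂ pr₂
    ce cf he hf hu₁ hbw₂ hbr₂ hbr₂'
  have cont : ∀ {g g' : ℝ → ℝ}, (∀ x, HasDerivAt g (g' x) x) → Continuous g := fun h =>
    continuous_iff_continuousAt.2 fun x => (h x).continuousAt
  have per : ∀ {g g' : ℝ → ℝ}, (∀ x, HasDerivAt g (g' x) x) → Function.Periodic g L →
      Function.Periodic g' L := fun {g g'} h hp => by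
    rw [show g' = deriv g from funext fun x => (h x).deriv.symm]; exact periodic_deriv hp
  have cw₁ := cont hw₁
  have cw₂ := cont hw₂
  have cr₁ := cont hr₁
  have cr₂ := cont hr₂
  have pw₁' := per hw₁ pw₁
  have pw₂' := per hw₂ pw₂
  set u₁ := velocity L a w₁ with hu₁d
  set u₂ := velocity L a w₂ with hu₂d
  have du₁ : ∀ x, HasDerivAt u₁ (velocity L a w₁' x) x := velocity_hasDerivAt hL ha pw₁ pw₁' hw₁ cw₁'
  have du₂ : ∀ x, HasDerivAt u₂ (velocity L a w₂' x) x := velocity_hasDerivAt hL ha pw₂ pw₂' hw₂ cw₂'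
  have cu₁ := cont du₁
  have cu₂ := cont du₂
  have cu₁' : Continuous (velocity L a w₁') := velocity_continuous hL ha pw₁' cw₁'
  have cu₂' : Continuous (velocity L a w₂') := velocity_continuous hL ha pw₂' cw₂'
  have bu₁ : ∀ x, |velocity L a w₁' x| ≤ M := fun x => by rw [← (du₁ x).deriv]; exact hu₁ x
  set D : ℝ → ℝ := fun x => w₁ x - w₂ x with hD
  set R : ℝ → ℝ := fun x => r₁ x - r₂ x with hR
  have cD : Continuous D := cw₁.sub cw₂
  have cR : Continuous R := cr₁.sub cr₂
  have dD : ∀ x, HasDerivAt D (w₁' x - w₂' x) x := fun x => (hw₁ x).sub (hw₂ x)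
  have dR : ∀ x, HasDerivAt R (r₁' x - r₂' x) x := fun x => (hr₁ x).sub (hr₂ x)
  have pD : Function.Periodic D L := fun x => by simp only [hD, pw₁ x, pw₂ x]
  have pR : Function.Periodic R L := fun x => by simp only [hR, pr₁ x, pr₂ x]
  have vD : l2 L (fun x => u₁ x - u₂ x) ≤ c * l2 L D := by
    rw [show (fun x => u₁ x - u₂ x) = velocity L a D from
      funext fun x => (velocity_sub hL ha cw₁ cw₂ pw₁ pw₂ x).symm]
    exact hc1 D pD cD
  -- The gain of one derivative: the difference of the velocity gradients is controlled by D itself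
  -- rather than by its derivative.
  have vD' : l2 L (fun x => velocity L a w₁' x - velocity L a w₂' x) ≤ c * l2 L D := by
    rw [show (fun x => velocity L a w₁' x - velocity L a w₂' x) = velocity L a (fun x => w₁' x - w₂' x)
      from funext fun x => (velocity_sub hL ha cw₁' cw₂' pw₁' pw₂' x).symm]
    exact hc2 D _ pD (fun x => by simp only [pw₁' x, pw₂' x]) dD (cw₁'.sub cw₂')
  have i1 : |∫ x in (0 : ℝ)..L, D x * R x| ≤ l2 L D * l2 L R := abs_integral_mul_le hL cD cR
  have i2 : |∫ x in (0 : ℝ)..L, u₁ x * (w₁' x - w₂' x) * D x| ≤ M * l2 L D ^ 2 :=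
    abs_integral_transport_le hL du₁ dD cu₁' (cw₁'.sub cw₂') (velocity_periodic hL a pw₁) pD bu₁
  have i3 : |∫ x in (0 : ℝ)..L, (w₂' x * (u₁ x - u₂ x)) * D x| ≤ (M * (c * l2 L D)) * l2 L D :=
    (abs_integral_mul_le hL (by fun_prop) cD).trans (mul_le_mul_of_nonneg_right
      ((l2_mul_le_of_bound hL cw₂' (cu₁.sub cu₂) hbw₂).trans (mul_le_mul_of_nonneg_left vD hM)) (l2_nonneg _ _))
  have i4 : |∫ x in (0 : ℝ)..L, e x * D x| ≤ √L * ε * l2 L D :=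
    (abs_integral_mul_le hL ce cD).trans (mul_le_mul_of_nonneg_right
      (l2_le_of_bound hL ce he) (l2_nonneg _ _))
  have i5 : |∫ x in (0 : ℝ)..L, u₁ x * (r₁' x - r₂' x) * R x| ≤ M * l2 L R ^ 2 :=
    abs_integral_transport_le hL du₁ dR cu₁' (cr₁'.sub cr₂') (velocity_periodic hL a pw₁) pR bu₁
  have i6 : |∫ x in (0 : ℝ)..L, (velocity L a w₁' x * R x) * R x| ≤ (M * l2 L R) * l2 L R :=
    (abs_integral_mul_le hL (by fun_prop) cR).trans (mul_le_mul_of_nonneg_right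
      (l2_mul_le_of_bound hL cu₁' cR bu₁) (l2_nonneg _ _))
  have i7 : |∫ x in (0 : ℝ)..L, (r₂' x * (u₁ x - u₂ x)) * R x| ≤ (M * (c * l2 L D)) * l2 L R :=
    (abs_integral_mul_le hL (by fun_prop) cR).trans (mul_le_mul_of_nonneg_right
      ((l2_mul_le_of_bound hL cr₂' (cu₁.sub cu₂) hbr₂').trans (mul_le_mul_of_nonneg_left vD hM)) (l2_nonneg _ _))
  have i8 : |∫ x in (0 : ℝ)..L, (r₂ x * (velocity L a w₁' x - velocity L a w₂' x)) * R x|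
      ≤ (M * (c * l2 L D)) * l2 L R :=
    (abs_integral_mul_le hL (by fun_prop) cR).trans (mul_le_mul_of_nonneg_right
      ((l2_mul_le_of_bound hL cr₂ (cu₁'.sub cu₂') hbr₂).trans (mul_le_mul_of_nonneg_left vD' hM)) (l2_nonneg _ _))
  have i9 : |∫ x in (0 : ℝ)..L, f x * R x| ≤ √L * ε * l2 L R :=
    (abs_integral_mul_le hL cf cR).trans (mul_le_mul_of_nonneg_right
      (l2_le_of_bound hL cf hf) (l2_nonneg _ _))
  -- The splitting u₁w₁' - u₂w₂' = u₁(w₁ - w₂)' + w₂'(u₁ - u₂) leaves a derivative of the difference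
  -- only under transport by u₁. Apart from u₁', pointwise bounds are then needed for the second
  -- state alone.
  have s1 : ∫ x in (0 : ℝ)..L, (w₁ x - w₂ x) * (r₁ x - r₂ x - (u₁ x * w₁' x - u₂ x * w₂' x) + e x)
      = (∫ x in (0 : ℝ)..L, D x * R x) - (∫ x in (0 : ℝ)..L, u₁ x * (w₁' x - w₂' x) * D x)
        - (∫ x in (0 : ℝ)..L, (w₂' x * (u₁ x - u₂ x)) * D x) + ∫ x in (0 : ℝ)..L, e x * D x := by
    rw [← intervalIntegral.integral_sub, ← intervalIntegral.integral_sub,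
      ← intervalIntegral.integral_add]
    · congr 1; ext x; simp only [hD, hR]; ring
    all_goals exact Continuous.intervalIntegrable (by fun_prop) _ _
  have ed₁ : ∀ x, deriv (fun y => u₁ y * r₁ y) x = velocity L a w₁' x * r₁ x + u₁ x * r₁' x :=
    fun x => ((du₁ x).mul (hr₁ x)).deriv
  have ed₂ : ∀ x, deriv (fun y => u₂ y * r₂ y) x = velocity L a w₂' x * r₂ x + u₂ x * r₂' x :=
    fun x => ((du₂ x).mul (hr₂ x)).deriv
  have s2 : ∫ x in (0 : ℝ)..L, (r₁ x - r₂ x) * (-(deriv (fun y => u₁ y * r₁ y) x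
          - deriv (fun y => u₂ y * r₂ y) x) + f x)
      = -(∫ x in (0 : ℝ)..L, u₁ x * (r₁' x - r₂' x) * R x)
        - (∫ x in (0 : ℝ)..L, (velocity L a w₁' x * R x) * R x)
        - (∫ x in (0 : ℝ)..L, (r₂' x * (u₁ x - u₂ x)) * R x)
        - (∫ x in (0 : ℝ)..L, (r₂ x * (velocity L a w₁' x - velocity L a w₂' x)) * R x)
        + ∫ x in (0 : ℝ)..L, f x * R x := by
    simp_rw [ed₁, ed₂]
    rw [← intervalIntegral.integral_neg, ← intervalIntegral.integral_sub,
      ← intervalIntegral.integral_sub, ← intervalIntegral.integral_sub,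
      ← intervalIntegral.integral_add]
    · congr 1; ext x; simp only [hR]; ring
    all_goals exact Continuous.intervalIntegrable (by fun_prop) _ _
  rw [s1, s2, stateDist]
  change _ ≤ 2 * (1 + 2 * M + 4 * M * c + 1 + L) * (l2 L D ^ 2 + l2 L R ^ 2 + ε ^ 2)
  exact difference_estimate_aux hL.le hM hc (Real.sq_sqrt hL.le)
    i1 i2 i3 i4 i5 i6 i7 i8 i9

/-- The time derivative of the distance of two approximate solutions. -/
theorem exists_stateDist_deriv_le {L a : ℝ} (hL : 0 < L) (ha : 0 < a) (M : ℝ) :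
    ∃ C, 0 ≤ C ∧ ∀ (I : Set ℝ) (w₁ r₁ w₂ r₂ e f : ℝ → ℝ → ℝ) (ε : ℝ), IsOpen I →
      ContDiffOn ℝ 1 (fun p : ℝ × ℝ => w₁ p.1 p.2) (I ×ˢ univ) →
      ContDiffOn ℝ 1 (fun p : ℝ × ℝ => r₁ p.1 p.2) (I ×ˢ univ) →
      ContDiffOn ℝ 1 (fun p : ℝ × ℝ => w₂ p.1 p.2) (I ×ˢ univ) →
      ContDiffOn ℝ 1 (fun p : ℝ × ℝ => r₂ p.1 p.2) (I ×ˢ univ) →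
      (∀ t ∈ I, Function.Periodic (w₁ t) L) → (∀ t ∈ I, Function.Periodic (r₁ t) L) →
      (∀ t ∈ I, Function.Periodic (w₂ t) L) → (∀ t ∈ I, Function.Periodic (r₂ t) L) →
      (∀ t ∈ I, ∀ x, HasDerivAt (fun s => w₁ s x - w₂ s x) (r₁ t x - r₂ t x
          - (velocity L a (w₁ t) x * deriv (w₁ t) x - velocity L a (w₂ t) x * deriv (w₂ t) x)
          + e t x) t) →
      (∀ t ∈ I, ∀ x, HasDerivAt (fun s => r₁ s x - r₂ s x)
          (-(deriv (fun y => velocity L a (w₁ t) y * r₁ t y) x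
          - deriv (fun y => velocity L a (w₂ t) y * r₂ t y) x) + f t x) t) →
      (∀ t ∈ I, ∀ x, |e t x| ≤ ε) → (∀ t ∈ I, ∀ x, |f t x| ≤ ε) →
      (∀ t ∈ I, ∀ x, |deriv (velocity L a (w₁ t)) x| ≤ M) →
      (∀ t ∈ I, ∀ x, |deriv (w₂ t) x| ≤ M) → (∀ t ∈ I, ∀ x, |r₂ t x| ≤ M) →
      (∀ t ∈ I, ∀ x, |deriv (r₂ t) x| ≤ M) →
      ∃ y' : ℝ → ℝ, ∀ t ∈ I, HasDerivAt (fun t => stateDist L (w₁ t) (r₁ t) (w₂ t) (r₂ t)) (y' t) t ∧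
        |y' t| ≤ C * (stateDist L (w₁ t) (r₁ t) (w₂ t) (r₂ t) + ε ^ 2) := by
  obtain ⟨C, hC, hst⟩ := exists_difference_estimate hL ha M
  refine ⟨C, hC, ?_⟩
  intro I w₁ r₁ w₂ r₂ e f ε hI sw₁ sr₁ sw₂ sr₂ pw₁ pr₁ pw₂ pr₂ ew er he hf hM1 hM2 hM3 hM4
  have sq_deriv : ∀ {g₁ g₂ h : ℝ → ℝ → ℝ},
      ContDiffOn ℝ 1 (fun p : ℝ × ℝ => g₁ p.1 p.2) (I ×ˢ univ) →
      ContDiffOn ℝ 1 (fun p : ℝ × ℝ => g₂ p.1 p.2) (I ×ˢ univ) →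
      (∀ t ∈ I, ∀ x, HasDerivAt (fun s => g₁ s x - g₂ s x) (h t x) t) → ∀ t ∈ I,
      Continuous (h t) ∧ HasDerivAt (fun t => l2 L (fun x => g₁ t x - g₂ t x) ^ 2)
        (2 * ∫ x in (0 : ℝ)..L, (g₁ t x - g₂ t x) * h t x) t := by
    intro g₁ g₂ h s₁ s₂ hd t ht
    have s : ContDiffOn ℝ ((0 : ℕ) + 1) (fun p : ℝ × ℝ => g₁ p.1 p.2 - g₂ p.1 p.2) (I ×ˢ univ) := by
      simpa using s₁.sub s₂
    obtain ⟨-, -, c, -⟩ := partials_of_contDiffOn_succ hI (f := fun t x => g₁ t x - g₂ t x) s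
    have ch : ContinuousOn (fun p : ℝ × ℝ => h p.1 p.2) (I ×ˢ univ) :=
      c.continuousOn.congr fun p hp => (hd p.1 hp.1 p.2).deriv.symm
    refine ⟨continuous_of_continuousOn_prod ch ht, ?_⟩
    have hi := hasDerivAt_weighted_integral (a := 0) (b := L) (k := fun _ => 1) (by simp) hI
      (f := fun t x => (g₁ t x - g₂ t x) ^ 2) (f' := fun t x => 2 * ((g₁ t x - g₂ t x) * h t x))
      (s.continuousOn.pow 2) (continuousOn_const.mul (s.continuousOn.mul ch))
      (fun t ht x => ((hd t ht x).pow 2).congr_deriv (by norm_num; ring)) ht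
    simp only [one_mul, intervalIntegral.integral_const_mul] at hi
    simp_rw [l2_sq hL]
    exact hi
  refine ⟨_, fun t ht => ⟨(sq_deriv sw₁ sw₂ ew t ht).2.add (sq_deriv sr₁ sr₂ er t ht).2, ?_⟩⟩
  have part : ∀ {g : ℝ → ℝ → ℝ}, ContDiffOn ℝ 1 (fun p : ℝ × ℝ => g p.1 p.2) (I ×ˢ univ) →
      (∀ x, HasDerivAt (g t) (deriv (g t) x) x) ∧ Continuous (deriv (g t)) := by
    intro g s
    obtain ⟨-, h2, -, c⟩ := partials_of_contDiffOn_succ (n := 0) hI (f := g) (by simpa using s)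
    exact ⟨h2 t ht, continuous_of_continuousOn_prod (f := fun t => deriv (g t)) c.continuousOn ht⟩
  have qw₁ := part sw₁
  have qw₂ := part sw₂
  have qr₁ := part sr₁
  have qr₂ := part sr₂
  have cont : ∀ {g g' : ℝ → ℝ}, (∀ x, HasDerivAt g (g' x) x) → Continuous g := fun h =>
    continuous_iff_continuousAt.2 fun x => (h x).continuousAt
  have hvel : ∀ {w r : ℝ → ℝ → ℝ}, Function.Periodic (w t) L → (∀ x, HasDerivAt (w t) (deriv (w t) x) x) ∧
      Continuous (deriv (w t)) → (∀ x, HasDerivAt (r t) (deriv (r t) x) x) ∧ Continuous (deriv (r t)) →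
      Continuous (velocity L a (w t)) ∧ Continuous (deriv (fun y => velocity L a (w t) y * r t y)) := by
    intro w r hp qw qr
    have du := velocity_hasDerivAt hL ha hp (periodic_deriv hp) qw.1 qw.2
    refine ⟨cont du, ?_⟩
    rw [show deriv (fun y => velocity L a (w t) y * r t y) = _ from
      funext fun x => ((du x).mul (qr.1 x)).deriv]
    exact ((velocity_continuous hL ha (periodic_deriv hp) qw.2).mul (cont qr.1)).add ((cont du).mul qr.2)
  obtain ⟨v1, v2⟩ := hvel (pw₁ t ht) qw₁ qr₁
  obtain ⟨v3, v4⟩ := hvel (pw₂ t ht) qw₂ qr₂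
  have cw₁ := cont qw₁.1
  have cw₂ := cont qw₂.1
  have cr₁ := cont qr₁.1
  have cr₂ := cont qr₂.1
  have c1 := (sq_deriv sw₁ sw₂ ew t ht).1
  have c2 := (sq_deriv sr₁ sr₂ er t ht).1
  -- Continuity of the error terms is not assumed. It follows from the equation, all of whose other
  -- terms are continuous in x.
  have ce : Continuous (e t) := by
    have : Continuous fun x => (r₁ t x - r₂ t x - (velocity L a (w₁ t) x * deriv (w₁ t) x
      - velocity L a (w₂ t) x * deriv (w₂ t) x) + e t x) - (r₁ t x - r₂ t x
      - (velocity L a (w₁ t) x * deriv (w₁ t) x - velocity L a (w₂ t) x * deriv (w₂ t) x)) :=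
      c1.sub ((cr₁.sub cr₂).sub ((v1.mul qw₁.2).sub (v3.mul qw₂.2)))
    simpa using this
  have cf : Continuous (f t) := by
    have : Continuous fun x => (-(deriv (fun y => velocity L a (w₁ t) y * r₁ t y) x
          - deriv (fun y => velocity L a (w₂ t) y * r₂ t y) x) + f t x)
          - (-(deriv (fun y => velocity L a (w₁ t) y * r₁ t y) x
          - deriv (fun y => velocity L a (w₂ t) y * r₂ t y) x)) := c2.sub (v2.sub v4).neg
    simpa using this
  exact hst (w₁ t) _ (r₁ t) _ (w₂ t) _ (r₂ t) _ (e t) (f t) ε qw₁.1 qr₁.1 qw₂.1 qr₂.1 qw₁.2 qr₁.2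
    qw₂.2 qr₂.2 (pw₁ t ht) (pr₁ t ht) (pw₂ t ht) (pr₂ t ht) ce cf (he t ht) (hf t ht) (hM1 t ht)
    (hM2 t ht) (hM3 t ht) (hM4 t ht)

end HouLuo
-- Uniqueness, and classical versus smooth solutions.
namespace HouLuo
open MeasureTheory Set

/-- Needed up to t = 0, where the time set is not open. The space derivative is still two-sided
because each slice in x is a full line. -/
theorem partial_right_of_contDiffOn_succ {J : Set ℝ} (hJ : UniqueDiffOn ℝ J) {f : ℝ → ℝ → ℝ} {n : ℕ}
    (hf : ContDiffOn ℝ (n + 1) (fun p : ℝ × ℝ => f p.1 p.2) (J ×ˢ univ)) :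
    (∀ t ∈ J, ∀ x, HasDerivAt (f t) (deriv (f t) x) x) ∧
    ContDiffOn ℝ n (fun p : ℝ × ℝ => deriv (f p.1) p.2) (J ×ˢ univ) := by
  have hU : UniqueDiffOn ℝ (J ×ˢ (univ : Set ℝ)) := hJ.prod uniqueDiffOn_univ
  have h := (contDiffOn_succ_iff_fderivWithin hU).1 hf
  have p2 : ∀ t ∈ J, ∀ x, HasDerivAt (f t)
      (fderivWithin ℝ (fun p : ℝ × ℝ => f p.1 p.2) (J ×ˢ univ) (t, x) (0, 1)) x := fun t ht x => by
    have hd := (h.1 (t, x) ⟨ht, mem_univ _⟩).hasFDerivWithinAt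
    have := hd.comp_hasDerivWithinAt (f := fun y : ℝ => (t, y)) (s := univ) x
      ((hasDerivAt_const x t).prodMk (hasDerivAt_id x)).hasDerivWithinAt (fun y _ => ⟨ht, mem_univ _⟩)
    exact hasDerivWithinAt_univ.1 this
  refine ⟨fun t ht x => (p2 t ht x).differentiableAt.hasDerivAt, ?_⟩
  exact (h.2.2.clm_apply contDiffOn_const).congr fun p hp => (p2 p.1 hp.1 p.2).deriv

/-- Equality of mixed partial derivatives. -/
theorem hasDerivAt_deriv_comm {I : Set ℝ} (hI : IsOpen I) {f : ℝ → ℝ → ℝ}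
    (hf : ContDiffOn ℝ 2 (fun p : ℝ × ℝ => f p.1 p.2) (I ×ˢ univ)) {t : ℝ} (ht : t ∈ I) (x : ℝ) :
    HasDerivAt (fun s => deriv (f s) x) (deriv (fun y => deriv (fun s => f s y) t) x) t := by
  have hO : IsOpen (I ×ˢ (univ : Set ℝ)) := hI.prod isOpen_univ
  set F : ℝ × ℝ → ℝ := fun p => f p.1 p.2 with hF
  have hmem : ∀ s ∈ I, ∀ y, (s, y) ∈ I ×ˢ (univ : Set ℝ) := fun s hs y => ⟨hs, mem_univ _⟩
  have h2 : ContDiffAt ℝ 2 F (t, x) := hf.contDiffAt (hO.mem_nhds (hmem t ht x))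
  have hsymm := h2.isSymmSndFDerivAt (by simp)
  have hd : ∀ s ∈ I, ∀ y, HasFDerivAt F (fderiv ℝ F (s, y)) (s, y) := fun s hs y =>
    ((hf.contDiffAt (hO.mem_nhds (hmem s hs y))).differentiableAt (by simp)).hasFDerivAt
  have p1 : ∀ s ∈ I, ∀ y, HasDerivAt (fun s => f s y) (fderiv ℝ F (s, y) (1, 0)) s := fun s hs y =>
    (hd s hs y).comp_hasDerivAt (f := fun s : ℝ => (s, y)) s
      ((hasDerivAt_id s).prodMk (hasDerivAt_const s y))
  have p2 : ∀ s ∈ I, ∀ y, HasDerivAt (f s) (fderiv ℝ F (s, y) (0, 1)) y := fun s hs y =>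
    (hd s hs y).comp_hasDerivAt (f := fun y : ℝ => (s, y)) y
      ((hasDerivAt_const y s).prodMk (hasDerivAt_id y))
  have hdd : HasFDerivAt (fderiv ℝ F) (fderiv ℝ (fderiv ℝ F) (t, x)) (t, x) :=
    ((h2.fderiv_right (m := 1) (by norm_num)).differentiableAt (by simp)).hasFDerivAt
  have q1 : HasDerivAt (fun s => fderiv ℝ F (s, x) (0, 1))
      (fderiv ℝ (fderiv ℝ F) (t, x) (1, 0) (0, 1)) t := by
    have := hdd.comp_hasDerivAt (f := fun s : ℝ => (s, x)) t
      ((hasDerivAt_id t).prodMk (hasDerivAt_const t x))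
    simpa using this.clm_apply (hasDerivAt_const t ((0 : ℝ), (1 : ℝ)))
  have q2 : HasDerivAt (fun y => fderiv ℝ F (t, y) (1, 0))
      (fderiv ℝ (fderiv ℝ F) (t, x) (0, 1) (1, 0)) x := by
    have := hdd.comp_hasDerivAt (f := fun y : ℝ => (t, y)) x
      ((hasDerivAt_const x t).prodMk (hasDerivAt_id x))
    simpa using this.clm_apply (hasDerivAt_const x ((1 : ℝ), (0 : ℝ)))
  rw [show (fun y => deriv (fun s => f s y) t) = fun y => fderiv ℝ F (t, y) (1, 0) from
    funext fun y => (p1 t ht y).deriv, q2.deriv, hsymm.eq (0, 1) (1, 0)]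
  refine q1.congr_of_eventuallyEq ?_
  filter_upwards [hI.mem_nhds ht] with s hs
  exact (p2 s hs x).deriv

theorem exists_bound_of_periodic {L : ℝ} (hL : 0 < L) {J K : Set ℝ} {g : ℝ → ℝ → ℝ}
    (hg : ContinuousOn (fun p : ℝ × ℝ => g p.1 p.2) (J ×ˢ univ))
    (hp : ∀ t ∈ J, Function.Periodic (g t) L) (hK : IsCompact K) (hKJ : K ⊆ J) :
    ∃ M, 0 ≤ M ∧ ∀ t ∈ K, ∀ x, |g t x| ≤ M := by
  obtain ⟨M, hM⟩ := (hK.prod (isCompact_Icc (a := (0 : ℝ)) (b := L))).exists_bound_of_continuousOn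
    (hg.mono (prod_mono hKJ (subset_univ _)))
  refine ⟨max 0 M, le_max_left _ _, fun t ht x => ?_⟩
  obtain ⟨y, hy, hxy⟩ := (hp t (hKJ ht)).exists_mem_Ico hL x 0
  rw [hxy]
  exact (hM (t, y) ⟨ht, by simpa using Ico_subset_Icc_self hy⟩).trans (le_max_right _ _)

/-- Smooth odd solutions of the system for the vorticity and the density gradient, on a set of
times `I`. -/
structure IsSmoothSolution (L a : ℝ) (I : Set ℝ) (w r : ℝ → ℝ → ℝ) : Prop where
  smooth_w : ContDiffOn ℝ ∞ (fun p : ℝ × ℝ => w p.1 p.2) (I ×ˢ univ)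
  smooth_r : ContDiffOn ℝ ∞ (fun p : ℝ × ℝ => r p.1 p.2) (I ×ˢ univ)
  odd_w : ∀ t ∈ I, OddPeriodic L (w t)
  odd_r : ∀ t ∈ I, OddPeriodic L (r t)
  eq_w : ∀ t ∈ I, ∀ x, HasDerivAt (fun s => w s x)
    (r t x - velocity L a (w t) x * deriv (w t) x) t
  eq_r : ∀ t ∈ I, ∀ x, HasDerivAt (fun s => r s x)
    (-deriv (fun y => velocity L a (w t) y * r t y) x) t

theorem IsSmoothSolution.mono {L a : ℝ} {I J : Set ℝ} {w r : ℝ → ℝ → ℝ}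
    (h : IsSmoothSolution L a I w r) (hJ : J ⊆ I) : IsSmoothSolution L a J w r :=
  ⟨h.smooth_w.mono (prod_mono hJ le_rfl), h.smooth_r.mono (prod_mono hJ le_rfl),
    fun t ht => h.odd_w t (hJ ht), fun t ht => h.odd_r t (hJ ht), fun t ht => h.eq_w t (hJ ht),
    fun t ht => h.eq_r t (hJ ht)⟩

theorem eq_of_stateDist_eq_zero {L : ℝ} (hL : 0 < L) {w₁ r₁ w₂ r₂ : ℝ → ℝ}
    (cw₁ : Continuous w₁) (cr₁ : Continuous r₁) (cw₂ : Continuous w₂) (cr₂ : Continuous r₂)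
    (pw₁ : Function.Periodic w₁ L) (pr₁ : Function.Periodic r₁ L) (pw₂ : Function.Periodic w₂ L)
    (pr₂ : Function.Periodic r₂ L) (h : stateDist L w₁ r₁ w₂ r₂ ≤ 0) : w₁ = w₂ ∧ r₁ = r₂ := by
  unfold stateDist at h
  have h1 : l2 L (fun x => w₁ x - w₂ x) = 0 := by
    nlinarith [l2_nonneg L (fun x => w₁ x - w₂ x), sq_nonneg (l2 L (fun x => r₁ x - r₂ x))]
  have h2 : l2 L (fun x => r₁ x - r₂ x) = 0 := by
    nlinarith [l2_nonneg L (fun x => r₁ x - r₂ x), sq_nonneg (l2 L (fun x => w₁ x - w₂ x))]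
  exact ⟨funext fun x => sub_eq_zero.1 (eq_zero_of_l2_eq_zero hL (cw₁.sub cw₂)
    (pw₁.sub pw₂) h1 x), funext fun x => sub_eq_zero.1
    (eq_zero_of_l2_eq_zero hL (cr₁.sub cr₂) (pr₁.sub pr₂) h2 x)⟩

/-- Stability of solutions: a `C¹` solution with bounded gradient stays close to a smooth one. -/
theorem exists_stateDist_le {L a : ℝ} (hL : 0 < L) (ha : 0 < a) {I : Set ℝ} (hI : IsOpen I)
    (hIc : Convex ℝ I) {w₁ r₁ w₂ r₂ : ℝ → ℝ → ℝ}
    (sw₁ : ContDiffOn ℝ 1 (fun p : ℝ × ℝ => w₁ p.1 p.2) (I ×ˢ univ))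
    (sr₁ : ContDiffOn ℝ 1 (fun p : ℝ × ℝ => r₁ p.1 p.2) (I ×ˢ univ))
    (pw₁ : ∀ t ∈ I, Function.Periodic (w₁ t) L) (pr₁ : ∀ t ∈ I, Function.Periodic (r₁ t) L)
    (ew : ∀ t ∈ I, ∀ x, HasDerivAt (fun s => w₁ s x)
      (r₁ t x - velocity L a (w₁ t) x * deriv (w₁ t) x) t)
    (er : ∀ t ∈ I, ∀ x, HasDerivAt (fun s => r₁ s x)
      (-deriv (fun y => velocity L a (w₁ t) y * r₁ t y) x) t)
    {M₁ : ℝ} (hM₁ : ∀ t ∈ I, ∀ x, |deriv (w₁ t) x| ≤ M₁)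
    {J K : Set ℝ} (h₂ : IsSmoothSolution L a J w₂ r₂) (hJ : IsOpen J) (hK : IsCompact K)
    (hIK : I ⊆ K) (hKJ : K ⊆ J) :
    ∃ C, 0 ≤ C ∧ ∀ s ∈ I, ∀ t ∈ I, stateDist L (w₁ t) (r₁ t) (w₂ t) (r₂ t)
      ≤ Real.exp (C * |t - s|) * stateDist L (w₁ s) (r₁ s) (w₂ s) (r₂ s) := by
  have hIJ : I ⊆ J := hIK.trans hKJ
  have sw₂ : ContDiffOn ℝ ((0 : ℕ) + 1) (fun p : ℝ × ℝ => w₂ p.1 p.2) (J ×ˢ univ) :=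
    h₂.smooth_w.of_le (by exact_mod_cast le_top)
  have sr₂ : ContDiffOn ℝ ((0 : ℕ) + 1) (fun p : ℝ × ℝ => r₂ p.1 p.2) (J ×ˢ univ) :=
    h₂.smooth_r.of_le (by exact_mod_cast le_top)
  obtain ⟨-, -, -, cw₂'⟩ := partials_of_contDiffOn_succ hJ sw₂
  obtain ⟨-, -, -, cr₂'⟩ := partials_of_contDiffOn_succ hJ sr₂
  obtain ⟨A₁, hA₁, hb₁⟩ := exists_bound_of_periodic hL (g := fun t => deriv (w₂ t)) cw₂'.continuousOn
    (fun t ht => periodic_deriv (h₂.odd_w t ht).periodic) hK hKJ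
  obtain ⟨A₂, hA₂, hb₂⟩ := exists_bound_of_periodic hL (g := fun t => deriv (r₂ t)) cr₂'.continuousOn
    (fun t ht => periodic_deriv (h₂.odd_r t ht).periodic) hK hKJ
  obtain ⟨A₃, hA₃, hb₃⟩ := exists_bound_of_periodic hL sr₂.continuousOn
    (fun t ht => (h₂.odd_r t ht).periodic) hK hKJ
  obtain ⟨C, hC, hCy⟩ := exists_stateDist_deriv_le hL ha (max (kernNorm L a * M₁) (max A₁ (max A₂ A₃)))
  have hv : ∀ t ∈ I, ∀ x, |deriv (velocity L a (w₁ t)) x| ≤ kernNorm L a * M₁ := by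
    intro t ht x
    obtain ⟨-, d, -, c⟩ := partials_of_contDiffOn_succ (n := 0) hI (f := w₁) (by simpa using sw₁)
    rw [(velocity_hasDerivAt hL ha (pw₁ t ht) (periodic_deriv (pw₁ t ht)) (d t ht)
      (continuous_of_continuousOn_prod (f := fun t => deriv (w₁ t)) c.continuousOn ht) x).deriv]
    exact abs_velocity_le hL ha (periodic_deriv (pw₁ t ht)) (hM₁ t ht) x
  obtain ⟨y', hy'⟩ := hCy I w₁ r₁ w₂ r₂ (fun _ _ => 0) (fun _ _ => 0) 0 hI sw₁ sr₁
    ((sw₂.mono (prod_mono hIJ le_rfl)).of_le (by simp))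
    ((sr₂.mono (prod_mono hIJ le_rfl)).of_le (by simp)) pw₁ pr₁
    (fun t ht => (h₂.odd_w t (hIJ ht)).periodic) (fun t ht => (h₂.odd_r t (hIJ ht)).periodic)
    (fun t ht x => ((ew t ht x).sub (h₂.eq_w t (hIJ ht) x)).congr_deriv (by ring))
    (fun t ht x => ((er t ht x).sub (h₂.eq_r t (hIJ ht) x)).congr_deriv (by ring))
    (by simp) (by simp) (fun t ht x => (hv t ht x).trans (le_max_left _ _))
    (fun t ht x => (hb₁ t (hIK ht) x).trans (by simp))
    (fun t ht x => (hb₃ t (hIK ht) x).trans (by simp))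
    (fun t ht x => (hb₂ t (hIK ht) x).trans (by simp))
  refine ⟨C, hC, fun s hs t ht => gronwall_zero hIc
    (y := fun t => stateDist L (w₁ t) (r₁ t) (w₂ t) (r₂ t)) (fun t _ => stateDist_nonneg _ _ _ _ _)
    (fun t ht => (hy' t ht).1) (fun t ht => ?_) hC hs ht⟩
  simpa using (hy' t ht).2

/-- Uniqueness of smooth solutions. -/
theorem IsSmoothSolution.eq_of_eq {L a : ℝ} (hL : 0 < L) (ha : 0 < a) {α β : ℝ}
    {w₁ r₁ w₂ r₂ : ℝ → ℝ → ℝ} (h₁ : IsSmoothSolution L a (Ioo α β) w₁ r₁)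
    (h₂ : IsSmoothSolution L a (Ioo α β) w₂ r₂) {s : ℝ} (hs : s ∈ Ioo α β) (hw : w₁ s = w₂ s)
    (hr : r₁ s = r₂ s) {t : ℝ} (ht : t ∈ Ioo α β) : w₁ t = w₂ t ∧ r₁ t = r₂ t := by
  obtain ⟨α', hα, hα'⟩ := exists_between (lt_min hs.1 ht.1)
  obtain ⟨β', hβ', hβ⟩ := exists_between (max_lt hs.2 ht.2)
  have hKJ : Icc α' β' ⊆ Ioo α β := Icc_subset_Ioo hα hβ
  have hIK : Ioo α' β' ⊆ Icc α' β' := Ioo_subset_Icc_self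
  have hIJ := hIK.trans hKJ
  have hs' : s ∈ Ioo α' β' := ⟨hα'.trans_le (min_le_left _ _), (le_max_left _ _).trans_lt hβ'⟩
  have ht' : t ∈ Ioo α' β' := ⟨hα'.trans_le (min_le_right _ _), (le_max_right _ _).trans_lt hβ'⟩
  have sw₁ : ContDiffOn ℝ ((0 : ℕ) + 1) (fun p : ℝ × ℝ => w₁ p.1 p.2) (Ioo α β ×ˢ univ) :=
    h₁.smooth_w.of_le (by exact_mod_cast le_top)
  obtain ⟨-, -, -, c⟩ := partials_of_contDiffOn_succ isOpen_Ioo sw₁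
  obtain ⟨M₁, -, hM₁⟩ := exists_bound_of_periodic hL (g := fun t => deriv (w₁ t)) c.continuousOn
    (fun t ht => periodic_deriv (h₁.odd_w t ht).periodic) isCompact_Icc hKJ
  obtain ⟨C, -, hC⟩ := exists_stateDist_le hL ha (I := Ioo α' β') isOpen_Ioo (convex_Ioo _ _)
    ((h₁.smooth_w.mono (prod_mono hIJ le_rfl)).of_le (by exact_mod_cast le_top))
    ((h₁.smooth_r.mono (prod_mono hIJ le_rfl)).of_le (by exact_mod_cast le_top))
    (fun t ht => (h₁.odd_w t (hIJ ht)).periodic) (fun t ht => (h₁.odd_r t (hIJ ht)).periodic)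
    (fun t ht => h₁.eq_w t (hIJ ht)) (fun t ht => h₁.eq_r t (hIJ ht)) (fun t ht => hM₁ t (hIK ht))
    h₂ isOpen_Ioo isCompact_Icc hIK hKJ
  have h := hC s hs' t ht'
  have h0 : stateDist L (w₁ s) (r₁ s) (w₂ s) (r₂ s) = 0 := by
    simp [stateDist, hw, hr, l2]
  rw [h0, mul_zero] at h
  exact eq_of_stateDist_eq_zero hL (h₁.odd_w t ht).continuous (h₁.odd_r t ht).continuous
    (h₂.odd_w t ht).continuous (h₂.odd_r t ht).continuous (h₁.odd_w t ht).periodic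
    (h₁.odd_r t ht).periodic (h₂.odd_w t ht).periodic (h₂.odd_r t ht).periodic h

/-- The density with gradient `r` that vanishes at the origin. -/
noncomputable def primitive (r : ℝ → ℝ) (x : ℝ) : ℝ := ∫ y in (0 : ℝ)..x, r y

theorem hasDerivAt_primitive {r : ℝ → ℝ} (hr : Continuous r) (x : ℝ) :
    HasDerivAt (primitive r) (r x) x :=
  intervalIntegral.integral_hasDerivAt_right (hr.intervalIntegrable _ _)
    hr.aestronglyMeasurable.stronglyMeasurableAtFilter hr.continuousAt

theorem OddPeriodic.primitive_periodic {L : ℝ} {r : ℝ → ℝ} (hr : OddPeriodic L r) :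
    Function.Periodic (primitive r) L := by
  intro x
  have h0 : ∫ y in (0 : ℝ)..L, r y = 0 := by
    have h := intervalIntegral.integral_comp_sub_left (a := 0) (b := L) r L
    have e : ∀ x, r (L - x) = -r x := fun x => by
      rw [← hr.odd, ← hr.periodic (-x)]; congr 1; ring
    simp only [e, sub_self, sub_zero, intervalIntegral.integral_neg] at h
    linarith
  have h1 := hr.periodic.intervalIntegral_add_eq x 0
  rw [zero_add, h0] at h1
  unfold primitive
  rw [← intervalIntegral.integral_add_adjacent_intervals (b := x)
    (hr.continuous.intervalIntegrable _ _) (hr.continuous.intervalIntegrable _ _), h1, add_zero]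

/-- Integrating r_t = -(u r)_x from 0 to x leaves only the boundary term at x, because u is odd and
vanishes at the origin. This recovers the transport equation of θ. -/
theorem IsSmoothSolution.hasDerivAt_primitive {L a : ℝ} (hL : 0 < L) (ha : 0 < a) {I : Set ℝ}
    (hI : IsOpen I) {w r : ℝ → ℝ → ℝ} (h : IsSmoothSolution L a I w r) {t : ℝ} (ht : t ∈ I) (x : ℝ) :
    HasDerivAt (fun s => primitive (r s) x) (-(velocity L a (w t) x * r t x)) t := by
  have sr : ContDiffOn ℝ ((0 : ℕ) + 1) (fun p : ℝ × ℝ => r p.1 p.2) (I ×ˢ univ) :=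
    h.smooth_r.of_le (by exact_mod_cast le_top)
  obtain ⟨-, -, c, -⟩ := partials_of_contDiffOn_succ hI sr
  have hi := hasDerivAt_weighted_integral (a := 0) (b := x) (k := fun _ => 1) (by simp) hI
      (f := r) (f' := fun t x => deriv (fun s => r s x) t) sr.continuousOn c.continuousOn
      (fun t ht x => (h.eq_r t ht x).differentiableAt.hasDerivAt) ht
  simp only [one_mul] at hi
  refine hi.congr_deriv ?_
  have hu := (h.odd_w t ht).velocity hL ha
  have hm := hu.toSmoothPeriodic.mul (h.odd_r t ht).toSmoothPeriodic
  simp_rw [fun y => (h.eq_r t ht y).deriv]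
  rw [intervalIntegral.integral_neg, intervalIntegral.integral_eq_sub_of_hasDerivAt
    (fun y _ => hm.hasDerivAt y) (hm.deriv.continuous.intervalIntegrable _ _), hu.apply_zero]
  ring

/-- The partial derivatives of the density are -u r and r, both jointly smooth, so the density is
one order smoother at every order. -/
theorem IsSmoothSolution.contDiffOn_primitive {L a : ℝ} (hL : 0 < L) (ha : 0 < a) {I : Set ℝ}
    (hI : IsOpen I) {w r : ℝ → ℝ → ℝ} (h : IsSmoothSolution L a I w r) :
    ContDiffOn ℝ ∞ (fun p : ℝ × ℝ => primitive (r p.1) p.2) (I ×ˢ univ) := by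
  rw [contDiffOn_infty]
  intro n
  refine ContDiffOn.of_le (n := n + 1) ?_ (by exact_mod_cast Nat.le_succ n)
  have hr : ContDiffOn ℝ n (fun p : ℝ × ℝ => r p.1 p.2) (I ×ˢ univ) :=
    h.smooth_r.of_le (by exact_mod_cast le_top)
  have hw : ContDiffOn ℝ n (fun p : ℝ × ℝ => w p.1 p.2) (I ×ˢ univ) :=
    h.smooth_w.of_le (by exact_mod_cast le_top)
  exact contDiffOn_succ_of_partials hI (f := fun t x => primitive (r t) x)
    (fun t ht x => h.hasDerivAt_primitive hL ha hI ht x)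
    (fun t ht x => HouLuo.hasDerivAt_primitive (h.odd_r t ht).continuous x)
    ((contDiffOn_velocity hL ha hI n (fun t ht => (h.odd_w t ht).periodic) hw).mul hr).neg hr

/-- A smooth solution is a classical solution. -/
theorem IsSmoothSolution.isClassicalSolution {L a : ℝ} (hL : 0 < L) (ha : 0 < a) {δ T : ℝ}
    (hδ : 0 < δ) {w r : ℝ → ℝ → ℝ} (h : IsSmoothSolution L a (Ioo (-δ) T) w r) :
    IsClassicalSolution L a T (w 0) (primitive (r 0)) w (fun t => primitive (r t)) := by
  have hsub : Ico 0 T ⊆ Ioo (-δ) T := fun t ht => ⟨by linarith [ht.1], ht.2⟩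
  have hθ := h.contDiffOn_primitive hL ha isOpen_Ioo
  have hd : ∀ t ∈ Ico 0 T, ∀ x, deriv (primitive (r t)) x = r t x := fun t ht x =>
    (HouLuo.hasDerivAt_primitive (h.odd_r t (hsub ht)).continuous x).deriv
  refine ⟨(h.smooth_w.mono (prod_mono hsub le_rfl)).of_le (by exact_mod_cast le_top),
    (hθ.mono (prod_mono hsub le_rfl)).of_le (WithTop.coe_le_coe.2 le_top),
    fun t ht => (h.odd_w t (hsub ht)).periodic, fun t ht => (h.odd_r t (hsub ht)).primitive_periodic,
    fun t ht x => ?_, fun t ht x => ?_, fun _ => rfl, fun _ => rfl⟩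
  · rw [hd t ht]
    exact (h.eq_w t (hsub ht) x).hasDerivWithinAt
  · rw [hd t ht]
    exact (h.hasDerivAt_primitive hL ha isOpen_Ioo (hsub ht) x).hasDerivWithinAt

/-- A classical solution coincides with the smooth solution with the same initial data. -/
theorem IsClassicalSolution.eq_smooth {L a : ℝ} (hL : 0 < L) (ha : 0 < a) {δ T T' : ℝ}
    (hδ : 0 < δ) {w r w' θ' : ℝ → ℝ → ℝ} {w₀ θ₀ : ℝ → ℝ} (hθ₀ : θ₀ 0 = 0)
    (h : IsSmoothSolution L a (Ioo (-δ) T) w r)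
    (hw0 : w 0 = w₀) (hr0 : r 0 = deriv θ₀) (h' : IsClassicalSolution L a T' w₀ θ₀ w' θ')
    {t : ℝ} (ht : t ∈ Ico 0 T) (ht' : t ∈ Ico 0 T') : w' t = w t ∧ θ' t = primitive (r t) := by
  have hJ : UniqueDiffOn ℝ (Ico 0 T') := uniqueDiffOn_Ico 0 T'
  obtain ⟨dw, cw⟩ := partial_right_of_contDiffOn_succ (n := 0) hJ (f := w')
    (by simpa using h'.regular_vorticity)
  obtain ⟨dθ, sr⟩ := partial_right_of_contDiffOn_succ (n := 1) hJ (f := θ')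
    (by simpa [one_add_one_eq_two] using h'.regular_density)
  rw [Nat.cast_one] at sr
  have hrp : ∀ s ∈ Ico 0 T', Function.Periodic (deriv (θ' s)) L := fun s hs =>
    periodic_deriv (h'.periodic_density s hs)
  have hI0 : Ioo 0 T' ⊆ Ico 0 T' := Ioo_subset_Ico_self
  have ew : ∀ s ∈ Ioo 0 T', ∀ x, HasDerivAt (fun s => w' s x)
      (deriv (θ' s) x - velocity L a (w' s) x * deriv (w' s) x) s := fun s hs x =>
    (h'.vorticity_eq s (hI0 hs) x).hasDerivAt (Ico_mem_nhds hs.1 hs.2)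
  have eθ : ∀ s ∈ Ioo 0 T', ∀ x, HasDerivAt (fun s => θ' s x)
      (-(velocity L a (w' s) x * deriv (θ' s) x)) s := fun s hs x =>
    (h'.density_eq s (hI0 hs) x).hasDerivAt (Ico_mem_nhds hs.1 hs.2)
  -- The gradient equation follows by exchanging the mixed derivatives of θ'; this is where the C²
  -- regularity of the density enters.
  have er : ∀ s ∈ Ioo 0 T', ∀ x, HasDerivAt (fun s => deriv (θ' s) x)
      (-deriv (fun y => velocity L a (w' s) y * deriv (θ' s) y) x) s := fun s hs x => by
    have := hasDerivAt_deriv_comm isOpen_Ioo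
      (h'.regular_density.mono (prod_mono hI0 (le_refl (univ : Set ℝ)))) hs x
    refine this.congr_deriv ?_
    rw [show (fun y => deriv (fun s => θ' s y) s) = fun y => -(velocity L a (w' s) y * deriv (θ' s) y)
      from funext fun y => (eθ s hs y).deriv, deriv.fun_neg]
  -- The equations are two-sided in time only for t > 0. Stability on (0, t₁) compares time t with a
  -- time s, and s → 0 brings in the common data.
  have key : ∀ t ∈ Ico 0 T, t ∈ Ico 0 T' → w' t = w t ∧ deriv (θ' t) = r t := by
    intro t ht ht'
    rcases ht.1.eq_or_lt with rfl | ht0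
    · exact ⟨by rw [hw0]; exact funext h'.initial_vorticity,
        by rw [hr0, show θ' 0 = θ₀ from funext h'.initial_density]⟩
    obtain ⟨t₁, ht1, ht1'⟩ := exists_between (lt_min ht.2 ht'.2)
    have hKJ : Icc 0 t₁ ⊆ Ioo (-δ) T := Icc_subset_Ioo (by linarith) (ht1'.trans_le (min_le_left _ _))
    have hKJ' : Icc 0 t₁ ⊆ Ico 0 T' := fun s hs =>
      ⟨hs.1, hs.2.trans_lt (ht1'.trans_le (min_le_right _ _))⟩
    have hIK : Ioo 0 t₁ ⊆ Icc 0 t₁ := Ioo_subset_Icc_self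
    have hII : Ioo 0 t₁ ⊆ Ioo 0 T' := Ioo_subset_Ioo_right (ht1'.le.trans (min_le_right _ _))
    obtain ⟨M₁, -, hM₁⟩ := exists_bound_of_periodic hL (g := fun t => deriv (w' t)) cw.continuousOn
      (fun t ht => periodic_deriv (h'.periodic_vorticity t ht)) isCompact_Icc hKJ'
    have hII' : Ioo 0 t₁ ⊆ Ico 0 T' := hII.trans hI0
    obtain ⟨C, hC0, hC⟩ := exists_stateDist_le hL ha (I := Ioo 0 t₁) isOpen_Ioo (convex_Ioo _ _)
      (w₁ := w') (r₁ := fun t => deriv (θ' t))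
      (h'.regular_vorticity.mono (prod_mono hII' le_rfl)) (sr.mono (prod_mono hII' le_rfl))
      (fun s hs => h'.periodic_vorticity s (hII' hs)) (fun s hs => hrp s (hII' hs))
      (fun s hs => ew s (hII hs)) (fun s hs => er s (hII hs)) (fun s hs => hM₁ s (hIK hs))
      h isOpen_Ioo isCompact_Icc hIK hKJ
    have hcont : ∀ {f g : ℝ → ℝ → ℝ}, ContinuousOn (fun p : ℝ × ℝ => f p.1 p.2) (Ico 0 T' ×ˢ univ) →
        ContinuousOn (fun p : ℝ × ℝ => g p.1 p.2) (Ioo (-δ) T ×ˢ univ) → f 0 = g 0 →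
        Tendsto (fun s => l2 L (fun x => f s x - g s x) ^ 2) (𝓝[>] 0) (𝓝 0) := by
      intro f g hf hg h0
      -- Time is clamped to [0, t₁], which makes the difference continuous for all real s, so that
      -- continuity of parametric integrals on open sets applies at s = 0.
      set F : ℝ → ℝ → ℝ := fun s x => f (max 0 (min s t₁)) x - g (max 0 (min s t₁)) x with hF
      have hproj : ∀ s : ℝ, max 0 (min s t₁) ∈ Icc 0 t₁ := fun s =>
        ⟨le_max_left _ _, max_le (ht0.le.trans ht1.le) (min_le_right _ _)⟩
      have hFc : ContinuousOn (fun p : ℝ × ℝ => F p.1 p.2 ^ 2) (univ ×ˢ univ) := by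
        refine ContinuousOn.pow (ContinuousOn.sub ?_ ?_) 2
        · exact hf.comp (f := fun p : ℝ × ℝ => (max 0 (min p.1 t₁), p.2)) (by fun_prop)
            fun p _ => ⟨hKJ' (hproj p.1), mem_univ _⟩
        · exact hg.comp (f := fun p : ℝ × ℝ => (max 0 (min p.1 t₁), p.2)) (by fun_prop)
            fun p _ => ⟨hKJ (hproj p.1), mem_univ _⟩
      have hcA := continuousAt_weighted_integral (a := 0) (b := L) (k := fun _ => 1) (by simp)
        (U := univ) isOpen_univ (f := fun s x => F s x ^ 2) hFc (mem_univ (0 : ℝ))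
      have hF0 : ∀ x, F 0 x = 0 := fun x => by
        have : max 0 (min 0 t₁) = 0 := by simp
        simp only [hF, this, h0, sub_self]
      have ht := hcA.tendsto.mono_left (nhdsWithin_le_nhds (s := Ioi 0))
      simp only [one_mul, hF0, ne_eq, OfNat.ofNat_ne_zero, not_false_eq_true, zero_pow,
        intervalIntegral.integral_zero] at ht
      refine ht.congr' ?_
      have : Ioo 0 t₁ ∈ 𝓝[>] (0 : ℝ) := Ioo_mem_nhdsGT (ht0.trans ht1)
      filter_upwards [this] with s hs
      rw [l2_sq hL]
      congr 1; ext x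
      have : max 0 (min s t₁) = s := by rw [min_eq_left hs.2.le, max_eq_right hs.1.le]
      simp only [hF, this]
    have hlim : Tendsto (fun s => Real.exp (C * |t - s|) * stateDist L (w' s) (deriv (θ' s)) (w s) (r s))
        (𝓝[>] 0) (𝓝 (Real.exp (C * |t - 0|) * (0 + 0))) := by
      refine Tendsto.mul ?_ (Tendsto.add ?_ ?_)
      · exact (Continuous.tendsto (by fun_prop) 0).mono_left nhdsWithin_le_nhds
      · exact hcont h'.regular_vorticity.continuousOn h.smooth_w.continuousOn
          (by rw [hw0]; exact funext h'.initial_vorticity)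
      · exact hcont (f := fun s => deriv (θ' s)) sr.continuousOn h.smooth_r.continuousOn
          (by rw [hr0, show θ' 0 = θ₀ from funext h'.initial_density])
    have hle : stateDist L (w' t) (deriv (θ' t)) (w t) (r t) ≤ Real.exp (C * |t - 0|) * (0 + 0) := by
      refine ge_of_tendsto hlim ?_
      have : Ioo 0 t₁ ∈ 𝓝[>] (0 : ℝ) := Ioo_mem_nhdsGT (ht0.trans ht1)
      filter_upwards [this] with s hs
      exact hC s hs t ⟨ht0, ht1⟩
    rw [add_zero, mul_zero] at hle
    have htJ := hKJ ⟨ht0.le, ht1.le⟩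
    exact eq_of_stateDist_eq_zero hL (continuous_of_continuousOn_prod h'.regular_vorticity.continuousOn ht')
      (continuous_of_continuousOn_prod (f := fun t => deriv (θ' t)) sr.continuousOn ht')
      (h.odd_w t htJ).continuous (h.odd_r t htJ).continuous (h'.periodic_vorticity t ht') (hrp t ht')
      (h.odd_w t htJ).periodic (h.odd_r t htJ).periodic hle
  refine ⟨(key t ht ht').1, ?_⟩
  -- The gradient determines θ' up to a function of time. At the origin the velocity vanishes, since
  -- the vorticity is now known to be odd, so θ'(t, 0) keeps its initial value 0.
  have hzero : θ' t 0 = 0 := by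
    have hsub : Icc 0 t ⊆ Ico 0 T' := fun s hs => ⟨hs.1, hs.2.trans_lt ht'.2⟩
    have hc : ContinuousOn (fun s => θ' s 0) (Icc 0 t) :=
      h'.regular_density.continuousOn.comp (f := fun s : ℝ => (s, (0 : ℝ))) (by fun_prop)
        fun s hs => ⟨hsub hs, mem_univ _⟩
    have := constant_of_has_deriv_right_zero hc (fun s hs => by
      have hs' : s ∈ Ico 0 T' := hsub (Ico_subset_Icc_self hs)
      have hsT : s ∈ Ico 0 T := ⟨hs.1, hs.2.trans ht.2⟩
      have hv : velocity L a (w' s) 0 = 0 := by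
        rw [(key s hsT hs').1]
        exact ((h.odd_w s ⟨by linarith [hs.1], hsT.2⟩).velocity hL ha).apply_zero
      have hd := h'.density_eq s hs' 0
      rw [hv, zero_mul, neg_zero] at hd
      exact hd.mono_of_mem_nhdsWithin (Filter.mem_of_superset (Ico_mem_nhdsGE hs'.2)
        (Ico_subset_Ico_left hs.1))) t ⟨ht.1, le_rfl⟩
    rw [this, h'.initial_density, hθ₀]
  ext x
  have hi := intervalIntegral.integral_eq_sub_of_hasDerivAt (a := 0) (b := x) (f := θ' t)
    (fun y _ => dθ t ht' y) ((continuous_of_continuousOn_prod (f := fun t => deriv (θ' t))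
      sr.continuousOn ht').intervalIntegrable _ _)
  rw [hzero, sub_zero, (key t ht ht').2] at hi
  exact hi.symm

end HouLuo
-- Sine projections and the Sobolev energy.
namespace HouLuo
open MeasureTheory Set

/-- Finite sine series. -/
noncomputable def sineSum (L : ℝ) (N : ℕ) (c : ℕ → ℝ) (x : ℝ) : ℝ :=
  ∑ n ∈ Finset.range N, c n * sineBasis L n x

theorem oddPeriodic_sineSum {L : ℝ} (hL : 0 < L) (N : ℕ) (c : ℕ → ℝ) :
    OddPeriodic L (sineSum L N c) :=
  ⟨.sum _ fun n _ => (smoothPeriodic_sineBasis hL n).const_mul (c n), fun x => by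
    simp [sineSum, sineBasis_neg, Finset.sum_neg_distrib]⟩

theorem iteratedDeriv_sineSum {L : ℝ} (hL : 0 < L) (N : ℕ) (c : ℕ → ℝ) (k : ℕ) (x : ℝ) :
    iteratedDeriv k (sineSum L N c) x
      = ∑ n ∈ Finset.range N, c n * iteratedDeriv k (sineBasis L n) x := by
  have hs : ∀ n, ContDiffAt ℝ k (sineBasis L n) x := fun n =>
    (smoothPeriodic_sineBasis hL n).smooth.contDiffAt.of_le (by exact_mod_cast le_top)
  unfold sineSum
  rw [iteratedDeriv_fun_sum fun n _ => contDiffAt_const.mul (hs n)]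
  exact Finset.sum_congr rfl fun n _ => by rw [iteratedDeriv_const_mul_field]

/-- Even derivatives map the span of the first N sines into itself, so they can be applied to a
Galerkin test function without leaving the space. -/
theorem neg_one_pow_mul_iteratedDeriv_sineSum {L : ℝ} (hL : 0 < L) (N : ℕ) (c : ℕ → ℝ) (k : ℕ)
    (x : ℝ) : (-1) ^ k * iteratedDeriv (2 * k) (sineSum L N c) x
      = sineSum L N (fun n => freq L n ^ (2 * k) * c n) x := by
  rw [iteratedDeriv_sineSum hL, Finset.mul_sum, sineSum]
  refine Finset.sum_congr rfl fun n _ => ?_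
  have h : ((-1 : ℝ) ^ k) * (-1) ^ k = 1 := by rw [← mul_pow]; simp
  rw [iteratedDeriv_two_mul_sineBasis]
  linear_combination (c n * freq L n ^ (2 * k) * sineBasis L n x) * h

theorem integral_mul_sineSum {L : ℝ} (hL : 0 < L) (N : ℕ) (c : ℕ → ℝ) {f : ℝ → ℝ}
    (hf : Continuous f) : ∫ x in (0 : ℝ)..L, f x * sineSum L N c x
      = L / 2 * ∑ n ∈ Finset.range N, c n * sineCoeff L f n := by
  have hs : ∀ n, Continuous (sineBasis L n) := fun n => (smoothPeriodic_sineBasis hL n).continuous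
  have e : ∀ x, f x * sineSum L N c x
      = ∑ n ∈ Finset.range N, c n * (f x * sineBasis L n x) := fun x => by
    rw [sineSum, Finset.mul_sum]
    exact Finset.sum_congr rfl fun n _ => by ring
  simp_rw [e]
  rw [intervalIntegral.integral_finsetSum fun n _ => Continuous.intervalIntegrable (by
    have := hs n; fun_prop) _ _, Finset.mul_sum]
  refine Finset.sum_congr rfl fun n _ => ?_
  rw [intervalIntegral.integral_const_mul, sineCoeff]
  field_simp

/-- The H^k pairing with a finite sine sum sees only the first N coefficients of f. For this reason
the projection disappears from the Galerkin energy identities. -/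
theorem integral_iteratedDeriv_mul_sineSum {L : ℝ} (hL : 0 < L) (N : ℕ) (c : ℕ → ℝ) {f : ℝ → ℝ}
    (hf : SmoothPeriodic L f) (k : ℕ) :
    ∫ x in (0 : ℝ)..L, iteratedDeriv k f x * iteratedDeriv k (sineSum L N c) x
      = L / 2 * ∑ n ∈ Finset.range N, freq L n ^ (2 * k) * c n * sineCoeff L f n := by
  rw [← hf.integral_mul_iteratedDeriv_two_mul (oddPeriodic_sineSum hL N c).toSmoothPeriodic]
  simp_rw [neg_one_pow_mul_iteratedDeriv_sineSum hL]
  exact integral_mul_sineSum hL N _ hf.continuous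

theorem sineCoeff_sineSum {L : ℝ} (hL : 0 < L) {N : ℕ} (c : ℕ → ℝ) {n : ℕ} (hn : n < N) :
    sineCoeff L (sineSum L N c) n = c n := by
  have hs : ∀ n, Continuous (sineBasis L n) := fun n => (smoothPeriodic_sineBasis hL n).continuous
  unfold sineCoeff sineSum
  simp_rw [Finset.sum_mul, mul_assoc]
  rw [intervalIntegral.integral_finsetSum fun m _ => Continuous.intervalIntegrable (by
    have := hs n; have := hs m; fun_prop) _ _]
  simp_rw [intervalIntegral.integral_const_mul, integral_sineBasis_mul_sineBasis hL]
  simp only [mul_ite, mul_zero, Finset.sum_ite_eq', Finset.mem_range, hn, if_true]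
  field_simp

theorem l2_iteratedDeriv_sineSum_sq {L : ℝ} (hL : 0 < L) (N : ℕ) (c : ℕ → ℝ) (k : ℕ) :
    l2 L (iteratedDeriv k (sineSum L N c)) ^ 2
      = L / 2 * ∑ n ∈ Finset.range N, freq L n ^ (2 * k) * c n ^ 2 := by
  rw [l2_sq hL]
  simp_rw [sq (iteratedDeriv k (sineSum L N c) _)]
  rw [integral_iteratedDeriv_mul_sineSum hL N c (oddPeriodic_sineSum hL N c).toSmoothPeriodic]
  congr 1
  refine Finset.sum_congr rfl fun n hn => ?_
  rw [sineCoeff_sineSum hL c (Finset.mem_range.1 hn)]; ring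

/-- The projection P is orthogonal in every Sobolev seminorm: ‖Pf‖² is the pairing of f with Pf, and
Cauchy–Schwarz gives the contraction. -/
theorem l2_iteratedDeriv_sineProj_le {L : ℝ} (hL : 0 < L) (N : ℕ) {f : ℝ → ℝ}
    (hf : SmoothPeriodic L f) (k : ℕ) :
    l2 L (iteratedDeriv k (sineProj L N f)) ≤ l2 L (iteratedDeriv k f) := by
  change l2 L (iteratedDeriv k (sineSum L N (sineCoeff L f))) ≤ _
  have hP := (oddPeriodic_sineSum hL N (sineCoeff L f)).iteratedDeriv k
  have h1 := l2_iteratedDeriv_sineSum_sq hL N (sineCoeff L f) k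
  have h2 := integral_iteratedDeriv_mul_sineSum hL N (sineCoeff L f) hf k
  have h3 := abs_integral_mul_le hL (hf.iteratedDeriv k).continuous hP.continuous
  rw [h2] at h3
  simp_rw [mul_assoc, ← sq] at h3
  rw [← h1, abs_of_nonneg (sq_nonneg _)] at h3
  have h0 := l2_nonneg L (iteratedDeriv k (sineSum L N (sineCoeff L f)))
  rcases h0.eq_or_lt with h0 | h0
  · rw [← h0]; exact l2_nonneg _ _
  · rw [sq] at h3
    exact le_of_mul_le_mul_right h3 h0

/-- The right-hand side of the vorticity equation. -/
noncomputable def vortRhs (L a : ℝ) (w r : ℝ → ℝ) (x : ℝ) : ℝ :=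
  r x - velocity L a w x * deriv w x

/-- The right-hand side of the equation of the density gradient. -/
noncomputable def gradRhs (L a : ℝ) (w r : ℝ → ℝ) (x : ℝ) : ℝ :=
  -(deriv (velocity L a w) x * r x + velocity L a w x * deriv r x)

theorem gradRhs_eq {L a : ℝ} (hL : 0 < L) (ha : 0 < a) {w r : ℝ → ℝ} (hw : OddPeriodic L w)
    (hr : OddPeriodic L r) (x : ℝ) :
    gradRhs L a w r x = -deriv (fun y => velocity L a w y * r y) x := by
  rw [deriv_fun_mul ((hw.velocity hL ha).hasDerivAt x).differentiableAt
    (hr.hasDerivAt x).differentiableAt, gradRhs]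

theorem OddPeriodic.neg {L : ℝ} {f : ℝ → ℝ} (hf : OddPeriodic L f) : OddPeriodic L (fun x => -f x) :=
  ⟨by simpa using hf.toSmoothPeriodic.const_mul (-1), fun x => by rw [hf.odd]⟩

/-- The system preserves oddness, which is why sines alone suffice for the Galerkin scheme. -/
theorem oddPeriodic_vortRhs {L a : ℝ} (hL : 0 < L) (ha : 0 < a) {w r : ℝ → ℝ}
    (hw : OddPeriodic L w) (hr : OddPeriodic L r) : OddPeriodic L (vortRhs L a w r) :=
  hr.sub ((hw.velocity hL ha).deriv_mul hw)

theorem oddPeriodic_gradRhs {L a : ℝ} (hL : 0 < L) (ha : 0 < a) {w r : ℝ → ℝ}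
    (hw : OddPeriodic L w) (hr : OddPeriodic L r) : OddPeriodic L (gradRhs L a w r) := by
  have h := (hr.deriv_mul (hw.velocity hL ha)).add ((hw.velocity hL ha).deriv_mul hr)
  simp_rw [mul_comm (r _)] at h
  exact h.neg

/-- The square of the Sobolev seminorm of order `k` of a state. -/
noncomputable def energy (L : ℝ) (k : ℕ) (w r : ℝ → ℝ) : ℝ :=
  l2 L (iteratedDeriv k w) ^ 2 + l2 L (iteratedDeriv k r) ^ 2

theorem energy_nonneg (L : ℝ) (k : ℕ) (w r : ℝ → ℝ) : 0 ≤ energy L k w r := by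
  unfold energy; positivity

theorem l2_le_sqrt_energy_left (L : ℝ) (k : ℕ) (w r : ℝ → ℝ) :
    l2 L (iteratedDeriv k w) ≤ √(energy L k w r) :=
  Real.le_sqrt_of_sq_le (by unfold energy; nlinarith [sq_nonneg (l2 L (iteratedDeriv k r))])

theorem l2_le_sqrt_energy_right (L : ℝ) (k : ℕ) (w r : ℝ → ℝ) :
    l2 L (iteratedDeriv k r) ≤ √(energy L k w r) :=
  Real.le_sqrt_of_sq_le (by unfold energy; nlinarith [sq_nonneg (l2 L (iteratedDeriv k w))])

/-- The energy inequality. -/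
theorem exists_energy_le {L a : ℝ} (hL : 0 < L) (ha : 0 < a) {k : ℕ} (hk : 1 ≤ k) :
    ∃ C, 0 ≤ C ∧ ∀ w r : ℝ → ℝ, OddPeriodic L w → OddPeriodic L r → ∀ B : ℝ,
      l2 L (iteratedDeriv (max 1 (k - 1)) w) ≤ B → l2 L (iteratedDeriv (max 1 (k - 1)) r) ≤ B →
      |2 * (∫ x in (0 : ℝ)..L, iteratedDeriv k (vortRhs L a w r) x * iteratedDeriv k w x)
        + 2 * ∫ x in (0 : ℝ)..L, iteratedDeriv k (gradRhs L a w r) x * iteratedDeriv k r x|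
        ≤ C * (1 + B) * energy L k w r := by
  obtain ⟨C₁, hC₁, h₁⟩ := exists_energy_transport hL ha hk
  obtain ⟨C₂, hC₂, h₂⟩ := exists_energy_stretching hL ha hk
  refine ⟨2 * (1 + 4 * C₁ + 2 * C₂), by positivity, fun w r hw hr B hBw hBr => ?_⟩
  have hB : 0 ≤ B := (l2_nonneg _ _).trans hBw
  have hu := hw.velocity hL ha
  have t1 := h₁ w w hw hw B hBw hBw
  have t2 := h₁ w r hw hr B hBw hBr
  have t3 := h₂ w r hw hr B hBw hBr
  have hat : ∀ {f : ℝ → ℝ}, SmoothPeriodic L f → ∀ x, ContDiffAt ℝ k f x := fun h x =>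
    h.smooth.contDiffAt.of_le (by exact_mod_cast le_top)
  have p1 := hu.toSmoothPeriodic.mul hw.toSmoothPeriodic.deriv
  have p2 := hu.toSmoothPeriodic.mul hr.toSmoothPeriodic.deriv
  have p3 := hu.toSmoothPeriodic.deriv.mul hr.toSmoothPeriodic
  have e1 : ∀ x, iteratedDeriv k (vortRhs L a w r) x = iteratedDeriv k r x
      - iteratedDeriv k (fun x => velocity L a w x * deriv w x) x := fun x =>
    iteratedDeriv_fun_sub (hat hr.toSmoothPeriodic x) (hat p1 x)
  have e2 : ∀ x, iteratedDeriv k (gradRhs L a w r) x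
      = -(iteratedDeriv k (fun x => deriv (velocity L a w) x * r x) x
      + iteratedDeriv k (fun x => velocity L a w x * deriv r x) x) := fun x => by
    unfold gradRhs
    rw [iteratedDeriv_fun_neg, iteratedDeriv_fun_add (hat p3 x) (hat p2 x)]
  have cw := (hw.iteratedDeriv k).continuous
  have cr := (hr.iteratedDeriv k).continuous
  have c1 := (p1.iteratedDeriv k).continuous
  have c2 := (p2.iteratedDeriv k).continuous
  have c3 := (p3.iteratedDeriv k).continuous
  simp_rw [e1, e2, sub_mul, neg_mul, add_mul]
  rw [intervalIntegral.integral_sub (Continuous.intervalIntegrable (by fun_prop) _ _)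
    (Continuous.intervalIntegrable (by fun_prop) _ _), intervalIntegral.integral_neg,
    intervalIntegral.integral_add (Continuous.intervalIntegrable (by fun_prop) _ _)
    (Continuous.intervalIntegrable (by fun_prop) _ _)]
  have t0 := abs_integral_mul_le hL cr cw
  unfold energy
  set m := l2 L (iteratedDeriv k w)
  set n := l2 L (iteratedDeriv k r)
  have hm : 0 ≤ m := l2_nonneg _ _
  have hn : 0 ≤ n := l2_nonneg _ _
  have hmn : 2 * (m * n) ≤ m ^ 2 + n ^ 2 := by nlinarith [sq_nonneg (m - n)]
  have b1 : C₁ * B * (m + m) * m ≤ C₁ * B * (2 * (m ^ 2 + n ^ 2)) := by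
    rw [mul_assoc]; exact mul_le_mul_of_nonneg_left (by nlinarith) (by positivity)
  have b2 : C₁ * B * (m + n) * n ≤ C₁ * B * (2 * (m ^ 2 + n ^ 2)) := by
    rw [mul_assoc]; exact mul_le_mul_of_nonneg_left (by nlinarith) (by positivity)
  have b3 : C₂ * B * (m + n) * n ≤ C₂ * B * (2 * (m ^ 2 + n ^ 2)) := by
    rw [mul_assoc]; exact mul_le_mul_of_nonneg_left (by nlinarith) (by positivity)
  have hE : 0 ≤ m ^ 2 + n ^ 2 := by positivity
  have hx : 0 ≤ (4 * C₁ + 2 * C₂) * (m ^ 2 + n ^ 2) := by positivity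
  have hy : 0 ≤ B * (m ^ 2 + n ^ 2) := by positivity
  rw [abs_le] at *
  constructor <;> nlinarith

end HouLuo
-- Uniform bounds for the Galerkin system.
namespace HouLuo
open MeasureTheory Set

/-- Solutions of the (damped) sine Galerkin system. -/
structure IsGalerkin (L a : ℝ) (N : ℕ) (I : Set ℝ) (χ : ℝ → ℝ) (A D : ℕ → ℝ → ℝ) : Prop where
  deriv_left : ∀ t ∈ I, ∀ n < N, HasDerivAt (A n) (χ t * sineCoeff L
    (vortRhs L a (sineSum L N fun n => A n t) (sineSum L N fun n => D n t)) n) t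
  deriv_right : ∀ t ∈ I, ∀ n < N, HasDerivAt (D n) (χ t * sineCoeff L
    (gradRhs L a (sineSum L N fun n => A n t) (sineSum L N fun n => D n t)) n) t

/-- The full right-hand side f appears in the derivative although the coefficients only follow its
projection; the test function lies in the projected space. -/
theorem hasDerivAt_l2_iteratedDeriv_sineSum_sq {L : ℝ} (hL : 0 < L) {N : ℕ} {A : ℕ → ℝ → ℝ}
    {f : ℝ → ℝ} (hf : SmoothPeriodic L f) {q t : ℝ}
    (h : ∀ n < N, HasDerivAt (A n) (q * sineCoeff L f n) t) (k : ℕ) :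
    HasDerivAt (fun t => l2 L (iteratedDeriv k (sineSum L N fun n => A n t)) ^ 2)
      (q * (2 * ∫ x in (0 : ℝ)..L, iteratedDeriv k f x
        * iteratedDeriv k (sineSum L N fun n => A n t) x)) t := by
  simp_rw [l2_iteratedDeriv_sineSum_sq hL]
  have h1 : HasDerivAt (fun t => L / 2 * ∑ n ∈ Finset.range N, freq L n ^ (2 * k) * A n t ^ 2)
      (L / 2 * ∑ n ∈ Finset.range N, freq L n ^ (2 * k) * (2 * A n t * (q * sineCoeff L f n))) t := by
    refine (HasDerivAt.fun_sum fun n hn => ?_).const_mul _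
    exact (((h n (Finset.mem_range.1 hn)).pow 2).congr_deriv (by simp)).const_mul _
  refine h1.congr_deriv ?_
  rw [integral_iteratedDeriv_mul_sineSum hL N _ hf, Finset.mul_sum, Finset.mul_sum, Finset.mul_sum,
    Finset.mul_sum]
  exact Finset.sum_congr rfl fun n _ => by ring

section Galerkin

variable {L a : ℝ} {N : ℕ} {I : Set ℝ} {χ : ℝ → ℝ} {A D : ℕ → ℝ → ℝ}

theorem IsGalerkin.hasDerivAt_energy (h : IsGalerkin L a N I χ A D) (hL : 0 < L) (ha : 0 < a)
    (k : ℕ) {t : ℝ} (ht : t ∈ I) :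
    HasDerivAt (fun t => energy L k (sineSum L N fun n => A n t) (sineSum L N fun n => D n t))
      (χ t * (2 * (∫ x in (0 : ℝ)..L, iteratedDeriv k
          (vortRhs L a (sineSum L N fun n => A n t) (sineSum L N fun n => D n t)) x
          * iteratedDeriv k (sineSum L N fun n => A n t) x)
        + 2 * ∫ x in (0 : ℝ)..L, iteratedDeriv k
          (gradRhs L a (sineSum L N fun n => A n t) (sineSum L N fun n => D n t)) x
          * iteratedDeriv k (sineSum L N fun n => D n t) x)) t := by
  have hw := oddPeriodic_sineSum hL N fun n => A n t
  have hr := oddPeriodic_sineSum hL N fun n => D n t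
  rw [mul_add]
  exact (hasDerivAt_l2_iteratedDeriv_sineSum_sq hL (oddPeriodic_vortRhs hL ha hw hr).toSmoothPeriodic
    (h.deriv_left t ht) k).add (hasDerivAt_l2_iteratedDeriv_sineSum_sq hL
    (oddPeriodic_gradRhs hL ha hw hr).toSmoothPeriodic (h.deriv_right t ht) k)

/-- The first order energy bound on a time interval which depends only on the initial energy. -/
theorem exists_galerkin_energy_one_le (hL : 0 < L) (ha : 0 < a) {B : ℝ} (hB : 0 ≤ B) :
    ∃ τ, 0 < τ ∧ ∀ (N : ℕ) (χ : ℝ → ℝ) (A D : ℕ → ℝ → ℝ), (∀ t, |χ t| ≤ 1) →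
      IsGalerkin L a N (Ioo (-τ) τ) χ A D →
      energy L 1 (sineSum L N fun n => A n 0) (sineSum L N fun n => D n 0) ≤ B →
      ∀ t ∈ Ioo (-τ) τ,
        energy L 1 (sineSum L N fun n => A n t) (sineSum L N fun n => D n t) ≤ 2 * (1 + B) := by
  obtain ⟨C, hC, hCb⟩ := exists_energy_le hL ha (le_refl 1)
  -- The time of `quadratic_gronwall` with the constant 2C + 1, which is positive even for C = 0 and
  -- satisfies C(1 + √y) y ≤ (2C + 1)(1 + y)².
  refine ⟨1 / (2 * (2 * C + 1) * (1 + B)), by positivity, fun N χ A D hχ h h0 t ht => ?_⟩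
  have hτ : 0 < 1 / (2 * (2 * C + 1) * (1 + B)) := by positivity
  refine quadratic_gronwall (C := 2 * C + 1) (convex_Ioo _ _) (by positivity) hB
    (fun t _ => energy_nonneg _ _ _ _) (fun t ht => h.hasDerivAt_energy hL ha 1 ht) (fun t _ => ?_)
    (s := 0) ⟨by linarith, hτ⟩ ht h0 (by rw [sub_zero]; exact (abs_lt.2 ht).le)
  have hw := oddPeriodic_sineSum hL N fun n => A n t
  have hr := oddPeriodic_sineSum hL N fun n => D n t
  have hb := hCb _ _ hw hr _ (l2_le_sqrt_energy_left L 1 _ _) (l2_le_sqrt_energy_right L 1 _ _)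
  set y := energy L 1 (sineSum L N fun n => A n t) (sineSum L N fun n => D n t)
  have hy : 0 ≤ y := energy_nonneg _ _ _ _
  have hsq : √y ≤ 1 + y := by
    nlinarith [Real.sq_sqrt hy, sq_nonneg (√y - 1), Real.sqrt_nonneg y]
  rw [abs_mul]
  refine (mul_le_of_le_one_left (abs_nonneg _) (hχ t)).trans (hb.trans ?_)
  calc C * (1 + √y) * y ≤ C * (1 + (1 + y)) * y := by gcongr
    _ ≤ (2 * C + 1) * (1 + y) ^ 2 := by nlinarith [mul_nonneg hC hy, mul_nonneg hC (mul_nonneg hy hy)]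

/-- Uniform bounds of all Sobolev norms of the Galerkin approximations. -/
theorem exists_galerkin_energy_le (hL : 0 < L) (ha : 0 < a) {τ M : ℝ} (hτ : 0 < τ) {w₀ r₀ : ℝ → ℝ}
    (hw₀ : OddPeriodic L w₀) (hr₀ : OddPeriodic L r₀) (k : ℕ) (hk : 1 ≤ k) :
    ∃ K, ∀ (N : ℕ) (A D : ℕ → ℝ → ℝ), IsGalerkin L a N (Ioo (-τ) τ) (fun _ => 1) A D →
      (∀ n, A n 0 = sineCoeff L w₀ n) → (∀ n, D n 0 = sineCoeff L r₀ n) →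
      (∀ t ∈ Ioo (-τ) τ, energy L 1 (sineSum L N fun n => A n t) (sineSum L N fun n => D n t) ≤ M) →
      ∀ t ∈ Ioo (-τ) τ, energy L k (sineSum L N fun n => A n t) (sineSum L N fun n => D n t) ≤ K := by
  induction k, hk using Nat.le_induction with
  | base => exact ⟨M, fun N A D _ _ _ h => h⟩
  | succ k hk ih =>
    obtain ⟨K, hK⟩ := ih
    obtain ⟨C, hC, hCb⟩ := exists_energy_le hL ha (k := k + 1) (by omega)
    -- The order k bound K makes the inequality of order k + 1 linear, with rate C(1 + √K). The time
    -- interval therefore does not shrink with k.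
    refine ⟨Real.exp (C * (1 + √K) * τ) * energy L (k + 1) w₀ r₀, fun N A D h hA hD h1 t ht => ?_⟩
    have hC' : 0 ≤ C * (1 + √K) := by positivity
    have hg := gronwall_zero (convex_Ioo (-τ) τ) (C := C * (1 + √K))
      (fun t _ => energy_nonneg L (k + 1) _ _)
      (fun t ht => h.hasDerivAt_energy hL ha (k + 1) ht) (fun t ht => by
        rw [one_mul]
        have hle := Real.sqrt_le_sqrt (hK N A D h hA hD h1 t ht)
        refine hCb _ _ (oddPeriodic_sineSum hL N fun n => A n t)
          (oddPeriodic_sineSum hL N fun n => D n t) _ ?_ ?_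
        · rw [Nat.add_sub_cancel, max_eq_right hk]
          exact (l2_le_sqrt_energy_left L k _ _).trans hle
        · rw [Nat.add_sub_cancel, max_eq_right hk]
          exact (l2_le_sqrt_energy_right L k _ _).trans hle) hC' (s := 0) ⟨by linarith, hτ⟩ ht
    refine hg.trans ?_
    have h0 : energy L (k + 1) (sineSum L N fun n => A n 0) (sineSum L N fun n => D n 0)
        ≤ energy L (k + 1) w₀ r₀ := by
      simp_rw [hA, hD]
      have e1 := l2_iteratedDeriv_sineProj_le hL N hw₀.toSmoothPeriodic (k + 1)
      have e2 := l2_iteratedDeriv_sineProj_le hL N hr₀.toSmoothPeriodic (k + 1)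
      exact add_le_add (pow_le_pow_left₀ (l2_nonneg _ _) e1 2) (pow_le_pow_left₀ (l2_nonneg _ _) e2 2)
    have hE := energy_nonneg L (k + 1) (sineSum L N fun n => A n 0) (sineSum L N fun n => D n 0)
    rw [sub_zero]
    gcongr
    exact (abs_lt.2 ht).le

end Galerkin

/-- Global solutions of autonomous differential equations with compactly supported vector field. -/
theorem exists_hasDerivAt_of_hasCompactSupport {E : Type*} [NormedAddCommGroup E] [NormedSpace ℝ E]
    [CompleteSpace E] {f : E → E} (hf : ContDiff ℝ 1 f) (hs : HasCompactSupport f) (x₀ : E) {T : ℝ}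
    (hT : 0 < T) : ∃ α : ℝ → E, α 0 = x₀ ∧ ∀ t ∈ Ioo (-T) T, HasDerivAt α (f (α t)) t := by
  obtain ⟨K, hK⟩ := hf.lipschitzWith_of_hasCompactSupport hs one_ne_zero
  obtain ⟨C, hC⟩ := hf.continuous.bounded_above_of_compact_support hs
  have hC0 : 0 ≤ C := (norm_nonneg _).trans (hC x₀)
  -- A trajectory of speed at most C stays within distance C T of its start up to time T, and the
  -- Lipschitz constant is global, so the existence time is all of [-T, T].
  have hp : IsPicardLindelof (fun _ => f) (tmin := -T) (tmax := T) ⟨0, by constructor <;> linarith⟩ x₀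
      (C.toNNReal * T.toNNReal) 0 C.toNNReal K :=
    .of_time_independent (fun x _ => by rw [Real.coe_toNNReal C hC0]; exact hC x) hK.lipschitzOnWith
      (by simp [hC0, hT.le])
  obtain ⟨α, h0, hα⟩ := hp.exists_eq_forall_mem_Icc_hasDerivWithinAt₀
  exact ⟨α, h0, fun t ht => (hα t (Ioo_subset_Icc_self ht)).hasDerivAt (Icc_mem_nhds ht.1 ht.2)⟩

theorem sineCoeff_sum {L : ℝ} {ι : Type*} (s : Finset ι) (c : ι → ℝ) {f : ι → ℝ → ℝ}
    (hf : ∀ i ∈ s, Continuous (f i)) (n : ℕ) (hs : Continuous (sineBasis L n)) :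
    sineCoeff L (fun x => ∑ i ∈ s, c i * f i x) n = ∑ i ∈ s, c i * sineCoeff L (f i) n := by
  unfold sineCoeff
  simp_rw [Finset.sum_mul, mul_assoc]
  rw [intervalIntegral.integral_finsetSum fun m hm => Continuous.intervalIntegrable (by
    have := hf m hm; fun_prop) _ _, Finset.mul_sum]
  exact Finset.sum_congr rfl fun i _ => by rw [intervalIntegral.integral_const_mul]; ring

theorem deriv_sineSum {L : ℝ} (hL : 0 < L) (N : ℕ) (c : ℕ → ℝ) (x : ℝ) :
    deriv (sineSum L N c) x = ∑ n ∈ Finset.range N, c n * deriv (sineBasis L n) x := by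
  have := iteratedDeriv_sineSum hL N c 1 x
  simpa only [iteratedDeriv_one] using this

theorem velocity_sineSum {L a : ℝ} (hL : 0 < L) (ha : 0 < a) (N : ℕ) (c : ℕ → ℝ) (x : ℝ) :
    velocity L a (sineSum L N c) x = ∑ n ∈ Finset.range N, c n * velocity L a (sineBasis L n) x :=
  velocity_sum hL ha _ c (fun n _ => (smoothPeriodic_sineBasis hL n).continuous)
    (fun n _ => (smoothPeriodic_sineBasis hL n).periodic) x

theorem deriv_velocity_sineSum {L a : ℝ} (hL : 0 < L) (ha : 0 < a) (N : ℕ) (c : ℕ → ℝ) (x : ℝ) :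
    deriv (velocity L a (sineSum L N c)) x
      = ∑ n ∈ Finset.range N, c n * deriv (velocity L a (sineBasis L n)) x := by
  rw [show velocity L a (sineSum L N c) = fun x => ∑ n ∈ Finset.range N,
    c n * velocity L a (sineBasis L n) x from funext (velocity_sineSum hL ha N c)]
  exact (HasDerivAt.fun_sum fun n _ =>
    (((smoothPeriodic_sineBasis hL n).velocity hL ha).hasDerivAt x).const_mul _).deriv

/-- Together with `sineCoeff_gradRhs`, this shows the Galerkin vector field to be a polynomial of
degree two in the coefficients, hence smooth. -/
theorem sineCoeff_vortRhs {L a : ℝ} (hL : 0 < L) (ha : 0 < a) {N : ℕ} (c d : ℕ → ℝ) {n : ℕ}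
    (hn : n < N) : sineCoeff L (vortRhs L a (sineSum L N c) (sineSum L N d)) n
      = d n - ∑ p ∈ Finset.range N ×ˢ Finset.range N, c p.1 * c p.2 * sineCoeff L
        (fun x => velocity L a (sineBasis L p.1) x * deriv (sineBasis L p.2) x) n := by
  have hs := smoothPeriodic_sineBasis hL
  have hc : ∀ p : ℕ × ℕ, Continuous fun x => velocity L a (sineBasis L p.1) x * deriv (sineBasis L p.2) x :=
    fun p => ((hs p.1).velocity hL ha).continuous.mul (hs p.2).deriv.continuous
  rw [← sineCoeff_sum _ (fun p : ℕ × ℕ => c p.1 * c p.2) (fun p _ => hc p) n (hs n).continuous,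
    ← sineCoeff_sineSum hL d hn]
  unfold sineCoeff
  have h1 := (hs n).continuous
  have h2 := (oddPeriodic_sineSum hL N d).continuous
  rw [← mul_sub, ← intervalIntegral.integral_sub (Continuous.intervalIntegrable (by fun_prop) _ _)
    (Continuous.intervalIntegrable (by fun_prop) _ _)]
  congr 2
  ext x
  rw [vortRhs, deriv_sineSum hL, velocity_sineSum hL ha, Finset.sum_mul_sum, ← Finset.sum_product',
    ← sub_mul]
  congr 2
  exact Finset.sum_congr rfl fun p _ => by ring

theorem sineCoeff_gradRhs {L a : ℝ} (hL : 0 < L) (ha : 0 < a) {N : ℕ} (c d : ℕ → ℝ) (n : ℕ) :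
    sineCoeff L (gradRhs L a (sineSum L N c) (sineSum L N d)) n
      = ∑ p ∈ Finset.range N ×ˢ Finset.range N, c p.1 * d p.2 * sineCoeff L
        (gradRhs L a (sineBasis L p.1) (sineBasis L p.2)) n := by
  have hs := smoothPeriodic_sineBasis hL
  have hc : ∀ p : ℕ × ℕ, Continuous (gradRhs L a (sineBasis L p.1) (sineBasis L p.2)) := fun p =>
    ((((hs p.1).velocity hL ha).deriv.continuous.mul (hs p.2).continuous).add
      (((hs p.1).velocity hL ha).continuous.mul (hs p.2).deriv.continuous)).neg
  rw [← sineCoeff_sum _ (fun p : ℕ × ℕ => c p.1 * d p.2) (fun p _ => hc p) n (hs n).continuous]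
  congr 1
  ext x
  unfold gradRhs
  rw [deriv_sineSum hL, velocity_sineSum hL ha, deriv_velocity_sineSum hL ha, sineSum,
    Finset.sum_mul_sum, Finset.sum_mul_sum, ← Finset.sum_product', ← Finset.sum_product',
    ← Finset.sum_add_distrib, ← Finset.sum_neg_distrib]
  exact Finset.sum_congr rfl fun p _ => by ring

end HouLuo
-- Solvability of the Galerkin system.
namespace HouLuo
open MeasureTheory Set

/-- Extension by zero of a finite sequence of coefficients. -/
def extendZero {N : ℕ} (c : Fin N → ℝ) (n : ℕ) : ℝ := if h : n < N then c ⟨n, h⟩ else 0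

theorem contDiff_extendZero {N : ℕ} (n : ℕ) :
    ContDiff ℝ 1 fun c : Fin N → ℝ => extendZero c n := by
  unfold extendZero
  split_ifs with h
  · fun_prop
  · exact contDiff_const

/-- The Galerkin vector field. -/
noncomputable def galerkinField (L a : ℝ) (N : ℕ) (v : (Fin N → ℝ) × (Fin N → ℝ)) :
    (Fin N → ℝ) × (Fin N → ℝ) :=
  (fun i => sineCoeff L (vortRhs L a (sineSum L N (extendZero v.1)) (sineSum L N (extendZero v.2))) i,
    fun i => sineCoeff L (gradRhs L a (sineSum L N (extendZero v.1)) (sineSum L N (extendZero v.2))) i)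

theorem contDiff_galerkinField {L a : ℝ} (hL : 0 < L) (ha : 0 < a) (N : ℕ) :
    ContDiff ℝ 1 (galerkinField L a N) := by
  have h1 : ∀ n, ContDiff ℝ 1 fun v : (Fin N → ℝ) × (Fin N → ℝ) => extendZero v.1 n := fun n =>
    (contDiff_extendZero n).comp contDiff_fst
  have h2 : ∀ n, ContDiff ℝ 1 fun v : (Fin N → ℝ) × (Fin N → ℝ) => extendZero v.2 n := fun n =>
    (contDiff_extendZero n).comp contDiff_snd
  refine ContDiff.prodMk (contDiff_pi.2 fun i => ?_) (contDiff_pi.2 fun i => ?_)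
  · simp_rw [sineCoeff_vortRhs hL ha _ _ i.2]
    exact (h2 i).sub (ContDiff.sum fun p _ => ((h1 p.1).mul (h1 p.2)).mul contDiff_const)
  · simp_rw [sineCoeff_gradRhs hL ha]
    exact ContDiff.sum fun p _ => ((h1 p.1).mul (h2 p.2)).mul contDiff_const

theorem freq_mono {L : ℝ} (hL : 0 < L) (n : ℕ) : freq L 0 ≤ freq L n := by
  unfold freq
  have := Real.pi_pos
  gcongr
  simp

/-- The smallest frequency is positive, so the first order energy dominates every single
coefficient. This keeps the trajectories in a ball fixed beforehand. -/
theorem abs_coeff_le_of_energy {L : ℝ} (hL : 0 < L) {N : ℕ} (c : ℕ → ℝ) {M : ℝ}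
    (h : l2 L (iteratedDeriv 1 (sineSum L N c)) ^ 2 ≤ M) {n : ℕ} (hn : n < N) :
    |c n| ≤ √(2 * M / (L * freq L 0 ^ 2)) := by
  have hf := freq_pos hL 0
  refine Real.abs_le_sqrt ?_
  rw [l2_iteratedDeriv_sineSum_sq hL] at h
  have h1 : freq L 0 ^ 2 * c n ^ 2 ≤ ∑ n ∈ Finset.range N, freq L n ^ (2 * 1) * c n ^ 2 := by
    refine le_trans ?_ (Finset.single_le_sum (f := fun n => freq L n ^ (2 * 1) * c n ^ 2)
      (fun n _ => by have := freq_pos hL n; positivity) (Finset.mem_range.2 hn))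
    have := freq_mono hL n
    gcongr
  rw [le_div_iff₀ (by positivity)]
  nlinarith

/-- Existence of Galerkin approximations on a uniform time interval. -/
theorem exists_isGalerkin {L a : ℝ} (hL : 0 < L) (ha : 0 < a) {B : ℝ} (hB : 0 ≤ B) :
    ∃ τ, 0 < τ ∧ ∀ w₀ r₀ : ℝ → ℝ, OddPeriodic L w₀ → OddPeriodic L r₀ → energy L 1 w₀ r₀ ≤ B →
      ∀ N : ℕ, ∃ A D : ℕ → ℝ → ℝ, IsGalerkin L a N (Ioo (-τ) τ) (fun _ => 1) A D ∧
        (∀ n, A n 0 = sineCoeff L w₀ n) ∧ (∀ n, D n 0 = sineCoeff L r₀ n) ∧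
        ∀ t ∈ Ioo (-τ) τ, energy L 1 (sineSum L N fun n => A n t) (sineSum L N fun n => D n t)
          ≤ 2 * (1 + B) := by
  obtain ⟨τ, hτ, hen⟩ := exists_galerkin_energy_one_le hL ha hB
  refine ⟨τ, hτ, fun w₀ r₀ hw₀ hr₀ hE N => ?_⟩
  set E := (Fin N → ℝ) × (Fin N → ℝ)
  set ρ := √(2 * (2 * (1 + B)) / (L * freq L 0 ^ 2)) with hρ
  have hρ0 : 0 ≤ ρ := Real.sqrt_nonneg _
  -- The quadratic field is cut off so that global solvability applies. The radius ρ is the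
  -- coefficient bound implied by the energy bound 2(1 + B), so the cut-off will turn out to be
  -- inactive.
  let φ : ContDiffBump (0 : E) := ⟨ρ + 1, ρ + 2, by positivity, by linarith⟩
  have hsupp : HasCompactSupport fun v : E => φ v • galerkinField L a N v :=
    φ.hasCompactSupport.smul_right
  obtain ⟨α, hα0, hα⟩ := exists_hasDerivAt_of_hasCompactSupport
    (φ.contDiff.smul (contDiff_galerkinField hL ha N)) hsupp
    ((fun i => sineCoeff L w₀ i, fun i => sineCoeff L r₀ i) : E) hτ
  -- For n ≥ N the value is irrelevant to the sums; it is set to the coefficient of the data so that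
  -- the initial condition holds for every n.
  set A : ℕ → ℝ → ℝ := fun n t => if n < N then extendZero (α t).1 n else sineCoeff L w₀ n with hA
  set D : ℕ → ℝ → ℝ := fun n t => if n < N then extendZero (α t).2 n else sineCoeff L r₀ n with hD
  have sA : ∀ t, sineSum L N (fun n => A n t) = sineSum L N (extendZero (α t).1) := fun t => by
    ext x
    exact Finset.sum_congr rfl fun n hn => by simp only [hA, Finset.mem_range.1 hn, if_true]
  have sD : ∀ t, sineSum L N (fun n => D n t) = sineSum L N (extendZero (α t).2) := fun t => by
    ext x
    exact Finset.sum_congr rfl fun n hn => by simp only [hD, Finset.mem_range.1 hn, if_true]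
  have hA0 : ∀ n, A n 0 = sineCoeff L w₀ n := fun n => by
    simp only [hA, extendZero, hα0]; split_ifs <;> rfl
  have hD0 : ∀ n, D n 0 = sineCoeff L r₀ n := fun n => by
    simp only [hD, extendZero, hα0]; split_ifs <;> rfl
  have hg : IsGalerkin L a N (Ioo (-τ) τ) (fun t => φ (α t)) A D := by
    refine ⟨fun t ht n hn => ?_, fun t ht n hn => ?_⟩
    · have e : A n = fun t => (α t).1 ⟨n, hn⟩ := by
        ext t; simp only [hA, hn, if_true, extendZero, dif_pos]
      rw [e, sA, sD]
      exact hasDerivAt_pi.1 (hα t ht).fst ⟨n, hn⟩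
    · have e : D n = fun t => (α t).2 ⟨n, hn⟩ := by
        ext t; simp only [hD, hn, if_true, extendZero, dif_pos]
      rw [e, sA, sD]
      exact hasDerivAt_pi.1 (hα t ht).snd ⟨n, hn⟩
  have h0 : energy L 1 (sineSum L N fun n => A n 0) (sineSum L N fun n => D n 0) ≤ B := by
    refine le_trans ?_ hE
    simp_rw [hA0, hD0]
    exact add_le_add (pow_le_pow_left₀ (l2_nonneg _ _)
      (l2_iteratedDeriv_sineProj_le hL N hw₀.toSmoothPeriodic 1) 2) (pow_le_pow_left₀ (l2_nonneg _ _)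
      (l2_iteratedDeriv_sineProj_le hL N hr₀.toSmoothPeriodic 1) 2)
  -- The energy bound holds for the damped system because 0 ≤ φ ≤ 1. It confines the trajectory to
  -- the ball where φ = 1, and the damping drops out.
  have hb := hen N _ A D (fun t => by rw [abs_of_nonneg φ.nonneg]; exact φ.le_one) hg h0
  have hone : ∀ t ∈ Ioo (-τ) τ, φ (α t) = 1 := by
    intro t ht
    refine φ.one_of_mem_closedBall (mem_closedBall_zero_iff.2 ?_)
    have hbt := hb t ht
    rw [sA, sD] at hbt
    unfold energy at hbt
    have h1 := fun i : Fin N => abs_coeff_le_of_energy hL (N := N) (extendZero (α t).1) (M := 2 * (1 + B))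
      (by nlinarith [sq_nonneg (l2 L (iteratedDeriv 1 (sineSum L N (extendZero (α t).2))))]) i.2
    have h2 := fun i : Fin N => abs_coeff_le_of_energy hL (N := N) (extendZero (α t).2) (M := 2 * (1 + B))
      (by nlinarith [sq_nonneg (l2 L (iteratedDeriv 1 (sineSum L N (extendZero (α t).1))))]) i.2
    refine le_trans ?_ (by linarith : ρ ≤ ρ + 1)
    refine (norm_prod_le_iff).2 ⟨(pi_norm_le_iff_of_nonneg hρ0).2 fun i => ?_,
      (pi_norm_le_iff_of_nonneg hρ0).2 fun i => ?_⟩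
    · simpa [extendZero] using h1 i
    · simpa [extendZero] using h2 i
  refine ⟨A, D, ⟨fun t ht => ?_, fun t ht => ?_⟩, hA0, hD0, hb⟩
  · have := hg.deriv_left t ht
    rwa [hone t ht] at this
  · have := hg.deriv_right t ht
    rwa [hone t ht] at this

end HouLuo
-- Compactness: limits of approximations with all derivatives.
namespace HouLuo
open MeasureTheory Set

/-- Interpolation: a sequence which converges in `L²` and is bounded in all Sobolev norms converges
uniformly with all derivatives. -/
theorem abs_iteratedDeriv_le_interpolation {L : ℝ} (hL : 0 < L) {h : ℝ → ℝ} (hh : OddPeriodic L h)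
    (k : ℕ) (x : ℝ) :
    |iteratedDeriv k h x| ≤ √L * √(l2 L h * l2 L (iteratedDeriv (2 * (k + 1)) h)) := by
  refine (hh.abs_iteratedDeriv_le hL k x).trans ?_
  gcongr
  refine Real.le_sqrt_of_sq_le ?_
  rw [l2_sq hL]
  simp_rw [sq]
  have hc := (hh.iteratedDeriv (2 * (k + 1))).continuous
  rw [← hh.integral_mul_iteratedDeriv_two_mul hh.toSmoothPeriodic]
  refine (le_abs_self _).trans ((abs_integral_mul_le hL hh.continuous (by fun_prop)).trans_eq ?_)
  rw [l2_const_mul]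
  simp

/-- Interpolation between the L² Cauchy bound and the uniform bound of order 2(k + 1) makes the k-th
derivatives uniformly Cauchy, for every k. The limits are then successive derivatives of one
function. -/
theorem exists_smooth_limit {L : ℝ} (hL : 0 < L) {I : Set ℝ} {f : ℕ → ℝ → ℝ → ℝ} {η : ℕ → ℝ}
    (hη : Tendsto η atTop (𝓝 0)) (ho : ∀ n, ∀ t ∈ I, OddPeriodic L (f n t))
    (hb : ∀ k, ∃ K, ∀ n, ∀ t ∈ I, l2 L (iteratedDeriv k (f n t)) ≤ K)
    (hc : ∀ m n, ∀ t ∈ I, l2 L (fun x => f m t x - f n t x) ≤ η m + η n) :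
    ∃ g : ℝ → ℝ → ℝ, (∀ t ∈ I, OddPeriodic L (g t)) ∧ ∀ k, TendstoUniformlyOn
      (fun n (p : ℝ × ℝ) => iteratedDeriv k (f n p.1) p.2)
      (fun p => iteratedDeriv k (g p.1) p.2) atTop (I ×ˢ univ) := by
  have hcauchy : ∀ k, UniformCauchySeqOn (fun n (p : ℝ × ℝ) => iteratedDeriv k (f n p.1) p.2) atTop
      (I ×ˢ univ) := by
    intro k
    obtain ⟨K, hK⟩ := hb (2 * (k + 1))
    have hle : ∀ m n, ∀ t ∈ I, ∀ x, |iteratedDeriv k (f m t) x - iteratedDeriv k (f n t) x|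
        ≤ √L * √((η m + η n) * (K + K)) := by
      intro m n t ht x
      have hm := ho m t ht
      have hn := ho n t ht
      have hat : ∀ {g : ℝ → ℝ}, OddPeriodic L g → ∀ j : ℕ, ∀ x, ContDiffAt ℝ j g x := fun h j x =>
        h.smooth.contDiffAt.of_le (by exact_mod_cast le_top)
      have e : ∀ j x, iteratedDeriv j (fun x => f m t x - f n t x) x
          = iteratedDeriv j (f m t) x - iteratedDeriv j (f n t) x := fun j x =>
        iteratedDeriv_fun_sub (hat hm j x) (hat hn j x)
      rw [← e]
      refine (abs_iteratedDeriv_le_interpolation hL (hm.sub hn) k x).trans ?_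
      have h1 := hc m n t ht
      have h2 : l2 L (iteratedDeriv (2 * (k + 1)) fun x => f m t x - f n t x) ≤ K + K := by
        rw [show (iteratedDeriv (2 * (k + 1)) fun x => f m t x - f n t x) = fun x =>
          iteratedDeriv (2 * (k + 1)) (f m t) x - iteratedDeriv (2 * (k + 1)) (f n t) x from
          funext (e _)]
        exact (l2_sub_le hL (hm.iteratedDeriv _).continuous (hn.iteratedDeriv _).continuous).trans
          (add_le_add (hK m t ht) (hK n t ht))
      gcongr
      · exact l2_nonneg _ _
      · exact (l2_nonneg _ _).trans h1
    have hlim : Tendsto (fun q : ℕ × ℕ => √L * √((η q.1 + η q.2) * (K + K))) (atTop ×ˢ atTop)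
        (𝓝 0) := by
      have h1 := ((hη.comp tendsto_fst).add (hη.comp (tendsto_snd (f := atTop (α := ℕ))))).mul_const
        (K + K)
      have h2 := ((Real.continuous_sqrt.tendsto _).comp h1).const_mul √L
      simpa using h2
    rw [Metric.uniformCauchySeqOn_iff]
    intro ε hε
    rw [prod_atTop_atTop_eq] at hlim
    obtain ⟨⟨N₁, N₂⟩, hN⟩ := eventually_atTop.1 (hlim.eventually (gt_mem_nhds hε))
    refine ⟨max N₁ N₂, fun m hm n hn p hp => ?_⟩
    rw [Real.dist_eq]
    exact (hle m n p.1 hp.1 p.2).trans_lt (hN (m, n) ⟨(le_max_left _ _).trans hm,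
      (le_max_right _ _).trans hn⟩)
  have hex : ∀ k (p : ℝ × ℝ), ∃ y, p ∈ I ×ˢ (univ : Set ℝ) →
      Tendsto (fun n => iteratedDeriv k (f n p.1) p.2) atTop (𝓝 y) := by
    intro k p
    by_cases hp : p ∈ I ×ˢ (univ : Set ℝ)
    · obtain ⟨y, hy⟩ := cauchySeq_tendsto_of_complete ((hcauchy k).cauchySeq hp)
      exact ⟨y, fun _ => hy⟩
    · exact ⟨0, fun h => absurd h hp⟩
  choose G hG using hex
  have hu : ∀ k, TendstoUniformlyOn (fun n (p : ℝ × ℝ) => iteratedDeriv k (f n p.1) p.2) (G k) atTop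
      (I ×ˢ univ) := fun k => (hcauchy k).tendstoUniformlyOn_of_tendsto (hG k)
  have hmem : ∀ t ∈ I, ∀ x, (t, x) ∈ I ×ˢ (univ : Set ℝ) := fun t ht x => ⟨ht, mem_univ _⟩
  have hd : ∀ k, ∀ t ∈ I, ∀ x, HasDerivAt (fun x => G k (t, x)) (G (k + 1) (t, x)) x := by
    intro k t ht x
    refine hasDerivAt_of_tendstoUniformly (f := fun n x => iteratedDeriv k (f n t) x)
      (f' := fun n x => iteratedDeriv (k + 1) (f n t) x) (g' := fun x => G (k + 1) (t, x))
      (l := atTop) ?_ ?_ ?_ x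
    · have := (hu (k + 1)).comp (fun x : ℝ => (t, x))
      rw [show (fun x : ℝ => (t, x)) ⁻¹' I ×ˢ univ = univ from eq_univ_of_forall (hmem t ht)] at this
      exact tendstoUniformlyOn_univ.1 this
    · exact Eventually.of_forall fun n x => hasDerivAt_iteratedDeriv (ho n t ht).smooth k x
    · exact fun x => hG k (t, x) (hmem t ht x)
  have hit : ∀ k, ∀ t ∈ I, iteratedDeriv k (fun x => G 0 (t, x)) = fun x => G k (t, x) := by
    intro k t ht
    induction k with
    | zero => exact iteratedDeriv_zero
    | succ k ih => rw [iteratedDeriv_succ, ih]; exact funext fun x => (hd k t ht x).deriv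
  refine ⟨fun t x => G 0 (t, x), fun t ht => ⟨⟨?_, fun x => ?_⟩, fun x => ?_⟩, fun k => ?_⟩
  · refine contDiff_of_differentiable_iteratedDeriv fun k _ => ?_
    rw [hit k t ht]
    exact fun x => (hd k t ht x).differentiableAt
  · have h1 := hG 0 (t, x + L) (hmem t ht _)
    have h2 := hG 0 (t, x) (hmem t ht _)
    simp only [iteratedDeriv_zero, (ho _ t ht).periodic x] at h1 h2
    exact tendsto_nhds_unique h1 h2
  · have h1 := hG 0 (t, -x) (hmem t ht _)
    have h2 := (hG 0 (t, x) (hmem t ht _)).neg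
    simp only [iteratedDeriv_zero, (ho _ t ht).odd x] at h1 h2
    exact tendsto_nhds_unique h1 h2
  · refine (hu k).congr_right fun p hp => ?_
    simp only [hit k p.1 hp.1]

/-- Interchange of a time derivative with a space derivative. -/
theorem hasDerivAt_partial_comm {I : Set ℝ} (hI : IsOpen I) {f g f₁ g₁ : ℝ → ℝ → ℝ}
    (hf : ∀ t ∈ I, ∀ x, HasDerivAt (fun s => f s x) (g t x) t)
    (hf₁ : ∀ t ∈ I, ∀ x, HasDerivAt (f t) (f₁ t x) x)
    (hg₁ : ∀ t ∈ I, ∀ x, HasDerivAt (g t) (g₁ t x) x)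
    (cg : ContinuousOn (fun p : ℝ × ℝ => g p.1 p.2) (I ×ˢ univ))
    (cg₁ : ContinuousOn (fun p : ℝ × ℝ => g₁ p.1 p.2) (I ×ˢ univ)) {t : ℝ} (ht : t ∈ I) (x : ℝ) :
    HasDerivAt (fun s => f₁ s x) (g₁ t x) t := by
  obtain ⟨δ, hδ, hball⟩ := Metric.isOpen_iff.1 hI t ht
  have hball' : ∀ s, |s - t| < δ → s ∈ I := fun s hs => hball (by rwa [Metric.mem_ball, Real.dist_eq])
  -- Clamping time to a closed interval around t inside I turns continuity on I into global
  -- continuity, as the parametric integral lemma requires.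
  set c : ℝ → ℝ := fun s => max (t - δ / 2) (min s (t + δ / 2)) with hc
  have cc : Continuous c := by fun_prop
  have hcI : ∀ s, c s ∈ I := fun s => hball' _ (by
    have h1 : t - δ / 2 ≤ c s := le_max_left _ _
    have h2 : c s ≤ t + δ / 2 := max_le (by linarith) (min_le_right _ _)
    rw [abs_lt]; constructor <;> linarith)
  have hcs : ∀ s ∈ Icc (t - δ / 2) (t + δ / 2), c s = s := fun s hs => by
    simp only [hc, min_eq_left hs.2, max_eq_right hs.1]
  have hIcc : Icc (t - δ / 2) (t + δ / 2) ∈ 𝓝 t := Icc_mem_nhds (by linarith) (by linarith)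
  have htI : t ∈ Icc (t - δ / 2) (t + δ / 2) := ⟨by linarith, by linarith⟩
  have comp : ∀ {h : ℝ → ℝ → ℝ}, ContinuousOn (fun p : ℝ × ℝ => h p.1 p.2) (I ×ˢ univ) →
      Continuous fun p : ℝ × ℝ => h (c p.2) p.1 := fun hh =>
    continuousOn_univ.1 (hh.comp (f := fun p : ℝ × ℝ => (c p.2, p.1)) (s := univ)
      (Continuous.continuousOn (by fun_prop)) fun p _ => ⟨hcI p.2, mem_univ _⟩)
  have cG := comp cg
  have cG₁ := comp cg₁
  -- Integrate g in time, differentiate under the integral in x, and compare with f₁(s) - f₁(t).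
  -- Only continuity of g and g₁ is used, not joint C² regularity of f.
  have key : ∀ s ∈ Icc (t - δ / 2) (t + δ / 2), f₁ s x = f₁ t x + ∫ y in t..s, g₁ (c y) x := by
    intro s hs
    have hsub : uIcc t s ⊆ Icc (t - δ / 2) (t + δ / 2) := uIcc_subset_Icc htI hs
    have h1 := hasDerivAt_weighted_integral (a := t) (b := s) (k := fun _ => 1) (by simp) isOpen_univ
      (f := fun x y => g (c y) x) (f' := fun x y => g₁ (c y) x) cG.continuousOn cG₁.continuousOn
      (fun x _ y => hg₁ (c y) (hcI y) x) (mem_univ x)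
    simp only [one_mul] at h1
    have e : ∀ x, ∫ y in t..s, g (c y) x = f s x - f t x := fun x =>
      intervalIntegral.integral_eq_sub_of_hasDerivAt (f := fun s => f s x) (fun y hy => by
        have := hf y (hcs y (hsub hy) ▸ hcI y) x
        rwa [hcs y (hsub hy)])
        (Continuous.intervalIntegrable (cG.comp (by fun_prop : Continuous fun y => (x, y))) _ _)
    simp_rw [e] at h1
    have hsI : s ∈ I := hcs s hs ▸ hcI s
    have := h1.unique ((hf₁ s hsI x).sub (hf₁ t ht x))
    rw [this]; ring
  have hcont : Continuous fun y => g₁ (c y) x := cG₁.comp (by fun_prop : Continuous fun y => (x, y))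
  have hd := (intervalIntegral.integral_hasDerivAt_right (hcont.intervalIntegrable t t)
    hcont.aestronglyMeasurable.stronglyMeasurableAtFilter hcont.continuousAt).const_add (f₁ t x)
  rw [hcs t htI] at hd
  refine hd.congr_of_eventuallyEq ?_
  filter_upwards [hIcc] with s hs using key s hs

end HouLuo
-- Joint smoothness in time and space.
namespace HouLuo
open MeasureTheory Set

theorem contDiffOn_iteratedDeriv_mul {I : Set ℝ} {n : ℕ} {f g : ℝ → ℝ → ℝ}
    (hf : ∀ t ∈ I, ContDiff ℝ ∞ (f t)) (hg : ∀ t ∈ I, ContDiff ℝ ∞ (g t))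
    (cf : ∀ k, ContDiffOn ℝ n (fun p : ℝ × ℝ => iteratedDeriv k (f p.1) p.2) (I ×ˢ univ))
    (cg : ∀ k, ContDiffOn ℝ n (fun p : ℝ × ℝ => iteratedDeriv k (g p.1) p.2) (I ×ˢ univ)) (k : ℕ) :
    ContDiffOn ℝ n (fun p : ℝ × ℝ => iteratedDeriv k (fun x => f p.1 x * g p.1 x) p.2)
      (I ×ˢ univ) := by
  refine ContDiffOn.congr (f := fun p : ℝ × ℝ => ∑ i ∈ Finset.range (k + 1),
    k.choose i * iteratedDeriv i (f p.1) p.2 * iteratedDeriv (k - i) (g p.1) p.2) ?_ fun p hp => ?_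
  · exact ContDiffOn.sum fun i _ => (contDiffOn_const.mul (cf i)).mul (cg (k - i))
  · rw [iteratedDeriv_mul_eq_sum (hf p.1 hp.1) (hg p.1 hp.1)]

section Regularity

variable {L a : ℝ} {I : Set ℝ} {w r : ℝ → ℝ → ℝ}

/-- The right-hand sides are built from w and r by convolution, products and space derivatives. All
of these preserve joint C^n regularity once it is known for every space derivative. -/
theorem contDiffOn_iteratedDeriv_rhs (hL : 0 < L) (ha : 0 < a) (hI : IsOpen I)
    (hw : ∀ t ∈ I, OddPeriodic L (w t)) (hr : ∀ t ∈ I, OddPeriodic L (r t)) {n : ℕ}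
    (cw : ∀ k, ContDiffOn ℝ n (fun p : ℝ × ℝ => iteratedDeriv k (w p.1) p.2) (I ×ˢ univ))
    (cr : ∀ k, ContDiffOn ℝ n (fun p : ℝ × ℝ => iteratedDeriv k (r p.1) p.2) (I ×ˢ univ)) (k : ℕ) :
    ContDiffOn ℝ n (fun p : ℝ × ℝ => iteratedDeriv k (vortRhs L a (w p.1) (r p.1)) p.2) (I ×ˢ univ) ∧
    ContDiffOn ℝ n (fun p : ℝ × ℝ => iteratedDeriv k (gradRhs L a (w p.1) (r p.1)) p.2)
      (I ×ˢ univ) := by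
  have hu : ∀ t ∈ I, OddPeriodic L (velocity L a (w t)) := fun t ht => (hw t ht).velocity hL ha
  have cu : ∀ k, ContDiffOn ℝ n (fun p : ℝ × ℝ => iteratedDeriv k (velocity L a (w p.1)) p.2)
      (I ×ˢ univ) := fun k => (contDiffOn_velocity hL ha hI n (f := fun t => iteratedDeriv k (w t))
    (fun t ht => ((hw t ht).iteratedDeriv k).periodic) (cw k)).congr fun p hp => by
      rw [iteratedDeriv_velocity hL ha (hw p.1 hp.1).toSmoothPeriodic]
  have cd : ∀ {f : ℝ → ℝ → ℝ}, (∀ k, ContDiffOn ℝ n (fun p : ℝ × ℝ => iteratedDeriv k (f p.1) p.2)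
      (I ×ˢ univ)) → ∀ k, ContDiffOn ℝ n (fun p : ℝ × ℝ => iteratedDeriv k (deriv (f p.1)) p.2)
      (I ×ˢ univ) := fun h k => (h (k + 1)).congr fun p _ => by rw [iteratedDeriv_succ']
  have sd : ∀ {f : ℝ → ℝ → ℝ}, (∀ t ∈ I, OddPeriodic L (f t)) → ∀ t ∈ I, ContDiff ℝ ∞ (deriv (f t)) :=
    fun h t ht => (h t ht).toSmoothPeriodic.deriv.smooth
  have sm : ∀ {f : ℝ → ℝ → ℝ}, (∀ t ∈ I, OddPeriodic L (f t)) → ∀ t ∈ I, ContDiff ℝ ∞ (f t) :=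
    fun h t ht => (h t ht).smooth
  have at_of : ∀ {f : ℝ → ℝ}, ContDiff ℝ ∞ f → ∀ x, ContDiffAt ℝ k f x := fun h x =>
    h.contDiffAt.of_le (by exact_mod_cast le_top)
  have m1 := contDiffOn_iteratedDeriv_mul (sm hu) (sd hw) cu (cd cw) k
  have m2 := contDiffOn_iteratedDeriv_mul (sd (f := fun t => velocity L a (w t)) hu) (sm hr)
    (cd (f := fun t => velocity L a (w t)) cu) cr k
  have m3 := contDiffOn_iteratedDeriv_mul (sm hu) (sd hr) cu (cd cr) k
  refine ⟨((cr k).sub m1).congr fun p hp => ?_, (m2.add m3).neg.congr fun p hp => ?_⟩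
  · exact iteratedDeriv_fun_sub (at_of (sm hr p.1 hp.1) _)
      (at_of ((sm hu p.1 hp.1).mul (sd hw p.1 hp.1)) _)
  · unfold gradRhs
    rw [iteratedDeriv_fun_neg, iteratedDeriv_fun_add
      (at_of ((sd hu p.1 hp.1).mul (sm hr p.1 hp.1)) _) (at_of ((sm hu p.1 hp.1).mul (sd hr p.1 hp.1)) _)]

/-- Joint smoothness of solutions which are smooth in space. -/
theorem isSmoothSolution_of_continuousOn (hL : 0 < L) (ha : 0 < a) (hI : IsOpen I)
    (hw : ∀ t ∈ I, OddPeriodic L (w t)) (hr : ∀ t ∈ I, OddPeriodic L (r t))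
    (cw : ∀ k, ContinuousOn (fun p : ℝ × ℝ => iteratedDeriv k (w p.1) p.2) (I ×ˢ univ))
    (cr : ∀ k, ContinuousOn (fun p : ℝ × ℝ => iteratedDeriv k (r p.1) p.2) (I ×ˢ univ))
    (ew : ∀ t ∈ I, ∀ x, HasDerivAt (fun s => w s x) (vortRhs L a (w t) (r t) x) t)
    (er : ∀ t ∈ I, ∀ x, HasDerivAt (fun s => r s x) (gradRhs L a (w t) (r t) x) t) :
    IsSmoothSolution L a I w r := by
  have hF : ∀ t ∈ I, OddPeriodic L (vortRhs L a (w t) (r t)) := fun t ht =>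
    oddPeriodic_vortRhs hL ha (hw t ht) (hr t ht)
  have hG : ∀ t ∈ I, OddPeriodic L (gradRhs L a (w t) (r t)) := fun t ht =>
    oddPeriodic_gradRhs hL ha (hw t ht) (hr t ht)
  have c0 := contDiffOn_iteratedDeriv_rhs hL ha hI hw hr (n := 0)
    (fun k => by simpa using (cw k)) (fun k => by simpa using (cr k))
  have cF : ∀ k, ContinuousOn (fun p : ℝ × ℝ => iteratedDeriv k (vortRhs L a (w p.1) (r p.1)) p.2)
      (I ×ˢ univ) := fun k => (c0 k).1.continuousOn
  have cG : ∀ k, ContinuousOn (fun p : ℝ × ℝ => iteratedDeriv k (gradRhs L a (w p.1) (r p.1)) p.2)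
      (I ×ˢ univ) := fun k => (c0 k).2.continuousOn
  have dw : ∀ k, ∀ t ∈ I, ∀ x, HasDerivAt (fun s => iteratedDeriv k (w s) x)
      (iteratedDeriv k (vortRhs L a (w t) (r t)) x) t := by
    intro k
    induction k with
    | zero => simpa using ew
    | succ k ih =>
      exact fun t ht x => hasDerivAt_partial_comm hI (f := fun t => iteratedDeriv k (w t))
        (g := fun t => iteratedDeriv k (vortRhs L a (w t) (r t)))
        (f₁ := fun t => iteratedDeriv (k + 1) (w t))
        (g₁ := fun t => iteratedDeriv (k + 1) (vortRhs L a (w t) (r t))) ih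
        (fun t ht x => hasDerivAt_iteratedDeriv (hw t ht).smooth k x)
        (fun t ht x => hasDerivAt_iteratedDeriv (hF t ht).smooth k x) (cF k) (cF (k + 1)) ht x
  have dr : ∀ k, ∀ t ∈ I, ∀ x, HasDerivAt (fun s => iteratedDeriv k (r s) x)
      (iteratedDeriv k (gradRhs L a (w t) (r t)) x) t := by
    intro k
    induction k with
    | zero => simpa using er
    | succ k ih =>
      exact fun t ht x => hasDerivAt_partial_comm hI (f := fun t => iteratedDeriv k (r t))
        (g := fun t => iteratedDeriv k (gradRhs L a (w t) (r t)))
        (f₁ := fun t => iteratedDeriv (k + 1) (r t))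
        (g₁ := fun t => iteratedDeriv (k + 1) (gradRhs L a (w t) (r t))) ih
        (fun t ht x => hasDerivAt_iteratedDeriv (hr t ht).smooth k x)
        (fun t ht x => hasDerivAt_iteratedDeriv (hG t ht).smooth k x) (cG k) (cG (k + 1)) ht x
  -- Bootstrap in n, for all k at once: the time derivative of the k-th space derivative is a space
  -- derivative of the right-hand side, and its space derivative has index k + 1. Both are C^n by
  -- induction.
  have hn : ∀ n : ℕ, ∀ k,
      ContDiffOn ℝ n (fun p : ℝ × ℝ => iteratedDeriv k (w p.1) p.2) (I ×ˢ univ) ∧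
      ContDiffOn ℝ n (fun p : ℝ × ℝ => iteratedDeriv k (r p.1) p.2) (I ×ˢ univ) := by
    intro n
    induction n with
    | zero => exact fun k => ⟨by simpa using cw k, by simpa using cr k⟩
    | succ n ih =>
      have c := contDiffOn_iteratedDeriv_rhs hL ha hI hw hr (fun k => (ih k).1) (fun k => (ih k).2)
      intro k
      push_cast
      exact ⟨contDiffOn_succ_of_partials hI (f := fun t => iteratedDeriv k (w t)) (dw k)
        (fun t ht x => hasDerivAt_iteratedDeriv (hw t ht).smooth k x) (c k).1 (ih (k + 1)).1,
        contDiffOn_succ_of_partials hI (f := fun t => iteratedDeriv k (r t)) (dr k)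
        (fun t ht x => hasDerivAt_iteratedDeriv (hr t ht).smooth k x) (c k).2 (ih (k + 1)).2⟩
  refine ⟨contDiffOn_infty.2 fun n => by simpa using (hn n 0).1,
    contDiffOn_infty.2 fun n => by simpa using (hn n 0).2, hw, hr, ew, fun t ht x => ?_⟩
  rw [← gradRhs_eq hL ha (hw t ht) (hr t ht)]
  exact er t ht x

end Regularity

theorem tendstoUniformlyOn_mul_of_bound {X : Type*} {s : Set X} {F G : ℕ → X → ℝ} {f g : X → ℝ}
    {K : ℝ} (hK : 0 ≤ K) (hF : TendstoUniformlyOn F f atTop s) (hG : TendstoUniformlyOn G g atTop s)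
    (bF : ∀ n, ∀ p ∈ s, |F n p| ≤ K) (bG : ∀ n, ∀ p ∈ s, |G n p| ≤ K) :
    TendstoUniformlyOn (fun n p => F n p * G n p) (fun p => f p * g p) atTop s := by
  have bg : ∀ p ∈ s, |g p| ≤ K := fun p hp =>
    le_of_tendsto (hG.tendsto_at hp).abs (Eventually.of_forall fun n => bG n p hp)
  rw [Metric.tendstoUniformlyOn_iff] at *
  intro ε hε
  have hε' : 0 < ε / (2 * K + 1) := by positivity
  filter_upwards [hF _ hε', hG _ hε'] with n h1 h2 p hp
  have a1 := h1 p hp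
  have a2 := h2 p hp
  rw [Real.dist_eq] at *
  have e : f p * g p - F n p * G n p = (f p - F n p) * g p + F n p * (g p - G n p) := by ring
  rw [e]
  refine (abs_add_le _ _).trans_lt ?_
  rw [abs_mul, abs_mul]
  have b1 : |f p - F n p| * |g p| ≤ ε / (2 * K + 1) * K := by gcongr; exact bg p hp
  have b2 : |F n p| * |g p - G n p| ≤ K * (ε / (2 * K + 1)) := by gcongr; exact bF n p hp
  have b3 : ε / (2 * K + 1) * (2 * K + 1) = ε := by field_simp
  nlinarith

theorem tendstoUniformlyOn_velocity {L a : ℝ} (hL : 0 < L) (ha : 0 < a) {I : Set ℝ}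
    {F : ℕ → ℝ → ℝ → ℝ} {f : ℝ → ℝ → ℝ} (cF : ∀ n, ∀ t ∈ I, Continuous (F n t))
    (pF : ∀ n, ∀ t ∈ I, Function.Periodic (F n t) L) (cf : ∀ t ∈ I, Continuous (f t))
    (pf : ∀ t ∈ I, Function.Periodic (f t) L)
    (h : TendstoUniformlyOn (fun n (p : ℝ × ℝ) => F n p.1 p.2) (fun p => f p.1 p.2) atTop
      (I ×ˢ univ)) :
    TendstoUniformlyOn (fun n (p : ℝ × ℝ) => velocity L a (F n p.1) p.2)
      (fun p => velocity L a (f p.1) p.2) atTop (I ×ˢ univ) := by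
  rw [Metric.tendstoUniformlyOn_iff] at *
  intro ε hε
  have hk := kernNorm_nonneg hL a
  have hε' : 0 < ε / (kernNorm L a + 1) := by positivity
  filter_upwards [h _ hε'] with n h1 p hp
  rw [Real.dist_eq, ← velocity_sub hL ha (cf p.1 hp.1) (cF n p.1 hp.1) (pf p.1 hp.1) (pF n p.1 hp.1)]
  refine (abs_velocity_le hL ha ((pf p.1 hp.1).sub (pF n p.1 hp.1)) (M := ε / (kernNorm L a + 1))
    (fun x => ?_) p.2).trans_lt ?_
  · exact (h1 (p.1, x) ⟨hp.1, mem_univ _⟩).le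
  · have : ε / (kernNorm L a + 1) * (kernNorm L a + 1) = ε := by field_simp
    nlinarith

end HouLuo
-- Consistency and the Cauchy property of the approximations.
namespace HouLuo
open MeasureTheory Set

/-- Approximate solutions with sine projected right-hand sides and uniform bounds. -/
structure IsApproximation (L a : ℝ) (I : Set ℝ) (W R : ℕ → ℝ → ℝ → ℝ) : Prop where
  odd_w : ∀ n, ∀ t ∈ I, OddPeriodic L (W n t)
  odd_r : ∀ n, ∀ t ∈ I, OddPeriodic L (R n t)
  smooth_w : ∀ n k, ContDiffOn ℝ 1 (fun p : ℝ × ℝ => iteratedDeriv k (W n p.1) p.2) (I ×ˢ univ)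
  smooth_r : ∀ n k, ContDiffOn ℝ 1 (fun p : ℝ × ℝ => iteratedDeriv k (R n p.1) p.2) (I ×ˢ univ)
  bound : ∀ k, ∃ K, ∀ n, ∀ t ∈ I, energy L k (W n t) (R n t) ≤ K
  eq_w : ∀ n, ∀ t ∈ I, ∀ x,
    HasDerivAt (fun s => W n s x) (sineProj L n (vortRhs L a (W n t) (R n t)) x) t
  eq_r : ∀ n, ∀ t ∈ I, ∀ x,
    HasDerivAt (fun s => R n s x) (sineProj L n (gradRhs L a (W n t) (R n t)) x) t

/-- The factor 4 is the sum of the binomial coefficients 1, 2, 1. -/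
theorem abs_iteratedDeriv_two_mul_le {f g : ℝ → ℝ} (hf : ContDiff ℝ ∞ f) (hg : ContDiff ℝ ∞ g)
    {K : ℝ} (bf : ∀ k ≤ 2, ∀ x, |iteratedDeriv k f x| ≤ K) (bg : ∀ k ≤ 2, ∀ x, |iteratedDeriv k g x| ≤ K)
    (x : ℝ) : |iteratedDeriv 2 (fun x => f x * g x) x| ≤ 4 * K ^ 2 := by
  have hK : 0 ≤ K := (abs_nonneg _).trans (bf 0 (by omega) 0)
  rw [iteratedDeriv_mul_eq_sum hf hg]
  have h : ∀ i ≤ 2, |iteratedDeriv i f x * iteratedDeriv (2 - i) g x| ≤ K ^ 2 := fun i hi => by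
    rw [abs_mul, sq]
    exact mul_le_mul (bf i hi x) (bg _ (by omega) x) (abs_nonneg _) hK
  have h0 := h 0 (by omega)
  have h1 := h 1 (by omega)
  have h2 := h 2 (by omega)
  simp only [Finset.sum_range_succ, Finset.sum_range_zero, Nat.choose_zero_right, Nat.choose_self,
    show Nat.choose 2 1 = 2 from rfl, zero_add, Nat.cast_one, one_mul, Nat.cast_ofNat, mul_assoc]
  rw [abs_le] at *
  constructor <;> linarith

section Approximation

variable {L a τ : ℝ} {I : Set ℝ} {W R : ℕ → ℝ → ℝ → ℝ}

theorem IsApproximation.exists_bound (h : IsApproximation L a I W R) (hL : 0 < L) (k : ℕ) :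
    ∃ K, 0 ≤ K ∧ ∀ j ≤ k, ∀ n, ∀ t ∈ I, ∀ x,
      |iteratedDeriv j (W n t) x| ≤ K ∧ |iteratedDeriv j (R n t) x| ≤ K := by
  choose K hK using h.bound
  refine ⟨∑ j ∈ Finset.range (k + 1), √L * √(K (j + 1)), by positivity, fun j hj n t ht x => ?_⟩
  have hle : √L * √(K (j + 1)) ≤ ∑ j ∈ Finset.range (k + 1), √L * √(K (j + 1)) :=
    Finset.single_le_sum (f := fun j => √L * √(K (j + 1))) (fun _ _ => by positivity)
      (Finset.mem_range.2 (by omega))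
  have hs := Real.sqrt_le_sqrt (hK (j + 1) n t ht)
  constructor
  · refine (((h.odd_w n t ht).abs_iteratedDeriv_le hL j x).trans ?_).trans hle
    gcongr
    exact (l2_le_sqrt_energy_left L (j + 1) _ (R n t)).trans hs
  · refine (((h.odd_r n t ht).abs_iteratedDeriv_le hL j x).trans ?_).trans hle
    gcongr
    exact (l2_le_sqrt_energy_right L (j + 1) (W n t) _).trans hs

theorem IsApproximation.exists_bound_velocity (h : IsApproximation L a I W R) (hL : 0 < L)
    (ha : 0 < a) (k : ℕ) : ∃ K, 0 ≤ K ∧ ∀ j ≤ k, ∀ n, ∀ t ∈ I, ∀ x,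
      |iteratedDeriv j (W n t) x| ≤ K ∧ |iteratedDeriv j (R n t) x| ≤ K ∧
      |iteratedDeriv j (velocity L a (W n t)) x| ≤ K := by
  obtain ⟨K, hK0, hK⟩ := h.exists_bound hL k
  refine ⟨max K (kernNorm L a * K), le_max_of_le_left hK0, fun j hj n t ht x =>
    ⟨(hK j hj n t ht x).1.trans (le_max_left _ _), (hK j hj n t ht x).2.trans (le_max_left _ _), ?_⟩⟩
  rw [iteratedDeriv_velocity hL ha (h.odd_w n t ht).toSmoothPeriodic]
  exact (abs_velocity_le hL ha ((h.odd_w n t ht).iteratedDeriv j).periodic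
    (fun x => (hK j hj n t ht x).1) x).trans (le_max_right _ _)

/-- The approximations solve the exact equations up to the projection error of their right-hand
sides, which is small uniformly in time by the uniform bounds. -/
theorem IsApproximation.exists_error_le (h : IsApproximation L a I W R) (hL : 0 < L) (ha : 0 < a) :
    ∃ E, 0 ≤ E ∧ ∀ n, ∀ t ∈ I, ∀ x,
      |vortRhs L a (W n t) (R n t) x - sineProj L n (vortRhs L a (W n t) (R n t)) x| ≤ E * sineTail L n ∧
      |gradRhs L a (W n t) (R n t) x - sineProj L n (gradRhs L a (W n t) (R n t)) x|
        ≤ E * sineTail L n := by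
  -- The projection error costs two derivatives of the right-hand sides, and these contain first
  -- derivatives: order three in total.
  obtain ⟨K, hK0, hK⟩ := h.exists_bound_velocity hL ha 3
  refine ⟨K + 8 * K ^ 2, by positivity, fun n t ht x => ?_⟩
  have hw := h.odd_w n t ht
  have hr := h.odd_r n t ht
  have hu := hw.velocity hL ha
  have hat : ∀ {f : ℝ → ℝ}, ContDiff ℝ ∞ f → ∀ x, ContDiffAt ℝ (2 : ℕ) f x := fun h x =>
    h.contDiffAt.of_le (WithTop.coe_le_coe.2 le_top)
  have bd : ∀ {f : ℝ → ℝ}, (∀ j ≤ 3, ∀ x, |iteratedDeriv j f x| ≤ K) → ∀ j ≤ 2, ∀ x,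
      |iteratedDeriv j (deriv f) x| ≤ K := fun hb j hj x => by
    rw [← iteratedDeriv_succ']; exact hb (j + 1) (by omega) x
  have bw : ∀ j ≤ 3, ∀ x, |iteratedDeriv j (W n t) x| ≤ K := fun j hj x => (hK j hj n t ht x).1
  have br : ∀ j ≤ 3, ∀ x, |iteratedDeriv j (R n t) x| ≤ K := fun j hj x => (hK j hj n t ht x).2.1
  have bu : ∀ j ≤ 3, ∀ x, |iteratedDeriv j (velocity L a (W n t)) x| ≤ K := fun j hj x =>
    (hK j hj n t ht x).2.2
  have low : ∀ {f : ℝ → ℝ}, (∀ j ≤ 3, ∀ x, |iteratedDeriv j f x| ≤ K) → ∀ j ≤ 2, ∀ x,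
      |iteratedDeriv j f x| ≤ K := fun hb j hj x => hb j (by omega) x
  have su := hu.smooth
  have su' := hu.toSmoothPeriodic.deriv.smooth
  have sw' := hw.toSmoothPeriodic.deriv.smooth
  have sr' := hr.toSmoothPeriodic.deriv.smooth
  have hF := oddPeriodic_vortRhs hL ha hw hr
  have hG := oddPeriodic_gradRhs hL ha hw hr
  constructor
  · refine abs_sub_sineProj_le hL hF.toSmoothPeriodic hF.odd (fun x => ?_) n x
    have e : iteratedDeriv 2 (vortRhs L a (W n t) (R n t)) x = iteratedDeriv 2 (R n t) x
        - iteratedDeriv 2 (fun x => velocity L a (W n t) x * deriv (W n t) x) x :=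
      iteratedDeriv_fun_sub (hat hr.smooth x) (hat (su.mul sw') x)
    have h1 := abs_iteratedDeriv_two_mul_le su sw' (low bu) (bd bw) x
    have h2 := br 2 (by omega) x
    rw [e]
    refine (abs_sub _ _).trans ?_
    nlinarith
  · refine abs_sub_sineProj_le hL hG.toSmoothPeriodic hG.odd (fun x => ?_) n x
    have e : iteratedDeriv 2 (gradRhs L a (W n t) (R n t)) x
        = -(iteratedDeriv 2 (fun x => deriv (velocity L a (W n t)) x * R n t x) x
        + iteratedDeriv 2 (fun x => velocity L a (W n t) x * deriv (R n t) x) x) := by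
      unfold gradRhs
      rw [iteratedDeriv_fun_neg, iteratedDeriv_fun_add (hat (su'.mul hr.smooth) x)
        (hat (su.mul sr') x)]
    have h1 := abs_iteratedDeriv_two_mul_le su sr' (low bu) (bd br) x
    have h2 := abs_iteratedDeriv_two_mul_le su' hr.smooth (bd bu) (low br) x
    rw [e, abs_neg]
    refine (abs_add_le _ _).trans ?_
    nlinarith

/-- Two approximations are approximate solutions with approximately equal data, so Gronwall bounds
their distance by projection errors of equation and data. The summands 1 / (n + 1) only make the
error parameter positive, as `gronwall_two_sided` requires. -/
theorem IsApproximation.exists_stateDist_le (h : IsApproximation L a (Ioo (-τ) τ) W R) (hL : 0 < L)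
    (ha : 0 < a) (hτ : 0 < τ) {w₀ r₀ : ℝ → ℝ} (hw₀ : OddPeriodic L w₀) (hr₀ : OddPeriodic L r₀)
    (h0w : ∀ n, W n 0 = sineProj L n w₀) (h0r : ∀ n, R n 0 = sineProj L n r₀) :
    ∃ K, 0 ≤ K ∧ ∀ m n, ∀ t ∈ Ioo (-τ) τ, stateDist L (W m t) (R m t) (W n t) (R n t)
      ≤ (K * (sineTail L m + 1 / (m + 1) + (sineTail L n + 1 / (n + 1)))) ^ 2 := by
  obtain ⟨E, hE0, hE⟩ := h.exists_error_le hL ha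
  obtain ⟨M, hM0, hM⟩ := h.exists_bound_velocity hL ha 1
  obtain ⟨C, hC, hCd⟩ := exists_stateDist_deriv_le hL ha M
  obtain ⟨A, hA0, hA⟩ := (hw₀.toSmoothPeriodic.iteratedDeriv 2).exists_bound hL
  obtain ⟨D, hD0, hD⟩ := (hr₀.toSmoothPeriodic.iteratedDeriv 2).exists_bound hL
  set Q := Real.exp (C * τ) * (L * A ^ 2 + L * D ^ 2 + (E + 1) ^ 2) with hQ
  have hQ0 : 0 ≤ Q := by positivity
  refine ⟨√Q, Real.sqrt_nonneg _, fun m n t ht => ?_⟩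
  set η : ℕ → ℝ := fun n => sineTail L n + 1 / (n + 1) with hη
  have hηn : ∀ n, sineTail L n ≤ η n := fun n => le_add_of_nonneg_right (by positivity)
  have hη0 : ∀ n, 0 < η n := fun n => add_pos_of_nonneg_of_pos (sineTail_nonneg L n) (by positivity)
  set ε := (E + 1) * (η m + η n) with hε
  have hε0 : 0 < ε := mul_pos (by positivity) (add_pos (hη0 m) (hη0 n))
  have hEη : ∀ n, E * sineTail L n ≤ (E + 1) * η n := fun n =>
    mul_le_mul (by linarith) (hηn n) (sineTail_nonneg L n) (by linarith)
  have one : ∀ {f : ℝ → ℝ → ℝ}, ContDiffOn ℝ 1 (fun p : ℝ × ℝ => iteratedDeriv 0 (f p.1) p.2)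
      (Ioo (-τ) τ ×ˢ univ) → ContDiffOn ℝ 1 (fun p : ℝ × ℝ => f p.1 p.2) (Ioo (-τ) τ ×ˢ univ) :=
    fun h => by simpa using h
  obtain ⟨y', hy'⟩ := hCd (Ioo (-τ) τ) (W m) (R m) (W n) (R n)
    (fun t x => (vortRhs L a (W n t) (R n t) x - sineProj L n (vortRhs L a (W n t) (R n t)) x)
      - (vortRhs L a (W m t) (R m t) x - sineProj L m (vortRhs L a (W m t) (R m t)) x))
    (fun t x => (gradRhs L a (W n t) (R n t) x - sineProj L n (gradRhs L a (W n t) (R n t)) x)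
      - (gradRhs L a (W m t) (R m t) x - sineProj L m (gradRhs L a (W m t) (R m t)) x))
    ε isOpen_Ioo (one (h.smooth_w m 0)) (one (h.smooth_r m 0)) (one (h.smooth_w n 0))
    (one (h.smooth_r n 0)) (fun t ht => (h.odd_w m t ht).periodic)
    (fun t ht => (h.odd_r m t ht).periodic) (fun t ht => (h.odd_w n t ht).periodic)
    (fun t ht => (h.odd_r n t ht).periodic)
    (fun t ht x => ((h.eq_w m t ht x).sub (h.eq_w n t ht x)).congr_deriv (by
      simp only [vortRhs]; ring))
    (fun t ht x => ((h.eq_r m t ht x).sub (h.eq_r n t ht x)).congr_deriv (by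
      linear_combination gradRhs_eq hL ha (h.odd_w m t ht) (h.odd_r m t ht) x
        - gradRhs_eq hL ha (h.odd_w n t ht) (h.odd_r n t ht) x))
    (fun t ht x => (abs_sub _ _).trans (by
      have := hEη m; have := hEη n; have := (hE n t ht x).1; have := (hE m t ht x).1; linarith))
    (fun t ht x => (abs_sub _ _).trans (by
      have := hEη m; have := hEη n; have := (hE n t ht x).2; have := (hE m t ht x).2; linarith))
    (fun t ht x => by simpa using (hM 1 le_rfl m t ht x).2.2)
    (fun t ht x => by simpa using (hM 1 le_rfl n t ht x).1)
    (fun t ht x => by simpa using (hM 0 (by omega) n t ht x).2.1)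
    (fun t ht x => by simpa using (hM 1 le_rfl n t ht x).2.1)
  have hg := gronwall_two_sided (convex_Ioo (-τ) τ) (pow_pos hε0 2)
    (fun t _ => stateDist_nonneg L (W m t) (R m t) (W n t) (R n t)) (fun t ht => (hy' t ht).1)
    (fun t ht => (hy' t ht).2) (s := 0) ⟨by linarith, hτ⟩ ht
  have proj : ∀ {f : ℝ → ℝ} {B : ℝ}, OddPeriodic L f → 0 ≤ B → (∀ x, |iteratedDeriv 2 f x| ≤ B) →
      l2 L (fun x => sineProj L m f x - sineProj L n f x) ^ 2 ≤ L * B ^ 2 * (η m + η n) ^ 2 := by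
    intro f B hf hB0 hB
    have hc : ∀ n, Continuous (sineProj L n f) := fun n => (oddPeriodic_sineSum hL n _).continuous
    have hb : ∀ x, |sineProj L m f x - sineProj L n f x| ≤ B * (η m + η n) := fun x => by
      have h1 := abs_sub_sineProj_le hL hf.toSmoothPeriodic hf.odd hB m x
      have h2 := abs_sub_sineProj_le hL hf.toSmoothPeriodic hf.odd hB n x
      have h3 := mul_le_mul_of_nonneg_left (hηn m) hB0
      have h4 := mul_le_mul_of_nonneg_left (hηn n) hB0
      rw [abs_le] at *
      constructor <;> linarith
    have := pow_le_pow_left₀ (l2_nonneg _ _) (l2_le_of_bound hL ((hc m).sub (hc n)) hb) 2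
    rw [mul_pow, Real.sq_sqrt hL.le, mul_pow, ← mul_assoc] at this
    exact this
  have h0 : stateDist L (W m 0) (R m 0) (W n 0) (R n 0)
      ≤ (L * A ^ 2 + L * D ^ 2) * (η m + η n) ^ 2 := by
    unfold stateDist
    rw [h0w, h0w, h0r, h0r, add_mul]
    exact add_le_add (proj hw₀ hA0 hA) (proj hr₀ hD0 hD)
  have hexp : Real.exp (C * |t - 0|) ≤ Real.exp (C * τ) := by
    rw [sub_zero]
    have := (abs_lt.2 ht).le
    gcongr
  calc stateDist L (W m t) (R m t) (W n t) (R n t)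
      ≤ stateDist L (W m t) (R m t) (W n t) (R n t) + ε ^ 2 := le_add_of_nonneg_right (sq_nonneg _)
    _ ≤ Real.exp (C * τ) * ((L * A ^ 2 + L * D ^ 2) * (η m + η n) ^ 2 + ε ^ 2) := by
        refine hg.trans ?_
        gcongr
        exact add_nonneg (stateDist_nonneg _ _ _ _ _) (sq_nonneg _)
    _ = Q * (η m + η n) ^ 2 := by rw [hQ, hε]; ring
    _ = _ := by rw [mul_pow, Real.sq_sqrt hQ0]

end Approximation

end HouLuo
-- Local existence of smooth solutions.
namespace HouLuo
open MeasureTheory Set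

section LocalExistence

variable {L a τ : ℝ} {I : Set ℝ}

theorem IsGalerkin.contDiffOn (hL : 0 < L) (ha : 0 < a) (hI : IsOpen I) {N : ℕ} {A D : ℕ → ℝ → ℝ}
    (h : IsGalerkin L a N I (fun _ => 1) A D) {n : ℕ} (hn : n < N) :
    ContDiffOn ℝ 1 (A n) I ∧ ContDiffOn ℝ 1 (D n) I := by
  have cA : ∀ n < N, ContinuousOn (A n) I := fun n hn t ht =>
    (h.deriv_left t ht n hn).continuousAt.continuousWithinAt
  have cD : ∀ n < N, ContinuousOn (D n) I := fun n hn t ht =>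
    (h.deriv_right t ht n hn).continuousAt.continuousWithinAt
  have hp : ∀ p ∈ Finset.range N ×ˢ Finset.range N, p.1 < N ∧ p.2 < N := fun p hp => by
    simpa using hp
  have key : ∀ {f f' : ℝ → ℝ}, (∀ t ∈ I, HasDerivAt f (f' t) t) → ContinuousOn f' I →
      ContDiffOn ℝ 1 f I := fun {f f'} hd hc => by
    rw [show (1 : WithTop ℕ∞) = 0 + 1 from rfl, contDiffOn_succ_iff_deriv_of_isOpen hI]
    refine ⟨fun t ht => (hd t ht).differentiableAt.differentiableWithinAt, by simp, ?_⟩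
    rw [contDiffOn_zero]
    exact hc.congr fun t ht => (hd t ht).deriv
  constructor
  · refine key (fun t ht => h.deriv_left t ht n hn) ?_
    simp_rw [sineCoeff_vortRhs hL ha _ _ hn]
    exact continuousOn_const.mul ((cD n hn).sub (continuousOn_finsetSum _ fun p hpm =>
      ((cA _ (hp p hpm).1).mul (cA _ (hp p hpm).2)).mul continuousOn_const))
  · refine key (fun t ht => h.deriv_right t ht n hn) ?_
    simp_rw [sineCoeff_gradRhs hL ha]
    exact continuousOn_const.mul (continuousOn_finsetSum _ fun p hpm =>
      ((cA _ (hp p hpm).1).mul (cD _ (hp p hpm).2)).mul continuousOn_const)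

theorem contDiffOn_iteratedDeriv_sineSum (hL : 0 < L) {N : ℕ} {A : ℕ → ℝ → ℝ}
    (h : ∀ n < N, ContDiffOn ℝ 1 (A n) I) (k : ℕ) :
    ContDiffOn ℝ 1 (fun p : ℝ × ℝ => iteratedDeriv k (sineSum L N fun n => A n p.1) p.2)
      (I ×ˢ univ) := by
  simp_rw [iteratedDeriv_sineSum hL]
  refine ContDiffOn.sum fun n hn => ContDiffOn.mul ?_ ?_
  · exact (h n (Finset.mem_range.1 hn)).comp contDiff_fst.contDiffOn fun p hp => hp.1
  · exact ((((smoothPeriodic_sineBasis hL n).iteratedDeriv k).smooth.of_le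
      (by exact_mod_cast le_top)).comp contDiff_snd).contDiffOn

theorem hasDerivAt_sineSum {N : ℕ} {A : ℕ → ℝ → ℝ} {c : ℕ → ℝ} {t : ℝ}
    (h : ∀ n < N, HasDerivAt (A n) (c n) t) (x : ℝ) :
    HasDerivAt (fun s => sineSum L N (fun n => A n s) x) (sineSum L N c x) t :=
  HasDerivAt.fun_sum fun n hn => (h n (Finset.mem_range.1 hn)).mul_const _

/-- The limit of approximate solutions is a smooth solution. -/
theorem IsApproximation.exists_isSmoothSolution {W R : ℕ → ℝ → ℝ → ℝ}
    (h : IsApproximation L a (Ioo (-τ) τ) W R) (hL : 0 < L) (ha : 0 < a) (hτ : 0 < τ)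
    {w₀ r₀ : ℝ → ℝ} (hw₀ : OddPeriodic L w₀) (hr₀ : OddPeriodic L r₀)
    (h0w : ∀ n, W n 0 = sineProj L n w₀) (h0r : ∀ n, R n 0 = sineProj L n r₀) :
    ∃ w r, IsSmoothSolution L a (Ioo (-τ) τ) w r ∧ w 0 = w₀ ∧ r 0 = r₀ := by
  obtain ⟨K, hK0, hK⟩ := h.exists_stateDist_le hL ha hτ hw₀ hr₀ h0w h0r
  set η : ℕ → ℝ := fun n => K * (sineTail L n + 1 / (n + 1)) with hη_def
  have hη : Tendsto η atTop (𝓝 0) := by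
    have := ((tendsto_sineTail L).add tendsto_one_div_add_atTop_nhds_zero_nat).const_mul K
    rwa [add_zero, mul_zero] at this
  have hη0 : ∀ n, 0 ≤ η n := fun n =>
    mul_nonneg hK0 (add_nonneg (sineTail_nonneg L n) (by positivity))
  have hK' : ∀ m n, ∀ t ∈ Ioo (-τ) τ, stateDist L (W m t) (R m t) (W n t) (R n t) ≤ (η m + η n) ^ 2 :=
    fun m n t ht => (hK m n t ht).trans_eq (by rw [mul_add])
  obtain ⟨w, hw, uw⟩ := exists_smooth_limit hL hη h.odd_w
    (fun k => by
      obtain ⟨M, hM⟩ := h.bound k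
      exact ⟨√M, fun n t ht => (l2_le_sqrt_energy_left L k _ (R n t)).trans
        (Real.sqrt_le_sqrt (hM n t ht))⟩)
    (fun m n t ht => le_of_sq_le_sq (by
      have := hK' m n t ht
      unfold stateDist at this
      nlinarith [sq_nonneg (l2 L fun x => R m t x - R n t x)]) (add_nonneg (hη0 m) (hη0 n)))
  obtain ⟨r, hr, ur⟩ := exists_smooth_limit hL hη h.odd_r
    (fun k => by
      obtain ⟨M, hM⟩ := h.bound k
      exact ⟨√M, fun n t ht => (l2_le_sqrt_energy_right L k (W n t) _).trans
        (Real.sqrt_le_sqrt (hM n t ht))⟩)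
    (fun m n t ht => le_of_sq_le_sq (by
      have := hK' m n t ht
      unfold stateDist at this
      nlinarith [sq_nonneg (l2 L fun x => W m t x - W n t x)]) (add_nonneg (hη0 m) (hη0 n)))
  obtain ⟨E, hE0, hE⟩ := h.exists_error_le hL ha
  obtain ⟨M, hM0, hM⟩ := h.exists_bound_velocity hL ha 1
  have hmem : ∀ t ∈ Ioo (-τ) τ, ∀ x, (t, x) ∈ Ioo (-τ) τ ×ˢ (univ : Set ℝ) := fun t ht x =>
    ⟨ht, mem_univ _⟩
  have uw0 : TendstoUniformlyOn (fun n (p : ℝ × ℝ) => W n p.1 p.2) (fun p => w p.1 p.2) atTop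
      (Ioo (-τ) τ ×ˢ univ) := by simpa using uw 0
  have ur0 : TendstoUniformlyOn (fun n (p : ℝ × ℝ) => R n p.1 p.2) (fun p => r p.1 p.2) atTop
      (Ioo (-τ) τ ×ˢ univ) := by simpa using ur 0
  have uw1 : TendstoUniformlyOn (fun n (p : ℝ × ℝ) => deriv (W n p.1) p.2)
      (fun p => deriv (w p.1) p.2) atTop (Ioo (-τ) τ ×ˢ univ) := by simpa using uw 1
  have ur1 : TendstoUniformlyOn (fun n (p : ℝ × ℝ) => deriv (R n p.1) p.2)
      (fun p => deriv (r p.1) p.2) atTop (Ioo (-τ) τ ×ˢ univ) := by simpa using ur 1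
  have uu := tendstoUniformlyOn_velocity hL ha (fun n t ht => (h.odd_w n t ht).continuous)
    (fun n t ht => (h.odd_w n t ht).periodic) (fun t ht => (hw t ht).continuous)
    (fun t ht => (hw t ht).periodic) uw0
  have dv : ∀ {f : ℝ → ℝ}, OddPeriodic L f → velocity L a (deriv f) = deriv (velocity L a f) :=
    fun hf => by
      have := iteratedDeriv_velocity hL ha hf.toSmoothPeriodic 1
      rw [iteratedDeriv_one, iteratedDeriv_one] at this
      exact this.symm
  have uu1 : TendstoUniformlyOn (fun n (p : ℝ × ℝ) => deriv (velocity L a (W n p.1)) p.2)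
      (fun p => deriv (velocity L a (w p.1)) p.2) atTop (Ioo (-τ) τ ×ˢ univ) := by
    have h1 := tendstoUniformlyOn_velocity hL ha (F := fun n t => deriv (W n t))
      (f := fun t => deriv (w t)) (fun n t ht => (h.odd_w n t ht).toSmoothPeriodic.deriv.continuous)
      (fun n t ht => (h.odd_w n t ht).toSmoothPeriodic.deriv.periodic)
      (fun t ht => (hw t ht).toSmoothPeriodic.deriv.continuous)
      (fun t ht => (hw t ht).toSmoothPeriodic.deriv.periodic) uw1
    refine (h1.congr (Eventually.of_forall fun n p hp => ?_)).congr_right fun p hp => ?_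
    · exact congrFun (dv (h.odd_w n p.1 hp.1)) p.2
    · exact congrFun (dv (hw p.1 hp.1)) p.2
  have bw1 : ∀ n, ∀ p ∈ Ioo (-τ) τ ×ˢ (univ : Set ℝ), |deriv (W n p.1) p.2| ≤ M := fun n p hp => by
    simpa using (hM 1 le_rfl n p.1 hp.1 p.2).1
  have br0 : ∀ n, ∀ p ∈ Ioo (-τ) τ ×ˢ (univ : Set ℝ), |R n p.1 p.2| ≤ M := fun n p hp => by
    simpa using (hM 0 (by omega) n p.1 hp.1 p.2).2.1
  have br1 : ∀ n, ∀ p ∈ Ioo (-τ) τ ×ˢ (univ : Set ℝ), |deriv (R n p.1) p.2| ≤ M := fun n p hp => by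
    simpa using (hM 1 le_rfl n p.1 hp.1 p.2).2.1
  have bu0 : ∀ n, ∀ p ∈ Ioo (-τ) τ ×ˢ (univ : Set ℝ), |velocity L a (W n p.1) p.2| ≤ M :=
    fun n p hp => by simpa using (hM 0 (by omega) n p.1 hp.1 p.2).2.2
  have bu1 : ∀ n, ∀ p ∈ Ioo (-τ) τ ×ˢ (univ : Set ℝ), |deriv (velocity L a (W n p.1)) p.2| ≤ M :=
    fun n p hp => by simpa using (hM 1 le_rfl n p.1 hp.1 p.2).2.2
  have uF := ur0.sub (tendstoUniformlyOn_mul_of_bound hM0 uu uw1 bu0 bw1)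
  have uG := ((tendstoUniformlyOn_mul_of_bound hM0 uu1 ur0 bu1 br0).add
    (tendstoUniformlyOn_mul_of_bound hM0 uu ur1 bu0 br1)).neg
  have hEt : Tendsto (fun n => E * sineTail L n) atTop (𝓝 0) := by
    simpa using (tendsto_sineTail L).const_mul E
  have uerr : ∀ {e : ℕ → ℝ × ℝ → ℝ}, (∀ n, ∀ p ∈ Ioo (-τ) τ ×ˢ (univ : Set ℝ),
      |e n p| ≤ E * sineTail L n) → TendstoUniformlyOn e (fun _ => 0) atTop (Ioo (-τ) τ ×ˢ univ) := by
    intro e he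
    rw [Metric.tendstoUniformlyOn_iff]
    intro ε hε
    filter_upwards [hEt.eventually (gt_mem_nhds hε)] with n hn p hp
    rw [dist_zero_left]
    exact (he n p hp).trans_lt hn
  -- The projected right-hand side is the full one minus the consistency error; the first converges
  -- uniformly and the second tends to zero.
  have uF' : TendstoUniformlyOn (fun n (p : ℝ × ℝ) =>
      sineProj L n (vortRhs L a (W n p.1) (R n p.1)) p.2) (fun p => vortRhs L a (w p.1) (r p.1) p.2)
      atTop (Ioo (-τ) τ ×ˢ univ) := by
    refine ((uF.sub (uerr fun n p hp => (hE n p.1 hp.1 p.2).1)).congr (Eventually.of_forall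
      fun n p _ => ?_)).congr_right fun p _ => ?_
    · simp [vortRhs]
    · simp [vortRhs]
  have uG' : TendstoUniformlyOn (fun n (p : ℝ × ℝ) =>
      sineProj L n (gradRhs L a (W n p.1) (R n p.1)) p.2) (fun p => gradRhs L a (w p.1) (r p.1) p.2)
      atTop (Ioo (-τ) τ ×ˢ univ) := by
    refine ((uG.sub (uerr fun n p hp => (hE n p.1 hp.1 p.2).2)).congr (Eventually.of_forall
      fun n p _ => ?_)).congr_right fun p _ => ?_
    · simp [gradRhs]
    · simp [gradRhs]
  have time : ∀ {f : ℕ → ℝ → ℝ → ℝ} {g : ℝ → ℝ → ℝ} {f' : ℕ → ℝ × ℝ → ℝ} {g' : ℝ × ℝ → ℝ},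
      TendstoUniformlyOn f' g' atTop (Ioo (-τ) τ ×ˢ univ) →
      TendstoUniformlyOn (fun n (p : ℝ × ℝ) => f n p.1 p.2) (fun p => g p.1 p.2) atTop
        (Ioo (-τ) τ ×ˢ univ) →
      (∀ n, ∀ t ∈ Ioo (-τ) τ, ∀ x, HasDerivAt (fun s => f n s x) (f' n (t, x)) t) →
      ∀ t ∈ Ioo (-τ) τ, ∀ x, HasDerivAt (fun s => g s x) (g' (t, x)) t := by
    intro f g f' g' hu' hu hd t ht x
    refine hasDerivAt_of_tendstoUniformlyOn (f := fun n s => f n s x) (f' := fun n s => f' n (s, x))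
      (g' := fun s => g' (s, x)) (l := atTop) isOpen_Ioo ?_
      (Eventually.of_forall fun n t ht => hd n t ht x) (fun s hs => hu.tendsto_at (hmem s hs x)) ht
    exact (hu'.comp (fun s : ℝ => (s, x))).mono fun s hs => hmem s hs x
  have h0 : (0 : ℝ) ∈ Ioo (-τ) τ := ⟨by linarith, hτ⟩
  have init : ∀ {f : ℕ → ℝ → ℝ → ℝ} {g : ℝ → ℝ → ℝ} {f₀ : ℝ → ℝ}, OddPeriodic L f₀ →
      TendstoUniformlyOn (fun n (p : ℝ × ℝ) => f n p.1 p.2) (fun p => g p.1 p.2) atTop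
        (Ioo (-τ) τ ×ˢ univ) → (∀ n, f n 0 = sineProj L n f₀) → g 0 = f₀ := by
    intro f g f₀ hf₀ hu hf
    ext x
    have h1 := hu.tendsto_at (hmem 0 h0 x)
    simp only [hf] at h1
    exact tendsto_nhds_unique h1 (hasSum_sineCoeff hL hf₀.toSmoothPeriodic hf₀.odd x).tendsto_sum_nat
  refine ⟨w, r, isSmoothSolution_of_continuousOn hL ha isOpen_Ioo hw hr
    (fun k => (uw k).continuousOn (Frequently.of_forall fun n => (h.smooth_w n k).continuousOn))
    (fun k => (ur k).continuousOn (Frequently.of_forall fun n => (h.smooth_r n k).continuousOn))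
    (time uF' uw0 h.eq_w) (time uG' ur0 h.eq_r), init hw₀ uw0 h0w, init hr₀ ur0 h0r⟩

/-- Local existence on a time interval which depends only on the first order energy. -/
theorem exists_local_solution (hL : 0 < L) (ha : 0 < a) {B : ℝ} (hB : 0 ≤ B) :
    ∃ τ, 0 < τ ∧ ∀ w₀ r₀ : ℝ → ℝ, OddPeriodic L w₀ → OddPeriodic L r₀ → energy L 1 w₀ r₀ ≤ B →
      ∃ w r, IsSmoothSolution L a (Ioo (-τ) τ) w r ∧ w 0 = w₀ ∧ r 0 = r₀ := by
  obtain ⟨τ, hτ, hG⟩ := exists_isGalerkin hL ha hB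
  refine ⟨τ, hτ, fun w₀ r₀ hw₀ hr₀ hE => ?_⟩
  choose A D hAD hA0 hD0 hen using hG w₀ r₀ hw₀ hr₀ hE
  have happ : IsApproximation L a (Ioo (-τ) τ) (fun N t => sineSum L N fun n => A N n t)
      (fun N t => sineSum L N fun n => D N n t) := by
    refine ⟨fun N t _ => oddPeriodic_sineSum hL N _, fun N t _ => oddPeriodic_sineSum hL N _,
      fun N k => contDiffOn_iteratedDeriv_sineSum hL
        (fun n hn => ((hAD N).contDiffOn hL ha isOpen_Ioo hn).1) k,
      fun N k => contDiffOn_iteratedDeriv_sineSum hL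
        (fun n hn => ((hAD N).contDiffOn hL ha isOpen_Ioo hn).2) k, fun k => ?_,
      fun N t ht x => hasDerivAt_sineSum (fun n hn => by simpa using (hAD N).deriv_left t ht n hn) x,
      fun N t ht x => hasDerivAt_sineSum (fun n hn => by simpa using (hAD N).deriv_right t ht n hn) x⟩
    have hk : ∀ k, 1 ≤ k → ∃ K, ∀ N, ∀ t ∈ Ioo (-τ) τ,
        energy L k (sineSum L N fun n => A N n t) (sineSum L N fun n => D N n t) ≤ K := fun k hk => by
      obtain ⟨K, hK⟩ := exists_galerkin_energy_le hL ha hτ (M := 2 * (1 + B)) hw₀ hr₀ k hk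
      exact ⟨K, fun N => hK N (A N) (D N) (hAD N) (hA0 N) (hD0 N) (hen N)⟩
    -- The energy bounds start at order one; order zero follows by Poincaré.
    rcases Nat.eq_zero_or_pos k with rfl | hkp
    · obtain ⟨K, hK⟩ := hk 1 le_rfl
      refine ⟨L ^ 2 * K, fun N t ht => le_trans ?_ (mul_le_mul_of_nonneg_left (hK N t ht)
        (sq_nonneg L))⟩
      unfold energy
      rw [mul_add, ← mul_pow, ← mul_pow]
      exact add_le_add (pow_le_pow_left₀ (l2_nonneg _ _)
        ((oddPeriodic_sineSum hL N _).l2_iteratedDeriv_le_succ hL 0) 2)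
        (pow_le_pow_left₀ (l2_nonneg _ _) ((oddPeriodic_sineSum hL N _).l2_iteratedDeriv_le_succ hL 0) 2)
    · exact hk k hkp
  refine happ.exists_isSmoothSolution hL ha hτ hw₀ hr₀ (fun N => ?_) (fun N => ?_)
  · simp only [hA0]; rfl
  · simp only [hD0]; rfl

end LocalExistence

end HouLuo
-- Variable-rate Gronwall and the maximum principle for transport.
namespace HouLuo
open MeasureTheory Set

theorem contDiffOn_deriv {I : Set ℝ} (hI : IsOpen I) {f : ℝ → ℝ → ℝ}
    (hf : ContDiffOn ℝ ∞ (fun p : ℝ × ℝ => f p.1 p.2) (I ×ˢ univ)) :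
    ContDiffOn ℝ ∞ (fun p : ℝ × ℝ => deriv (f p.1) p.2) (I ×ˢ univ) :=
  contDiffOn_infty.2 fun n => (partials_of_contDiffOn_succ hI (n := n)
    (hf.of_le (by exact_mod_cast le_top))).2.2.2

theorem contDiffOn_iteratedDeriv {I : Set ℝ} (hI : IsOpen I) {f : ℝ → ℝ → ℝ}
    (hf : ContDiffOn ℝ ∞ (fun p : ℝ × ℝ => f p.1 p.2) (I ×ˢ univ)) (k : ℕ) :
    ContDiffOn ℝ ∞ (fun p : ℝ × ℝ => iteratedDeriv k (f p.1) p.2) (I ×ˢ univ) := by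
  induction k with
  | zero => simpa using hf
  | succ k ih =>
    simp_rw [iteratedDeriv_succ]
    exact contDiffOn_deriv hI (f := fun t => iteratedDeriv k (f t)) ih

/-- One-sided Grönwall inequality with a variable coefficient. -/
theorem le_exp_mul_of_hasDerivAt {T : ℝ} {y y' Φ φ : ℝ → ℝ}
    (hy : ∀ t ∈ Icc 0 T, HasDerivAt y (y' t) t) (hΦ : ∀ t ∈ Icc 0 T, HasDerivAt Φ (φ t) t)
    (h : ∀ t ∈ Icc 0 T, y' t ≤ φ t * y t) {t : ℝ} (ht : t ∈ Icc 0 T) :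
    y t ≤ Real.exp (Φ t - Φ 0) * y 0 := by
  have hd : ∀ t ∈ Icc 0 T, HasDerivAt (fun t => y t * Real.exp (-Φ t))
      (y' t * Real.exp (-Φ t) + y t * (Real.exp (-Φ t) * -φ t)) t := fun t ht =>
    (hy t ht).mul (hΦ t ht).neg.exp
  have hanti : AntitoneOn (fun t => y t * Real.exp (-Φ t)) (Icc 0 T) := by
    refine antitoneOn_of_deriv_nonpos (convex_Icc 0 T)
      (fun t ht => (hd t ht).continuousAt.continuousWithinAt)
      (fun t ht => (hd t (interior_subset ht)).differentiableAt.differentiableWithinAt) fun t ht => ?_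
    rw [(hd t (interior_subset ht)).deriv]
    have := mul_le_mul_of_nonneg_right (h t (interior_subset ht)) (Real.exp_pos (-Φ t)).le
    linarith
  have h1 := hanti (a := 0) ⟨le_rfl, ht.1.trans ht.2⟩ ht ht.1
  have h2 := mul_le_mul_of_nonneg_right h1 (Real.exp_pos (Φ t)).le
  simp only [mul_assoc, ← Real.exp_add] at h2
  rw [neg_add_cancel, Real.exp_zero, mul_one] at h2
  rw [sub_eq_neg_add, mul_comm]
  exact h2

/-- The square of the negative part is differentiable also at 0, so the maximum principle can be
proved by an L² estimate without characteristics. -/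
theorem hasDerivAt_min_zero_sq (s : ℝ) : HasDerivAt (fun s : ℝ => min s 0 ^ 2) (2 * min s 0) s := by
  rcases lt_trichotomy s 0 with h | rfl | h
  · rw [min_eq_left h.le]
    refine (((hasDerivAt_id s).pow 2).congr_deriv (by simp)).congr_of_eventuallyEq ?_
    filter_upwards [gt_mem_nhds h] with x hx
    simp [min_eq_left (le_of_lt hx)]
  · rw [min_self, mul_zero, hasDerivAt_iff_isLittleO]
    simp only [min_self, ne_eq, OfNat.ofNat_ne_zero, not_false_eq_true, zero_pow, sub_zero, smul_zero]
    have h1 : (fun s : ℝ => min s 0 ^ 2) =O[𝓝 0] fun s : ℝ => s ^ 2 := by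
      refine Asymptotics.IsBigO.of_bound 1 (Eventually.of_forall fun s => ?_)
      rw [one_mul, Real.norm_of_nonneg (sq_nonneg _), Real.norm_of_nonneg (sq_nonneg _), sq_le_sq]
      rcases le_total s 0 with h | h
      · rw [min_eq_left h]
      · rw [min_eq_right h, abs_zero]; exact abs_nonneg _
    refine h1.trans_isLittleO ?_
    simpa using (Asymptotics.isLittleO_pow_pow (𝕜 := ℝ) (m := 1) (n := 2) one_lt_two)
  · rw [min_eq_right h.le, mul_zero]
    refine (hasDerivAt_const s (0 : ℝ)).congr_of_eventuallyEq ?_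
    filter_upwards [lt_mem_nhds h] with x hx
    simp [min_eq_right (le_of_lt hx)]

/-- Maximum principle for transport equations on an interval whose end points are stagnation
points. -/
theorem nonneg_of_transport {I : Set ℝ} (hI : IsOpen I) {T ℓ : ℝ} (hT : 0 ≤ T) (hTI : Icc 0 T ⊆ I)
    (hℓ : 0 < ℓ) {q qt qx u ux c : ℝ → ℝ → ℝ}
    (hqt : ∀ t ∈ I, ∀ x, HasDerivAt (fun s => q s x) (qt t x) t)
    (hqx : ∀ t ∈ I, ∀ x, HasDerivAt (q t) (qx t x) x)
    (hux : ∀ t ∈ I, ∀ x, HasDerivAt (u t) (ux t x) x)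
    (cq : ContinuousOn (fun p : ℝ × ℝ => q p.1 p.2) (I ×ˢ univ))
    (cqt : ContinuousOn (fun p : ℝ × ℝ => qt p.1 p.2) (I ×ˢ univ))
    (cqx : ContinuousOn (fun p : ℝ × ℝ => qx p.1 p.2) (I ×ˢ univ))
    (cux : ContinuousOn (fun p : ℝ × ℝ => ux p.1 p.2) (I ×ˢ univ))
    (cc : ContinuousOn (fun p : ℝ × ℝ => c p.1 p.2) (I ×ˢ univ))
    (hu0 : ∀ t ∈ I, u t 0 = 0) (huℓ : ∀ t ∈ I, u t ℓ = 0)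
    (hq : ∀ t ∈ Icc 0 T, ∀ x ∈ Icc 0 ℓ, 0 ≤ qt t x + u t x * qx t x + c t x * q t x)
    (hq0 : ∀ x ∈ Icc 0 ℓ, 0 ≤ q 0 x) : ∀ x ∈ Icc 0 ℓ, 0 ≤ q T x := by
  have slice : ∀ {f : ℝ → ℝ → ℝ}, ContinuousOn (fun p : ℝ × ℝ => f p.1 p.2) (I ×ˢ univ) →
      ∀ t ∈ I, Continuous (f t) := fun hf t ht => continuous_of_continuousOn_prod hf ht
  have cm : Continuous fun s : ℝ => min s 0 := by fun_prop
  have cqm : ContinuousOn (fun p : ℝ × ℝ => min (q p.1 p.2) 0) (I ×ˢ univ) := cm.comp_continuousOn cq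
  -- The squared L² norm of the negative part of q, which is to be kept at zero.
  set y : ℝ → ℝ := fun t => ∫ x in (0 : ℝ)..ℓ, min (q t x) 0 ^ 2 with hy
  have hyd : ∀ t ∈ I, HasDerivAt y (∫ x in (0 : ℝ)..ℓ, 2 * min (q t x) 0 * qt t x) t := by
    intro t ht
    have := hasDerivAt_weighted_integral (a := 0) (b := ℓ) (k := fun _ => 1) (by simp) hI
      (f := fun t x => min (q t x) 0 ^ 2) (f' := fun t x => 2 * min (q t x) 0 * qt t x)
      (cqm.pow 2) ((continuousOn_const.mul cqm).mul cqt)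
      (fun t ht x => (hasDerivAt_min_zero_sq (q t x)).comp t (hqt t ht x)) ht
    simpa only [one_mul] using this
  -- The rate is a bound for u_x - 2c: u_x comes from integrating the transport term by parts, -2c
  -- from the zeroth order term.
  obtain ⟨C, hC⟩ := (isCompact_Icc.prod isCompact_Icc).exists_bound_of_continuousOn
    (s := Icc (0 : ℝ) T ×ˢ Icc (0 : ℝ) ℓ)
    ((cux.sub (continuousOn_const (c := (2 : ℝ)).mul cc)).mono (prod_mono hTI (subset_univ _)))
  have hle : ∀ t ∈ Icc 0 T, ∫ x in (0 : ℝ)..ℓ, 2 * min (q t x) 0 * qt t x ≤ C * y t := by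
    intro t ht
    have htI := hTI ht
    have c1 := slice (f := fun t x => min (q t x) 0) cqm t htI
    have c2 := slice cqt t htI
    have c3 := slice cqx t htI
    have c4 := slice cux t htI
    have c5 := slice cc t htI
    have c6 : Continuous (u t) := continuous_iff_continuousAt.2 fun x => (hux t htI x).continuousAt
    -- No boundary terms appear because both end points are stagnation points.
    have hibp : ∫ x in (0 : ℝ)..ℓ, (ux t x * min (q t x) 0 ^ 2 + u t x * (2 * min (q t x) 0 * qx t x)) = 0 := by
      rw [intervalIntegral.integral_eq_sub_of_hasDerivAt (f := fun x => u t x * min (q t x) 0 ^ 2)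
        (fun x _ => (hux t htI x).mul ((hasDerivAt_min_zero_sq (q t x)).comp x (hqx t htI x)))
        (Continuous.intervalIntegrable (by fun_prop) _ _), hu0 t htI, huℓ t htI]
      ring
    have e : C * y t = ∫ x in (0 : ℝ)..ℓ, (C * min (q t x) 0 ^ 2
        - (ux t x * min (q t x) 0 ^ 2 + u t x * (2 * min (q t x) 0 * qx t x))) := by
      rw [intervalIntegral.integral_sub (Continuous.intervalIntegrable (by fun_prop) _ _)
        (Continuous.intervalIntegrable (by fun_prop) _ _), hibp, sub_zero,
        intervalIntegral.integral_const_mul]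
    rw [e]
    refine intervalIntegral.integral_mono_on hℓ.le (Continuous.intervalIntegrable (by fun_prop) _ _)
      (Continuous.intervalIntegrable (by fun_prop) _ _) fun x hx => ?_
    have h1 := mul_nonneg_of_nonpos_of_nonpos (min_le_right (q t x) 0) (neg_nonpos.2 (hq t ht x hx))
    have h2 : min (q t x) 0 * q t x = min (q t x) 0 ^ 2 := by
      rcases le_total (q t x) 0 with h | h
      · rw [min_eq_left h]; ring
      · rw [min_eq_right h]; ring
    have h3 := (abs_le.1 (hC (t, x) ⟨ht, hx⟩)).2
    simp only [Pi.sub_apply, Pi.mul_apply] at h3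
    have h4 := mul_le_mul_of_nonneg_right h3 (sq_nonneg (min (q t x) 0))
    have h5 : c t x * (min (q t x) 0 * q t x) = c t x * min (q t x) 0 ^ 2 := by rw [h2]
    nlinarith
  have hy0 : y 0 = 0 := by
    rw [hy]
    refine (intervalIntegral.integral_congr (g := fun _ => (0 : ℝ)) fun x hx => ?_).trans (by simp)
    rw [uIcc_of_le hℓ.le] at hx
    simp [min_eq_right (hq0 x hx)]
  have hyT := le_exp_mul_of_hasDerivAt (Φ := fun t => C * t) (fun t ht => hyd t (hTI ht))
    (fun t _ => by simpa using (hasDerivAt_id t).const_mul C) hle (⟨hT, le_rfl⟩ : T ∈ Icc 0 T)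
  rw [hy0, mul_zero] at hyT
  intro x hx
  by_contra hneg
  rw [not_le] at hneg
  have hcT := (slice (f := fun t x => min (q t x) 0) cqm T (hTI ⟨hT, le_rfl⟩)).pow 2
  have := intervalIntegral.integral_pos (f := fun x => min (q T x) 0 ^ 2) hℓ hcT.continuousOn (fun x _ => sq_nonneg _)
    ⟨x, hx, by simp only [min_eq_left hneg.le]; exact sq_pos_of_neg hneg⟩
  exact absurd hyT (not_le.2 this)

end HouLuo
-- The continuation criterion in terms of ∫ ‖u_x‖.
namespace HouLuo
open MeasureTheory Set

section Continuation

variable {L a : ℝ} {I : Set ℝ} {w r : ℝ → ℝ → ℝ}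

theorem IsSmoothSolution.contDiffOn_velocity (h : IsSmoothSolution L a I w r) (hL : 0 < L)
    (ha : 0 < a) (hI : IsOpen I) :
    ContDiffOn ℝ ∞ (fun p : ℝ × ℝ => velocity L a (w p.1) p.2) (I ×ˢ univ) :=
  contDiffOn_infty.2 fun n => HouLuo.contDiffOn_velocity hL ha hI n
    (fun t ht => (h.odd_w t ht).periodic) (h.smooth_w.of_le (by exact_mod_cast le_top))

theorem IsSmoothSolution.continuousOn_deriv_velocity (h : IsSmoothSolution L a I w r) (hL : 0 < L)
    (ha : 0 < a) (hI : IsOpen I) :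
    ContinuousOn (fun p : ℝ × ℝ => deriv (velocity L a (w p.1)) p.2) (I ×ˢ univ) :=
  (contDiffOn_deriv hI (f := fun t => velocity L a (w t))
    (h.contDiffOn_velocity hL ha hI)).continuousOn

/-- Over a compact period the supremum depends continuously on time, which is how
`continuousOn_gradNorm` follows. -/
theorem gradNorm_eq (hL : 0 < L) {w : ℝ → ℝ} (hw : Function.Periodic w L) :
    gradNorm L a w = sSup ((fun x => |deriv (velocity L a w) x|) '' Icc 0 L) := by
  have hp : Function.Periodic (fun x => |deriv (velocity L a w) x|) L := fun x => by
    simp only [periodic_deriv (velocity_periodic hL a hw) x]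
  have := hp.image_Icc hL 0
  rw [zero_add] at this
  rw [gradNorm, iSup, this]

theorem bddAbove_abs_deriv_velocity (hL : 0 < L) (ha : 0 < a) {w : ℝ → ℝ} (hw : OddPeriodic L w) :
    BddAbove (range fun x => |deriv (velocity L a w) x|) := by
  obtain ⟨M, -, hM⟩ := (hw.velocity hL ha).toSmoothPeriodic.deriv.exists_bound hL
  exact ⟨M, by rintro _ ⟨x, rfl⟩; exact hM x⟩

theorem abs_deriv_velocity_le_gradNorm (hL : 0 < L) (ha : 0 < a) {w : ℝ → ℝ} (hw : OddPeriodic L w)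
    (x : ℝ) : |deriv (velocity L a w) x| ≤ gradNorm L a w :=
  le_ciSup (bddAbove_abs_deriv_velocity hL ha hw) x

theorem gradNorm_nonneg (w : ℝ → ℝ) : 0 ≤ gradNorm L a w :=
  Real.iSup_nonneg fun _ => abs_nonneg _

theorem IsSmoothSolution.continuousOn_gradNorm (h : IsSmoothSolution L a I w r) (hL : 0 < L)
    (ha : 0 < a) (hI : IsOpen I) : ContinuousOn (fun t => gradNorm L a (w t)) I := by
  rw [continuousOn_iff_continuous_domRestrict]
  have e : I.domRestrict (fun t => gradNorm L a (w t)) = fun t : I =>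
      sSup ((fun x => |deriv (velocity L a (w t)) x|) '' Icc 0 L) :=
    funext fun t => gradNorm_eq hL (h.odd_w t t.2).periodic
  rw [e]
  refine isCompact_Icc.continuous_sSup ?_
  have := (h.continuousOn_deriv_velocity hL ha hI).comp_continuous
    (f := fun p : I × ℝ => ((p.1 : ℝ), p.2)) (by fun_prop) fun p => ⟨p.1.2, mem_univ _⟩
  exact this.abs

theorem hasDerivAt_primitive_of_continuousOn {α β : ℝ} {f : ℝ → ℝ} (hf : ContinuousOn f (Ioo α β))
    {s t : ℝ} (hs : s ∈ Ioo α β) (ht : t ∈ Ioo α β) :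
    HasDerivAt (fun t => ∫ x in s..t, f x) (f t) t :=
  intervalIntegral.integral_hasDerivAt_right
    (hf.mono ((ordConnected_Ioo).uIcc_subset hs ht)).intervalIntegrable
    (hf.stronglyMeasurableAtFilter isOpen_Ioo t ht) (hf.continuousAt (isOpen_Ioo.mem_nhds ht))

variable {δ T : ℝ}

/-- The density gradient is bounded as long as the velocity gradient is integrable. -/
theorem IsSmoothSolution.abs_r_le (h : IsSmoothSolution L a (Ioo (-δ) T) w r) (hL : 0 < L)
    (ha : 0 < a) (hδ : 0 < δ) {M : ℝ} (hM : ∀ x, |r 0 x| ≤ M) {t : ℝ} (ht : t ∈ Ico 0 T) (x : ℝ) :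
    |r t x| ≤ M * Real.exp (∫ s in (0 : ℝ)..t, gradNorm L a (w s)) := by
  have hI : IsOpen (Ioo (-δ) T) := isOpen_Ioo
  have h0 : (0 : ℝ) ∈ Ioo (-δ) T := ⟨by linarith, ht.1.trans_lt ht.2⟩
  have hsub : Icc 0 t ⊆ Ioo (-δ) T := Icc_subset_Ioo (by linarith) ht.2
  have htI := hsub ⟨ht.1, le_rfl⟩
  have hg := h.continuousOn_gradNorm hL ha hI
  have hM0 : 0 ≤ M := (abs_nonneg _).trans (hM 0)
  set G : ℝ → ℝ := fun t => ∫ s in (0 : ℝ)..t, gradNorm L a (w s) with hG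
  have hGd : ∀ t ∈ Ioo (-δ) T, HasDerivAt G (gradNorm L a (w t)) t := fun t ht =>
    hasDerivAt_primitive_of_continuousOn hg h0 ht
  have hGc : ContinuousOn G (Ioo (-δ) T) := fun t ht => (hGd t ht).continuousAt.continuousWithinAt
  have fst : ∀ {f : ℝ → ℝ}, ContinuousOn f (Ioo (-δ) T) →
      ContinuousOn (fun p : ℝ × ℝ => f p.1) (Ioo (-δ) T ×ˢ univ) := fun hf =>
    hf.comp continuous_fst.continuousOn fun p hp => hp.1
  have cu := (h.contDiffOn_velocity hL ha hI).continuousOn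
  have cux := h.continuousOn_deriv_velocity hL ha hI
  have cr := h.smooth_r.continuousOn
  have crx := (contDiffOn_deriv hI h.smooth_r).continuousOn
  have hu : ∀ t ∈ Ioo (-δ) T, OddPeriodic L (velocity L a (w t)) := fun t ht =>
    (h.odd_w t ht).velocity hL ha
  -- M exp(∫ ‖u_x‖) is a supersolution of the equations of r and of -r, so the maximum principle
  -- applies to both differences. The whole period [0, L] serves as interval, its ends being zeros
  -- of u.
  have main : ∀ σ : ℝ, |σ| = 1 → ∀ x ∈ Icc 0 L, 0 ≤ M * Real.exp (G t) - σ * r t x := by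
    intro σ hσ
    refine nonneg_of_transport hI ht.1 hsub hL
      (q := fun t x => M * Real.exp (G t) - σ * r t x)
      (qt := fun t x => M * (Real.exp (G t) * gradNorm L a (w t)) - σ * gradRhs L a (w t) (r t) x)
      (qx := fun t x => -(σ * deriv (r t) x)) (u := fun t => velocity L a (w t))
      (ux := fun t => deriv (velocity L a (w t))) (c := fun t => deriv (velocity L a (w t)))
      (fun t ht x => ?_) (fun t ht x => ?_) (fun t ht x => (hu t ht).hasDerivAt x) ?_ ?_ ?_ cux cux
      (fun t ht => (hu t ht).apply_zero) (fun t ht => ?_) (fun t ht x _ => ?_) fun x _ => ?_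
    · refine ((hGd t ht).exp.const_mul M).sub (((h.eq_r t ht x).congr_deriv ?_).const_mul σ)
      exact (gradRhs_eq hL ha (h.odd_w t ht) (h.odd_r t ht) x).symm
    · simpa using (((h.odd_r t ht).hasDerivAt x).const_mul σ).const_sub (M * Real.exp (G t))
    · exact (continuousOn_const.mul (fst hGc.rexp)).sub (continuousOn_const.mul cr)
    · refine (continuousOn_const.mul (fst (hGc.rexp.mul hg))).sub (continuousOn_const.mul ?_)
      exact ((cux.mul cr).add (cu.mul crx)).neg
    · exact (continuousOn_const.mul crx).neg
    · have := (hu t ht).periodic 0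
      rwa [zero_add, (hu t ht).apply_zero] at this
    · have hb := abs_deriv_velocity_le_gradNorm hL ha (h.odd_w t (hsub ht)) x
      have h1 : 0 ≤ M * Real.exp (G t) * (gradNorm L a (w t) + deriv (velocity L a (w t)) x) :=
        mul_nonneg (by positivity) (by linarith [(abs_le.1 hb).1])
      unfold gradRhs
      nlinarith
    · have hr : |σ * r 0 x| ≤ M := by rw [abs_mul, hσ, one_mul]; exact hM x
      simp only [hG, intervalIntegral.integral_same, Real.exp_zero, mul_one]
      linarith [le_abs_self (σ * r 0 x)]
  obtain ⟨z, hz, hxz⟩ := (h.odd_r t htI).periodic.exists_mem_Ico hL x 0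
  rw [zero_add] at hz
  rw [hxz, abs_le]
  have m1 := main 1 (by simp) z (Ico_subset_Icc_self hz)
  have m2 := main (-1) (by simp) z (Ico_subset_Icc_self hz)
  constructor <;> linarith

theorem IsSmoothSolution.hasDerivAt_energy_one (h : IsSmoothSolution L a I w r) (hL : 0 < L)
    (ha : 0 < a) (hI : IsOpen I) {t : ℝ} (ht : t ∈ I) :
    HasDerivAt (fun t => energy L 1 (w t) (r t))
      (2 * (∫ x in (0 : ℝ)..L, deriv (vortRhs L a (w t) (r t)) x * deriv (w t) x)
        + 2 * ∫ x in (0 : ℝ)..L, deriv (gradRhs L a (w t) (r t)) x * deriv (r t) x) t := by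
  have cit : ∀ {f : ℝ → ℝ → ℝ}, ContDiffOn ℝ ∞ (fun p : ℝ × ℝ => f p.1 p.2) (I ×ˢ univ) → ∀ k,
      ContDiffOn ℝ (0 : ℕ) (fun p : ℝ × ℝ => iteratedDeriv k (f p.1) p.2) (I ×ˢ univ) := fun hf k =>
    (contDiffOn_iteratedDeriv hI hf k).of_le (by simp)
  have hc := contDiffOn_iteratedDeriv_rhs hL ha hI h.odd_w h.odd_r (cit h.smooth_w) (cit h.smooth_r)
  have part : ∀ {f g : ℝ → ℝ → ℝ}, ContDiffOn ℝ ∞ (fun p : ℝ × ℝ => f p.1 p.2) (I ×ˢ univ) →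
      (∀ t ∈ I, SmoothPeriodic L (f t)) → (∀ t ∈ I, SmoothPeriodic L (g t)) →
      (∀ t ∈ I, ∀ x, HasDerivAt (fun s => f s x) (g t x) t) →
      ContinuousOn (fun p : ℝ × ℝ => g p.1 p.2) (I ×ˢ univ) →
      ContinuousOn (fun p : ℝ × ℝ => deriv (g p.1) p.2) (I ×ˢ univ) →
      HasDerivAt (fun t => l2 L (iteratedDeriv 1 (f t)) ^ 2)
        (2 * ∫ x in (0 : ℝ)..L, deriv (g t) x * deriv (f t) x) t := by
    intro f g cf sf sg hd cg cg'
    have cfx := (contDiffOn_deriv hI cf).continuousOn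
    have := hasDerivAt_weighted_integral (a := 0) (b := L) (k := fun _ => 1) (by simp) hI
      (f := fun t x => deriv (f t) x ^ 2) (f' := fun t x => 2 * (deriv (g t) x * deriv (f t) x))
      (cfx.pow 2) (continuousOn_const.mul (cg'.mul cfx)) (fun t ht x => by
        refine ((hasDerivAt_partial_comm hI hd (fun t ht x => (sf t ht).hasDerivAt x)
          (fun t ht x => (sg t ht).hasDerivAt x) cg cg' ht x).pow 2).congr_deriv ?_
        simp only [Nat.cast_ofNat]; ring) ht
    simp only [one_mul, intervalIntegral.integral_const_mul] at this
    simp_rw [l2_sq hL, iteratedDeriv_one]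
    exact this
  refine (part h.smooth_w (fun t ht => (h.odd_w t ht).toSmoothPeriodic) (fun t ht =>
    (oddPeriodic_vortRhs hL ha (h.odd_w t ht) (h.odd_r t ht)).toSmoothPeriodic) h.eq_w
    (by simpa using (hc 0).1.continuousOn) (by simpa using (hc 1).1.continuousOn)).add
    (part h.smooth_r (fun t ht => (h.odd_r t ht).toSmoothPeriodic) (fun t ht =>
    (oddPeriodic_gradRhs hL ha (h.odd_w t ht) (h.odd_r t ht)).toSmoothPeriodic) (fun t ht x =>
    (h.eq_r t ht x).congr_deriv (gradRhs_eq hL ha (h.odd_w t ht) (h.odd_r t ht) x).symm)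
    (by simpa using (hc 0).2.continuousOn) (by simpa using (hc 1).2.continuousOn))

/-- First order energy inequality in terms of the velocity gradient. -/
theorem exists_energy_one_le (hL : 0 < L) (ha : 0 < a) : ∃ C, 0 ≤ C ∧ ∀ w r : ℝ → ℝ,
    OddPeriodic L w → OddPeriodic L r → ∀ ρ : ℝ, (∀ x, |r x| ≤ ρ) →
      2 * (∫ x in (0 : ℝ)..L, deriv (vortRhs L a w r) x * deriv w x)
        + 2 * (∫ x in (0 : ℝ)..L, deriv (gradRhs L a w r) x * deriv r x)
        ≤ C * (1 + ρ + gradNorm L a w) * energy L 1 w r := by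
  obtain ⟨c, hc, -, hc2⟩ := exists_l2_velocity_le hL ha
  refine ⟨8 + 2 * c, by positivity, fun w r hw hr ρ hρ => ?_⟩
  have hρ0 : 0 ≤ ρ := (abs_nonneg _).trans (hρ 0)
  have hu := hw.velocity hL ha
  set g := gradNorm L a w with hg_def
  have hg0 : 0 ≤ g := gradNorm_nonneg w
  have hg : ∀ x, |deriv (velocity L a w) x| ≤ g := abs_deriv_velocity_le_gradNorm hL ha hw
  set u := velocity L a w with hu_def
  have hw1 := hw.toSmoothPeriodic.deriv
  have hr1 := hr.toSmoothPeriodic.deriv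
  have hu1 := hu.toSmoothPeriodic.deriv
  have e1 : ∀ x, deriv (vortRhs L a w r) x * deriv w x = deriv r x * deriv w x
      - deriv u x * deriv w x * deriv w x - u x * deriv (deriv w) x * deriv w x := fun x => by
    rw [show deriv (vortRhs L a w r) x = deriv r x - (deriv u x * deriv w x + u x * deriv (deriv w) x)
      from ((hr.hasDerivAt x).sub ((hu.hasDerivAt x).mul (hw1.hasDerivAt x))).deriv]
    ring
  have e2 : ∀ x, deriv (gradRhs L a w r) x * deriv r x = -(r x * deriv (deriv u) x * deriv r x)
      - 2 * (deriv u x * deriv r x * deriv r x) - u x * deriv (deriv r) x * deriv r x := fun x => by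
    rw [show deriv (gradRhs L a w r) x = -((deriv (deriv u) x * r x + deriv u x * deriv r x)
      + (deriv u x * deriv r x + u x * deriv (deriv r) x))
      from (((hu1.hasDerivAt x).mul (hr.hasDerivAt x)).add
        ((hu.hasDerivAt x).mul (hr1.hasDerivAt x))).neg.deriv]
    ring
  have k1 := hu.continuous
  have k2 := hu1.continuous
  have k3 := hu1.deriv.continuous
  have k4 := hw1.continuous
  have k5 := hw1.deriv.continuous
  have k6 := hr.continuous
  have k7 := hr1.continuous
  have k8 := hr1.deriv.continuous
  have int : ∀ {f : ℝ → ℝ}, Continuous f → IntervalIntegrable f volume 0 L := fun hf =>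
    hf.intervalIntegrable _ _
  simp_rw [e1, e2]
  rw [intervalIntegral.integral_sub (int (by fun_prop)) (int (by fun_prop)),
    intervalIntegral.integral_sub (int (by fun_prop)) (int (by fun_prop)),
    intervalIntegral.integral_sub (int (by fun_prop)) (int (by fun_prop)),
    intervalIntegral.integral_sub (int (by fun_prop)) (int (by fun_prop)),
    intervalIntegral.integral_neg, intervalIntegral.integral_const_mul]
  have t1 := abs_integral_mul_le hL k7 k4
  have t2 := (abs_integral_mul_le hL (k2.mul k4) k4).trans
    (mul_le_mul_of_nonneg_right (l2_mul_le_of_bound hL k2 k4 hg) (l2_nonneg _ _))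
  have t3 := abs_integral_transport_le hL hu.hasDerivAt hw1.hasDerivAt k2 k5 hu.periodic
    hw1.periodic hg
  have t4 := (abs_integral_mul_le hL (k6.mul k3) k7).trans
    (mul_le_mul_of_nonneg_right (l2_mul_le_of_bound hL k6 k3 hρ) (l2_nonneg _ _))
  have t5 := (abs_integral_mul_le hL (k2.mul k7) k7).trans
    (mul_le_mul_of_nonneg_right (l2_mul_le_of_bound hL k2 k7 hg) (l2_nonneg _ _))
  have t6 := abs_integral_transport_le hL hu.hasDerivAt hr1.hasDerivAt k2 k8 hu.periodic
    hr1.periodic hg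
  simp only [Pi.mul_apply] at t2 t4 t5
  -- The term r u'' is harmless: u'' is controlled in L² by w', so it costs only sup |r| times the
  -- energy.
  have hv : l2 L (deriv (deriv u)) ≤ c * l2 L (deriv w) := by
    have e : deriv (deriv u) = velocity L a (deriv (deriv w)) := by
      have := iteratedDeriv_velocity hL ha hw.toSmoothPeriodic 2
      rwa [iteratedDeriv_succ, iteratedDeriv_one, iteratedDeriv_succ, iteratedDeriv_one] at this
    rw [e]
    exact hc2 _ _ hw1.periodic hw1.deriv.periodic hw1.hasDerivAt k5
  unfold energy
  rw [iteratedDeriv_one, iteratedDeriv_one]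
  set m := l2 L (deriv w)
  set n := l2 L (deriv r)
  have hm : 0 ≤ m := l2_nonneg _ _
  have hn : 0 ≤ n := l2_nonneg _ _
  have t4' : ρ * l2 L (deriv (deriv u)) * n ≤ ρ * c * (m * n) := by
    calc ρ * l2 L (deriv (deriv u)) * n ≤ ρ * (c * m) * n := by gcongr
      _ = _ := by ring
  have hmn : 2 * (m * n) ≤ m ^ 2 + n ^ 2 := by nlinarith [sq_nonneg (m - n)]
  have hmn0 : 0 ≤ m * n := mul_nonneg hm hn
  have p1 := mul_le_mul_of_nonneg_left hmn (mul_nonneg hρ0 hc)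
  have hE : 0 ≤ m ^ 2 + n ^ 2 := by positivity
  have q1 : 0 ≤ ρ * (m ^ 2 + n ^ 2) := by positivity
  have q2 : 0 ≤ g * (m ^ 2 + n ^ 2) := by positivity
  have q3 : 0 ≤ c * (m ^ 2 + n ^ 2) := by positivity
  have q4 : 0 ≤ c * ρ * (m ^ 2 + n ^ 2) := by positivity
  have q5 : 0 ≤ c * g * (m ^ 2 + n ^ 2) := by positivity
  have q6 : 0 ≤ g * m ^ 2 := by positivity
  have q7 : 0 ≤ g * n ^ 2 := by positivity
  have a1 := (abs_le.1 t1).2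
  have a2 := (abs_le.1 t2).1
  have a3 := (abs_le.1 t3).1
  have a4 := (abs_le.1 t4).1
  have a5 := (abs_le.1 t5).1
  have a6 := (abs_le.1 t6).1
  have final : (8 + 2 * c) * (1 + ρ + g) * (m ^ 2 + n ^ 2) = 8 * (m ^ 2 + n ^ 2)
    + 8 * (ρ * (m ^ 2 + n ^ 2)) + 8 * (g * (m ^ 2 + n ^ 2)) + 2 * (c * (m ^ 2 + n ^ 2))
    + 2 * (c * ρ * (m ^ 2 + n ^ 2)) + 2 * (c * g * (m ^ 2 + n ^ 2)) := by ring
  rw [final]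
  have s1 : g * (m ^ 2 + n ^ 2) = g * m ^ 2 + g * n ^ 2 := by ring
  have s2 : g * m * m = g * m ^ 2 := by ring
  have s3 : g * n * n = g * n ^ 2 := by ring
  have s4 : n * m = m * n := mul_comm _ _
  have s5 : ρ * c * (2 * (m * n)) = 2 * (ρ * c * (m * n)) := by ring
  have s6 : ρ * c * (m ^ 2 + n ^ 2) = c * ρ * (m ^ 2 + n ^ 2) := by ring
  rw [s2] at a2
  rw [s3] at a5
  rw [s4] at a1
  rw [s5, s6] at p1
  linarith

/-- Continuation criterion: the energy is bounded if the velocity gradient is integrable. -/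
theorem IsSmoothSolution.exists_energy_le (h : IsSmoothSolution L a (Ioo (-δ) T) w r) (hL : 0 < L)
    (ha : 0 < a) (hδ : 0 < δ) (hT : 0 < T) {A : ℝ}
    (hA : ∀ t ∈ Ico 0 T, ∫ s in (0 : ℝ)..t, gradNorm L a (w s) ≤ A) :
    ∃ B, 0 ≤ B ∧ ∀ t ∈ Ico 0 T, energy L 1 (w t) (r t) ≤ B := by
  have hI : IsOpen (Ioo (-δ) T) := isOpen_Ioo
  have h0 : (0 : ℝ) ∈ Ioo (-δ) T := ⟨by linarith, hT⟩
  obtain ⟨M, hM0, hM⟩ := (h.odd_r 0 h0).toSmoothPeriodic.exists_bound hL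
  obtain ⟨C, hC, hCe⟩ := exists_energy_one_le hL ha
  have hg := h.continuousOn_gradNorm hL ha hI
  -- The maximum principle bounds r first. The energy inequality is then linear, with a coefficient
  -- whose time integral is bounded.
  set ρ := M * Real.exp A with hρ
  have hρ0 : 0 ≤ ρ := by positivity
  have hr : ∀ t ∈ Ico 0 T, ∀ x, |r t x| ≤ ρ := fun t ht x =>
    (h.abs_r_le hL ha hδ hM ht x).trans (by have := hA t ht; rw [hρ]; gcongr)
  have hE0 := energy_nonneg L 1 (w 0) (r 0)
  refine ⟨Real.exp (C * ((1 + ρ) * T + A)) * energy L 1 (w 0) (r 0), by positivity, fun t ht => ?_⟩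
  have hsub : Icc 0 t ⊆ Ioo (-δ) T := Icc_subset_Ioo (by linarith) ht.2
  have hy := le_exp_mul_of_hasDerivAt (T := t)
    (Φ := fun t => C * ((1 + ρ) * t + ∫ s in (0 : ℝ)..t, gradNorm L a (w s)))
    (φ := fun t => C * (1 + ρ + gradNorm L a (w t)))
    (fun s hs => h.hasDerivAt_energy_one hL ha hI (hsub hs))
    (fun s hs => (((hasDerivAt_id s).const_mul (1 + ρ)).add
      (hasDerivAt_primitive_of_continuousOn hg h0 (hsub hs))).const_mul C |>.congr_deriv (by ring))
    (fun s hs => hCe _ _ (h.odd_w s (hsub hs)) (h.odd_r s (hsub hs)) ρ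
      (hr s ⟨hs.1, hs.2.trans_lt ht.2⟩)) ⟨ht.1, le_rfl⟩
  refine hy.trans ?_
  have h1 := hA t ht
  have h2 : (1 + ρ) * t ≤ (1 + ρ) * T := by have := ht.2.le; gcongr
  simp only [mul_zero, intervalIntegral.integral_same, add_zero, sub_zero]
  gcongr

end Continuation

end HouLuo
-- The cotangent weight and the quadratic lower bound.
namespace HouLuo
open MeasureTheory Set

/-- The weight `cot (π x / L)`. -/
noncomputable def cotWeight (L x : ℝ) : ℝ := Real.cos (Real.pi / L * x) / Real.sin (Real.pi / L * x)

section

variable {L : ℝ}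

theorem sin_pos_of_mem_Ioo (hL : 0 < L) {x : ℝ} (hx : x ∈ Ioo 0 L) : 0 < Real.sin (Real.pi / L * x) := by
  refine Real.sin_pos_of_pos_of_lt_pi (by have := hx.1; positivity) ?_
  rw [div_mul_eq_mul_div, div_lt_iff₀ hL]
  exact mul_lt_mul_of_pos_left hx.2 Real.pi_pos

theorem mul_le_pi_div_two (hL : 0 < L) {x : ℝ} (hx : x ≤ L / 2) : Real.pi / L * x ≤ Real.pi / 2 := by
  rw [div_mul_eq_mul_div, div_le_iff₀ hL]
  nlinarith [Real.pi_pos]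

theorem cos_nonneg_of_mem_Icc (hL : 0 < L) {x : ℝ} (hx : x ∈ Icc 0 (L / 2)) :
    0 ≤ Real.cos (Real.pi / L * x) := by
  refine Real.cos_nonneg_of_neg_pi_div_two_le_of_le ?_ (mul_le_pi_div_two hL hx.2)
  have : 0 ≤ Real.pi / L * x := mul_nonneg (by positivity) hx.1
  linarith [Real.pi_pos]

theorem two_mul_div_le_sin (hL : 0 < L) {x : ℝ} (hx : x ∈ Icc 0 (L / 2)) :
    2 * x / L ≤ Real.sin (Real.pi / L * x) := by
  have := Real.mul_le_sin (x := Real.pi / L * x) (mul_nonneg (by positivity) hx.1)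
    (mul_le_pi_div_two hL hx.2)
  have e : 2 / Real.pi * (Real.pi / L * x) = 2 * x / L := by field_simp
  rwa [e] at this

theorem mem_Ioo_of_mem_Ioc_half (hL : 0 < L) {x : ℝ} (hx : x ∈ Ioc 0 (L / 2)) : x ∈ Ioo 0 L :=
  ⟨hx.1, by linarith [hx.2]⟩

theorem cotWeight_nonneg (hL : 0 < L) {x : ℝ} (hx : x ∈ Ioc 0 (L / 2)) : 0 ≤ cotWeight L x :=
  div_nonneg (cos_nonneg_of_mem_Icc hL ⟨hx.1.le, hx.2⟩)
    (sin_pos_of_mem_Ioo hL (mem_Ioo_of_mem_Ioc_half hL hx)).le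

theorem cotWeight_half (hL : 0 < L) : cotWeight L (L / 2) = 0 := by
  have : Real.pi / L * (L / 2) = Real.pi / 2 := by field_simp
  simp [cotWeight, this]

/-- Jordan's inequality: 1 / sin has only a simple pole at 0, so functions with a zero at the origin
stay bounded against it, and against the cotangent. -/
theorem mul_inv_sin_le (hL : 0 < L) {x : ℝ} (hx : x ∈ Ioc 0 (L / 2)) :
    x / Real.sin (Real.pi / L * x) ≤ L / 2 := by
  have h1 := sin_pos_of_mem_Ioo hL (mem_Ioo_of_mem_Ioc_half hL hx)
  have h2 := two_mul_div_le_sin hL ⟨hx.1.le, hx.2⟩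
  rw [div_le_iff₀ h1]
  rw [div_le_iff₀ hL] at h2
  linarith

theorem mul_cotWeight_le (hL : 0 < L) {x : ℝ} (hx : x ∈ Ioc 0 (L / 2)) : x * cotWeight L x ≤ L / 2 := by
  have h1 := sin_pos_of_mem_Ioo hL (mem_Ioo_of_mem_Ioc_half hL hx)
  refine le_trans ?_ (mul_inv_sin_le hL hx)
  rw [cotWeight, ← mul_div_assoc]
  gcongr
  exact mul_le_of_le_one_right hx.1.le (Real.cos_le_one _)

theorem continuousOn_cotWeight (hL : 0 < L) : ContinuousOn (cotWeight L) (Ioo 0 L) :=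
  ContinuousOn.div (by fun_prop) (by fun_prop) fun _ hx => (sin_pos_of_mem_Ioo hL hx).ne'

theorem hasDerivAt_cotWeight (hL : 0 < L) {x : ℝ} (hx : x ∈ Ioo 0 L) :
    HasDerivAt (cotWeight L) (-(Real.pi / L) / Real.sin (Real.pi / L * x) ^ 2) x := by
  have h1 := sin_pos_of_mem_Ioo hL hx
  have hl : HasDerivAt (fun x => Real.pi / L * x) (Real.pi / L) x := by
    simpa using (hasDerivAt_id x).const_mul (Real.pi / L)
  refine (hl.cos.div hl.sin h1.ne').congr_deriv ?_
  congr 1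
  linear_combination -(Real.pi / L) * Real.sin_sq_add_cos_sq (Real.pi / L * x)

theorem exists_abs_le_mul {f : ℝ → ℝ} (hf : ContDiff ℝ ∞ f) (h0 : f 0 = 0) (ℓ : ℝ) :
    ∃ M, 0 ≤ M ∧ ∀ x ∈ Icc 0 ℓ, |f x| ≤ M * x := by
  have hc : Continuous (deriv f) := hf.continuous_deriv (by simp)
  obtain ⟨M, hM⟩ := isCompact_Icc (a := (0 : ℝ)) (b := ℓ) |>.exists_bound_of_continuousOn hc.continuousOn
  refine ⟨|M|, abs_nonneg _, fun x hx => ?_⟩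
  have := Convex.norm_image_sub_le_of_norm_deriv_le (f := f) (s := Icc 0 ℓ) (C := |M|)
    (fun y _ => (hf.differentiable (by simp)).differentiableAt)
    (fun y hy => (hM y hy).trans (le_abs_self _)) (convex_Icc _ _)
    (left_mem_Icc.2 (hx.1.trans hx.2)) hx
  simpa [h0, abs_of_nonneg hx.1] using this

theorem intervalIntegrable_of_continuousOn_Ioo {f : ℝ → ℝ} {α β C : ℝ} (hαβ : α ≤ β)
    (hf : ContinuousOn f (Ioo α β)) (hC : ∀ x ∈ Ioo α β, |f x| ≤ C) :
    IntervalIntegrable f volume α β := by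
  rw [intervalIntegrable_iff_integrableOn_Ioo_of_le hαβ]
  refine IntegrableOn.of_bound (C := C) (by simp) (hf.aestronglyMeasurable measurableSet_Ioo) ?_
  exact (ae_restrict_iff' measurableSet_Ioo).2 (Eventually.of_forall hC)

theorem abs_mul_cotWeight_le (hL : 0 < L) {f : ℝ → ℝ} {M : ℝ} (hM : 0 ≤ M)
    (hf : ∀ x ∈ Icc 0 (L / 2), |f x| ≤ M * x) {x : ℝ} (hx : x ∈ Ioc 0 (L / 2)) :
    |f x * cotWeight L x| ≤ M * (L / 2) := by
  rw [abs_mul, abs_of_nonneg (cotWeight_nonneg hL hx)]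
  calc |f x| * cotWeight L x ≤ M * x * cotWeight L x :=
        mul_le_mul_of_nonneg_right (hf x ⟨hx.1.le, hx.2⟩) (cotWeight_nonneg hL hx)
    _ = M * (x * cotWeight L x) := by ring
    _ ≤ _ := mul_le_mul_of_nonneg_left (mul_cotWeight_le hL hx) hM

theorem Ioo_half_subset (hL : 0 < L) : Ioo 0 (L / 2) ⊆ Ioo 0 L := Ioo_subset_Ioo_right (by linarith)

theorem intervalIntegrable_mul_cotWeight (hL : 0 < L) {f : ℝ → ℝ} (hf : ContDiff ℝ ∞ f) (h0 : f 0 = 0) :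
    IntervalIntegrable (fun x => f x * cotWeight L x) volume 0 (L / 2) := by
  obtain ⟨M, hM, hb⟩ := exists_abs_le_mul hf h0 (L / 2)
  exact intervalIntegrable_of_continuousOn_Ioo (by linarith)
    (hf.continuous.continuousOn.mul ((continuousOn_cotWeight hL).mono (Ioo_half_subset hL)))
    fun x hx => abs_mul_cotWeight_le hL hM hb ⟨hx.1, hx.2.le⟩

/-- Fubini on a triangle, in the form of an integration by parts. -/
theorem integral_mul_tail {θ r h : ℝ → ℝ} {ℓ : ℝ} (hℓ : 0 ≤ ℓ) (hθ : ∀ x, HasDerivAt θ (r x) x)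
    (hr : Continuous r) (h0 : θ 0 = 0) (hh : IntervalIntegrable h volume 0 ℓ)
    (hc : ContinuousOn h (Ioo 0 ℓ)) :
    ∫ x in (0 : ℝ)..ℓ, θ x * h x = ∫ z in (0 : ℝ)..ℓ, r z * ∫ x in z..ℓ, h x := by
  have hθc : Continuous θ := continuous_iff_continuousAt.2 fun x => (hθ x).continuousAt
  have hT : ContinuousOn (fun z => ∫ x in z..ℓ, h x) (Icc 0 ℓ) := by
    have := intervalIntegral.continuousOn_primitive_interval_left (f := h) (a := 0) (b := ℓ) (μ := volume)
      (by rw [uIcc_of_le hℓ]; exact (intervalIntegrable_iff_integrableOn_Icc_of_le hℓ).1 hh)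
    rwa [uIcc_of_le hℓ] at this
  have i1 : IntervalIntegrable (fun x => θ x * h x) volume 0 ℓ := hh.continuousOn_mul hθc.continuousOn
  have i2 : IntervalIntegrable (fun z => r z * ∫ x in z..ℓ, h x) volume 0 ℓ :=
    ContinuousOn.intervalIntegrable (by rw [uIcc_of_le hℓ]; exact hr.continuousOn.mul hT)
  -- The product of θ with the tail of h vanishes at both ends: θ at 0 and the tail at ℓ.
  have := intervalIntegral.integral_eq_sub_of_hasDerivAt_of_le hℓ
    (f := fun z => θ z * ∫ x in z..ℓ, h x) (f' := fun z => (r z * ∫ x in z..ℓ, h x) - θ z * h z)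
    (hθc.continuousOn.mul hT) (fun z hz => ?_) (i2.sub i1)
  · rw [intervalIntegral.integral_sub i2 i1] at this
    simp [h0] at this
    linarith
  · have hd : HasDerivAt (fun z => ∫ x in z..ℓ, h x) (-h z) z :=
      intervalIntegral.integral_hasDerivAt_left
        (hh.mono_set (by rw [uIcc_of_le hz.2.le, uIcc_of_le hℓ]; exact Icc_subset_Icc_left hz.1.le))
        (hc.stronglyMeasurableAtFilter isOpen_Ioo z hz) (hc.continuousAt (isOpen_Ioo.mem_nhds hz))
    exact ((hθ z).mul hd).congr_deriv (by ring)

theorem intervalIntegrable_sq_div_sin (hL : 0 < L) {θ : ℝ → ℝ} (hθs : ContDiff ℝ ∞ θ) (h0 : θ 0 = 0) :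
    IntervalIntegrable (fun x => (θ x / Real.sin (Real.pi / L * x)) ^ 2) volume 0 (L / 2) := by
  obtain ⟨M, hM, hb⟩ := exists_abs_le_mul hθs h0 (L / 2)
  have hL2 : 0 ≤ L / 2 := by linarith
  refine intervalIntegrable_of_continuousOn_Ioo (C := (M * (L / 2)) ^ 2) hL2
    ((hθs.continuous.continuousOn.div (by fun_prop) fun x hx =>
      (sin_pos_of_mem_Ioo hL (Ioo_half_subset hL hx)).ne').pow 2) fun x hx => ?_
  have hx' : x ∈ Ioc 0 (L / 2) := ⟨hx.1, hx.2.le⟩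
  have hs := sin_pos_of_mem_Ioo hL (Ioo_half_subset hL hx)
  rw [abs_pow]
  refine pow_le_pow_left₀ (abs_nonneg _) ?_ 2
  rw [abs_div, abs_of_pos hs]
  calc |θ x| / Real.sin (Real.pi / L * x) ≤ M * x / Real.sin (Real.pi / L * x) := by
        gcongr; exact hb x ⟨hx.1.le, hx.2.le⟩
    _ = M * (x / Real.sin (Real.pi / L * x)) := by ring
    _ ≤ _ := mul_le_mul_of_nonneg_left (mul_inv_sin_le hL hx') hM

/-- Integration by parts with θ θ' = (θ²)' / 2. The boundary terms vanish because cot(π/2) = 0 and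
because θ² cot tends to 0 at the origin, where θ has a zero. -/
theorem integral_mul_deriv_mul_cotWeight (hL : 0 < L) {θ r : ℝ → ℝ} (hθs : ContDiff ℝ ∞ θ)
    (hθ : ∀ x, HasDerivAt θ (r x) x) (hr : Continuous r) (h0 : θ 0 = 0) :
    ∫ x in (0 : ℝ)..L / 2, θ x * r x * cotWeight L x
      = Real.pi / L / 2 * ∫ x in (0 : ℝ)..L / 2, (θ x / Real.sin (Real.pi / L * x)) ^ 2 := by
  obtain ⟨M, hM, hb⟩ := exists_abs_le_mul hθs h0 (L / 2)
  have hL2 : 0 ≤ L / 2 := by linarith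
  have hcw := (continuousOn_cotWeight hL).mono (Ioo_half_subset hL)
  have i1 : IntervalIntegrable (fun x => θ x * r x * cotWeight L x) volume 0 (L / 2) := by
    have := (intervalIntegrable_mul_cotWeight hL hθs h0).continuousOn_mul hr.continuousOn
    refine this.congr fun x _ => ?_
    ring
  have i2 := intervalIntegrable_sq_div_sin hL hθs h0
  have hcont : ContinuousOn (fun x => θ x ^ 2 / 2 * cotWeight L x) (Icc 0 (L / 2)) := by
    intro x hx
    rcases hx.1.eq_or_lt with rfl | hx0
    · have hz : θ 0 ^ 2 / 2 * cotWeight L 0 = 0 := by simp [h0]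
      rw [ContinuousWithinAt, hz]
      refine squeeze_zero_norm' (a := fun x => M * (L / 2) * |θ x|) ?_ ?_
      · filter_upwards [self_mem_nhdsWithin] with x hx
        rcases hx.1.eq_or_lt with rfl | hx0
        · simp [h0]
        · have := abs_mul_cotWeight_le hL hM hb ⟨hx0, hx.2⟩
          have e : θ x ^ 2 / 2 * cotWeight L x = θ x * cotWeight L x * θ x / 2 := by ring
          rw [e, Real.norm_eq_abs, abs_div, abs_mul, abs_two]
          have h2 : |θ x * cotWeight L x| * |θ x| ≤ M * (L / 2) * |θ x| :=
            mul_le_mul_of_nonneg_right this (abs_nonneg _)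
          have h3 : 0 ≤ |θ x * cotWeight L x| * |θ x| := by positivity
          linarith
      · have : ContinuousAt (fun x => M * (L / 2) * |θ x|) 0 := by
          have := hθs.continuous
          fun_prop
        have h2 := this.tendsto
        simp only [h0, abs_zero, mul_zero] at h2
        exact h2.mono_left nhdsWithin_le_nhds
    · have hxL := mem_Ioo_of_mem_Ioc_half hL ⟨hx0, hx.2⟩
      exact ((((hθ x).continuousAt.pow 2).div_const 2).mul
        (hasDerivAt_cotWeight hL hxL).continuousAt).continuousWithinAt
  have key := intervalIntegral.integral_eq_sub_of_hasDerivAt_of_le hL2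
    (f := fun x => θ x ^ 2 / 2 * cotWeight L x)
    (f' := fun x => θ x * r x * cotWeight L x
      - Real.pi / L / 2 * (θ x / Real.sin (Real.pi / L * x)) ^ 2) hcont (fun x hx => ?_)
    (i1.sub (i2.const_mul _))
  · rw [intervalIntegral.integral_sub i1 (i2.const_mul _), intervalIntegral.integral_const_mul] at key
    simp only [cotWeight_half hL, h0] at key
    linarith
  · have := (((hθ x).pow 2).div_const 2).mul (hasDerivAt_cotWeight hL (Ioo_half_subset hL hx))
    refine this.congr_deriv ?_
    simp only [div_pow, Pi.pow_apply]
    push_cast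
    ring

/-- The quadratic lower bound that drives the blow-up. -/
theorem sq_integral_mul_cotWeight_le (hL : 0 < L) {θ r : ℝ → ℝ} (hθs : ContDiff ℝ ∞ θ)
    (hθ : ∀ x, HasDerivAt θ (r x) x) (hr : Continuous r) (h0 : θ 0 = 0) :
    Real.pi / L ^ 2 * (∫ x in (0 : ℝ)..L / 2, θ x * cotWeight L x) ^ 2
      ≤ ∫ x in (0 : ℝ)..L / 2, θ x * r x * cotWeight L x := by
  have hL2 : 0 ≤ L / 2 := by linarith
  rw [integral_mul_deriv_mul_cotWeight hL hθs hθ hr h0]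
  obtain ⟨M, hM, hb⟩ := exists_abs_le_mul hθs h0 (L / 2)
  have i1 := intervalIntegrable_mul_cotWeight hL hθs h0
  set J := ∫ x in (0 : ℝ)..L / 2, θ x * cotWeight L x with hJ
  have i2 : IntervalIntegrable (fun x => (θ x / Real.sin (Real.pi / L * x)) ^ 2) volume 0 (L / 2) :=
    intervalIntegrable_sq_div_sin hL hθs h0
  -- Cauchy–Schwarz in tangent form: λ = J / (L/2) is the mean of θ cot, and 2λs - λ² ≤ s² is
  -- integrated with s = θ cot, where s² ≤ (θ / sin)².
  have i3 : IntervalIntegrable (fun x => 2 * (J / (L / 2)) * (θ x * cotWeight L x)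
      - (J / (L / 2)) ^ 2) volume 0 (L / 2) := (i1.const_mul _).sub intervalIntegrable_const
  have h1 := intervalIntegral.integral_mono_on hL2 i3 i2 fun x _ => by
    have h2 : (θ x * cotWeight L x) ^ 2 ≤ (θ x / Real.sin (Real.pi / L * x)) ^ 2 := by
      rw [cotWeight, mul_div_assoc', div_pow, div_pow, mul_pow]
      gcongr
      exact mul_le_of_le_one_right (sq_nonneg _) (Real.cos_sq_le_one _)
    linarith [sq_nonneg (θ x * cotWeight L x - J / (L / 2))]
  rw [intervalIntegral.integral_sub (i1.const_mul _) intervalIntegrable_const,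
    intervalIntegral.integral_const_mul, ← hJ] at h1
  have h3 : 2 * (J / (L / 2)) * J - (J / (L / 2)) ^ 2 * (L / 2) = 2 / L * J ^ 2 := by
    field_simp
    ring
  simp only [intervalIntegral.integral_const, sub_zero, smul_eq_mul] at h1
  rw [show 2 * (J / (L / 2)) * J - L / 2 * (J / (L / 2)) ^ 2 = 2 / L * J ^ 2 by rw [← h3]; ring] at h1
  have h4 := mul_le_mul_of_nonneg_left (a := Real.pi / L / 2) h1
    (by positivity)
  refine le_trans (le_of_eq ?_) h4
  field_simp
end
end HouLuo
-- Lower bounds for the reflected kernel and the velocity.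
namespace HouLuo
open MeasureTheory Set

section

variable {L a : ℝ}

/-- Folding the period by oddness of w leaves an integral over [0, L/2] against the kernel minus its
reflection, which has a sign. -/
theorem velocity_eq_half (hL : 0 < L) (ha : 0 < a) {w : ℝ → ℝ} (hw : OddPeriodic L w) (x : ℝ) :
    velocity L a w x = ∫ y in (0 : ℝ)..L / 2, w y * (kern L a (x - y) - kern L a (x + y)) := by
  rw [velocity_eq_integral_kern_sub]
  have hper : Function.Periodic (fun y => w y * kern L a (x - y)) L := fun y => by
    simp only [hw.periodic y]
    rw [← kern_periodic hL a (x - (y + L))]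
    congr 2; ring
  have ii : ∀ b c, IntervalIntegrable (fun y => w y * kern L a (x - y)) volume b c := fun b c => by
    have := (intervalIntegrable_kern hL ha (x - b) (x - c)).comp_sub_left x
    simp only [sub_sub_cancel] at this
    exact this.continuousOn_mul hw.smooth.continuous.continuousOn
  have ij : ∀ b c, IntervalIntegrable (fun y => w y * kern L a (x + y)) volume b c := fun b c => by
    have := (intervalIntegrable_kern hL ha (x + b) (x + c)).comp_add_left x
    simp only [add_sub_cancel_left] at this
    exact this.continuousOn_mul hw.smooth.continuous.continuousOn
  have h2 := hper.intervalIntegral_add_eq 0 (-(L / 2))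
  rw [zero_add, show -(L / 2) + L = L / 2 by ring] at h2
  rw [h2, ← intervalIntegral.integral_add_adjacent_intervals (ii _ 0) (ii 0 _)]
  have h3 := intervalIntegral.integral_comp_neg (a := 0) (b := L / 2)
    (fun y => w y * kern L a (x - y))
  simp only [neg_zero] at h3
  rw [← h3]
  simp_rw [mul_sub]
  rw [intervalIntegral.integral_sub (ii _ _) (ij _ _), add_comm, sub_eq_add_neg,
    ← intervalIntegral.integral_neg]
  congr 2
  ext y
  rw [hw.odd, sub_neg_eq_add, neg_mul]

theorem kern_eq (ha : 0 < a) (z : ℝ) : kern L a z = 1 / (2 * Real.pi) *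
    (Real.log (Real.sin (Real.pi / L * z) ^ 2) - Real.log (Real.sin (Real.pi / L * z) ^ 2 + a)) := by
  rw [kern, abs_of_nonneg (sq_nonneg _), abs_of_nonneg (by positivity)]

/-- The inequality 1 - 1/x ≤ log x at x = n(m + a) / (m(n + a)). The hypothesis m ≤ 1 replaces m + a
by 1 + a in the denominator. -/
theorem log_ratio_lower {m n : ℝ} (ha : 0 < a) (hm : 0 < m) (hm1 : m ≤ 1) (hmn : m ≤ n) :
    a / (1 + a) * ((n - m) / n) ≤ Real.log n - Real.log (n + a) - (Real.log m - Real.log (m + a)) := by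
  have hn : 0 < n := hm.trans_le hmn
  have h := Real.one_sub_inv_le_log_of_pos (x := n * (m + a) / (m * (n + a))) (by positivity)
  rw [Real.log_div (by positivity) (by positivity), Real.log_mul (by positivity) (by positivity),
    Real.log_mul (by positivity) (by positivity)] at h
  refine le_trans ?_ (h.trans (le_of_eq (by ring)))
  have e : 1 - (n * (m + a) / (m * (n + a)))⁻¹ = a * (n - m) / (n * (m + a)) := by
    field_simp; ring
  rw [e, div_mul_div_comm]
  refine div_le_div_of_nonneg_left (mul_nonneg ha.le (by linarith)) (by positivity) ?_
  nlinarith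

theorem sin_mul_add (x y : ℝ) : Real.sin (Real.pi / L * (x + y))
    = Real.sin (Real.pi / L * x) * Real.cos (Real.pi / L * y)
      + Real.cos (Real.pi / L * x) * Real.sin (Real.pi / L * y) := by
  rw [mul_add, Real.sin_add]

theorem sin_mul_sub (x y : ℝ) : Real.sin (Real.pi / L * (x - y))
    = Real.sin (Real.pi / L * x) * Real.cos (Real.pi / L * y)
      - Real.cos (Real.pi / L * x) * Real.sin (Real.pi / L * y) := by
  rw [mul_sub, Real.sin_sub]

theorem cos_pos_of_mem_Ioo (hL : 0 < L) {x : ℝ} (hx : x ∈ Ioo 0 (L / 2)) :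
    0 < Real.cos (Real.pi / L * x) := by
  have h0 : 0 < Real.pi / L * x := mul_pos (by positivity) hx.1
  refine Real.cos_pos_of_mem_Ioo ⟨by linarith [Real.pi_pos], ?_⟩
  rw [div_mul_eq_mul_div, div_lt_iff₀ hL]
  nlinarith [Real.pi_pos, hx.2]

theorem sin_sub_sq_pos (hL : 0 < L) {x y : ℝ} (hx : x ∈ Ioo 0 (L / 2)) (hy : y ∈ Ioo 0 (L / 2))
    (hxy : x ≠ y) : 0 < Real.sin (Real.pi / L * (x - y)) ^ 2 := by
  have key : ∀ {x y : ℝ}, x ∈ Ioo 0 (L / 2) → y ∈ Ioo 0 (L / 2) → x < y →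
      0 < Real.sin (Real.pi / L * (y - x)) := fun hx hy h =>
    sin_pos_of_mem_Ioo hL ⟨sub_pos.2 h, by linarith [hx.1, hy.2]⟩
  rcases hxy.lt_or_gt with h | h
  · have := key hx hy h
    rw [← neg_sub, mul_neg, Real.sin_neg, neg_sq]
    positivity
  · have := key hy hx h
    positivity

/-- `log_ratio_lower` with n = sin² μ(x + y) and m = sin² μ(x - y), whose difference is 4 sin μx cos
μx sin μy cos μy. -/
theorem kern_sub_kern_lower (hL : 0 < L) (ha : 0 < a) {x y : ℝ} (hx : x ∈ Ioo 0 (L / 2))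
    (hy : y ∈ Ioo 0 (L / 2)) (hxy : x ≠ y) :
    1 / (2 * Real.pi) * (a / (1 + a)) * (4 * (Real.sin (Real.pi / L * x) * Real.cos (Real.pi / L * x) *
      (Real.sin (Real.pi / L * y) * Real.cos (Real.pi / L * y))) /
      Real.sin (Real.pi / L * (x + y)) ^ 2) ≤ kern L a (x + y) - kern L a (x - y) := by
  have h0 := sin_sub_sq_pos hL hx hy hxy
  have hs := sin_pos_of_mem_Ioo hL (Ioo_half_subset hL hx)
  have hq := sin_pos_of_mem_Ioo hL (Ioo_half_subset hL hy)
  have hc := cos_pos_of_mem_Ioo hL hx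
  have hp := cos_pos_of_mem_Ioo hL hy
  have e : Real.sin (Real.pi / L * (x + y)) ^ 2 - Real.sin (Real.pi / L * (x - y)) ^ 2
      = 4 * (Real.sin (Real.pi / L * x) * Real.cos (Real.pi / L * x) *
      (Real.sin (Real.pi / L * y) * Real.cos (Real.pi / L * y))) := by
    rw [sin_mul_add, sin_mul_sub]; ring
  have h1 := log_ratio_lower (n := Real.sin (Real.pi / L * (x + y)) ^ 2) ha h0 (Real.sin_sq_le_one _)
    (by rw [← sub_nonneg, e]; positivity)
  rw [e] at h1
  rw [kern_eq ha, kern_eq ha, ← mul_sub, mul_assoc]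
  exact mul_le_mul_of_nonneg_left h1 (by positivity)

theorem kern_sub_kern_nonneg (hL : 0 < L) (ha : 0 < a) {x y : ℝ} (hx : x ∈ Ioo 0 (L / 2))
    (hy : y ∈ Ioo 0 (L / 2)) (hxy : x ≠ y) : 0 ≤ kern L a (x + y) - kern L a (x - y) := by
  have hs := sin_pos_of_mem_Ioo hL (Ioo_half_subset hL hx)
  have hq := sin_pos_of_mem_Ioo hL (Ioo_half_subset hL hy)
  have hc := cos_pos_of_mem_Ioo hL hx
  have hp := cos_pos_of_mem_Ioo hL hy
  exact le_trans (by positivity) (kern_sub_kern_lower hL ha hx hy hxy)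

/-- For x < y, sin μ(y - x) > 0 gives sin μ(x + y) ≤ 2 sin μy cos μx. In the previous bound times
cot μx, the dependence on x then cancels and cot μy remains. -/
theorem kern_sub_kern_mul_cotWeight_lower (hL : 0 < L) (ha : 0 < a) {x y : ℝ} (hx : x ∈ Ioo 0 (L / 2))
    (hy : y ∈ Ioo 0 (L / 2)) (hxy : x < y) :
    1 / (2 * Real.pi) * (a / (1 + a)) * cotWeight L y
      ≤ (kern L a (x + y) - kern L a (x - y)) * cotWeight L x := by
  refine le_trans ?_ (mul_le_mul_of_nonneg_right (kern_sub_kern_lower hL ha hx hy hxy.ne)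
    (cotWeight_nonneg hL ⟨hx.1, hx.2.le⟩))
  have hs := sin_pos_of_mem_Ioo hL (Ioo_half_subset hL hx)
  have hq := sin_pos_of_mem_Ioo hL (Ioo_half_subset hL hy)
  have hc := cos_pos_of_mem_Ioo hL hx
  have hp := cos_pos_of_mem_Ioo hL hy
  have hd : 0 < Real.sin (Real.pi / L * (y - x)) :=
    sin_pos_of_mem_Ioo hL ⟨sub_pos.2 hxy, by linarith [hx.1, hy.2]⟩
  rw [sin_mul_sub] at hd
  rw [cotWeight, cotWeight, sin_mul_add, mul_assoc (1 / (2 * Real.pi) * (a / (1 + a)))]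
  refine mul_le_mul_of_nonneg_left ?_ (by positivity)
  set s := Real.sin (Real.pi / L * x)
  set c := Real.cos (Real.pi / L * x)
  set q := Real.sin (Real.pi / L * y)
  set p := Real.cos (Real.pi / L * y)
  have hn : 0 < s * p + c * q := by positivity
  rw [div_mul_div_comm, div_le_div_iff₀ hq (by positivity)]
  have h5 : (s * p + c * q) ^ 2 ≤ (2 * (q * c)) ^ 2 := pow_le_pow_left₀ hn.le (by linarith) 2
  have := mul_le_mul_of_nonneg_left h5 (by positivity : 0 ≤ p * s)
  nlinarith

theorem integral_nonneg_of_Ioo {f : ℝ → ℝ} {α β : ℝ} (hαβ : α ≤ β) (hf : IntervalIntegrable f volume α β)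
    (h : ∀ x ∈ Ioo α β, 0 ≤ f x) : 0 ≤ ∫ x in α..β, f x := by
  simpa using intervalIntegral.integral_mono_on_of_le_Ioo hαβ (f := fun _ => (0 : ℝ))
    intervalIntegrable_const hf h

/-- The velocity is controlled from above by the tail of `w cot`. -/
theorem tail_le_neg_velocity_mul_cotWeight (hL : 0 < L) (ha : 0 < a) {w : ℝ → ℝ} (hw : OddPeriodic L w)
    (h0 : ∀ x ∈ Icc 0 (L / 2), 0 ≤ w x) {x : ℝ} (hx : x ∈ Ioo 0 (L / 2)) :
    1 / (2 * Real.pi) * (a / (1 + a)) * ∫ y in x..L / 2, w y * cotWeight L y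
      ≤ -velocity L a w x * cotWeight L x := by
  have hcx := cotWeight_nonneg hL ⟨hx.1, hx.2.le⟩
  have ii : ∀ b c, IntervalIntegrable (fun y => w y * (kern L a (x + y) - kern L a (x - y))) volume b c :=
    fun b c => by
    have h1 := (intervalIntegrable_kern hL ha (x - b) (x - c)).comp_sub_left x
    simp only [sub_sub_cancel] at h1
    have h2 := (intervalIntegrable_kern hL ha (x + b) (x + c)).comp_add_left x
    simp only [add_sub_cancel_left] at h2
    exact (h2.sub h1).continuousOn_mul hw.smooth.continuous.continuousOn
  have e : -velocity L a w x * cotWeight L x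
      = ∫ y in (0 : ℝ)..L / 2, w y * (kern L a (x + y) - kern L a (x - y)) * cotWeight L x := by
    rw [velocity_eq_half hL ha hw, ← intervalIntegral.integral_neg, ← intervalIntegral.integral_mul_const]
    congr 1; ext y; ring
  rw [e, ← intervalIntegral.integral_add_adjacent_intervals ((ii 0 x).mul_const _)
    ((ii x (L / 2)).mul_const _), ← intervalIntegral.integral_const_mul]
  -- The contribution of y < x is nonnegative and is dropped; the comparison of weights is available
  -- only for y > x.
  have h1 : 0 ≤ ∫ y in (0 : ℝ)..x, w y * (kern L a (x + y) - kern L a (x - y)) * cotWeight L x := by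
    refine integral_nonneg_of_Ioo hx.1.le ((ii 0 x).mul_const _) fun y hy => ?_
    have hy' : y ∈ Ioo 0 (L / 2) := ⟨hy.1, hy.2.trans hx.2⟩
    exact mul_nonneg (mul_nonneg (h0 y ⟨hy'.1.le, hy'.2.le⟩)
      (kern_sub_kern_nonneg hL ha hx hy' hy.2.ne')) hcx
  refine le_add_of_nonneg_of_le h1 ?_
  have hsub : uIcc x (L / 2) ⊆ uIcc 0 (L / 2) := by
    rw [uIcc_of_le hx.2.le, uIcc_of_le (by linarith)]
    exact Icc_subset_Icc_left hx.1.le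
  refine intervalIntegral.integral_mono_on_of_le_Ioo hx.2.le
    (((intervalIntegrable_mul_cotWeight hL hw.smooth hw.apply_zero).mono_set hsub).const_mul _)
    ((ii x (L / 2)).mul_const _) fun y hy => ?_
  have hy' : y ∈ Ioo 0 (L / 2) := ⟨hx.1.trans hy.1, hy.2⟩
  have := mul_le_mul_of_nonneg_left (kern_sub_kern_mul_cotWeight_lower hL ha hx hy' hy.1)
    (h0 y ⟨hy'.1.le, hy'.2.le⟩)
  linarith
end
end HouLuo
-- Monotonicity of the derivative kernel in the regularisation.
namespace HouLuo
open MeasureTheory Set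

/-- With `s, c = sin μx, cos μx` and `q, p = sin μy, cos μy`, this is
`∂ₓ (cot μx (log (sin² μ(x - y) + τ) - log (sin² μ(x + y) + τ))) / μ`. -/
noncomputable def cotKernelDeriv (s c q p τ : ℝ) : ℝ :=
  -(Real.log ((s * p - c * q) ^ 2 + τ) - Real.log ((s * p + c * q) ^ 2 + τ)) / s ^ 2
    + 2 * (c / s) * ((s * p - c * q) * (c * p + s * q) / ((s * p - c * q) ^ 2 + τ)
      - (s * p + c * q) * (c * p - s * q) / ((s * p + c * q) ^ 2 + τ))

/-- Differentiation in τ removes the logarithms, and the resulting rational function factors: for s,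
c, q, p ≥ 0 its sign is opposite to that of (p² + τ)² - c⁴. -/
theorem hasDerivAt_cotKernelDeriv {s c q p τ : ℝ} (hs : 0 < s) (h1 : s ^ 2 + c ^ 2 = 1)
    (h2 : q ^ 2 + p ^ 2 = 1) (hτ : 0 < τ) :
    HasDerivAt (cotKernelDeriv s c q p) (-8 * (s * c * (q * p)) * ((p ^ 2 + τ) ^ 2 - (c ^ 2) ^ 2)
      / (((s * p - c * q) ^ 2 + τ) ^ 2 * ((s * p + c * q) ^ 2 + τ) ^ 2)) τ := by
  have hM : 0 < (s * p - c * q) ^ 2 + τ := by positivity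
  have hN : 0 < (s * p + c * q) ^ 2 + τ := by positivity
  have dM : HasDerivAt (fun τ => (s * p - c * q) ^ 2 + τ) 1 τ := (hasDerivAt_id τ).const_add _
  have dN : HasDerivAt (fun τ => (s * p + c * q) ^ 2 + τ) 1 τ := (hasDerivAt_id τ).const_add _
  have d := (((dM.log hM.ne').sub (dN.log hN.ne')).neg.div_const (s ^ 2)).add
    ((((hasDerivAt_const τ ((s * p - c * q) * (c * p + s * q))).div dM hM.ne').sub
      ((hasDerivAt_const τ ((s * p + c * q) * (c * p - s * q))).div dN hN.ne')).const_mul (2 * (c / s)))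
  refine d.congr_deriv ?_
  set M := (s * p - c * q) ^ 2 + τ with hMd
  set N := (s * p + c * q) ^ 2 + τ with hNd
  have hC : s ^ 2 = 1 - c ^ 2 := by linarith
  have hQ : q ^ 2 = 1 - p ^ 2 := by linarith
  have e1 : M - N = -4 * (s * c * (q * p)) := by rw [hMd, hNd]; ring
  have e2 : M + N = 2 * ((1 - c ^ 2) * p ^ 2 + c ^ 2 * (1 - p ^ 2)) + 2 * τ := by
    rw [hMd, hNd, ← hC, ← hQ]; ring
  have e3 : M * N = (p ^ 2 - c ^ 2) ^ 2 + τ * (M + N) - τ ^ 2 := by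
    have : (s * p - c * q) * (s * p + c * q) = p ^ 2 - c ^ 2 := by
      linear_combination p ^ 2 * hC - c ^ 2 * hQ
    rw [← this, hMd, hNd]; ring
  have e4 : (s * p + c * q) * (c * p - s * q) = s * c * (p ^ 2 - q ^ 2) + q * p * (c ^ 2 - s ^ 2) := by ring
  have e5 : (s * p - c * q) * (c * p + s * q) = s * c * (p ^ 2 - q ^ 2) - q * p * (c ^ 2 - s ^ 2) := by ring
  -- Once the factor s c q p is extracted, the rest is symmetric in M and N, hence expressed by M +
  -- N and M N. These become polynomials in c², p², τ after eliminating s² and q².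
  have key : -(N - M) * (M * N) + 2 * (c * s) * ((s * p + c * q) * (c * p - s * q) * M ^ 2
      - (s * p - c * q) * (c * p + s * q) * N ^ 2)
      = s ^ 2 * (-8 * (s * c * (q * p)) * ((p ^ 2 + τ) ^ 2 - (c ^ 2) ^ 2)) := by
    have f1 : -(N - M) * (M * N) + 2 * (c * s) * ((s * p + c * q) * (c * p - s * q) * M ^ 2
      - (s * p - c * q) * (c * p + s * q) * N ^ 2)
      = 2 * (s * c * (q * p)) * (-2 * (M * N) - 4 * (s ^ 2 * c ^ 2 * (p ^ 2 - q ^ 2)) * (M + N)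
        + (c ^ 2 - s ^ 2) * ((M + N) ^ 2 - 2 * (M * N))) := by
      rw [e4, e5]
      linear_combination (M * N + 2 * (c * s) * (s * c * (p ^ 2 - q ^ 2)) * (M + N)) * e1
    rw [f1, e3, e2, hQ, hC]
    ring
  rw [mul_comm M N] at *
  field_simp
  linear_combination key

/-- The condition c ≤ p, that is y ≤ x, gives c² ≤ p² + τ and so fixes the sign of the derivative.
-/
theorem cotKernelDeriv_antitoneOn {s c q p : ℝ} (hs : 0 < s) (hc : 0 ≤ c) (hq : 0 ≤ q)
    (h1 : s ^ 2 + c ^ 2 = 1) (h2 : q ^ 2 + p ^ 2 = 1) (hcp : c ≤ p) :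
    AntitoneOn (cotKernelDeriv s c q p) (Ioi 0) := by
  have hd := fun τ (hτ : τ ∈ Ioi (0 : ℝ)) => hasDerivAt_cotKernelDeriv hs h1 h2 hτ
  refine antitoneOn_of_deriv_nonpos (convex_Ioi 0) (fun τ hτ => (hd τ hτ).continuousAt.continuousWithinAt)
    (fun τ hτ => (hd τ (interior_subset hτ)).differentiableAt.differentiableWithinAt) fun τ hτ => ?_
  have hτ' : 0 < τ := interior_subset hτ
  rw [(hd τ hτ').deriv]
  have hp : 0 ≤ p := hc.trans hcp
  have h3 : c ^ 2 ≤ p ^ 2 + τ := by nlinarith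
  have h4 : 0 ≤ (p ^ 2 + τ) ^ 2 - (c ^ 2) ^ 2 := sub_nonneg.2 (pow_le_pow_left₀ (sq_nonneg c) h3 2)
  refine div_nonpos_of_nonpos_of_nonneg ?_ (by positivity)
  have : 0 ≤ s * c * (q * p) * ((p ^ 2 + τ) ^ 2 - (c ^ 2) ^ 2) := by positivity
  linarith

/-- Adding the swapped kernel, the numerators combine to (p² + τ)² - c⁴ + (c² + τ)² - p⁴ = 2τ(p² +
c² + τ), which is nonnegative whatever the order of x and y. -/
theorem cotKernelDeriv_add_swap_antitoneOn {s c q p : ℝ} (hs : 0 < s) (hc : 0 ≤ c) (hq : 0 < q)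
    (hp : 0 ≤ p) (h1 : s ^ 2 + c ^ 2 = 1) (h2 : q ^ 2 + p ^ 2 = 1) :
    AntitoneOn (fun τ => cotKernelDeriv s c q p τ + cotKernelDeriv q p s c τ) (Ioi 0) := by
  have hd := fun τ (hτ : τ ∈ Ioi (0 : ℝ)) => (hasDerivAt_cotKernelDeriv hs h1 h2 hτ).add
    (hasDerivAt_cotKernelDeriv hq h2 h1 hτ)
  refine antitoneOn_of_deriv_nonpos (convex_Ioi 0) (fun τ hτ => (hd τ hτ).continuousAt.continuousWithinAt)
    (fun τ hτ => (hd τ (interior_subset hτ)).differentiableAt.differentiableWithinAt) fun τ hτ => ?_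
  have hτ' : 0 < τ := interior_subset hτ
  refine (hd τ hτ').deriv.le.trans ?_
  have e : (q * c - p * s) ^ 2 = (s * p - c * q) ^ 2 := by ring
  have e' : (q * c + p * s) ^ 2 = (s * p + c * q) ^ 2 := by ring
  rw [e, e', ← add_div]
  refine div_nonpos_of_nonpos_of_nonneg ?_ (by positivity)
  have : 0 ≤ 16 * (s * c * (q * p)) * (τ * (p ^ 2 + c ^ 2 + τ)) := by positivity
  nlinarith
end HouLuo
-- Positivity of the stretching term for the mollified kernel.
namespace HouLuo
open MeasureTheory Set

/-- The inner integral is split at z. For y < z ≤ x the kernel itself is nonnegative; on the square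
[z, ℓ]² the integral equals half that of the symmetrised kernel, because the weight w(x) w(y) is
symmetric. -/
theorem integral_integral_nonneg_of_symm {w : ℝ → ℝ} {K : ℝ → ℝ → ℝ} {z ℓ β : ℝ} (hz : 0 < z) (hzℓ : z ≤ ℓ)
    (hℓ : ℓ < β) (hw : Continuous w) (hw0 : ∀ x ∈ Icc 0 ℓ, 0 ≤ w x)
    (cK : ContinuousOn (fun p : ℝ × ℝ => K p.1 p.2) (Ioo 0 β ×ˢ univ))
    (h1 : ∀ x ∈ Ioo 0 ℓ, ∀ y ∈ Ioo 0 ℓ, y ≤ x → 0 ≤ K x y)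
    (h2 : ∀ x ∈ Ioo 0 ℓ, ∀ y ∈ Ioo 0 ℓ, 0 ≤ K x y + K y x) :
    0 ≤ ∫ x in z..ℓ, w x * ∫ y in (0 : ℝ)..ℓ, w y * K x y := by
  have hsub : Icc z ℓ ⊆ Ioo 0 β := fun x hx => ⟨hz.trans_le hx.1, hx.2.trans_lt hℓ⟩
  have hsq : ContinuousOn (fun p : ℝ × ℝ => K p.1 p.2) (Icc z ℓ ×ˢ Icc z ℓ) :=
    cK.mono (prod_mono hsub (subset_univ _))
  have cy : ∀ x ∈ Ioo 0 β, Continuous (K x) := fun x hx => continuousOn_univ.1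
    (cK.comp (f := fun y : ℝ => (x, y)) (by fun_prop) fun y _ => ⟨hx, mem_univ _⟩)
  have ii : ∀ x ∈ Ioo 0 β, ∀ b c, IntervalIntegrable (fun y => w y * K x y) volume b c := fun x hx b c =>
    (hw.mul (cy x hx)).intervalIntegrable _ _
  have cA : ∀ b c, ContinuousOn (fun x => w x * ∫ y in b..c, w y * K x y) (Icc z ℓ) := fun b c x hx =>
    hw.continuousWithinAt.mul (continuousAt_weighted_integral (k := w) (hw.intervalIntegrable b c) isOpen_Ioo
      (f := K) cK (hsub hx)).continuousWithinAt
  have iA : ∀ b c, IntervalIntegrable (fun x => w x * ∫ y in b..c, w y * K x y) volume z ℓ := fun b c =>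
    ContinuousOn.intervalIntegrable (by rw [uIcc_of_le hzℓ]; exact cA b c)
  have e : ∫ x in z..ℓ, w x * ∫ y in (0 : ℝ)..ℓ, w y * K x y
      = (∫ x in z..ℓ, w x * ∫ y in (0 : ℝ)..z, w y * K x y)
        + ∫ x in z..ℓ, w x * ∫ y in z..ℓ, w y * K x y := by
    rw [← intervalIntegral.integral_add (iA _ _) (iA _ _)]
    refine intervalIntegral.integral_congr fun x hx => ?_
    rw [uIcc_of_le hzℓ] at hx
    rw [← intervalIntegral.integral_add_adjacent_intervals (ii x (hsub hx) 0 z) (ii x (hsub hx) z ℓ), mul_add]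
  have hA : 0 ≤ ∫ x in z..ℓ, w x * ∫ y in (0 : ℝ)..z, w y * K x y := by
    refine integral_nonneg_of_Ioo hzℓ (iA _ _) fun x hx => mul_nonneg (hw0 x ⟨(hz.trans hx.1).le, hx.2.le⟩) ?_
    refine integral_nonneg_of_Ioo hz.le (ii x (hsub (Ioo_subset_Icc_self hx)) _ _) fun y hy => ?_
    exact mul_nonneg (hw0 y ⟨hy.1.le, (hy.2.le.trans hzℓ)⟩)
      (h1 x ⟨hz.trans hx.1, hx.2⟩ y ⟨hy.1, hy.2.trans_le hzℓ⟩ (hy.2.trans hx.1).le)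
  have hJ : ∫ x in z..ℓ, w x * ∫ y in z..ℓ, w y * K x y
      = ∫ x in z..ℓ, w x * ∫ y in z..ℓ, w y * K y x := by
    simp_rw [← intervalIntegral.integral_const_mul]
    rw [intervalIntegral_intervalIntegral_swap]
    · congr 1; ext x; congr 1; ext y; ring
    · rw [uIoc_of_le hzℓ]
      refine (ContinuousOn.integrableOn_compact (isCompact_Icc.prod isCompact_Icc) ?_).mono_set
        (prod_mono Ioc_subset_Icc_self Ioc_subset_Icc_self)
      exact (hw.comp continuous_fst).continuousOn.mul ((hw.comp continuous_snd).continuousOn.mul hsq)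
  have cK' : ∀ x ∈ Icc z ℓ, ContinuousOn (fun y => w y * K y x) (Icc z ℓ) := fun x hx =>
    hw.continuousOn.mul (hsq.comp (f := fun y : ℝ => (y, x)) (by fun_prop) fun y hy => ⟨hy, hx⟩)
  have iK' : ∀ x ∈ Icc z ℓ, IntervalIntegrable (fun y => w y * K y x) volume z ℓ := fun x hx =>
    ContinuousOn.intervalIntegrable (by rw [uIcc_of_le hzℓ]; exact cK' x hx)
  have iB : IntervalIntegrable (fun x => w x * ∫ y in z..ℓ, w y * K y x) volume z ℓ := by
    have hF : IntegrableOn (fun p : ℝ × ℝ => w p.1 * (w p.2 * K p.2 p.1)) (Ioc z ℓ ×ˢ Ioc z ℓ) := by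
      refine (ContinuousOn.integrableOn_compact (isCompact_Icc.prod isCompact_Icc) ?_).mono_set
        (prod_mono Ioc_subset_Icc_self Ioc_subset_Icc_self)
      exact (hw.comp continuous_fst).continuousOn.mul ((hw.comp continuous_snd).continuousOn.mul
        (hsq.comp (f := fun p : ℝ × ℝ => (p.2, p.1)) (by fun_prop) fun p hp => ⟨hp.2, hp.1⟩))
    rw [IntegrableOn, Measure.volume_eq_prod, ← Measure.prod_restrict] at hF
    rw [intervalIntegrable_iff_integrableOn_Ioc_of_le hzℓ]
    refine hF.integral_prod_left.congr (Eventually.of_forall fun x => ?_)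
    simp only
    rw [integral_const_mul, intervalIntegral.integral_of_le hzℓ]
  have hS : 0 ≤ (∫ x in z..ℓ, w x * ∫ y in z..ℓ, w y * K x y)
      + ∫ x in z..ℓ, w x * ∫ y in z..ℓ, w y * K y x := by
    rw [← intervalIntegral.integral_add (iA _ _) iB]
    refine integral_nonneg_of_Ioo hzℓ ((iA _ _).add iB) fun x hx => ?_
    have hx' := Ioo_subset_Icc_self hx
    rw [← mul_add, ← intervalIntegral.integral_add (ii x (hsub hx') _ _) (iK' x hx')]
    refine mul_nonneg (hw0 x ⟨(hz.trans hx.1).le, hx.2.le⟩)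
      (integral_nonneg_of_Ioo hzℓ ((ii x (hsub hx') _ _).add (iK' x hx')) fun y hy => ?_)
    rw [← mul_add]
    exact mul_nonneg (hw0 y ⟨(hz.trans hy.1).le, hy.2.le⟩)
      (h2 x ⟨hz.trans hx.1, hx.2⟩ y ⟨hz.trans hy.1, hy.2⟩)
  rw [e]
  linarith

section

variable {L a : ℝ}

/-- The difference of the logarithmic kernel with its reflection, regularised by `τ`. -/
noncomputable def logReflect (L τ x y : ℝ) : ℝ :=
  Real.log (Real.sin (Real.pi / L * (x - y)) ^ 2 + τ) - Real.log (Real.sin (Real.pi / L * (x + y)) ^ 2 + τ)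

/-- The derivative in `x` of `logReflect L τ x y * cot (π x / L)`, up to the factor `π / L`. -/
noncomputable def logReflectDeriv (L τ x y : ℝ) : ℝ :=
  cotKernelDeriv (Real.sin (Real.pi / L * x)) (Real.cos (Real.pi / L * x))
    (Real.sin (Real.pi / L * y)) (Real.cos (Real.pi / L * y)) τ

theorem hasDerivAt_log_sin_sq_add {τ : ℝ} (hτ : 0 < τ) (b x : ℝ) :
    HasDerivAt (fun x => Real.log (Real.sin (Real.pi / L * (x + b)) ^ 2 + τ))
      (2 * (Real.pi / L) * (Real.sin (Real.pi / L * (x + b)) * Real.cos (Real.pi / L * (x + b)))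
        / (Real.sin (Real.pi / L * (x + b)) ^ 2 + τ)) x := by
  have h0 : 0 < Real.sin (Real.pi / L * (x + b)) ^ 2 + τ := by positivity
  have hl : HasDerivAt (fun x => Real.pi / L * (x + b)) (Real.pi / L) x := by
    simpa using ((hasDerivAt_id x).add_const b).const_mul (Real.pi / L)
  refine (((hl.sin.pow 2).add_const τ).log h0.ne').congr_deriv ?_
  simp only [Pi.pow_apply]
  push_cast
  ring

theorem hasDerivAt_logReflect_mul_cotWeight (hL : 0 < L) {τ : ℝ} (hτ : 0 < τ) {x : ℝ} (hx : x ∈ Ioo 0 L)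
    (y : ℝ) : HasDerivAt (fun x => logReflect L τ x y * cotWeight L x)
      (Real.pi / L * logReflectDeriv L τ x y) x := by
  have h1 : HasDerivAt (fun x => logReflect L τ x y) _ x :=
    (hasDerivAt_log_sin_sq_add (L := L) hτ (-y) x).sub (hasDerivAt_log_sin_sq_add (L := L) hτ y x)
  refine (h1.mul (hasDerivAt_cotWeight hL hx)).congr_deriv ?_
  have hs := (sin_pos_of_mem_Ioo hL hx).ne'
  have hc1 : Real.cos (Real.pi / L * (x - y)) = Real.cos (Real.pi / L * x) * Real.cos (Real.pi / L * y)
      + Real.sin (Real.pi / L * x) * Real.sin (Real.pi / L * y) := by rw [mul_sub, Real.cos_sub]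
  have hc2 : Real.cos (Real.pi / L * (x + y)) = Real.cos (Real.pi / L * x) * Real.cos (Real.pi / L * y)
      - Real.sin (Real.pi / L * x) * Real.sin (Real.pi / L * y) := by rw [mul_add, Real.cos_add]
  simp only [← sub_eq_add_neg, hc1, hc2, logReflect, logReflectDeriv, cotKernelDeriv, cotWeight, sin_mul_add,
    sin_mul_sub]
  ring

theorem continuousOn_logReflectDeriv (hL : 0 < L) {τ : ℝ} (hτ : 0 < τ) :
    ContinuousOn (fun p : ℝ × ℝ => logReflectDeriv L τ p.1 p.2) (Ioo 0 L ×ˢ univ) := by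
  have hs : ∀ p ∈ Ioo 0 L ×ˢ (univ : Set ℝ), Real.sin (Real.pi / L * p.1) ≠ 0 := fun p hp =>
    (sin_pos_of_mem_Ioo hL hp.1).ne'
  have h0 : ∀ r : ℝ, r ^ 2 + τ ≠ 0 := fun r => by positivity
  unfold logReflectDeriv cotKernelDeriv
  refine ContinuousOn.add (ContinuousOn.div (ContinuousOn.neg (ContinuousOn.sub ?_ ?_)) (by fun_prop)
    fun p hp => pow_ne_zero 2 (hs p hp)) (ContinuousOn.mul (ContinuousOn.mul continuousOn_const
    (ContinuousOn.div (by fun_prop) (by fun_prop) hs)) (ContinuousOn.sub ?_ ?_))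
  · exact ContinuousOn.log (by fun_prop) fun _ _ => h0 _
  · exact ContinuousOn.log (by fun_prop) fun _ _ => h0 _
  · exact ContinuousOn.div (by fun_prop) (by fun_prop) fun _ _ => h0 _
  · exact ContinuousOn.div (by fun_prop) (by fun_prop) fun _ _ => h0 _

theorem continuous_logReflect {τ : ℝ} (hτ : 0 < τ) :
    Continuous (fun p : ℝ × ℝ => logReflect L τ p.1 p.2) := by
  have h0 : ∀ r : ℝ, r ^ 2 + τ ≠ 0 := fun r => by positivity
  unfold logReflect
  exact (Continuous.log (by fun_prop) fun _ => h0 _).sub (Continuous.log (by fun_prop) fun _ => h0 _)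

/-- The velocity of the mollified kernel `kern L a - kern L τ`. -/
theorem velocity_sub_velocity_eq (hL : 0 < L) (ha : 0 < a) {τ : ℝ} (hτ : 0 < τ) {w : ℝ → ℝ}
    (hw : OddPeriodic L w) (x : ℝ) : velocity L a w x - velocity L τ w x
      = ∫ y in (0 : ℝ)..L / 2, w y * (1 / (2 * Real.pi) * (logReflect L τ x y - logReflect L a x y)) := by
  have ii : ∀ {b : ℝ}, 0 < b → IntervalIntegrable (fun y => w y * (kern L b (x - y) - kern L b (x + y)))
      volume 0 (L / 2) := fun {b} hb => by
    have h1 := (intervalIntegrable_kern hL hb (x - 0) (x - L / 2)).comp_sub_left x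
    have h2 := (intervalIntegrable_kern hL hb (x + 0) (x + L / 2)).comp_add_left x
    simp only [sub_sub_cancel, add_sub_cancel_left] at h1 h2
    exact (h1.sub h2).continuousOn_mul hw.smooth.continuous.continuousOn
  rw [velocity_eq_half hL ha hw, velocity_eq_half hL hτ hw, ← intervalIntegral.integral_sub (ii ha) (ii hτ)]
  congr 1; ext y
  rw [← mul_sub, kern_eq ha, kern_eq ha, kern_eq hτ, kern_eq hτ, logReflect, logReflect]
  ring

/-- Positivity of the stretching term for the mollified kernel. -/
theorem mollified_stretching_nonneg (hL : 0 < L) {τ : ℝ} (hτ : 0 < τ) (hτa : τ ≤ a) {w : ℝ → ℝ}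
    (hw : OddPeriodic L w) (h0 : ∀ x ∈ Icc 0 (L / 2), 0 ≤ w x) {z : ℝ} (hz : z ∈ Ioo 0 (L / 2)) :
    0 ≤ -(w z * ((velocity L a w z - velocity L τ w z) * cotWeight L z))
      - ∫ x in z..L / 2, deriv w x * ((velocity L a w x - velocity L τ w x) * cotWeight L x) := by
  have ha : 0 < a := hτ.trans_le hτa
  set K : ℝ → ℝ → ℝ := fun x y => 1 / (2 * Real.pi) * (Real.pi / L) *
    (logReflectDeriv L τ x y - logReflectDeriv L a x y) with hK
  set v : ℝ → ℝ := fun x => (velocity L a w x - velocity L τ w x) * cotWeight L x with hv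
  have hwc := hw.smooth.continuous
  have cK : ContinuousOn (fun p : ℝ × ℝ => K p.1 p.2) (Ioo 0 L ×ˢ univ) :=
    continuousOn_const.mul ((continuousOn_logReflectDeriv hL hτ).sub (continuousOn_logReflectDeriv hL ha))
  have dv : ∀ x ∈ Ioo 0 L, HasDerivAt v (∫ y in (0 : ℝ)..L / 2, w y * K x y) x := fun x hx => by
    have e : v = fun x => ∫ y in (0 : ℝ)..L / 2, w y *
        (1 / (2 * Real.pi) * ((logReflect L τ x y - logReflect L a x y) * cotWeight L x)) := by
      ext x
      rw [hv]
      simp only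
      rw [velocity_sub_velocity_eq hL ha hτ hw, ← intervalIntegral.integral_mul_const]
      congr 1; ext y; ring
    rw [e]
    refine hasDerivAt_weighted_integral (k := w) (f := fun x y => 1 / (2 * Real.pi) *
      ((logReflect L τ x y - logReflect L a x y) * cotWeight L x)) (f' := K)
      (hwc.intervalIntegrable _ _) isOpen_Ioo ?_ cK (fun x hx y => ?_) hx
    · refine continuousOn_const.mul (((continuous_logReflect hτ).sub (continuous_logReflect ha)).continuousOn.mul
        ((continuousOn_cotWeight hL).comp continuousOn_fst fun p hp => hp.1))
    · have := ((hasDerivAt_logReflect_mul_cotWeight hL hτ hx y).sub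
        (hasDerivAt_logReflect_mul_cotWeight hL ha hx y)).const_mul (1 / (2 * Real.pi))
      refine (this.congr_deriv (by rw [hK]; ring)).congr_of_eventuallyEq (Eventually.of_forall fun x => ?_)
      simp only [Pi.sub_apply]
      ring
  have hsub : Icc z (L / 2) ⊆ Ioo 0 L := fun x hx => ⟨hz.1.trans_le hx.1, by linarith [hx.2]⟩
  have cv : ContinuousOn v (Icc z (L / 2)) := fun x hx => (dv x (hsub hx)).continuousAt.continuousWithinAt
  have cv' : ContinuousOn (fun x => ∫ y in (0 : ℝ)..L / 2, w y * K x y) (Icc z (L / 2)) := fun x hx =>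
    (continuousAt_weighted_integral (k := w) (hwc.intervalIntegrable _ _) isOpen_Ioo
      (f := K) cK (hsub hx)).continuousWithinAt
  have cdw : Continuous (deriv w) := hw.smooth.continuous_deriv (by simp)
  have i1 : IntervalIntegrable (fun x => deriv w x * v x) volume z (L / 2) :=
    ContinuousOn.intervalIntegrable (by rw [uIcc_of_le hz.2.le]; exact cdw.continuousOn.mul cv)
  have i2 : IntervalIntegrable (fun x => w x * ∫ y in (0 : ℝ)..L / 2, w y * K x y) volume z (L / 2) :=
    ContinuousOn.intervalIntegrable (by rw [uIcc_of_le hz.2.le]; exact hwc.continuousOn.mul cv')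
  -- Since w vanishes at L/2, the boundary term and the integral of w' v combine to ∫ w v' over [z,
  -- L/2], and v' is the integral of w against K.
  have ftc := intervalIntegral.integral_eq_sub_of_hasDerivAt_of_le hz.2.le (f := fun x => w x * v x)
    (hwc.continuousOn.mul cv) (fun x hx =>
      ((hw.smooth.differentiable (by simp)).differentiableAt.hasDerivAt.mul
        (dv x (hsub (Ioo_subset_Icc_self hx))))) (i1.add i2)
  rw [intervalIntegral.integral_add i1 i2, hw.apply_half, zero_mul] at ftc
  have e : -(w z * v z) - ∫ x in z..L / 2, deriv w x * v x
      = ∫ x in z..L / 2, w x * ∫ y in (0 : ℝ)..L / 2, w y * K x y := by linarith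
  rw [e]
  have hc0 : 0 ≤ 1 / (2 * Real.pi) * (Real.pi / L) := by positivity
  refine integral_integral_nonneg_of_symm hz.1 hz.2.le (by linarith) hwc h0 cK
    (fun x hx y hy hyx => ?_) fun x hx y hy => ?_
  -- K is the value at τ minus the value at a ≥ τ, so its sign is monotonicity in the parameter; the
  -- cosine being decreasing turns y ≤ x into the required order.
  · refine mul_nonneg hc0 (sub_nonneg.2 ?_)
    have hs := sin_pos_of_mem_Ioo hL (Ioo_half_subset hL hx)
    have hq := sin_pos_of_mem_Ioo hL (Ioo_half_subset hL hy)
    have hc := cos_pos_of_mem_Ioo hL hx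
    refine cotKernelDeriv_antitoneOn hs hc.le hq.le (Real.sin_sq_add_cos_sq _) (Real.sin_sq_add_cos_sq _)
      ?_ hτ ha hτa
    refine Real.cos_le_cos_of_nonneg_of_le_pi (mul_nonneg (by positivity) hy.1.le) ?_ (by gcongr)
    linarith [mul_le_pi_div_two hL hx.2.le, Real.pi_pos]
  · have hs := sin_pos_of_mem_Ioo hL (Ioo_half_subset hL hx)
    have hq := sin_pos_of_mem_Ioo hL (Ioo_half_subset hL hy)
    have hc := cos_pos_of_mem_Ioo hL hx
    have hp := cos_pos_of_mem_Ioo hL hy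
    have := cotKernelDeriv_add_swap_antitoneOn hs hc.le hq hp.le (Real.sin_sq_add_cos_sq _)
      (Real.sin_sq_add_cos_sq _) hτ ha hτa
    rw [hK, ← mul_add]
    refine mul_nonneg hc0 ?_
    simp only [logReflectDeriv]
    linarith
end
end HouLuo
-- Removal of the mollification and the two differential inequalities.
namespace HouLuo
open MeasureTheory Set

section

variable {L a : ℝ}

/-- As τ → 0 the two logarithms in the kernel cancel. Hence `velocity L τ w` tends uniformly to 0
for bounded periodic w, and the mollified velocity tends to the true one. -/
theorem tendsto_kernNorm_zero (hL : 0 < L) : Tendsto (kernNorm L) (𝓝[>] 0) (𝓝 0) := by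
  have hint := intervalIntegrable_log_sin_sq hL 0 L
  have hint1 := (continuous_log_sin_sq_add (L := L) one_pos).intervalIntegrable (μ := volume) 0 L
  have key : Tendsto (fun τ => ∫ y in (0 : ℝ)..L, |kern L τ y|) (𝓝[>] 0) (𝓝 (∫ _ in (0 : ℝ)..L, (0 : ℝ))) := by
    refine intervalIntegral.tendsto_integral_filter_of_dominated_convergence
      (fun y => 1 / (2 * Real.pi) * (2 * abs (Real.log |Real.sin (Real.pi / L * y) ^ 2|)
        + abs (Real.log |Real.sin (Real.pi / L * y) ^ 2 + 1|))) ?_ ?_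
      (((hint.abs.const_mul 2).add hint1.abs).const_mul _) ?_
    · filter_upwards [self_mem_nhdsWithin] with τ hτ
      exact (intervalIntegrable_kern hL hτ 0 L).abs.aestronglyMeasurable_restrict_uIoc
    · filter_upwards [Ioo_mem_nhdsGT one_pos] with τ hτ
      -- The endpoint L, where the sine vanishes, is negligible. Elsewhere log(sin² + τ) lies
      -- between its values for τ = 0 and τ = 1, whence the majorant.
      filter_upwards [compl_mem_ae_iff.2 (measure_singleton L)] with y hyL hy
      rw [uIoc_of_le hL.le] at hy
      have hs := sin_pos_of_mem_Ioo hL ⟨hy.1, lt_of_le_of_ne hy.2 hyL⟩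
      have hs2 : 0 < Real.sin (Real.pi / L * y) ^ 2 := by positivity
      rw [Real.norm_eq_abs, abs_abs, kern_eq hτ.1, abs_mul, abs_of_nonneg (by positivity : 0 ≤ 1 / (2 * Real.pi)),
        abs_of_pos hs2, abs_of_pos (by positivity : 0 < Real.sin (Real.pi / L * y) ^ 2 + 1)]
      refine mul_le_mul_of_nonneg_left ?_ (by positivity)
      set S := Real.sin (Real.pi / L * y) ^ 2
      have h1 : Real.log S ≤ Real.log (S + τ) := Real.log_le_log hs2 (by linarith [hτ.1])
      have h2 : Real.log (S + τ) ≤ Real.log (S + 1) :=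
        Real.log_le_log (by linarith [hτ.1]) (by linarith [hτ.2])
      have h3 := neg_abs_le (Real.log S)
      have h4 := le_abs_self (Real.log (S + 1))
      rw [abs_le]
      constructor <;> linarith [abs_nonneg (Real.log S), abs_nonneg (Real.log (S + 1)), le_abs_self (Real.log S)]
    · filter_upwards [compl_mem_ae_iff.2 (measure_singleton L)] with y hyL hy
      rw [uIoc_of_le hL.le] at hy
      have hs := sin_pos_of_mem_Ioo hL ⟨hy.1, lt_of_le_of_ne hy.2 hyL⟩
      have hs2 : 0 < Real.sin (Real.pi / L * y) ^ 2 := by positivity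
      have hc : ContinuousAt (fun τ => |kern L τ y|) 0 := by
        unfold kern
        refine (continuousAt_const.mul (continuousAt_const.sub (ContinuousAt.log (by fun_prop) ?_))).abs
        rw [add_zero]
        exact (abs_pos.2 hs2.ne').ne'
      have h0 : |kern L 0 y| = 0 := by simp [kern]
      have := hc.tendsto
      rw [h0] at this
      exact this.mono_left nhdsWithin_le_nhds
  simp only [intervalIntegral.integral_zero] at key
  exact key

theorem OddPeriodic.exists_abs_le (hL : 0 < L) {w : ℝ → ℝ} (hw : OddPeriodic L w) :
    ∃ M, 0 ≤ M ∧ ∀ x, |w x| ≤ M := by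
  obtain ⟨M, hM⟩ := hw.periodic.isBounded_of_continuous hL.ne' hw.smooth.continuous |>.exists_norm_le
  exact ⟨|M|, abs_nonneg _, fun x => (hM _ (mem_range_self x)).trans (le_abs_self _)⟩

/-- Positivity of the stretching term. -/
theorem stretching_nonneg (hL : 0 < L) (ha : 0 < a) {w : ℝ → ℝ} (hw : OddPeriodic L w)
    (h0 : ∀ x ∈ Icc 0 (L / 2), 0 ≤ w x) {z : ℝ} (hz : z ∈ Ioo 0 (L / 2)) :
    0 ≤ -(w z * (velocity L a w z * cotWeight L z))
      - ∫ x in z..L / 2, deriv w x * (velocity L a w x * cotWeight L x) := by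
  obtain ⟨M, hM, hb⟩ := hw.exists_abs_le hL
  have hsub : Icc z (L / 2) ⊆ Ioo 0 L := fun x hx => ⟨hz.1.trans_le hx.1, by linarith [hx.2]⟩
  have hcw := (continuousOn_cotWeight hL).mono hsub
  have cdw : Continuous (deriv w) := hw.smooth.continuous_deriv (by simp)
  have ii : ∀ {b : ℝ}, 0 < b → IntervalIntegrable
      (fun x => deriv w x * (velocity L b w x * cotWeight L x)) volume z (L / 2) := fun hb =>
    ContinuousOn.intervalIntegrable (by
      rw [uIcc_of_le hz.2.le]
      exact cdw.continuousOn.mul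
        ((velocity_continuous hL hb hw.periodic hw.smooth.continuous).continuousOn.mul hcw))
  have id : IntervalIntegrable (fun x => |deriv w x| * (M * cotWeight L x)) volume z (L / 2) :=
    ContinuousOn.intervalIntegrable (by
      rw [uIcc_of_le hz.2.le]
      exact cdw.abs.continuousOn.mul (continuousOn_const.mul hcw))
  set H := -(w z * (velocity L a w z * cotWeight L z))
      - ∫ x in z..L / 2, deriv w x * (velocity L a w x * cotWeight L x) with hH
  set D := |w z| * (M * cotWeight L z) + ∫ x in z..L / 2, |deriv w x| * (M * cotWeight L x) with hD
  -- Replacing the mollified velocity by the full one costs at most `kernNorm L τ` times the fixed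
  -- quantity D, which disappears in the limit.
  have key : ∀ τ ∈ Ioo 0 a, 0 ≤ H + kernNorm L τ * D := fun τ hτ => by
    have h1 := mollified_stretching_nonneg hL hτ.1 hτ.2.le hw h0 hz
    have hpt : ∀ x ∈ Icc z (L / 2), ∀ b : ℝ, b * (velocity L τ w x * cotWeight L x)
        ≤ kernNorm L τ * (|b| * (M * cotWeight L x)) := fun x hx b => by
      have hc := cotWeight_nonneg hL ⟨hz.1.trans_le hx.1, hx.2⟩
      have hv := abs_velocity_le hL hτ.1 hw.periodic hb x
      calc b * (velocity L τ w x * cotWeight L x) ≤ |b * (velocity L τ w x * cotWeight L x)| := le_abs_self _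
        _ = |b| * (|velocity L τ w x| * cotWeight L x) := by rw [abs_mul, abs_mul, abs_of_nonneg hc]
        _ ≤ |b| * (kernNorm L τ * M * cotWeight L x) := by gcongr
        _ = _ := by ring
    have h2 := hpt z (left_mem_Icc.2 hz.2.le) (w z)
    have h3 := intervalIntegral.integral_mono_on hz.2.le (ii hτ.1) (id.const_mul (kernNorm L τ))
      fun x hx => hpt x hx (deriv w x)
    rw [intervalIntegral.integral_const_mul] at h3
    have e : ∫ x in z..L / 2, deriv w x * ((velocity L a w x - velocity L τ w x) * cotWeight L x)
        = (∫ x in z..L / 2, deriv w x * (velocity L a w x * cotWeight L x))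
          - ∫ x in z..L / 2, deriv w x * (velocity L τ w x * cotWeight L x) := by
      rw [← intervalIntegral.integral_sub (ii ha) (ii hτ.1)]
      congr 1; ext x; ring
    rw [e] at h1
    rw [hH, hD, mul_add]
    linarith
  have ht : Tendsto (fun τ => H + kernNorm L τ * D) (𝓝[>] 0) (𝓝 (H + 0 * D)) :=
    ((tendsto_kernNorm_zero hL).mul_const D).const_add H
  rw [zero_mul, add_zero] at ht
  exact ge_of_tendsto ht (by filter_upwards [Ioo_mem_nhdsGT ha] with τ hτ using key τ hτ)

variable {w θ r : ℝ → ℝ}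

/-- This is X' ≥ c₁ Y. Fubini rewrites Y as the integral of r against the tail of w cot, and the
tail is bounded pointwise by -u cot. -/
theorem integral_velocity_mul_cotWeight_lower (hL : 0 < L) (ha : 0 < a) (hw : OddPeriodic L w)
    (hw0 : ∀ x ∈ Icc 0 (L / 2), 0 ≤ w x) (hr : ContDiff ℝ ∞ r) (hr0 : ∀ x ∈ Icc 0 (L / 2), 0 ≤ r x)
    (hθ : ∀ x, HasDerivAt θ (r x) x) (h0 : θ 0 = 0) :
    1 / (2 * Real.pi) * (a / (1 + a)) * ∫ x in (0 : ℝ)..L / 2, θ x * w x * cotWeight L x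
      ≤ ∫ x in (0 : ℝ)..L / 2, -(velocity L a w x * r x) * cotWeight L x := by
  have hL2 : 0 ≤ L / 2 := by linarith
  have hu := hw.velocity hL ha
  have iw := intervalIntegrable_mul_cotWeight hL hw.smooth hw.apply_zero
  have e := integral_mul_tail hL2 hθ hr.continuous h0 iw
    (hw.smooth.continuous.continuousOn.mul ((continuousOn_cotWeight hL).mono (Ioo_half_subset hL)))
  simp_rw [mul_assoc (θ _)]
  rw [e, ← intervalIntegral.integral_const_mul]
  have hT : ContinuousOn (fun z => ∫ x in z..L / 2, w x * cotWeight L x) (Icc 0 (L / 2)) := by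
    have := intervalIntegral.continuousOn_primitive_interval_left (f := fun x => w x * cotWeight L x)
      (a := 0) (b := L / 2) (μ := volume)
      (by rw [uIcc_of_le hL2]; exact (intervalIntegrable_iff_integrableOn_Icc_of_le hL2).1 iw)
    rwa [uIcc_of_le hL2] at this
  refine intervalIntegral.integral_mono_on_of_le_Ioo hL2
    (ContinuousOn.intervalIntegrable (by
      rw [uIcc_of_le hL2]; exact continuousOn_const.mul (hr.continuous.continuousOn.mul hT)))
    (intervalIntegrable_mul_cotWeight hL (f := fun x => -(velocity L a w x * r x)) ((hu.smooth.mul hr).neg)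
      (by simp [hu.apply_zero])) fun x hx => ?_
  have := mul_le_mul_of_nonneg_left (tail_le_neg_velocity_mul_cotWeight hL ha hw hw0 hx)
    (hr0 x ⟨hx.1.le, hx.2.le⟩)
  linarith

/-- This is Y' ≥ c₂ X². Apart from ∫ θ r cot, Fubini collects the terms of Y' into an integral of
r(z) times the stretching term at z, and both factors are nonnegative. -/
theorem sq_le_integral_deriv_mul_cotWeight (hL : 0 < L) (ha : 0 < a) (hw : OddPeriodic L w)
    (hw0 : ∀ x ∈ Icc 0 (L / 2), 0 ≤ w x) (hr : ContDiff ℝ ∞ r) (hr0 : ∀ x ∈ Icc 0 (L / 2), 0 ≤ r x)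
    (hθs : ContDiff ℝ ∞ θ) (hθ : ∀ x, HasDerivAt θ (r x) x) (h0 : θ 0 = 0) :
    Real.pi / L ^ 2 * (∫ x in (0 : ℝ)..L / 2, θ x * cotWeight L x) ^ 2
      ≤ ∫ x in (0 : ℝ)..L / 2, (-(velocity L a w x * r x) * w x
        + θ x * (r x - velocity L a w x * deriv w x)) * cotWeight L x := by
  have hL2 : 0 ≤ L / 2 := by linarith
  have hu := hw.velocity hL ha
  have hdw : ContDiff ℝ ∞ (deriv w) := hw.smooth.deriv' 
  refine (sq_integral_mul_cotWeight_le hL hθs hθ hr.continuous h0).trans ?_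
  have i1 : IntervalIntegrable (fun x => θ x * r x * cotWeight L x) volume 0 (L / 2) :=
    intervalIntegrable_mul_cotWeight hL (f := fun x => θ x * r x) (hθs.mul hr) (by simp [h0])
  have i2 : IntervalIntegrable (fun x => velocity L a w x * r x * w x * cotWeight L x) volume 0 (L / 2) :=
    intervalIntegrable_mul_cotWeight hL (f := fun x => velocity L a w x * r x * w x)
      ((hu.smooth.mul hr).mul hw.smooth) (by simp [hu.apply_zero])
  have ih : IntervalIntegrable (fun x => deriv w x * velocity L a w x * cotWeight L x) volume 0 (L / 2) :=
    intervalIntegrable_mul_cotWeight hL (f := fun x => deriv w x * velocity L a w x)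
      (hdw.mul hu.smooth) (by simp [hu.apply_zero])
  have i3 : IntervalIntegrable (fun x => θ x * (deriv w x * velocity L a w x * cotWeight L x)) volume 0 (L / 2) :=
    ih.continuousOn_mul hθs.continuous.continuousOn
  have e3 := integral_mul_tail hL2 hθ hr.continuous h0 ih
    ((hdw.mul hu.smooth).continuous.continuousOn.mul ((continuousOn_cotWeight hL).mono (Ioo_half_subset hL)))
  have i4 : IntervalIntegrable (fun z => r z * ∫ x in z..L / 2, deriv w x * velocity L a w x * cotWeight L x)
      volume 0 (L / 2) := by
    have := intervalIntegral.continuousOn_primitive_interval_left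
      (f := fun x => deriv w x * velocity L a w x * cotWeight L x) (a := 0) (b := L / 2) (μ := volume)
      (by rw [uIcc_of_le hL2]; exact (intervalIntegrable_iff_integrableOn_Icc_of_le hL2).1 ih)
    exact ContinuousOn.intervalIntegrable (hr.continuous.continuousOn.mul this)
  have e : ∫ x in (0 : ℝ)..L / 2, (-(velocity L a w x * r x) * w x
        + θ x * (r x - velocity L a w x * deriv w x)) * cotWeight L x
      = (∫ x in (0 : ℝ)..L / 2, θ x * r x * cotWeight L x)
        - (∫ x in (0 : ℝ)..L / 2, velocity L a w x * r x * w x * cotWeight L x)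
        - ∫ x in (0 : ℝ)..L / 2, θ x * (deriv w x * velocity L a w x * cotWeight L x) := by
    rw [← intervalIntegral.integral_sub i1 i2, ← intervalIntegral.integral_sub (i1.sub i2) i3]
    congr 1; ext x; ring
  have hpos : 0 ≤ ∫ z in (0 : ℝ)..L / 2, -(velocity L a w z * r z * w z * cotWeight L z)
      - r z * ∫ x in z..L / 2, deriv w x * velocity L a w x * cotWeight L x := by
    refine integral_nonneg_of_Ioo hL2 (i2.neg.sub i4) fun z hz => ?_
    have := mul_nonneg (hr0 z ⟨hz.1.le, hz.2.le⟩) (stretching_nonneg hL ha hw hw0 hz)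
    simp_rw [← mul_assoc (deriv w _)] at this
    linarith
  have i2n : IntervalIntegrable (fun x => -(velocity L a w x * r x * w x * cotWeight L x)) volume 0 (L / 2) :=
    i2.neg
  rw [intervalIntegral.integral_sub i2n i4, intervalIntegral.integral_neg] at hpos
  rw [e, e3]
  linarith
end
end HouLuo
-- Finite lifespan from the differential inequalities.
namespace HouLuo
open MeasureTheory Set

/-- Weighted arithmetic–geometric mean. The weights 2/5 and 3/5 give x³ and y² the common power 6/5.
-/
theorem rpow_mul_le_sq_add_cube {x y : ℝ} (hx : 0 ≤ x) (hy : 0 ≤ y) :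
    (x * y) ^ (6 / 5 : ℝ) ≤ y ^ 2 + x ^ 3 := by
  have h := Real.geom_mean_le_arith_mean2_weighted (w₁ := 2 / 5) (w₂ := 3 / 5) (by norm_num) (by norm_num)
    (pow_nonneg hx 3) (pow_nonneg hy 2) (by norm_num)
  rw [← Real.rpow_natCast, ← Real.rpow_natCast, ← Real.rpow_mul hx, ← Real.rpow_mul hy,
    show ((3 : ℕ) : ℝ) * (2 / 5) = 6 / 5 by norm_num, show ((2 : ℕ) : ℝ) * (3 / 5) = 6 / 5 by norm_num,
    ← Real.mul_rpow hx hy, Real.rpow_natCast, Real.rpow_natCast] at h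
  linarith [pow_nonneg hx 3, pow_nonneg hy 2]

/-- Solutions of the differential inequalities `x' ≥ c₁ y`, `y' ≥ c₂ x²` have a bounded lifespan. -/
theorem exists_lifespan_bound {c₁ c₂ x₀ : ℝ} (hc₁ : 0 < c₁) (hc₂ : 0 < c₂) (hx₀ : 0 < x₀) :
    ∃ B, ∀ (T : ℝ) (x y x' y' : ℝ → ℝ), (∀ t ∈ Ico 0 T, HasDerivAt x (x' t) t) →
      (∀ t ∈ Ico 0 T, HasDerivAt y (y' t) t) → (∀ t ∈ Ico 0 T, c₁ * y t ≤ x' t) →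
      (∀ t ∈ Ico 0 T, c₂ * x t ^ 2 ≤ y' t) → 0 ≤ y 0 → x 0 = x₀ → T ≤ B := by
  set c := min c₁ c₂ with hc
  have hc0 : 0 < c := lt_min hc₁ hc₂
  -- p bounds (xy)^(-1/5) at time 1. Afterwards this positive quantity decreases at rate at least c
  -- / 5, which can last no longer than 5p / c.
  set p := (c₂ * x₀ ^ 3) ^ (-(1 / 5) : ℝ) with hp
  have hp0 : 0 < p := by positivity
  refine ⟨1 + 5 * p / c, fun T x y x' y' hx hy hx' hy' hy0 hx0 => ?_⟩
  by_contra! hT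
  have hB : 1 + 5 * p / c ∈ Ico 1 T := ⟨le_add_of_nonneg_right (by positivity), hT⟩
  have mono : ∀ {f f' : ℝ → ℝ}, (∀ t ∈ Ico 0 T, HasDerivAt f (f' t) t) → (∀ t ∈ Ico 0 T, 0 ≤ f' t) →
      MonotoneOn f (Ico 0 T) := fun {f f'} hf hf' =>
    monotoneOn_of_deriv_nonneg (convex_Ico 0 T) (fun t ht => (hf t ht).continuousAt.continuousWithinAt)
      (fun t ht => (hf t (interior_subset ht)).differentiableAt.differentiableWithinAt)
      fun t ht => by rw [(hf t (interior_subset ht)).deriv]; exact hf' t (interior_subset ht)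
  have h0T : (0 : ℝ) ∈ Ico 0 T := ⟨le_rfl, by linarith [hB.1, hB.2]⟩
  have y0 : ∀ t ∈ Ico 0 T, 0 ≤ y t := fun t ht =>
    hy0.trans (mono hy (fun t ht => le_trans (by positivity) (hy' t ht)) h0T ht ht.1)
  have xx : ∀ t ∈ Ico 0 T, x₀ ≤ x t := fun t ht => by
    rw [← hx0]
    exact mono hx (fun t ht => le_trans (mul_nonneg hc₁.le (y0 t ht)) (hx' t ht)) h0T ht ht.1
  -- Only y 0 ≥ 0 is known. One unit of time is spent to make y, and hence the product xy, positive
  -- with an explicit lower bound.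
  have yy : ∀ t ∈ Ico 0 T, c₂ * x₀ ^ 2 * t ≤ y t := fun t ht => by
    have := mono (f := fun t => y t - c₂ * x₀ ^ 2 * t) (f' := fun t => y' t - c₂ * x₀ ^ 2)
      (fun t ht => ((hy t ht).sub ((hasDerivAt_id t).const_mul (c₂ * x₀ ^ 2))).congr_deriv (by simp))
      (fun t ht => sub_nonneg.2 (le_trans (by gcongr; exact xx t ht) (hy' t ht))) h0T ht ht.1
    simp only [mul_zero, sub_zero] at this
    linarith
  have hsub : Ico 1 T ⊆ Ico 0 T := Ico_subset_Ico_left zero_le_one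
  have hP : ∀ t ∈ Ico 1 T, c₂ * x₀ ^ 3 ≤ x t * y t := fun t ht => by
    have h1 : c₂ * x₀ ^ 2 ≤ y t := le_trans (le_mul_of_one_le_right (by positivity) ht.1) (yy t (hsub ht))
    calc c₂ * x₀ ^ 3 = x₀ * (c₂ * x₀ ^ 2) := by ring
      _ ≤ x t * y t := mul_le_mul (xx t (hsub ht)) h1 (by positivity) (hx₀.le.trans (xx t (hsub ht)))
  have hP0 : ∀ t ∈ Ico 1 T, 0 < x t * y t := fun t ht => lt_of_lt_of_le (by positivity) (hP t ht)
  have hd : ∀ t ∈ Ico 1 T, HasDerivAt (fun t => (x t * y t) ^ (-(1 / 5) : ℝ) + c / 5 * t)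
      ((x' t * y t + x t * y' t) * (-(1 / 5)) * (x t * y t) ^ (-(1 / 5) - 1 : ℝ) + c / 5) t := fun t ht =>
    ((((hx t (hsub ht)).mul (hy t (hsub ht))).rpow_const (p := (-(1 / 5) : ℝ))
      (Or.inl (hP0 t ht).ne')).add ((hasDerivAt_id t).const_mul (c / 5))).congr_deriv (by simp)
  have anti := antitoneOn_of_deriv_nonpos (convex_Ico 1 T)
    (fun t ht => (hd t ht).continuousAt.continuousWithinAt)
    (fun t ht => (hd t (interior_subset ht)).differentiableAt.differentiableWithinAt) fun t ht => by
      have ht1 : t ∈ Ico 1 T := interior_subset ht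
      have ht0 := hsub ht1
      rw [(hd t ht1).deriv]
      have hx0' : 0 ≤ x t := hx₀.le.trans (xx t ht0)
      have h1 : c * (x t * y t) ^ (6 / 5 : ℝ) ≤ x' t * y t + x t * y' t := by
        calc c * (x t * y t) ^ (6 / 5 : ℝ) ≤ c * (y t ^ 2 + x t ^ 3) :=
              mul_le_mul_of_nonneg_left (rpow_mul_le_sq_add_cube hx0' (y0 t ht0)) hc0.le
          _ ≤ c₁ * y t ^ 2 + c₂ * x t ^ 3 := by
              rw [mul_add]
              exact add_le_add (mul_le_mul_of_nonneg_right (min_le_left _ _) (sq_nonneg _))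
                (mul_le_mul_of_nonneg_right (min_le_right _ _) (pow_nonneg hx0' 3))
          _ = c₁ * y t * y t + x t * (c₂ * x t ^ 2) := by ring
          _ ≤ _ := add_le_add (mul_le_mul_of_nonneg_right (hx' t ht0) (y0 t ht0))
              (mul_le_mul_of_nonneg_left (hy' t ht0) hx0')
      have h2 := mul_le_mul_of_nonneg_right h1 (Real.rpow_nonneg (hP0 t ht1).le (-(1 / 5) - 1 : ℝ))
      rw [mul_assoc, ← Real.rpow_add (hP0 t ht1), show (6 / 5 + (-(1 / 5) - 1) : ℝ) = 0 by norm_num,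
        Real.rpow_zero, mul_one] at h2
      linarith
  have h1 := anti (⟨le_rfl, by linarith [hB.1, hB.2]⟩ : (1 : ℝ) ∈ Ico 1 T) hB hB.1
  have h2 := Real.rpow_le_rpow_of_nonpos (by positivity) (hP 1 ⟨le_rfl, by linarith [hB.1, hB.2]⟩)
    (by norm_num : (-(1 / 5) : ℝ) ≤ 0)
  have h3 := Real.rpow_pos_of_pos (hP0 _ hB) (-(1 / 5) : ℝ)
  have e : c / 5 * (1 + 5 * p / c) = c / 5 + p := by field_simp
  simp only [e] at h1
  linarith

section

variable {L a : ℝ}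

/-- The cotangent is not integrable at 0. The zero of f' there, with a bound on its x-derivative
uniform for times near t, gives |f'| ≤ |M| x and thus a constant majorant. -/
theorem hasDerivAt_integral_mul_cotWeight (hL : 0 < L) {I : Set ℝ} (hI : IsOpen I) {f f' : ℝ → ℝ → ℝ}
    (cf : ContDiffOn ℝ ∞ (fun p : ℝ × ℝ => f p.1 p.2) (I ×ˢ univ))
    (cf' : ContDiffOn ℝ ∞ (fun p : ℝ × ℝ => f' p.1 p.2) (I ×ˢ univ))
    (h0 : ∀ t ∈ I, f t 0 = 0) (h0' : ∀ t ∈ I, f' t 0 = 0)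
    (hd : ∀ t ∈ I, ∀ x, HasDerivAt (fun s => f s x) (f' t x) t) {t : ℝ} (ht : t ∈ I) :
    HasDerivAt (fun t => ∫ x in (0 : ℝ)..L / 2, f t x * cotWeight L x)
      (∫ x in (0 : ℝ)..L / 2, f' t x * cotWeight L x) t := by
  have hL2 : 0 ≤ L / 2 := by linarith
  obtain ⟨V, hV, hVI, hVc⟩ := local_compact_nhds (hI.mem_nhds ht)
  have cd := (contDiffOn_deriv hI cf').continuousOn
  obtain ⟨M, hM⟩ := (hVc.prod (isCompact_Icc (a := (0 : ℝ)) (b := L / 2))).exists_bound_of_continuousOn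
    (cd.mono (prod_mono hVI (subset_univ _)))
  have slice : ∀ {g : ℝ → ℝ → ℝ}, ContDiffOn ℝ ∞ (fun p : ℝ × ℝ => g p.1 p.2) (I ×ˢ univ) →
      ∀ t ∈ I, ContDiff ℝ ∞ (g t) := fun {g} cg t ht => contDiffOn_univ.1
    (cg.comp (f := fun x : ℝ => (t, x)) (by fun_prop) fun x _ => ⟨ht, mem_univ _⟩)
  have hb : ∀ s ∈ V, ∀ x ∈ Icc 0 (L / 2), |f' s x| ≤ |M| * x := fun s hs x hx => by
    have := Convex.norm_image_sub_le_of_norm_deriv_le (f := f' s) (s := Icc 0 (L / 2)) (C := |M|)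
      (fun y _ => ((slice cf' s (hVI hs)).differentiable (by simp)).differentiableAt)
      (fun y hy => (hM (s, y) ⟨hs, hy⟩).trans (le_abs_self _)) (convex_Icc _ _)
      (left_mem_Icc.2 hL2) hx
    simpa [h0' s (hVI hs), abs_of_nonneg hx.1] using this
  have ii : ∀ {g : ℝ → ℝ → ℝ}, ContDiffOn ℝ ∞ (fun p : ℝ × ℝ => g p.1 p.2) (I ×ˢ univ) →
      (∀ t ∈ I, g t 0 = 0) → ∀ t ∈ I, IntervalIntegrable (fun x => g t x * cotWeight L x) volume 0 (L / 2) :=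
    fun cg hg t ht => intervalIntegrable_mul_cotWeight hL (slice cg t ht) (hg t ht)
  refine (intervalIntegral.hasDerivAt_integral_of_dominated_loc_of_deriv_le (s := V)
    (F := fun t x => f t x * cotWeight L x) (F' := fun t x => f' t x * cotWeight L x)
    (bound := fun _ => |M| * (L / 2)) hV ?_ (ii cf h0 t ht)
    (ii cf' h0' t ht).aestronglyMeasurable_restrict_uIoc ?_ intervalIntegrable_const ?_).2
  · filter_upwards [hV] with s hs
    exact (ii cf h0 s (hVI hs)).aestronglyMeasurable_restrict_uIoc
  · refine Eventually.of_forall fun x hx s hs => ?_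
    rw [uIoc_of_le hL2] at hx
    exact abs_mul_cotWeight_le hL (abs_nonneg M) (hb s hs) hx
  · exact Eventually.of_forall fun x _ s hs => (hd s (hVI hs) x).mul_const _

variable {δ T : ℝ} {w r : ℝ → ℝ → ℝ}

/-- The equation r_t + u r_x + u_x r = 0 is a transport equation with zeroth order term, and u
vanishes at 0 and L/2 by oddness and periodicity. -/
theorem IsSmoothSolution.nonneg_r (h : IsSmoothSolution L a (Ioo (-δ) T) w r) (hL : 0 < L) (ha : 0 < a)
    (hδ : 0 < δ) (h0 : ∀ x ∈ Icc 0 (L / 2), 0 ≤ r 0 x) {t : ℝ} (ht : t ∈ Ico 0 T) :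
    ∀ x ∈ Icc 0 (L / 2), 0 ≤ r t x := by
  have hI : IsOpen (Ioo (-δ) T) := isOpen_Ioo
  have hsub : Icc 0 t ⊆ Ioo (-δ) T := Icc_subset_Ioo (by linarith) ht.2
  have cu := (h.contDiffOn_velocity hL ha hI).continuousOn
  have cux := h.continuousOn_deriv_velocity hL ha hI
  have cr := h.smooth_r.continuousOn
  have crx := (contDiffOn_deriv hI h.smooth_r).continuousOn
  have hu : ∀ t ∈ Ioo (-δ) T, OddPeriodic L (velocity L a (w t)) := fun t ht =>
    (h.odd_w t ht).velocity hL ha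
  refine nonneg_of_transport hI ht.1 hsub (by linarith) (q := r)
    (qt := fun t x => gradRhs L a (w t) (r t) x) (qx := fun t => deriv (r t))
    (u := fun t => velocity L a (w t)) (ux := fun t => deriv (velocity L a (w t)))
    (c := fun t => deriv (velocity L a (w t)))
    (fun t ht x => (h.eq_r t ht x).congr_deriv (gradRhs_eq hL ha (h.odd_w t ht) (h.odd_r t ht) x).symm)
    (fun t ht x => (h.odd_r t ht).hasDerivAt x) (fun t ht x => (hu t ht).hasDerivAt x)
    cr ((cux.mul cr).add (cu.mul crx)).neg crx cux cux
    (fun t ht => (hu t ht).apply_zero) (fun t ht => (hu t ht).apply_half) (fun t ht x _ => ?_) h0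
  unfold gradRhs
  linarith

/-- The vorticity is transported with source r, which is already known to be nonnegative. -/
theorem IsSmoothSolution.nonneg_w (h : IsSmoothSolution L a (Ioo (-δ) T) w r) (hL : 0 < L) (ha : 0 < a)
    (hδ : 0 < δ) (h0 : ∀ x ∈ Icc 0 (L / 2), 0 ≤ w 0 x) (h0' : ∀ x ∈ Icc 0 (L / 2), 0 ≤ r 0 x)
    {t : ℝ} (ht : t ∈ Ico 0 T) : ∀ x ∈ Icc 0 (L / 2), 0 ≤ w t x := by
  have hI : IsOpen (Ioo (-δ) T) := isOpen_Ioo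
  have hsub : Icc 0 t ⊆ Ioo (-δ) T := Icc_subset_Ioo (by linarith) ht.2
  have cu := (h.contDiffOn_velocity hL ha hI).continuousOn
  have cux := h.continuousOn_deriv_velocity hL ha hI
  have cr := h.smooth_r.continuousOn
  have cw := h.smooth_w.continuousOn
  have cwx := (contDiffOn_deriv hI h.smooth_w).continuousOn
  have hu : ∀ t ∈ Ioo (-δ) T, OddPeriodic L (velocity L a (w t)) := fun t ht =>
    (h.odd_w t ht).velocity hL ha
  refine nonneg_of_transport hI ht.1 hsub (by linarith) (q := w)
    (qt := fun t x => r t x - velocity L a (w t) x * deriv (w t) x) (qx := fun t => deriv (w t))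
    (u := fun t => velocity L a (w t)) (ux := fun t => deriv (velocity L a (w t)))
    (c := fun _ _ => 0) h.eq_w
    (fun t ht x => (h.odd_w t ht).hasDerivAt x) (fun t ht x => (hu t ht).hasDerivAt x)
    cw (cr.sub (cu.mul cwx)) cwx cux continuousOn_const
    (fun t ht => (hu t ht).apply_zero) (fun t ht => (hu t ht).apply_half) (fun s hs x hx => ?_) h0
  have := h.nonneg_r hL ha hδ h0' (t := s) ⟨hs.1, hs.2.trans_lt ht.2⟩ x hx
  linarith

/-- Smooth solutions with given nonnegative data have a bounded lifespan. -/
theorem exists_lifespan_bound_of_smoothSolution (hL : 0 < L) (ha : 0 < a) {w₀ r₀ : ℝ → ℝ}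
    (hw₀ : ∀ x ∈ Icc 0 (L / 2), 0 ≤ w₀ x) (hr₀ : ∀ x ∈ Icc 0 (L / 2), 0 ≤ r₀ x)
    (hI₀ : 0 < ∫ x in (0 : ℝ)..L / 2, primitive r₀ x * cotWeight L x) :
    ∃ B, ∀ δ T w r, 0 < δ → IsSmoothSolution L a (Ioo (-δ) T) w r → w 0 = w₀ → r 0 = r₀ → T ≤ B := by
  obtain ⟨B, hB⟩ := exists_lifespan_bound (c₁ := 1 / (2 * Real.pi) * (a / (1 + a)))
    (c₂ := Real.pi / L ^ 2) (by positivity) (by positivity) hI₀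
  refine ⟨max B 0, fun δ T w r hδ h hw hr => ?_⟩
  rcases le_or_gt T 0 with hT | hT
  · exact hT.trans (le_max_right _ _)
  refine le_trans ?_ (le_max_left _ _)
  have hI : IsOpen (Ioo (-δ) T) := isOpen_Ioo
  have hsub : Ico 0 T ⊆ Ioo (-δ) T := fun t ht => ⟨by linarith [ht.1], ht.2⟩
  have su := h.contDiffOn_velocity hL ha hI
  have sθ := h.contDiffOn_primitive hL ha hI
  have swx := contDiffOn_deriv hI h.smooth_w
  have hu : ∀ t ∈ Ioo (-δ) T, OddPeriodic L (velocity L a (w t)) := fun t ht =>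
    (h.odd_w t ht).velocity hL ha
  have p0 : ∀ r : ℝ → ℝ, primitive r 0 = 0 := fun r => by simp [primitive]
  have hr' := fun t ht => h.nonneg_r hL ha hδ (by rwa [hr]) (t := t) ht
  have hw' := fun t ht => h.nonneg_w hL ha hδ (by rwa [hw]) (by rwa [hr]) (t := t) ht
  have hθ : ∀ t ∈ Ioo (-δ) T, ∀ x, HasDerivAt (primitive (r t)) (r t x) x := fun t ht =>
    HouLuo.hasDerivAt_primitive (h.odd_r t ht).continuous
  have sθt : ∀ t ∈ Ioo (-δ) T, ContDiff ℝ ∞ (primitive (r t)) := fun t ht => contDiffOn_univ.1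
    (sθ.comp (f := fun x : ℝ => (t, x)) (by fun_prop) fun x _ => ⟨ht, mem_univ _⟩)
  -- The functionals X and Y of the solution, followed by their time derivatives as read off from
  -- the equations.
  refine hB T (fun t => ∫ x in (0 : ℝ)..L / 2, primitive (r t) x * cotWeight L x)
    (fun t => ∫ x in (0 : ℝ)..L / 2, primitive (r t) x * w t x * cotWeight L x)
    (fun t => ∫ x in (0 : ℝ)..L / 2, -(velocity L a (w t) x * r t x) * cotWeight L x)
    (fun t => ∫ x in (0 : ℝ)..L / 2, (-(velocity L a (w t) x * r t x) * w t x
        + primitive (r t) x * (r t x - velocity L a (w t) x * deriv (w t) x)) * cotWeight L x)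
    (fun t ht => ?_) (fun t ht => ?_) (fun t ht => ?_) (fun t ht => ?_) ?_ (by rw [hr])
  · exact hasDerivAt_integral_mul_cotWeight hL hI (f := fun t => primitive (r t))
      (f' := fun t x => -(velocity L a (w t) x * r t x)) sθ (su.mul h.smooth_r).neg (fun t _ => p0 _)
      (fun t ht => by simp [(hu t ht).apply_zero]) (fun t ht => h.hasDerivAt_primitive hL ha hI ht) (hsub ht)
  · refine hasDerivAt_integral_mul_cotWeight hL hI (f := fun t x => primitive (r t) x * w t x)
      (f' := fun t x => -(velocity L a (w t) x * r t x) * w t x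
        + primitive (r t) x * (r t x - velocity L a (w t) x * deriv (w t) x)) (sθ.mul h.smooth_w)
      (((su.mul h.smooth_r).neg.mul h.smooth_w).add (sθ.mul (h.smooth_r.sub (su.mul swx))))
      (fun t _ => by simp [p0]) (fun t ht => by simp [(hu t ht).apply_zero, p0])
      (fun t ht x => (h.hasDerivAt_primitive hL ha hI ht x).mul (h.eq_w t ht x)) (hsub ht)
  · exact integral_velocity_mul_cotWeight_lower hL ha (h.odd_w t (hsub ht)) (hw' t ht)
      (h.odd_r t (hsub ht)).smooth (hr' t ht) (hθ t (hsub ht)) (p0 _)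
  · exact sq_le_integral_deriv_mul_cotWeight hL ha (h.odd_w t (hsub ht)) (hw' t ht)
      (h.odd_r t (hsub ht)).smooth (hr' t ht) (sθt t (hsub ht)) (hθ t (hsub ht)) (p0 _)
  · have h0T : (0 : ℝ) ∈ Ico 0 T := ⟨le_rfl, hT⟩
    refine integral_nonneg_of_Ioo (by linarith) (intervalIntegrable_mul_cotWeight hL
      (f := fun x => primitive (r 0) x * w 0 x) ((sθt 0 (hsub h0T)).mul (h.odd_w 0 (hsub h0T)).smooth)
      (by simp [p0])) fun x hx => ?_
    have hxI : x ∈ Icc 0 (L / 2) := Ioo_subset_Icc_self hx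
    refine mul_nonneg (mul_nonneg ?_ (hw' 0 h0T x hxI)) (cotWeight_nonneg hL ⟨hx.1, hx.2.le⟩)
    exact intervalIntegral.integral_nonneg hx.1.le fun y hy =>
      hr' 0 h0T y ⟨hy.1, hy.2.trans hx.2.le⟩
end
end HouLuo
-- Maximal solutions and the explicit initial data.
namespace HouLuo
open MeasureTheory Set

section

variable {L a : ℝ}

/-- Being a smooth solution is a local property in time. -/
theorem IsSmoothSolution.of_local {I : Set ℝ} {w r : ℝ → ℝ → ℝ}
    (h : ∀ t ∈ I, ∃ (J : Set ℝ) (w' r' : ℝ → ℝ → ℝ), IsOpen J ∧ t ∈ J ∧ IsSmoothSolution L a J w' r' ∧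
      ∀ s ∈ J, w s = w' s ∧ r s = r' s) : IsSmoothSolution L a I w r := by
  have ev : ∀ {J : Set ℝ} {f g : ℝ → ℝ → ℝ} {t : ℝ}, IsOpen J → t ∈ J → (∀ s ∈ J, f s = g s) →
      ∀ x, (fun s => f s x) =ᶠ[𝓝 t] fun s => g s x := fun hJ ht hfg x => by
    filter_upwards [hJ.mem_nhds ht] with s hs
    rw [hfg s hs]
  have cd : ∀ {J : Set ℝ} {f g : ℝ → ℝ → ℝ} {t : ℝ}, IsOpen J → t ∈ J → (∀ s ∈ J, f s = g s) →
      ContDiffOn ℝ ∞ (fun p : ℝ × ℝ => g p.1 p.2) (J ×ˢ univ) → ∀ x,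
      ContDiffWithinAt ℝ ∞ (fun p : ℝ × ℝ => f p.1 p.2) (I ×ˢ univ) (t, x) :=
    fun {J f g t} hJ ht hfg hg x => by
    have hn : J ×ˢ (univ : Set ℝ) ∈ 𝓝 (t, x) := (hJ.prod isOpen_univ).mem_nhds ⟨ht, mem_univ _⟩
    refine (((hg (t, x) ⟨ht, mem_univ _⟩).contDiffAt hn).congr_of_eventuallyEq ?_).contDiffWithinAt
    filter_upwards [hn] with p hp
    rw [hfg p.1 hp.1]
  refine ⟨fun p hp => ?_, fun p hp => ?_, fun t ht => ?_, fun t ht => ?_, fun t ht x => ?_, fun t ht x => ?_⟩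
  · obtain ⟨J, w', r', hJ, htJ, hs, he⟩ := h p.1 hp.1
    exact cd hJ htJ (fun s hs => (he s hs).1) hs.smooth_w p.2
  · obtain ⟨J, w', r', hJ, htJ, hs, he⟩ := h p.1 hp.1
    exact cd hJ htJ (fun s hs => (he s hs).2) hs.smooth_r p.2
  · obtain ⟨J, w', r', hJ, htJ, hs, he⟩ := h t ht
    rw [(he t htJ).1]
    exact hs.odd_w t htJ
  · obtain ⟨J, w', r', hJ, htJ, hs, he⟩ := h t ht
    rw [(he t htJ).2]
    exact hs.odd_r t htJ
  · obtain ⟨J, w', r', hJ, htJ, hs, he⟩ := h t ht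
    rw [(he t htJ).1, (he t htJ).2]
    exact (hs.eq_w t htJ x).congr_of_eventuallyEq (ev hJ htJ (fun s hs => (he s hs).1) x)
  · obtain ⟨J, w', r', hJ, htJ, hs, he⟩ := h t ht
    rw [(he t htJ).1, (he t htJ).2]
    exact (hs.eq_r t htJ x).congr_of_eventuallyEq (ev hJ htJ (fun s hs => (he s hs).2) x)

theorem IsSmoothSolution.comp_sub_const {α β : ℝ} {w r : ℝ → ℝ → ℝ}
    (h : IsSmoothSolution L a (Ioo α β) w r) (c : ℝ) :
    IsSmoothSolution L a (Ioo (c + α) (c + β)) (fun t => w (t - c)) (fun t => r (t - c)) := by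
  have hm : ∀ t ∈ Ioo (c + α) (c + β), t - c ∈ Ioo α β := fun t ht =>
    ⟨by linarith [ht.1], by linarith [ht.2]⟩
  have cd : ∀ {f : ℝ → ℝ → ℝ}, ContDiffOn ℝ ∞ (fun p : ℝ × ℝ => f p.1 p.2) (Ioo α β ×ˢ univ) →
      ContDiffOn ℝ ∞ (fun p : ℝ × ℝ => f (p.1 - c) p.2) (Ioo (c + α) (c + β) ×ˢ univ) := fun hf =>
    hf.comp (f := fun p : ℝ × ℝ => (p.1 - c, p.2)) (by fun_prop) fun p hp => ⟨hm _ hp.1, mem_univ _⟩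
  exact ⟨cd h.smooth_w, cd h.smooth_r, fun t ht => h.odd_w _ (hm t ht), fun t ht => h.odd_r _ (hm t ht),
    fun t ht x => (h.eq_w _ (hm t ht) x).comp_sub_const t c,
    fun t ht x => (h.eq_r _ (hm t ht) x).comp_sub_const t c⟩

/-- A smooth solution can be continued by another one that agrees with it at one time. -/
theorem IsSmoothSolution.exists_extend (hL : 0 < L) (ha : 0 < a) {δ T α β s : ℝ} {w r w' r' : ℝ → ℝ → ℝ}
    (hδ : 0 < δ) (h : IsSmoothSolution L a (Ioo (-δ) T) w r) (h' : IsSmoothSolution L a (Ioo α β) w' r')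
    (hs : s ∈ Ico 0 T) (hs' : s ∈ Ioo α β) (hw : w s = w' s) (hr : r s = r' s) :
    ∃ W R, IsSmoothSolution L a (Ioo (-δ) β) W R ∧ W 0 = w 0 ∧ R 0 = r 0 := by
  have hT : 0 < T := hs.1.trans_lt hs.2
  refine ⟨fun t => if t < T then w t else w' t, fun t => if t < T then r t else r' t,
    .of_local fun t ht => ?_, by simp [hT], by simp [hT]⟩
  rcases lt_or_ge t T with htT | htT
  · exact ⟨Ioo (-δ) T, w, r, isOpen_Ioo, ⟨ht.1, htT⟩, h, fun u hu => by simp [hu.2]⟩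
  · refine ⟨Ioo (max (-δ) α) β, w', r', isOpen_Ioo,
      ⟨max_lt ht.1 (hs'.1.trans (hs.2.trans_le htT)), ht.2⟩,
      h'.mono (Ioo_subset_Ioo_left (le_max_right _ _)), fun u hu => ?_⟩
    rcases lt_or_ge u T with huT | huT
    · have := IsSmoothSolution.eq_of_eq hL ha (α := max (-δ) α) (β := min T β)
        (h.mono (Ioo_subset_Ioo (le_max_left _ _) (min_le_left _ _)))
        (h'.mono (Ioo_subset_Ioo (le_max_right _ _) (min_le_right _ _)))
        (s := s) ⟨max_lt (by linarith [hs.1]) hs'.1, lt_min hs.2 hs'.2⟩ hw hr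
        (t := u) ⟨hu.1, lt_min huT hu.2⟩
      simpa [huT] using this
    · simp [not_lt.2 huT]

/-- Smooth solutions with a bounded lifespan have a maximal extension, along which the time integral of
`‖u_x‖_{L^∞}` is unbounded. -/
theorem exists_maximal_solution (hL : 0 < L) (ha : 0 < a) {w₀ r₀ : ℝ → ℝ} (hw₀ : OddPeriodic L w₀)
    (hr₀ : OddPeriodic L r₀)
    (hB : ∃ B, ∀ δ T w r, 0 < δ → IsSmoothSolution L a (Ioo (-δ) T) w r → w 0 = w₀ → r 0 = r₀ → T ≤ B) :
    ∃ δ T, 0 < δ ∧ 0 < T ∧ ∃ w r, IsSmoothSolution L a (Ioo (-δ) T) w r ∧ w 0 = w₀ ∧ r 0 = r₀ ∧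
      ∀ A, ∃ t ∈ Ico 0 T, A < ∫ s in (0 : ℝ)..t, gradNorm L a (w s) := by
  obtain ⟨B, hB⟩ := hB
  obtain ⟨δ, hδ, hloc⟩ := exists_local_solution hL ha (energy_nonneg (L := L) (k := 1) (w := w₀) (r := r₀))
  -- The backward extent δ is fixed once by local existence, so solutions with different T share an
  -- open interval around 0 on which they can be compared.
  set S : Set ℝ := {T | 0 < T ∧ ∃ w r, IsSmoothSolution L a (Ioo (-δ) T) w r ∧ w 0 = w₀ ∧ r 0 = r₀} with hS
  have hne : δ ∈ S := ⟨hδ, hloc w₀ r₀ hw₀ hr₀ le_rfl⟩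
  have hbdd : BddAbove S := ⟨B, fun T hT => by
    obtain ⟨-, w, r, h, hw, hr⟩ := hT
    exact hB δ T w r hδ h hw hr⟩
  have hTpos : 0 < sSup S := hδ.trans_le (le_csSup hbdd hne)
  have hex : ∀ t, t < sSup S → ∃ T w r, 0 < T ∧ t < T ∧ IsSmoothSolution L a (Ioo (-δ) T) w r ∧
      w 0 = w₀ ∧ r 0 = r₀ := fun t ht => by
    obtain ⟨T, ⟨hT, w, r, h⟩, htT⟩ := exists_lt_of_lt_csSup ⟨δ, hne⟩ ht
    exact ⟨T, w, r, hT, htT, h⟩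
  choose! τ W R hτ0 hτ hsol hW hR using hex
  -- The value at time t is taken from a chosen solution that lives beyond t. By uniqueness all
  -- choices agree near t, so the diagonal is again a solution.
  have hsolution : IsSmoothSolution L a (Ioo (-δ) (sSup S)) (fun t => W t t) (fun t => R t t) := by
    refine .of_local fun t ht => ⟨Ioo (-δ) (min (τ t) (sSup S)), W t, R t, isOpen_Ioo,
      ⟨ht.1, lt_min (hτ t ht.2) ht.2⟩, (hsol t ht.2).mono (Ioo_subset_Ioo_right (min_le_left _ _)),
      fun s hs => ?_⟩
    have hs2 : s < sSup S := hs.2.trans_le (min_le_right _ _)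
    exact IsSmoothSolution.eq_of_eq hL ha (α := -δ) (β := min (τ s) (τ t))
      ((hsol s hs2).mono (Ioo_subset_Ioo_right (min_le_left _ _)))
      ((hsol t ht.2).mono (Ioo_subset_Ioo_right (min_le_right _ _))) (s := 0)
      ⟨by linarith, lt_min (hτ0 s hs2) (hτ0 t ht.2)⟩ ((hW s hs2).trans (hW t ht.2).symm)
      ((hR s hs2).trans (hR t ht.2).symm)
      ⟨hs.1, lt_min (hτ s hs2) (hs.2.trans_le (min_le_left _ _))⟩
  refine ⟨δ, sSup S, hδ, hTpos, _, _, hsolution, hW 0 hTpos, hR 0 hTpos, fun A => ?_⟩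
  by_contra! hA
  obtain ⟨E, hE0, hE⟩ := hsolution.exists_energy_le hL ha hδ hTpos hA
  obtain ⟨ε, hε, hloc'⟩ := exists_local_solution hL ha hE0
  -- The restart time lies within ε / 2 of the supremum, or is 0. As the existence time ε does not
  -- depend on it, the continued solution outlives `sSup S`.
  set s := max 0 (sSup S - ε / 2) with hs
  have hsI : s ∈ Ico 0 (sSup S) := ⟨le_max_left _ _, max_lt hTpos (by linarith)⟩
  have hsI' : s ∈ Ioo (-δ) (sSup S) := ⟨by linarith [hsI.1], hsI.2⟩
  obtain ⟨w', r', h', hw', hr'⟩ := hloc' _ _ (hsolution.odd_w s hsI') (hsolution.odd_r s hsI') (hE s hsI)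
  obtain ⟨w'', r'', h'', hw'', hr''⟩ := hsolution.exists_extend hL ha hδ (h'.comp_sub_const s) hsI
    ⟨by linarith, by linarith⟩ (by simp [hw']) (by simp [hr'])
  have hmem : s + ε ∈ S := ⟨by linarith [hsI.1], w'', r'', h'', hw''.trans (hW 0 hTpos), hr''.trans (hR 0 hTpos)⟩
  have h1 := le_csSup hbdd hmem
  linarith [le_max_right 0 (sSup S - ε / 2)]

/-- A C¹ vorticity has bounded w_x on compact time sets, and u_x is the convolution of the kernel
with w_x. This excludes classical solutions beyond the maximal time. -/
theorem IsClassicalSolution.exists_gradNorm_le (hL : 0 < L) (ha : 0 < a) {T : ℝ} {w₀ θ₀ : ℝ → ℝ}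
    {w θ : ℝ → ℝ → ℝ} (h : IsClassicalSolution L a T w₀ θ₀ w θ) {K : Set ℝ} (hK : IsCompact K)
    (hKT : K ⊆ Ico 0 T) : ∃ M, ∀ t ∈ K, gradNorm L a (w t) ≤ M := by
  obtain ⟨dw, cw⟩ := partial_right_of_contDiffOn_succ (n := 0) (uniqueDiffOn_Ico 0 T) (f := w)
    (by simpa using h.regular_vorticity)
  have hp : ∀ t ∈ Ico 0 T, Function.Periodic (deriv (w t)) L := fun t ht =>
    periodic_deriv (h.periodic_vorticity t ht)
  obtain ⟨M, -, hM⟩ := exists_bound_of_periodic hL (g := fun t => deriv (w t)) cw.continuousOn hp hK hKT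
  refine ⟨kernNorm L a * M, fun t ht => ciSup_le fun x => ?_⟩
  rw [(velocity_hasDerivAt hL ha (h.periodic_vorticity t (hKT ht)) (hp t (hKT ht)) (dw t (hKT ht))
    (continuous_of_continuousOn_prod (f := fun t => deriv (w t)) cw.continuousOn (hKT ht)) x).deriv]
  exact abs_velocity_le hL ha (hp t (hKT ht)) (hM t ht) x

/-- The time integral is nondecreasing, so being unbounded it tends to infinity. -/
theorem IsSmoothSolution.tendsto_integral_gradNorm {δ T : ℝ} {w r : ℝ → ℝ → ℝ}
    (h : IsSmoothSolution L a (Ioo (-δ) T) w r) (hL : 0 < L) (ha : 0 < a) (hδ : 0 < δ)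
    (hA : ∀ A, ∃ t ∈ Ico 0 T, A < ∫ s in (0 : ℝ)..t, gradNorm L a (w s)) :
    Tendsto (fun t => ∫ s in (0 : ℝ)..t, gradNorm L a (w s)) (𝓝[<] T) atTop := by
  have hg := h.continuousOn_gradNorm hL ha isOpen_Ioo
  refine tendsto_atTop.2 fun A => ?_
  obtain ⟨t, ht, hAt⟩ := hA A
  filter_upwards [Ioo_mem_nhdsLT ht.2] with s hs
  have hi : ∀ {α β : ℝ}, 0 ≤ α → α ≤ β → β < T →
      IntervalIntegrable (fun s => gradNorm L a (w s)) volume α β := fun h0 hαβ hβ =>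
    (hg.mono (by rw [uIcc_of_le hαβ]; exact Icc_subset_Ioo (by linarith) hβ)).intervalIntegrable
  rw [← intervalIntegral.integral_add_adjacent_intervals (hi le_rfl ht.1 ht.2) (hi ht.1 hs.1.le hs.2)]
  have : 0 ≤ ∫ s in t..s, gradNorm L a (w s) :=
    intervalIntegral.integral_nonneg hs.1.le fun u _ => gradNorm_nonneg _
  linarith

theorem hasDerivAt_one_sub_cos (k x : ℝ) :
    HasDerivAt (fun x => 1 - Real.cos (k * x)) (k * Real.sin (k * x)) x := by
  have hl : HasDerivAt (fun x => k * x) k x := by simpa using (hasDerivAt_id x).const_mul k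
  exact (hl.cos.const_sub 1).congr_deriv (by ring)

theorem primitive_sin (k : ℝ) : primitive (fun x => k * Real.sin (k * x)) = fun x => 1 - Real.cos (k * x) := by
  ext x
  rw [primitive, intervalIntegral.integral_eq_sub_of_hasDerivAt (fun y _ => hasDerivAt_one_sub_cos k y)
    (Continuous.intervalIntegrable (by fun_prop) _ _)]
  simp

theorem oddPeriodic_sin (hL : 0 < L) (c : ℝ) :
    OddPeriodic L fun x => c * Real.sin (2 * Real.pi / L * x) where
  smooth := by fun_prop
  periodic x := by
    have : 2 * Real.pi / L * (x + L) = 2 * Real.pi / L * x + 2 * Real.pi := by field_simp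
    simp only [this, Real.sin_add_two_pi]
  odd x := by simp

theorem sin_pos_of_mem_Ioo_half (hL : 0 < L) {x : ℝ} (hx : x ∈ Ioo 0 (L / 2)) :
    0 < Real.sin (2 * Real.pi / L * x) := by
  rw [show 2 * Real.pi / L * x = 2 * (Real.pi / L * x) by ring, Real.sin_two_mul]
  have := sin_pos_of_mem_Ioo hL (Ioo_half_subset hL hx)
  have := cos_pos_of_mem_Ioo hL hx
  positivity

theorem sin_nonneg_of_mem_Icc_half (hL : 0 < L) {x : ℝ} (hx : x ∈ Icc 0 (L / 2)) :
    0 ≤ Real.sin (2 * Real.pi / L * x) := by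
  rw [show 2 * Real.pi / L * x = 2 * (Real.pi / L * x) by ring, Real.sin_two_mul]
  have h1 : 0 ≤ Real.sin (Real.pi / L * x) := by
    refine Real.sin_nonneg_of_nonneg_of_le_pi (mul_nonneg (by positivity) hx.1) ?_
    linarith [mul_le_pi_div_two hL hx.2, Real.pi_pos]
  have := cos_nonneg_of_mem_Icc hL hx
  positivity

/-- With z = πx/L, (1 - cos 2z) cot z = 2 sin z cos z = sin 2z, which is positive inside the
interval. This is X(0) > 0 for the chosen data. -/
theorem integral_one_sub_cos_mul_cotWeight_pos (hL : 0 < L) :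
    0 < ∫ x in (0 : ℝ)..L / 2, (1 - Real.cos (2 * Real.pi / L * x)) * cotWeight L x := by
  have e : ∫ x in (0 : ℝ)..L / 2, (1 - Real.cos (2 * Real.pi / L * x)) * cotWeight L x
      = ∫ x in (0 : ℝ)..L / 2, Real.sin (2 * Real.pi / L * x) := by
    refine intervalIntegral.integral_congr fun x _ => ?_
    simp only [cotWeight]
    rw [show 2 * Real.pi / L * x = 2 * (Real.pi / L * x) by ring, Real.sin_two_mul, Real.cos_two_mul]
    rcases eq_or_ne (Real.sin (Real.pi / L * x)) 0 with h | h
    · simp [h]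
    · rw [mul_div_assoc', div_eq_iff h]
      linear_combination -2 * Real.cos (Real.pi / L * x) * Real.sin_sq_add_cos_sq (Real.pi / L * x)
  rw [e]
  exact intervalIntegral.intervalIntegral_pos_of_pos_on (Continuous.intervalIntegrable (by fun_prop) _ _)
    (fun x hx => sin_pos_of_mem_Ioo_half hL hx) (by linarith)

theorem isInitialDatum_zero_one_sub_cos (hL : 0 < L) :
    IsInitialDatum L (fun _ => 0) (fun x => 1 - Real.cos (2 * Real.pi / L * x)) := by
  have hd : deriv (fun x => 1 - Real.cos (2 * Real.pi / L * x))
      = fun x => 2 * Real.pi / L * Real.sin (2 * Real.pi / L * x) :=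
    funext fun x => (hasDerivAt_one_sub_cos _ x).deriv
  refine ⟨contDiff_const, by fun_prop, fun _ => rfl, fun x => ?_, by simp, fun x => by simp [hd], by simp,
    fun x hx => ?_, by simp, by simp⟩
  · have : 2 * Real.pi / L * (x + L) = 2 * Real.pi / L * x + 2 * Real.pi := by field_simp
    simp only [this, Real.cos_add_two_pi]
  · rw [hd]
    exact mul_nonneg (by positivity) (sin_nonneg_of_mem_Icc_half hL hx)
end
end HouLuo
theorem mainTheorem1 (L a : ℝ) (hL : 0 < L) (ha : 0 < a) :
    ∃ w₀ θ₀ : ℝ → ℝ, HouLuo.IsInitialDatum L w₀ θ₀ ∧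
      ∃ Tstar : ℝ, 0 < Tstar ∧ ∃ w θ : ℝ → ℝ → ℝ,
        HouLuo.IsClassicalSolution L a Tstar w₀ θ₀ w θ ∧
        ContDiffOn ℝ ∞ (fun p : ℝ × ℝ => w p.1 p.2) (Set.Ico 0 Tstar ×ˢ Set.univ) ∧
        ContDiffOn ℝ ∞ (fun p : ℝ × ℝ => θ p.1 p.2) (Set.Ico 0 Tstar ×ˢ Set.univ) ∧
        (∀ (T : ℝ) (w' θ' : ℝ → ℝ → ℝ), 0 < T →
          HouLuo.IsClassicalSolution L a T w₀ θ₀ w' θ' →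
          T ≤ Tstar ∧ ∀ t ∈ Set.Ico 0 T, w' t = w t ∧ θ' t = θ t) ∧
        Tendsto (fun t : ℝ => ∫ τ in (0 : ℝ)..t, HouLuo.gradNorm L a (w τ))
          (𝓝[<] Tstar) atTop := by
  have hd : deriv (fun x => 1 - Real.cos (2 * Real.pi / L * x))
      = fun x => 2 * Real.pi / L * Real.sin (2 * Real.pi / L * x) :=
    funext fun x => (HouLuo.hasDerivAt_one_sub_cos _ x).deriv
  have hw₀ : HouLuo.OddPeriodic L fun _ => 0 := by simpa using HouLuo.oddPeriodic_sin hL 0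
  obtain ⟨δ, T, hδ, hT, w, r, h, hw, hr, hA⟩ := HouLuo.exists_maximal_solution hL ha hw₀
    (HouLuo.oddPeriodic_sin hL (2 * Real.pi / L))
    (HouLuo.exists_lifespan_bound_of_smoothSolution hL ha (fun _ _ => le_rfl)
      (fun x hx => mul_nonneg (by positivity) (HouLuo.sin_nonneg_of_mem_Icc_half hL hx))
      (by rw [HouLuo.primitive_sin]; exact HouLuo.integral_one_sub_cos_mul_cotWeight_pos hL))
  have hsub : Set.Ico 0 T ⊆ Set.Ioo (-δ) T := fun t ht => ⟨by linarith [ht.1], ht.2⟩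
  have hlim := h.tendsto_integral_gradNorm hL ha hδ hA
  refine ⟨_, _, HouLuo.isInitialDatum_zero_one_sub_cos hL, T, hT, w, fun t => HouLuo.primitive (r t), ?_,
    h.smooth_w.mono (Set.prod_mono hsub le_rfl),
    (h.contDiffOn_primitive hL ha isOpen_Ioo).mono (Set.prod_mono hsub le_rfl),
    fun T' w' θ' hT' h' => ?_, hlim⟩
  · have := h.isClassicalSolution hL ha hδ
    rwa [hw, hr, HouLuo.primitive_sin] at this
  have heq := fun t ht ht' => HouLuo.IsClassicalSolution.eq_smooth hL ha hδ (by simp) h hw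
    (by rw [hr, hd]) h' (t := t) ht ht'
  have hle : T' ≤ T := by
    -- A classical solution on a longer interval would have bounded velocity gradient on [0, T] and
    -- coincide with w on [0, T), so the time integral would be bounded there.
    by_contra! hTT
    obtain ⟨M, hM⟩ := h'.exists_gradNorm_le hL ha (K := Set.Icc 0 T) isCompact_Icc
      fun t ht => ⟨ht.1, ht.2.trans_lt hTT⟩
    obtain ⟨t, ht, htA⟩ := hA (|M| * T)
    refine htA.not_ge ?_
    have hb := intervalIntegral.norm_integral_le_of_norm_le_const (a := 0) (b := t) (C := |M|)
      (f := fun s => HouLuo.gradNorm L a (w s)) fun s hs => by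
        rw [Set.uIoc_of_le ht.1] at hs
        have hsT : s < T := hs.2.trans_lt ht.2
        rw [Real.norm_of_nonneg (HouLuo.gradNorm_nonneg _), ← (heq s ⟨hs.1.le, hsT⟩ ⟨hs.1.le, hsT.trans hTT⟩).1]
        exact (hM s ⟨hs.1.le, hsT.le⟩).trans (le_abs_self M)
    refine (le_abs_self _).trans (hb.trans ?_)
    rw [sub_zero, abs_of_nonneg ht.1]
    exact mul_le_mul_of_nonneg_left ht.2.le (abs_nonneg M)
  exact ⟨hle, fun t ht => heq t ⟨ht.1, ht.2.trans_le hle⟩ ht⟩
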